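/- **Setting.** Let $d\ge 1$, $T>0$, $\Lambda\in\mathbb R$, $\alpha\ge 1$. Let $(\Omega,\mathcal F,(\mathcal F_t),\mathbb P)$ be a complete filtered probability space, with $(\Omega,\mathcal F_0,\mathbb P)$ atomless, carrying a $d$-dimensional $(\mathcal F_t)$-Brownian motion $(W_t)_{0\le t\le T}$. Write $[\cdot]$ for the law of a random variable, $\|\cdot\|_p$ for the norm of $L^p(\mathbb P)$, $\mathcal P_2$ for the set of probability measures with finite second moment, $\mathcal W_2$ for the 2-Wasserstein distance, and $\|\mu\|_2=(\int|x|^2d\mu)^{1/2}$. Consider $dX=b(X,Y,[X,Y])dt+\sigma(X,[X])dW$, $dY=-f(X,Y,Z,[X,Y])dt+Z\cdot dW$, $Y_T=g(X_T,[X_T])$, with $X$ in $\mathbb R^d$, $Y$ in $\mathbb R$, $Z$ in $\mathbb R^d$. **(H0)** $b,\sigma,f,g$ are $\Lambda$-Lipschitz in all the variables (measures being compared through $\mathcal W_2$) and $|\sigma|\le\Lambda$. **(H1)** $\mathcal U:[0,T]\times\mathbb R^d\times\mathcal P_2(\mathbb R^d)\to\mathbb R$ is a classical solution, with $\mathcal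 U(T,\cdot)=g$, of $$\partial_t\mathcal U+b(x,\mathcal U,\nu)\cdot\partial_x\mathcal U+\tfrac12\mathrm{Tr}[\partial^2_{xx}\mathcal U\,a(x,\mu)]+f(x,\mathcal U,\sigma^\dagger(x,\mu)\partial_x\mathcal U,\nu)+\int\Bigl(\partial_\mu\mathcal U(t,x,\mu)(v)\cdot b(v,\mathcal U(t,v,\mu),\nu)+\tfrac12\mathrm{Tr}[\partial_v\partial_\mu\mathcal U(t,x,\mu)(v)a(v,\mu)]\Bigr)d\mu(v)=0$$ on $[0,T)$, where $a=\sigma\sigma^\dagger$ and $\nu$ is the image of $\mu$ by $v\mapsto(v,\mathcal U(t,v,\mu))$. Here $\partial_\mu$ is Lions' derivative (the lifting of $\mathcal U(t,x,\cdot)$ to $L^2(\Omega,\mathcal F_0,\mathbb P;\mathbb R^d)$ is Fréchet differentiable with gradient $\partial_\mu\mathcal U(t,x,[\xi])(\xi)$), $v\mapsto\partial_\mu\mathcal U(t,x,\mu)(v)$ is differentiable, $\mathcal U,\partial_t\mathcal U,\partial_x\mathcal U,\partial_{xx}^2\mathcal U$ are jointly continuous ($\partial_t\mathcal U$ for $t<T$),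 and $\partial_\mu\mathcal U,\partial_v\partial_\mu\mathcal U$ are continuous at all $(t,x,\mu,v)$ with $v\in\mathrm{supp}\,\mu$. Moreover, for all $t,t+h\in[0,T]$ with $h\ge0$, $x,x',v,v'\in\mathbb R^d$, $\mu,\mu'\in\mathcal P_2(\mathbb R^d)$: $|\mathcal U(t,x,\mu)-\mathcal U(t,x,\mu')|+|\partial_x\mathcal U(t,x,\mu)-\partial_x\mathcal U(t,x,\mu')|\le\Lambda\mathcal W_2(\mu,\mu')$; $|\partial_x\mathcal U(t,x,\mu)|+\|\partial_\mu\mathcal U(t,x,\mu)(\cdot)\|_{L^2(\mu)}\le\Lambda$; $|\partial^2_{xx}\mathcal U(t,x,\mu)|+\|\partial_v\partial_\mu\mathcal U(t,x,\mu)(\cdot)\|_{L^2(\mu)}\le\Lambda$; $|\partial^2_{xx}\mathcal U(t,x,\mu)-\partial^2_{xx}\mathcal U(t,x',\mu)|\le\Lambda|x-x'|$; $|\mathcal U(t+h,x,\mu)-\mathcal U(t,x,\mu)|+|\partial_x\mathcal U(t+h,x,\mu)-\partial_x\mathcal U(t,x,\mu)|\le\Lambda h^{1/2}(1+|x|+\|\mu\|_2)$;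 $|\partial_v\partial_\mu\mathcal U(t,x,\mu)(v)-\partial_v\partial_\mu\mathcal U(t,x,\mu)(v')|\le\Lambda(1+|v|^{2\alpha}+|v'|^{2\alpha}+\|\mu\|_2^{2\alpha})^{1/2}|v-v'|$. **Scheme.** Let $N\ge2$, $\delta=T/N$, $r_k=k\delta$, and let $\pi=\{0=t_0<\dots<t_n=T\}$ contain all the $r_k$; $h_i=t_{i+1}-t_i$, $|\pi|=\max_i h_i$. Let $\Gamma:\mathbb R^d\to\mathbb R^d$ be measurable, with finite range, bounded by $\Lambda$, centered and with identity covariance under the standard Gaussian law, and $\Delta\bar W_i=h_i^{1/2}\Gamma(h_i^{-1/2}(W_{t_{i+1}}-W_{t_i}))$. Given a level $k<N$, an input process $\bar{\mathfrak X}$ on $\pi\cap[r_k,r_{k+1}]$, a terminal condition $\eta$ and a driver $f'$, the one-step solver returns square-integrable $(\bar X,\bar Y,\bar Z)$ on $\pi\cap[r_k,r_{k+1}]$ with $(\bar Y_{r_{k+1}},\bar Z_{r_{k+1}})=(\eta,0)$, $\bar X_{r_k}=\bar{\mathfrak X}_{r_k}$ and, for $r_k\le t_i<r_{k+1}$, $$\bar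 Z_{t_i}=\mathbb E_{t_i}[h_i^{-1}\bar Y_{t_{i+1}}\Delta\bar W_i],\qquad \bar Y_{t_i}=\mathbb E_{t_i}[\bar Y_{t_{i+1}}+h_if'(\bar{\mathfrak X}_{t_i},\bar Y_{t_i},\bar Z_{t_i},[\bar{\mathfrak X}_{t_i},\bar Y_{t_i}])],$$ $$\bar X_{t_{i+1}}=\bar X_{t_i}+h_ib(\bar X_{t_i},\bar Y_{t_i},[\bar X_{t_i},\bar Y_{t_i}])+\sigma(\bar X_{t_i},[\bar X_{t_i}])\Delta\bar W_i .$$ Let $J\ge1$. Set $\mathrm{sol}^N(\xi)=g(\xi,[\xi])$. For $k<N$ and $\xi\in L^2(\mathcal F_{r_k})$, let $\bar X^0$ be the forward output for the input $\xi$, $\eta=0$, $f'=0$; for $1\le j\le J$ let $(\bar X^j,\bar Y^j,\bar Z^j)$ be the output for the input $\bar X^{j-1}$, $\eta=\mathrm{sol}^{k+1}(\bar X^{j-1}_{r_{k+1}})$, $f'=f$; and set $\mathrm{sol}^k(\xi)=\bar Y^J_{r_k}$. **Statement.** There is a constant $C_0>0$, depending only on $d,\Lambda,\alpha$, such that, under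 (H0)–(H1), there are constants $c_0,K,C>0$, independent of $N,J,\pi,\beta,k,\xi$, for which the following holds. Let $\bar\delta:=C_0\delta<\min(c_0,1)$ and assume that, for some $\beta>0$, $$(J-1)\bigl(\Lambda\bar\delta^J+e^{\beta\bar\delta}K|\pi|^{1/2}\bigr)\frac{e^{\beta C_0T}}{e^{\beta\bar\delta}-1}\le1 .$$ Then, for all $k\in\{0,\dots,N\}$ and $\xi\in L^2(\mathcal F_{r_k})$, the solver $\mathrm{sol}^k$ has an output for the input $\xi$, and every such output satisfies: (i) if $g$ and $(x,\mu)\mapsto f(x,0,0,\mu\otimes\delta_0)$ are bounded, then $$\|\mathrm{sol}^k(\xi)-\mathcal U(r_k,\xi,[\xi])\|_{2\alpha}\le C\Bigl((C\delta)^{J-1}+|\pi|^{1/2}\delta^{-1}(1+\|\xi\|_{2\alpha}^{\alpha})\Bigr);$$ (ii) if $\alpha=1$, then $$\|\mathrm{sol}^k(\xi)-\mathcal U(r_k,\xi,[\xi])\|_{2}\le C\bigl((C\delta)^{J-1}+|\pi|^{1/2}\delta^{-1}\bigr)(1+\|\xi\|_{2}).$$ -/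

import Mathlib

open MeasureTheory ProbabilityTheory Set
open scoped NNReal ENNReal Topology RealInnerProductSpace

noncomputable section

namespace MKV

/-- The state space `ℝᵈ` with its Euclidean norm. -/
abbrev E (d : ℕ) : Type := EuclideanSpace ℝ (Fin d)

/-- The space `ℝᵈ × ℝ` with its Euclidean norm, which carries the joint laws `[X, Y]`. -/
abbrev EY (d : ℕ) : Type := WithLp 2 (E d × ℝ)

/-! ### Probability measures with a finite second moment and the Wasserstein distance -/

section Wasserstein

variable {X : Type*} [NormedAddCommGroup X] [MeasurableSpace X]

/-- `μ ∈ 𝒫₂(X)`. -/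
structure IsP2 (μ : Measure X) : Prop where
  isProb : IsProbabilityMeasure μ
  memLp : MemLp (fun x : X => x) 2 μ

/-- `(∫ |x|² dμ)^{1/2}`, that is `‖ξ‖₂` for any `ξ` of law `μ`. -/
def norm2 (μ : Measure X) : ℝ := (eLpNorm (fun x : X => x) 2 μ).toReal

/-- The couplings of `μ` and `ν`. -/
def couplings (μ ν : Measure X) : Set (Measure (X × X)) :=
  {ρ | ρ.map Prod.fst = μ ∧ ρ.map Prod.snd = ν}

/-- The 2-Wasserstein distance (finite as soon as `μ, ν ∈ 𝒫₂(X)`). -/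
def W2 (μ ν : Measure X) : ℝ :=
  Real.sqrt (⨅ ρ ∈ couplings μ ν, ∫⁻ p, ‖p.1 - p.2‖ₑ ^ 2 ∂ρ).toReal

end Wasserstein

/-- The joint law `[X, Y]`. -/
def jointLaw {Ω : Type*} {d : ℕ} [MeasurableSpace Ω] (P : Measure Ω) (X : Ω → E d) (Y : Ω → ℝ) :
    Measure (EY d) :=
  P.map fun ω => WithLp.toLp 2 (X ω, Y ω)

/-! ### The stochastic basis -/

/-- The probability space `(Ω, m, P)` has no atom: every event of positive probability contains an
event of smaller but positive probability. -/
def Atomless {Ω : Type*} (m : MeasurableSpace Ω) {_mΩ : MeasurableSpace Ω} (P : Measure Ω) :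
    Prop :=
  ∀ A, MeasurableSet[m] A → 0 < P A → ∃ B, B ⊆ A ∧ MeasurableSet[m] B ∧ 0 < P B ∧ P B < P A

/-- A complete filtered probability space, atomless at time `0`, with a `d`-dimensional Brownian
motion `W` on `[0, T]` with respect to the filtration. -/
structure IsBasis {Ω : Type*} {mΩ : MeasurableSpace Ω} {d : ℕ} (P : Measure Ω)
    (ℱ : Filtration ℝ mΩ) (T : ℝ) (W : ℝ → Ω → E d) : Prop where
  complete : ∀ A : Set Ω, P A = 0 → MeasurableSet[ℱ 0] A
  atomless : Atomless (ℱ 0) P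
  adapted : ∀ t ∈ Icc 0 T, StronglyMeasurable[ℱ t] (W t)
  zero : ∀ᵐ ω ∂P, W 0 ω = 0
  continuous : ∀ᵐ ω ∂P, ContinuousOn (fun t => W t ω) (Icc 0 T)
  indep : ∀ s t, 0 ≤ s → s ≤ t → t ≤ T →
    Indep (MeasurableSpace.comap (fun ω => W t ω - W s ω) inferInstance) (ℱ s) P
  gaussian : ∀ s t, 0 ≤ s → s ≤ t → t ≤ T →
    P.map (fun ω => W t ω - W s ω) = (stdGaussian (E d)).map fun z => Real.sqrt (t - s) • z

/-! ### The coefficients -/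

/-- The coefficients of the forward-backward system
`dX = b(X, Y, [X, Y]) dt + σ(X, [X]) dW`, `dY = - f(X, Y, Z, [X, Y]) dt + Z · dW`,
`Y_T = g(X_T, [X_T])`. Only their values at measures of `𝒫₂` matter. -/
structure Coeffs (d : ℕ) where
  b : E d → ℝ → Measure (EY d) → E d
  σ : E d → Measure (E d) → E d →L[ℝ] E d
  f : E d → ℝ → E d → Measure (EY d) → ℝ
  g : E d → Measure (E d) → ℝ

/-- The coefficients are `Λ`-Lipschitz in all the variables and `σ` is bounded by `Λ`. -/
structure H0 {d : ℕ} (c : Coeffs d) (Λ : ℝ) : Prop where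
  b_lip : ∀ x x' y y' ν ν', IsP2 ν → IsP2 ν' →
    ‖c.b x y ν - c.b x' y' ν'‖ ≤ Λ * (‖x - x'‖ + |y - y'| + W2 ν ν')
  σ_lip : ∀ x x' μ μ', IsP2 μ → IsP2 μ' → ‖c.σ x μ - c.σ x' μ'‖ ≤ Λ * (‖x - x'‖ + W2 μ μ')
  f_lip : ∀ x x' y y' z z' ν ν', IsP2 ν → IsP2 ν' →
    |c.f x y z ν - c.f x' y' z' ν'| ≤ Λ * (‖x - x'‖ + |y - y'| + ‖z - z'‖ + W2 ν ν')
  g_lip : ∀ x x' μ μ', IsP2 μ → IsP2 μ' → |c.g x μ - c.g x' μ'| ≤ Λ * (‖x - x'‖ + W2 μ μ')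
  σ_bdd : ∀ x μ, IsP2 μ → ‖c.σ x μ‖ ≤ Λ

/-- `g` and `f(·, 0, 0, [·, 0])` are bounded. -/
def BoundedData {d : ℕ} (c : Coeffs d) : Prop :=
  ∃ M : ℝ, ∀ x μ, IsP2 μ → |c.g x μ| ≤ M ∧
    |c.f x 0 0 (μ.map fun v => WithLp.toLp 2 (v, (0 : ℝ)))| ≤ M

/-- `a = σ σ†`. -/
def Coeffs.a {d : ℕ} (c : Coeffs d) (x : E d) (μ : Measure (E d)) : E d →L[ℝ] E d :=
  (c.σ x μ).comp (ContinuousLinearMap.adjoint (c.σ x μ))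

/-- The trace of an endomorphism of `ℝᵈ`. -/
def tr {d : ℕ} (A : E d →L[ℝ] E d) : ℝ := LinearMap.trace ℝ (E d) (A : E d →ₗ[ℝ] E d)

/-! ### The decoupling field -/

/-- A function `𝒰` on `[0, T] × ℝᵈ × 𝒫₂(ℝᵈ)` together with functions intended to be its derivatives
`∂ₜ𝒰`, `∂ₓ𝒰`, `∂ₓₓ²𝒰`, `∂_μ𝒰(·)(v)` and `∂_v∂_μ𝒰(·)(v)`; that they are is part of
`IsClassicalSolution`. -/
structure Field (d : ℕ) where
  U : ℝ → E d → Measure (E d) → ℝ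
  Ut : ℝ → E d → Measure (E d) → ℝ
  Ux : ℝ → E d → Measure (E d) → E d
  Uxx : ℝ → E d → Measure (E d) → E d →L[ℝ] E d
  Um : ℝ → E d → Measure (E d) → E d → E d
  Uvm : ℝ → E d → Measure (E d) → E d → E d →L[ℝ] E d

/-- `D` is a Wasserstein derivative of `V : 𝒫₂(ℝᵈ) → ℝ` in the sense of Lions: the lifting
`ξ ↦ V [ξ]` is Fréchet differentiable on `L²(Ω, m, P; ℝᵈ)` and its gradient at `ξ` is
`D [ξ] (ξ)`. -/
def HasLionsDeriv {Ω : Type*} {d : ℕ} (m : MeasurableSpace Ω) {_mΩ : MeasurableSpace Ω}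
    (P : Measure Ω) (V : Measure (E d) → ℝ) (D : Measure (E d) → E d → E d) : Prop :=
  ∀ ξ : Ω → E d, StronglyMeasurable[m] ξ → MemLp ξ 2 P →
    MemLp (fun ω => D (P.map ξ) (ξ ω)) 2 P ∧
    ∀ ε > 0, ∃ η > 0, ∀ ζ : Ω → E d, StronglyMeasurable[m] ζ → MemLp ζ 2 P →
      (eLpNorm ζ 2 P).toReal ≤ η →
      |V (P.map fun ω => ξ ω + ζ ω) - V (P.map ξ) - ∫ ω, ⟪D (P.map ξ) (ξ ω), ζ ω⟫ ∂P|
        ≤ ε * (eLpNorm ζ 2 P).toReal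

/-- Joint continuity on `I × ℝᵈ × 𝒫₂(ℝᵈ)`. -/
def JointCont {d : ℕ} {V : Type*} [NormedAddCommGroup V] (I : Set ℝ)
    (F : ℝ → E d → Measure (E d) → V) : Prop :=
  ∀ t ∈ I, ∀ x μ, IsP2 μ → ∀ ε > 0, ∃ η > 0, ∀ t' ∈ I, ∀ x' μ', IsP2 μ' →
    |t' - t| < η → ‖x' - x‖ < η → W2 μ' μ < η → ‖F t' x' μ' - F t x μ‖ < ε

/-- Continuity on `I × ℝᵈ × 𝒫₂(ℝᵈ) × ℝᵈ` at every point `(t, x, μ, v)` such that `v` is in the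
support of `μ`. -/
def JointContSupp {d : ℕ} {V : Type*} [NormedAddCommGroup V] (I : Set ℝ)
    (F : ℝ → E d → Measure (E d) → E d → V) : Prop :=
  ∀ t ∈ I, ∀ x μ, IsP2 μ → ∀ v ∈ μ.support, ∀ ε > 0, ∃ η > 0, ∀ t' ∈ I, ∀ x' μ', IsP2 μ' → ∀ v',
    |t' - t| < η → ‖x' - x‖ < η → W2 μ' μ < η → ‖v' - v‖ < η →
      ‖F t' x' μ' v' - F t x μ v‖ < ε

/-- The image of `μ` by `v ↦ (v, 𝒰(t, v, μ))`. -/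
def Field.graphLaw {d : ℕ} (u : Field d) (t : ℝ) (μ : Measure (E d)) : Measure (EY d) :=
  μ.map fun v => WithLp.toLp 2 (v, u.U t v μ)

/-- `𝒰` is a classical solution of the equation on `[0, T) × ℝᵈ × 𝒫₂(ℝᵈ)` with terminal
condition `g`. The derivatives in the measure are taken on `L²(Ω, m, P; ℝᵈ)`. -/
structure IsClassicalSolution {Ω : Type*} {d : ℕ} (m : MeasurableSpace Ω) {_mΩ : MeasurableSpace Ω}
    (P : Measure Ω) (T : ℝ) (c : Coeffs d) (u : Field d) : Prop where
  hasDeriv_t : ∀ t ∈ Ico 0 T, ∀ x μ, IsP2 μ →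
    HasDerivWithinAt (fun s => u.U s x μ) (u.Ut t x μ) (Icc 0 T) t
  hasDeriv_x : ∀ t ∈ Icc 0 T, ∀ x μ, IsP2 μ →
    HasGradientAt (fun y => u.U t y μ) (u.Ux t x μ) x
  hasDeriv_xx : ∀ t ∈ Icc 0 T, ∀ x μ, IsP2 μ →
    HasFDerivAt (fun y => u.Ux t y μ) (u.Uxx t x μ) x
  hasDeriv_m : ∀ t ∈ Icc 0 T, ∀ x, HasLionsDeriv m P (u.U t x) (u.Um t x)
  hasDeriv_vm : ∀ t ∈ Icc 0 T, ∀ x μ, IsP2 μ → ∀ v,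
    HasFDerivAt (u.Um t x μ) (u.Uvm t x μ v) v
  cont_U : JointCont (Icc 0 T) u.U
  cont_t : JointCont (Ico 0 T) u.Ut
  cont_x : JointCont (Icc 0 T) u.Ux
  cont_xx : JointCont (Icc 0 T) u.Uxx
  cont_m : JointContSupp (Icc 0 T) u.Um
  cont_vm : JointContSupp (Icc 0 T) u.Uvm
  pde : ∀ t ∈ Ico 0 T, ∀ x μ, IsP2 μ →
    u.Ut t x μ
      + ⟪c.b x (u.U t x μ) (u.graphLaw t μ), u.Ux t x μ⟫
      + 1 / 2 * tr ((u.Uxx t x μ).comp (c.a x μ))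
      + c.f x (u.U t x μ) (ContinuousLinearMap.adjoint (c.σ x μ) (u.Ux t x μ)) (u.graphLaw t μ)
      + ∫ v, ⟪u.Um t x μ v, c.b v (u.U t v μ) (u.graphLaw t μ)⟫ ∂μ
      + ∫ v, 1 / 2 * tr ((u.Uvm t x μ v).comp (c.a v μ)) ∂μ = 0
  terminal : ∀ x μ, IsP2 μ → u.U T x μ = c.g x μ

/-- `𝒰` is a classical solution and it satisfies, with its derivatives, the regularity estimates
with the constants `Λ` and `α`. -/
structure H1 {Ω : Type*} {d : ℕ} (m : MeasurableSpace Ω) {_mΩ : MeasurableSpace Ω}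
    (P : Measure Ω) (T : ℝ) (c : Coeffs d) (u : Field d) (Λ α : ℝ) : Prop where
  classical : IsClassicalSolution m P T c u
  lip_m : ∀ t ∈ Icc 0 T, ∀ x μ μ', IsP2 μ → IsP2 μ' →
    |u.U t x μ - u.U t x μ'| + ‖u.Ux t x μ - u.Ux t x μ'‖ ≤ Λ * W2 μ μ'
  bound_first : ∀ t ∈ Icc 0 T, ∀ x μ, IsP2 μ →
    ‖u.Ux t x μ‖ₑ + eLpNorm (u.Um t x μ) 2 μ ≤ ENNReal.ofReal Λ
  bound_second : ∀ t ∈ Icc 0 T, ∀ x μ, IsP2 μ →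
    ‖u.Uxx t x μ‖ₑ + eLpNorm (u.Uvm t x μ) 2 μ ≤ ENNReal.ofReal Λ
  lip_xx : ∀ t ∈ Icc 0 T, ∀ x x' μ, IsP2 μ → ‖u.Uxx t x μ - u.Uxx t x' μ‖ ≤ Λ * ‖x - x'‖
  hold_t : ∀ t h, 0 ≤ t → 0 ≤ h → t + h ≤ T → ∀ x μ, IsP2 μ →
    |u.U (t + h) x μ - u.U t x μ| + ‖u.Ux (t + h) x μ - u.Ux t x μ‖
      ≤ Λ * Real.sqrt h * (1 + ‖x‖ + norm2 μ)
  lip_vm : ∀ t ∈ Icc 0 T, ∀ x μ, IsP2 μ → ∀ v v',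
    ‖u.Uvm t x μ v - u.Uvm t x μ v'‖
      ≤ Λ * Real.sqrt (1 + ‖v‖ ^ (2 * α) + ‖v'‖ ^ (2 * α) + norm2 μ ^ (2 * α)) * ‖v - v'‖

/-! ### The grids -/

/-- A grid `0 = t₀ < ⋯ < tₙ = T` which contains the points `r_k = k T / N`, `0 ≤ k ≤ N`;
`j k` is the index of `r_k` in the grid. -/
structure Grid (T : ℝ) (N : ℕ) where
  n : ℕ
  t : ℕ → ℝ
  j : ℕ → ℕ
  t_zero : t 0 = 0
  t_last : t n = T
  t_lt : ∀ i < n, t i < t (i + 1)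
  j_le : ∀ k ≤ N, j k ≤ n
  t_j : ∀ k ≤ N, t (j k) = k * (T / N)

/-- The time step `h_i = t_{i+1} - t_i`. -/
def Grid.h {T : ℝ} {N : ℕ} (G : Grid T N) (i : ℕ) : ℝ := G.t (i + 1) - G.t i

/-- The mesh size `|π|`. -/
def Grid.mesh {T : ℝ} {N : ℕ} (G : Grid T N) : ℝ := ⨆ i : Fin G.n, G.h i

/-! ### The scheme -/

/-- `Γ` maps `ℝᵈ` onto a finite set, is bounded by `Λ`, and is centered with the identity matrix as
covariance matrix under the standard Gaussian measure. -/
structure IsQuantizer {d : ℕ} (Γ : E d → E d) (Λ : ℝ) : Prop where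
  measurable : Measurable Γ
  finite : (range Γ).Finite
  bdd : ∀ w, ‖Γ w‖ ≤ Λ
  centered : ∫ w, Γ w ∂(stdGaussian (E d)) = 0
  covariance : ∀ u v : E d, ∫ w, ⟪Γ w, u⟫ * ⟪Γ w, v⟫ ∂(stdGaussian (E d)) = ⟪u, v⟫

section Scheme

variable {Ω : Type*} {mΩ : MeasurableSpace Ω} {d : ℕ}

/-- The quantized Brownian increment `h_i^{1/2} Γ(h_i^{-1/2} (W_{t_{i+1}} - W_{t_i}))`. -/
def incr {T : ℝ} {N : ℕ} (G : Grid T N) (W : ℝ → Ω → E d) (Γ : E d → E d) (i : ℕ) (ω : Ω) : E d :=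
  Real.sqrt (G.h i) • Γ ((Real.sqrt (G.h i))⁻¹ • (W (G.t (i + 1)) ω - W (G.t i) ω))

/-- `(X, Y, Z)`, indexed by the indices of the points of the grid in `[r_k, r_{k+1}]`, is an output
of the one-step solver at level `k`, for the input process `XX`, the terminal condition `η` and the
driver `f'`. -/
structure IsStep (P : Measure Ω) (ℱ : Filtration ℝ mΩ) (W : ℝ → Ω → E d) (c : Coeffs d)
    (Γ : E d → E d) {T : ℝ} {N : ℕ} (G : Grid T N) (k : ℕ)
    (XX : ℕ → Ω → E d) (η : Ω → ℝ) (f' : E d → ℝ → E d → Measure (EY d) → ℝ)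
    (X : ℕ → Ω → E d) (Y : ℕ → Ω → ℝ) (Z : ℕ → Ω → E d) : Prop where
  memLp_Y : ∀ i ∈ Icc (G.j k) (G.j (k + 1)), MemLp (Y i) 2 P
  terminal_Y : Y (G.j (k + 1)) =ᵐ[P] η
  terminal_Z : Z (G.j (k + 1)) =ᵐ[P] 0
  backward_Z : ∀ i ∈ Ico (G.j k) (G.j (k + 1)),
    Z i =ᵐ[P] P[fun ω => (G.h i)⁻¹ • Y (i + 1) ω • incr G W Γ i ω | ℱ (G.t i)]
  backward_Y : ∀ i ∈ Ico (G.j k) (G.j (k + 1)),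
    Y i =ᵐ[P] P[fun ω => Y (i + 1) ω
      + G.h i * f' (XX i ω) (Y i ω) (Z i ω) (jointLaw P (XX i) (Y i)) | ℱ (G.t i)]
  initial_X : X (G.j k) =ᵐ[P] XX (G.j k)
  forward_X : ∀ i ∈ Ico (G.j k) (G.j (k + 1)),
    X (i + 1) =ᵐ[P] fun ω => X i ω + G.h i • c.b (X i ω) (Y i ω) (jointLaw P (X i) (Y i))
      + c.σ (X i ω) (P.map (X i)) (incr G W Γ i ω)

/-- `IsSolFrom … J l ξ v`: the random variable `v` is an output, for the input `ξ`, of the full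
solver with `J` Picard iterations per period at the level `N - l`. At the level `N` the output is
`g(ξ, [ξ])`. At a level `k = N - l < N`, the forward component is initialized by the one-step
solver with null terminal condition and null driver (for the constant input `ξ`), and the `q`-th
Picard iteration, `1 ≤ q ≤ J`, runs the one-step solver with the driver `f` on the forward
component of the previous iteration, the terminal condition being the output of the full solver at
the level `k + 1` for the value of this component at time `r_{k+1}`; the output is the value at
time `r_k` of the backward component of the last iteration. -/
def IsSolFrom (P : Measure Ω) (ℱ : Filtration ℝ mΩ) (W : ℝ → Ω → E d) (c : Coeffs d)
    (Γ : E d → E d) {T : ℝ} {N : ℕ} (G : Grid T N) (J : ℕ) : ℕ → (Ω → E d) → (Ω → ℝ) → Prop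
  | 0, ξ, v => v =ᵐ[P] fun ω => c.g (ξ ω) (P.map ξ)
  | l + 1, ξ, v =>
    let k := N - (l + 1)
    ∃ (X : ℕ → ℕ → Ω → E d) (Y : ℕ → ℕ → Ω → ℝ) (Z : ℕ → ℕ → Ω → E d),
      IsStep P ℱ W c Γ G k (fun _ => ξ) 0 (fun _ _ _ _ => 0) (X 0) (Y 0) (Z 0) ∧
      (∀ q < J, ∃ η : Ω → ℝ,
        IsSolFrom P ℱ W c Γ G J l (X q (G.j (k + 1))) η ∧
        IsStep P ℱ W c Γ G k (X q) η c.f (X (q + 1)) (Y (q + 1)) (Z (q + 1))) ∧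
      v =ᵐ[P] Y J (G.j k)

/-- `v` is an output of the full solver `sol^k` at the level `k ≤ N`, for the input `ξ`. -/
def IsSol (P : Measure Ω) (ℱ : Filtration ℝ mΩ) (W : ℝ → Ω → E d) (c : Coeffs d)
    (Γ : E d → E d) {T : ℝ} {N : ℕ} (G : Grid T N) (J k : ℕ) (ξ : Ω → E d) (v : Ω → ℝ) : Prop :=
  IsSolFrom P ℱ W c Γ G J (N - k) ξ v

end Scheme

/-- The smallness condition
`(J - 1) (Λ δ'^J + e^{β δ'} K |π|^{1/2}) e^{β C₀ T} / (e^{β δ'} - 1) ≤ 1` with `δ' = C₀ T / N`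
and `mesh = |π|`. -/
def Smallness (Λ C₀ K β T : ℝ) (N J : ℕ) (mesh : ℝ) : Prop :=
  ((J : ℝ) - 1) *
      (Λ * (C₀ * (T / N)) ^ J + Real.exp (β * (C₀ * (T / N))) * (K * Real.sqrt mesh)) *
      (Real.exp (β * C₀ * T) / (Real.exp (β * (C₀ * (T / N))) - 1)) ≤ 1

end MKV

end

noncomputable section

namespace MKV

/-! ### Atomless probability spaces -/

section Atomless

variable {Ω : Type*} [mΩ : MeasurableSpace Ω] {μ : Measure Ω} [IsFiniteMeasure μ]

/-! The solver is compared directly with the field `𝒰` evaluated along the scheme; no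
continuous-time process and no Itô formula enter.

Local analysis. The noise of one step takes finitely many values γ and is independent of the past,
so conditioning on the past amounts to a finite average `Cubature.avg`. An Euler step started from
(X, Y) at time t is interpolated by X + (s - t) b + √(s - t) σγ, and the average over γ of `𝒰` along
these branches, with the law of the interpolated step as measure argument, is differentiated in s.
The chain rule creates terms with the singular factor 1 / (2√(s - t)). Because the noise is centered
with identity covariance, a second order expansion turns them into the two traces of the equation,
up to an error of order √h (`H1.abs_avg_Ux_sub_le` in space, `H1.abs_integral_Um_sub_le` in
measure). The equation then cancels everything except the driver and terms governed by the defect Y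
- 𝒰(t, X, [X]). With the mean value theorem, this yields `IsEuler.bound_consistency`: along the
scheme, `𝒰` solves the backward recursion up to h C (a + √h V^α), where a bounds the defect and V
bounds X and Y in L^{2α}.

Derivative in the measure. Lions' derivative is tested only on variables measurable at time 0,
whereas the interpolated step also uses later information. A function of laws does not see the
difference: since the space at time 0 is atomless, the triple of coefficients of the curve has a
copy with the same joint law there (`Atomless.exists_copy`, through Sierpiński's theorem and a
uniform variable), and the derivative is computed on the copy.

Stability. Over one step, an Euler increment changes the square of the L^{2α} norm by O(h)
relatively (`IsNoise.lpNorm_add_sq_le`), and the pair (conditional mean, conditional covariance with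
the noise) satisfies a Bessel inequality (`IsNoise.sq_condExp_add_sq_le`), which makes the backward
recursion stable although Z carries a factor h^{-1/2}. Discrete Gronwall lemmas propagate this over
a period of length δ.

Picard iterations and levels. Write θ = Cδ and let e be the error of the solver at the next level.
One iteration replaces a defect a by (1 + θ) e + θ (a + √|π| V^α) (`Setting.picard_step`); J
iterations give the error (1 + 4θ) e + 2θ √|π| V^α + θ^J a over one period (`Setting.level_error`).
Backward induction over the N levels multiplies by a bounded exponential factor and adds N
contributions, and Nδ = T.

Control of V and of the first defect. For bounded data, the backward components are bounded a priori
in every L^{2α}, and the first defect is absorbed thanks to θ ≤ 1/2 (`Setting.exists_first_defect`).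
For α = 1, everything is linear in the size of the input; the smallness condition ensures that the
error already obtained at the next level is at most that size, so that no iteration leaves the scale
of the input (`Setting.level_bound`), and this bound is proved inside the same induction. -/

theorem Atomless.exists_subset_pos_le (h : Atomless mΩ μ) {A : Set Ω} (hA : MeasurableSet A)
    (hpos : 0 < μ A) {ε : ℝ≥0∞} (hε : 0 < ε) :
    ∃ B, B ⊆ A ∧ MeasurableSet B ∧ 0 < μ B ∧ μ B ≤ ε := by
  -- Repeated halving: when a set is split into two pieces of positive measure, one of them carries
  -- at most half of its measure.
  have key : ∀ n : ℕ, ∃ B, B ⊆ A ∧ MeasurableSet B ∧ 0 < μ B ∧ μ B ≤ μ A / 2 ^ n := by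
    intro n
    induction n with
    | zero => exact ⟨A, subset_rfl, hA, hpos, by simp⟩
    | succ n ih =>
      obtain ⟨B, hBA, hB, hB0, hBn⟩ := ih
      obtain ⟨C, hCB, hC, hC0, hClt⟩ := h B hB hB0
      have hsplit : μ C + μ (B \ C) = μ B := by
        rw [measure_sdiff hCB hC.nullMeasurableSet (measure_ne_top _ _)]
        exact add_tsub_cancel_of_le hClt.le
      have hdiff : 0 < μ (B \ C) := by
        rw [measure_sdiff hCB hC.nullMeasurableSet (measure_ne_top _ _)]
        exact tsub_pos_of_lt hClt
      have hhalf : μ B / 2 ≤ μ A / 2 ^ (n + 1) := by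
        have hpow : μ A / 2 ^ (n + 1) = μ A / 2 ^ n / 2 := by
          simp only [div_eq_mul_inv, pow_succ]
          rw [ENNReal.mul_inv (by simp) (by simp), mul_assoc]
        rw [hpow]
        gcongr
      rcases le_total (μ C) (μ (B \ C)) with hle | hle
      · refine ⟨C, hCB.trans hBA, hC, hC0, le_trans ?_ hhalf⟩
        rw [ENNReal.le_div_iff_mul_le (by simp) (by simp), mul_two, ← hsplit]
        gcongr
      · refine ⟨B \ C, sdiff_subset.trans hBA, hB.diff hC, hdiff, le_trans ?_ hhalf⟩
        rw [ENNReal.le_div_iff_mul_le (by simp) (by simp), mul_two, ← hsplit]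
        gcongr
  have htend : Filter.Tendsto (fun n : ℕ => μ A / 2 ^ n) Filter.atTop (𝓝 0) := by
    have := ENNReal.Tendsto.const_mul (a := μ A)
      (ENNReal.tendsto_pow_atTop_nhds_zero_of_lt_one (r := 2⁻¹) (by simp))
      (Or.inr (measure_ne_top _ _))
    simpa [div_eq_mul_inv, ENNReal.inv_pow] using this
  obtain ⟨n, hn⟩ := (htend.eventually (gt_mem_nhds hε)).exists
  obtain ⟨B, h1, h2, h3, h4⟩ := key n
  exact ⟨B, h1, h2, h3, h4.trans hn.le⟩

/-- Sierpiński's theorem: an atomless finite measure takes all intermediate values. -/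
theorem Atomless.exists_subset_eq (h : Atomless mΩ μ) {A : Set Ω} (hA : MeasurableSet A)
    {c : ℝ≥0∞} (hc : c ≤ μ A) : ∃ B, B ⊆ A ∧ MeasurableSet B ∧ μ B = c := by
  have hctop : c ≠ ⊤ := (hc.trans_lt (measure_lt_top _ _)).ne
  let Adm : Set Ω → Set Ω → Prop := fun B D =>
    D ⊆ A \ B ∧ MeasurableSet D ∧ μ B + μ D ≤ c
  let s : Set Ω → ℝ≥0∞ := fun B => ⨆ D, ⨆ _ : Adm B D, μ D
  -- Greedy choice: D exhausts at least half of the largest measure that can still be added to B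
  -- without exceeding c.
  have step : ∀ B, ∃ D, (μ B ≤ c → Adm B D) ∧ (s B ≤ 2 * μ D ∨ ¬ μ B ≤ c) := by
    intro B
    by_cases hB : μ B ≤ c
    swap
    · exact ⟨∅, fun h => absurd h hB, Or.inr hB⟩
    by_cases hs : s B = 0
    · exact ⟨∅, fun _ => ⟨empty_subset _, .empty, by simpa using hB⟩, Or.inl (by simp [hs])⟩
    have h_top : s B ≠ ⊤ := by
      refine ne_top_of_le_ne_top (measure_ne_top μ univ) ?_
      exact iSup₂_le fun D _ => measure_mono (subset_univ _)
    have : s B / 2 < s B := ENNReal.half_lt_self hs h_top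
    obtain ⟨D, hD⟩ := lt_iSup_iff.1 this
    obtain ⟨hadm, hlt⟩ := lt_iSup_iff.1 hD
    refine ⟨D, fun _ => hadm, Or.inl ?_⟩
    rw [mul_comm]
    exact (ENNReal.div_le_iff_le_mul (by simp) (by simp)).1 hlt.le
  choose D hD using step
  let B : ℕ → Set Ω := fun n => Nat.rec ∅ (fun _ B => B ∪ D B) n
  have hBs : ∀ n, B (n + 1) = B n ∪ D (B n) := fun n => rfl
  have inv : ∀ n, B n ⊆ A ∧ MeasurableSet (B n) ∧ μ (B n) ≤ c := by
    intro n
    induction n with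
    | zero => exact ⟨empty_subset _, .empty, by simp [B]⟩
    | succ n ih =>
      obtain ⟨h1, h2, h3⟩ := ih
      obtain ⟨d1, d2, d3⟩ := (hD (B n)).1 h3
      rw [hBs]
      exact ⟨union_subset h1 (d1.trans sdiff_subset), h2.union d2, (measure_union_le _ _).trans d3⟩
  have hmeas : ∀ n, μ (B (n + 1)) = μ (B n) + μ (D (B n)) := by
    intro n
    obtain ⟨d1, d2, d3⟩ := (hD (B n)).1 (inv n).2.2
    rw [hBs, measure_union (disjoint_left.2 fun x hx hx' => (d1 hx').2 hx) d2]
  have hmono : Monotone B := monotone_nat_of_le_succ fun n => by rw [hBs]; exact subset_union_left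
  have hU : μ (⋃ n, B n) ≤ c := by
    rw [hmono.measure_iUnion]; exact iSup_le fun n => (inv n).2.2
  have hsum : ∀ n, ∑ i ∈ Finset.range n, μ (D (B i)) = μ (B n) := by
    intro n
    induction n with
    | zero => simp [B]
    | succ n ih => rw [Finset.sum_range_succ, ih, hmeas]
  have hto : Filter.Tendsto (fun n => μ (D (B n))) Filter.atTop (𝓝 0) := by
    refine ENNReal.tendsto_atTop_zero_of_tsum_ne_top ?_
    rw [ENNReal.tsum_eq_iSup_nat]
    refine ne_top_of_le_ne_top hctop (iSup_le fun n => ?_)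
    rw [hsum]; exact (inv n).2.2
  refine ⟨⋃ n, B n, iUnion_subset fun n => (inv n).1, .iUnion fun n => (inv n).2.1, ?_⟩
  by_contra hne
  have hlt : μ (⋃ n, B n) < c := lt_of_le_of_ne hU hne
  have hUm : MeasurableSet (⋃ n, B n) := .iUnion fun n => (inv n).2.1
  have hdiff : 0 < μ (A \ ⋃ n, B n) := by
    rw [measure_sdiff (iUnion_subset fun n => (inv n).1) hUm.nullMeasurableSet (measure_ne_top _ _)]
    exact tsub_pos_of_lt (hlt.trans_le hc)
  obtain ⟨F, hF1, hF2, hF3, hF4⟩ := h.exists_subset_pos_le (hA.diff hUm) hdiff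
    (tsub_pos_of_lt hlt)
  -- F could have been added at every stage, so the greedy choice keeps all increments above μ F /
  -- 2, whereas the increments are summable.
  have hbound : ∀ n, μ F ≤ 2 * μ (D (B n)) := by
    intro n
    have hadm : Adm (B n) F := by
      refine ⟨hF1.trans (sdiff_subset_sdiff_right (subset_iUnion B n)), hF2, ?_⟩
      calc μ (B n) + μ F ≤ μ (⋃ n, B n) + (c - μ (⋃ n, B n)) := by
            gcongr; exact subset_iUnion B n
        _ = c := add_tsub_cancel_of_le hlt.le
    rcases (hD (B n)).2 with h' | h'
    · exact (le_iSup₂_of_le F hadm le_rfl).trans h'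
    · exact absurd (inv n).2.2 h'
  have h0 : Filter.Tendsto (fun n => 2 * μ (D (B n))) Filter.atTop (𝓝 0) := by
    simpa using ENNReal.Tendsto.const_mul hto (Or.inr (by simp : (2 : ℝ≥0∞) ≠ ⊤))
  exact absurd (ge_of_tendsto' h0 hbound) (not_le.2 hF3)

theorem Atomless.exists_between (h : Atomless mΩ μ) {A B : Set Ω} (hA : MeasurableSet A)
    (hB : MeasurableSet B) (hAB : A ⊆ B) :
    ∃ M, A ⊆ M ∧ M ⊆ B ∧ MeasurableSet M ∧ μ M = (μ A + μ B) / 2 := by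
  have hle : μ A ≤ μ B := measure_mono hAB
  obtain ⟨D, hD1, hD2, hD3⟩ := h.exists_subset_eq (hB.diff hA) (c := μ (B \ A) / 2)
    ENNReal.half_le_self
  refine ⟨A ∪ D, subset_union_left, union_subset hAB (hD1.trans sdiff_subset), hA.union hD2, ?_⟩
  rw [measure_union (disjoint_left.2 fun x hx hx' => (hD1 hx').2 hx) hD2, hD3]
  have hsum : μ B = μ A + μ (B \ A) := by
    rw [measure_sdiff hAB hA.nullMeasurableSet (measure_ne_top _ _), add_tsub_cancel_of_le hle]
  rw [hsum, ← add_assoc, ENNReal.add_div, ← two_mul, mul_div_assoc,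
    ENNReal.mul_div_cancel (by simp) (by simp)]

/-- On an atomless probability space there is an increasing family of events indexed by the dyadic
numbers of `[0, 1]`, with the indices as probabilities. -/
theorem Atomless.exists_dyadic [IsProbabilityMeasure μ] (h : Atomless mΩ μ) :
    ∃ S : ℕ → ℕ → Set Ω, (∀ n k, MeasurableSet (S n k)) ∧ (∀ n, Monotone (S n)) ∧
      (∀ n k, S (n + 1) (2 * k) = S n k) ∧
      (∀ n k, k ≤ 2 ^ n → μ (S n k) = k / 2 ^ n) := by
  classical
  have hmid : ∀ A B : Set Ω, ∃ M, MeasurableSet A → MeasurableSet B → A ⊆ B →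
      A ⊆ M ∧ M ⊆ B ∧ MeasurableSet M ∧ μ M = (μ A + μ B) / 2 := by
    intro A B
    by_cases hh : MeasurableSet A ∧ MeasurableSet B ∧ A ⊆ B
    · obtain ⟨M, hM⟩ := h.exists_between hh.1 hh.2.1 hh.2.2
      exact ⟨M, fun _ _ _ => hM⟩
    · exact ⟨∅, fun h1 h2 h3 => absurd ⟨h1, h2, h3⟩ hh⟩
  choose M hM using hmid
  -- Even indices repeat the previous generation and odd indices insert a set halfway. All indices k
  -- ≥ 1 start with the whole space, so that monotonicity needs no upper bound on k.
  let S : ℕ → ℕ → Set Ω := fun n => Nat.rec (fun k => if k = 0 then ∅ else univ)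
    (fun _ s k => if k % 2 = 0 then s (k / 2) else M (s (k / 2)) (s (k / 2 + 1))) n
  have S0 : ∀ k, S 0 k = if k = 0 then ∅ else univ := fun _ => rfl
  have Ss : ∀ n k, S (n + 1) k =
      if k % 2 = 0 then S n (k / 2) else M (S n (k / 2)) (S n (k / 2 + 1)) := fun _ _ => rfl
  have even : ∀ n k, S (n + 1) (2 * k) = S n k := by
    intro n k; rw [Ss, if_pos (by omega), Nat.mul_div_cancel_left _ (by norm_num)]
  have odd : ∀ n k, S (n + 1) (2 * k + 1) = M (S n k) (S n (k + 1)) := by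
    intro n k
    rw [Ss, if_neg (by omega), show (2 * k + 1) / 2 = k by omega]
  have main : ∀ n, (∀ k, MeasurableSet (S n k)) ∧ (∀ k, S n k ⊆ S n (k + 1)) ∧
      (∀ k, k ≤ 2 ^ n → μ (S n k) = k / 2 ^ n) := by
    intro n
    induction n with
    | zero =>
      refine ⟨fun k => ?_, fun k => ?_, fun k hk => ?_⟩
      · rw [S0]; split_ifs <;> simp
      · rw [S0, S0]; simp
      · rw [S0]
        have : k = 0 ∨ k = 1 := by simp at hk; omega
        rcases this with rfl | rfl <;> simp
    | succ n ih =>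
      obtain ⟨i1, i2, i3⟩ := ih
      have hMk := fun k => hM (S n k) (S n (k + 1)) (i1 k) (i1 (k + 1)) (i2 k)
      refine ⟨fun k => ?_, fun k => ?_, fun k hk => ?_⟩
      · obtain ⟨j, rfl | rfl⟩ := Nat.even_or_odd' k
        · rw [even]; exact i1 j
        · rw [odd]; exact (hMk j).2.2.1
      · obtain ⟨j, rfl | rfl⟩ := Nat.even_or_odd' k
        · rw [even, odd]; exact (hMk j).1
        · rw [odd, show 2 * j + 1 + 1 = 2 * (j + 1) by ring, even]; exact (hMk j).2.1
      · obtain ⟨j, rfl | rfl⟩ := Nat.even_or_odd' k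
        · rw [even, i3 j (by rw [pow_succ] at hk; omega), pow_succ]
          push_cast
          rw [mul_comm (2 : ℝ≥0∞) j, ENNReal.mul_div_mul_right _ _ (by simp) (by simp)]
        · rw [odd, (hMk j).2.2.2, i3 j (by rw [pow_succ] at hk; omega),
            i3 (j + 1) (by rw [pow_succ] at hk; omega), ← ENNReal.add_div,
            div_eq_mul_inv, div_eq_mul_inv, mul_assoc, ← ENNReal.mul_inv (by simp) (by simp),
            ← pow_succ, div_eq_mul_inv]
          push_cast
          congr 1
          ring
  exact ⟨S, fun n => (main n).1, fun n => monotone_nat_of_le_succ (main n).2.1, even,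
    fun n => (main n).2.2⟩

/-- The variable is the infimum of the dyadic thresholds at which ω has entered the increasing
family. It is below x exactly on the union of the sets with index below x, and the measure of this
union is x. -/
theorem Atomless.exists_uniform [IsProbabilityMeasure μ] (h : Atomless mΩ μ) :
    ∃ U : Ω → unitInterval, Measurable U ∧ μ.map U = volume := by
  obtain ⟨S, Sm, Smono, Seven, Sμ⟩ := h.exists_dyadic
  have Spow : ∀ m n k, S (n + m) (2 ^ m * k) = S n k := by
    intro m
    induction m with
    | zero => intro n k; simp
    | succ m ih =>
      intro n k
      rw [← add_assoc, pow_succ', mul_assoc, Seven, ih]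
  have Scomp : ∀ n k n' k' : ℕ, (k : ℝ) / 2 ^ n ≤ k' / 2 ^ n' → S n k ⊆ S n' k' := by
    intro n k n' k' hle
    rw [← Spow n' n k, ← Spow n n' k', add_comm n' n]
    apply Smono
    rw [div_le_div_iff₀ (by positivity) (by positivity)] at hle
    have : k * 2 ^ n' ≤ k' * 2 ^ n := by exact_mod_cast hle
    linarith
  let T : ℝ → Set Ω := fun x => ⋃ (n : ℕ) (k : ℕ) (_ : k ≤ 2 ^ n ∧ (k : ℝ) / 2 ^ n < x), S n k
  have Tm : ∀ x, MeasurableSet (T x) := fun x =>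
    .iUnion fun n => .iUnion fun k => .iUnion fun _ => Sm n k
  let V : Ω → Set ℝ := fun ω => insert 1 {r | ∃ n k : ℕ, k ≤ 2 ^ n ∧ r = k / 2 ^ n ∧ ω ∈ S n k}
  have V0 : ∀ ω, ∀ r ∈ V ω, 0 ≤ r := by
    rintro ω r (rfl | ⟨n, k, -, rfl, -⟩)
    · norm_num
    · positivity
  have Vne : ∀ ω, (V ω).Nonempty := fun ω => ⟨1, mem_insert _ _⟩
  have Vbdd : ∀ ω, BddBelow (V ω) := fun ω => ⟨0, fun r hr => V0 ω r hr⟩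
  let u : Ω → ℝ := fun ω => sInf (V ω)
  have u_mem : ∀ ω, u ω ∈ Icc (0 : ℝ) 1 := fun ω =>
    ⟨le_csInf (Vne ω) (V0 ω), csInf_le (Vbdd ω) (mem_insert _ _)⟩
  have hlt : ∀ x ≤ (1 : ℝ), {ω | u ω < x} = T x := by
    intro x hx
    ext ω
    simp only [mem_ofPred_eq, u, csInf_lt_iff (Vbdd ω) (Vne ω), T, mem_iUnion]
    constructor
    · rintro ⟨r, rfl | ⟨n, k, hk, rfl, hω⟩, hr⟩
      · exact absurd hr (not_lt.2 hx)
      · exact ⟨n, k, ⟨hk, hr⟩, hω⟩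
    · rintro ⟨n, k, ⟨hk, hr⟩, hω⟩
      exact ⟨_, Or.inr ⟨n, k, hk, rfl, hω⟩, hr⟩
  have um : Measurable u := by
    refine measurable_of_Iio fun x => ?_
    rcases le_or_gt x 1 with hx | hx
    · change MeasurableSet {ω | u ω < x}
      rw [hlt x hx]; exact Tm x
    · convert MeasurableSet.univ
      ext ω; simpa using (u_mem ω).2.trans_lt hx
  have hT : ∀ x ∈ Icc (0 : ℝ) 1, μ (T x) = ENNReal.ofReal x := by
    intro x hx
    have hS : ∀ n k : ℕ, k ≤ 2 ^ n → μ (S n k) = ENNReal.ofReal (k / 2 ^ n) := by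
      intro n k hk
      rw [Sμ n k hk, ENNReal.ofReal_div_of_pos (by positivity), ENNReal.ofReal_natCast,
        ENNReal.ofReal_pow (by norm_num), ENNReal.ofReal_ofNat]
    apply le_antisymm
    -- The sets are nested according to their dyadic index, so the union is directed and its measure
    -- is a supremum.
    · let I := {p : ℕ × ℕ // p.2 ≤ 2 ^ p.1 ∧ (p.2 : ℝ) / 2 ^ p.1 < x}
      have hTI : T x = ⋃ p : I, S p.1.1 p.1.2 := by
        ext ω; simp [T, I]
      rw [hTI, Directed.measure_iUnion]
      · refine iSup_le fun p => ?_
        rw [hS _ _ p.2.1]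
        exact ENNReal.ofReal_le_ofReal p.2.2.le
      · intro p q
        rcases le_total ((p.1.2 : ℝ) / 2 ^ p.1.1) (q.1.2 / 2 ^ q.1.1) with hpq | hpq
        · exact ⟨q, Scomp _ _ _ _ hpq, subset_rfl⟩
        · exact ⟨p, subset_rfl, Scomp _ _ _ _ hpq⟩
    -- The dyadic number of generation n just below x misses it by at most 2⁻ⁿ, which is less than
    -- ε.
    · refine ENNReal.le_of_forall_pos_le_add fun ε hε _ => ?_
      obtain ⟨n, hn⟩ := exists_pow_lt_of_lt_one (show (0 : ℝ) < ε by exact_mod_cast hε)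
        (by norm_num : (1 / 2 : ℝ) < 1)
      rcases hx.1.eq_or_lt with rfl | hx0
      · simp
      have hc0 : 0 < ⌈x * 2 ^ n⌉₊ := Nat.ceil_pos.2 (by positivity)
      obtain ⟨k, hk⟩ : ∃ k, ⌈x * 2 ^ n⌉₊ = k + 1 := ⟨_, (Nat.succ_pred_eq_of_pos hc0).symm⟩
      have hk1 : (k : ℝ) < x * 2 ^ n := Nat.lt_ceil.1 (by omega)
      have hk2 : x * 2 ^ n ≤ k + 1 := by
        have := Nat.le_ceil (x * 2 ^ n); rw [hk] at this; exact_mod_cast this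
      have hkn : k ≤ 2 ^ n := by
        have : (k : ℝ) ≤ 2 ^ n := hk1.le.trans (by nlinarith [hx.2, show (0:ℝ) < 2 ^ n by positivity])
        exact_mod_cast this
      have hsub : S n k ⊆ T x := by
        intro ω hω
        simp only [T, mem_iUnion]
        exact ⟨n, k, ⟨hkn, by rw [div_lt_iff₀ (by positivity)]; exact hk1⟩, hω⟩
      calc ENNReal.ofReal x ≤ ENNReal.ofReal (k / 2 ^ n + ε) := by
            apply ENNReal.ofReal_le_ofReal
            have : x ≤ (k + 1) / 2 ^ n := by rw [le_div_iff₀ (by positivity)]; exact hk2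
            rw [add_div] at this
            have h2 : (1 : ℝ) / 2 ^ n < ε := by simpa [div_pow] using hn
            linarith
        _ = μ (S n k) + ε := by
            rw [ENNReal.ofReal_add (by positivity) ε.coe_nonneg, hS n k hkn, ENNReal.ofReal_coe_nnreal]
        _ ≤ μ (T x) + ε := by gcongr
  refine ⟨fun ω => ⟨u ω, u_mem ω⟩, um.subtype_mk, ?_⟩
  have hUm : Measurable fun ω => (⟨u ω, u_mem ω⟩ : unitInterval) := um.subtype_mk
  have : IsProbabilityMeasure (μ.map fun ω => (⟨u ω, u_mem ω⟩ : unitInterval)) :=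
    Measure.isProbabilityMeasure_map hUm.aemeasurable
  refine Measure.ext_of_Ici _ _ fun x => ?_
  have hIio : MeasurableSet (Iio x) := measurableSet_Iio
  rw [← compl_Iio, prob_compl_eq_one_sub hIio, prob_compl_eq_one_sub hIio,
    Measure.map_apply hUm hIio]
  congr 1
  have : (fun ω => (⟨u ω, u_mem ω⟩ : unitInterval)) ⁻¹' Iio x = {ω | u ω < x} := by
    ext ω; simp [← Subtype.coe_lt_coe]
  rw [this, hlt x x.2.2, hT x x.2, unitInterval.volume_Iio]

end Atomless

/-- The restriction of P to m is itself atomless, hence carries a uniform variable, and every law on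
a standard Borel space is the image of the uniform law. This is what moves any finite family of
random vectors to time 0 without changing its joint law. -/
theorem Atomless.exists_copy {Ω S : Type*} {m mΩ : MeasurableSpace Ω} {P : Measure Ω}
    [IsProbabilityMeasure P] (hm : m ≤ mΩ) (h : Atomless m P)
    [MeasurableSpace S] [StandardBorelSpace S] (X : Ω → S) (hX : Measurable X) :
    ∃ X' : Ω → S, Measurable[m] X' ∧ P.map X' = P.map X := by
  have hmu : ∀ A, MeasurableSet[m] A → P.trim hm A = P A := fun A hA => trim_measurableSet_eq hm hA
  have : IsProbabilityMeasure (P.trim hm) :=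
    ⟨by rw [trim_measurableSet_eq hm .univ]; exact measure_univ⟩
  have h' : @Atomless Ω m m (P.trim hm) := by
    intro A hA hpos
    rw [hmu A hA] at hpos
    obtain ⟨B, h1, h2, h3, h4⟩ := h A hA hpos
    exact ⟨B, h1, h2, by rwa [hmu B h2], by rwa [hmu B h2, hmu A hA]⟩
  obtain ⟨U, hU, hUl⟩ := @Atomless.exists_uniform Ω m (P.trim hm) _ _ h'
  have : IsProbabilityMeasure (P.map X) := Measure.isProbabilityMeasure_map hX.aemeasurable
  have : Nonempty S := by
    obtain ⟨ω⟩ := nonempty_of_isProbabilityMeasure P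
    exact ⟨X ω⟩
  obtain ⟨f, hf, hfl⟩ := (P.map X).exists_measurable_map_eq
  refine ⟨f ∘ U, hf.comp hU, ?_⟩
  rw [← hfl, ← hUl]
  ext A hA
  rw [Measure.map_apply ((hf.comp hU).mono hm le_rfl) hA, Measure.map_apply hf hA,
    Measure.map_apply hU (hf hA), hmu _ (hU (hf hA))]
  rfl

end MKV
end

noncomputable section

namespace MKV

/-! ### Finitely supported standardized laws -/

/-- A finitely supported probability on `ℝᵈ`, bounded by `Λ`, centered, with covariance `1`. -/
structure Cubature (d : ℕ) (Λ : ℝ) where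
  S : Finset (E d)
  w : E d → ℝ
  w_nonneg : ∀ γ, 0 ≤ w γ
  sum_w : ∑ γ ∈ S, w γ = 1
  bdd : ∀ γ ∈ S, ‖γ‖ ≤ Λ
  centered : ∑ γ ∈ S, w γ • γ = 0
  cov : ∀ u v : E d, ∑ γ ∈ S, w γ * (⟪γ, u⟫ * ⟪γ, v⟫) = ⟪u, v⟫

namespace Cubature

variable {d : ℕ} {Λ : ℝ} (q : Cubature d Λ) {V : Type*} [NormedAddCommGroup V] [NormedSpace ℝ V]

/-- The mean of `φ`. -/
def avg (φ : E d → V) : V := ∑ γ ∈ q.S, q.w γ • φ γ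

theorem avg_const (v : V) : q.avg (fun _ => v) = v := by
  simp [avg, ← Finset.sum_smul, q.sum_w]

theorem avg_add (φ ψ : E d → V) : q.avg (fun γ => φ γ + ψ γ) = q.avg φ + q.avg ψ := by
  simp [avg, Finset.sum_add_distrib]

theorem avg_sub (φ ψ : E d → V) : q.avg (fun γ => φ γ - ψ γ) = q.avg φ - q.avg ψ := by
  simp [avg, smul_sub, Finset.sum_sub_distrib]

theorem avg_smul (a : ℝ) (φ : E d → V) : q.avg (fun γ => a • φ γ) = a • q.avg φ := by
  simp only [avg, Finset.smul_sum]
  exact Finset.sum_congr rfl fun γ _ => smul_comm _ _ _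

theorem avg_mul (a : ℝ) (φ : E d → ℝ) : q.avg (fun γ => a * φ γ) = a * q.avg φ :=
  q.avg_smul a φ

theorem avg_clm {V' : Type*} [NormedAddCommGroup V'] [NormedSpace ℝ V'] (A : V →L[ℝ] V')
    (φ : E d → V) : q.avg (fun γ => A (φ γ)) = A (q.avg φ) := by
  simp [avg, map_sum]

theorem avg_mono {φ ψ : E d → ℝ} (h : ∀ γ ∈ q.S, φ γ ≤ ψ γ) : q.avg φ ≤ q.avg ψ :=
  Finset.sum_le_sum fun γ hγ => mul_le_mul_of_nonneg_left (h γ hγ) (q.w_nonneg γ)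

theorem avg_le {φ : E d → ℝ} {c : ℝ} (h : ∀ γ ∈ q.S, φ γ ≤ c) : q.avg φ ≤ c :=
  (q.avg_mono h).trans_eq (q.avg_const c)

theorem norm_avg_le (φ : E d → V) : ‖q.avg φ‖ ≤ q.avg fun γ => ‖φ γ‖ := by
  refine (norm_sum_le _ _).trans (Finset.sum_le_sum fun γ _ => ?_)
  rw [norm_smul, Real.norm_of_nonneg (q.w_nonneg γ), smul_eq_mul]

theorem norm_avg_le_of_forall {φ : E d → V} {c : ℝ} (h : ∀ γ ∈ q.S, ‖φ γ‖ ≤ c) :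
    ‖q.avg φ‖ ≤ c :=
  (q.norm_avg_le φ).trans (q.avg_le h)

theorem avg_id : q.avg (fun γ => γ) = 0 := q.centered

theorem avg_inner (v : E d) : q.avg (fun γ => ⟪v, γ⟫) = 0 := by
  have := q.avg_clm (innerSL ℝ v) fun γ => γ
  simpa [q.avg_id] using this

theorem avg_inner_mul (u v : E d) : q.avg (fun γ => ⟪γ, u⟫ * ⟪γ, v⟫) = ⟪u, v⟫ := q.cov u v

/-- Discrete integration by parts, dual to the identity covariance: this is how the scheme for Z
reads the gradient of a function of the noise. -/
theorem avg_inner_smul (u : E d) : q.avg (fun γ => ⟪u, γ⟫ • γ) = u := by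
  refine ext_inner_right ℝ fun v => ?_
  have h := q.avg_clm (innerSL ℝ v) fun γ => ⟪u, γ⟫ • γ
  simp only [innerSL_apply_apply] at h
  rw [real_inner_comm, ← h, ← q.avg_inner_mul u v]
  congr 1
  ext γ
  rw [inner_smul_right, real_inner_comm u γ, real_inner_comm v γ]

theorem bound_nonneg {d : ℕ} {Λ : ℝ} (q : Cubature d Λ) : 0 ≤ Λ := by
  obtain ⟨γ, hγ⟩ : q.S.Nonempty := by
    rw [Finset.nonempty_iff_ne_empty]
    intro h
    have := q.sum_w
    simp [h] at this
  exact (norm_nonneg γ).trans (q.bdd γ hγ)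

/-- Expand both vectors in an orthonormal basis; the covariance collapses the double products to the
diagonal. -/
theorem avg_inner_trace (A : E d →L[ℝ] E d) : q.avg (fun γ => ⟪A γ, γ⟫) = tr A := by
  have h : ∀ γ : E d, ⟪A γ, γ⟫ = ∑ i, ⟪γ, EuclideanSpace.basisFun (Fin d) ℝ i⟫ *
      ⟪γ, (ContinuousLinearMap.adjoint A) (EuclideanSpace.basisFun (Fin d) ℝ i)⟫ := by
    intro γ
    rw [← OrthonormalBasis.sum_inner_mul_inner (EuclideanSpace.basisFun (Fin d) ℝ) (A γ) γ]
    refine Finset.sum_congr rfl fun i _ => ?_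
    rw [ContinuousLinearMap.adjoint_inner_right, mul_comm, real_inner_comm γ]
  unfold avg
  simp_rw [h, Finset.smul_sum]
  rw [Finset.sum_comm]
  unfold tr
  rw [LinearMap.trace_eq_sum_inner _ (EuclideanSpace.basisFun (Fin d) ℝ)]
  refine Finset.sum_congr rfl fun i _ => ?_
  have := q.cov (EuclideanSpace.basisFun (Fin d) ℝ i)
    ((ContinuousLinearMap.adjoint A) (EuclideanSpace.basisFun (Fin d) ℝ i))
  simp only [smul_eq_mul]
  rw [this, ContinuousLinearMap.adjoint_inner_right, real_inner_comm]
  rfl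

/-- The cubature plays the role of the quadratic variation. The operator is conjugated by s, and the
cyclicity of the trace brings s s† to the right. -/
theorem avg_trace (A s : E d →L[ℝ] E d) :
    q.avg (fun γ => ⟪A (s γ), s γ⟫) =
      tr (A.comp (s.comp (ContinuousLinearMap.adjoint s))) := by
  have h := q.avg_inner_trace ((ContinuousLinearMap.adjoint s).comp (A.comp s))
  simp only [ContinuousLinearMap.comp_apply, ContinuousLinearMap.adjoint_inner_left] at h
  rw [h]
  unfold tr
  have := LinearMap.trace_mul_comm ℝ ((ContinuousLinearMap.adjoint s : E d →L[ℝ] E d) : E d →ₗ[ℝ] E d)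
    ((A.comp s : E d →L[ℝ] E d) : E d →ₗ[ℝ] E d)
  exact this

end Cubature

theorem abs_tr_le {d : ℕ} (A : E d →L[ℝ] E d) : |tr A| ≤ d * ‖A‖ := by
  unfold tr
  rw [LinearMap.trace_eq_sum_inner _ (EuclideanSpace.basisFun (Fin d) ℝ)]
  refine (Finset.abs_sum_le_sum_abs _ _).trans ?_
  have : ∀ i ∈ Finset.univ, |⟪EuclideanSpace.basisFun (Fin d) ℝ i,
      (A : E d →ₗ[ℝ] E d) (EuclideanSpace.basisFun (Fin d) ℝ i)⟫| ≤ ‖A‖ := by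
    intro i _
    refine (abs_real_inner_le_norm _ _).trans ?_
    have h1 : ‖EuclideanSpace.basisFun (Fin d) ℝ i‖ = 1 :=
      (EuclideanSpace.basisFun (Fin d) ℝ).orthonormal.1 i
    rw [h1, one_mul]
    have := A.le_opNorm (EuclideanSpace.basisFun (Fin d) ℝ i)
    rw [h1, mul_one] at this
    exact this
  refine (Finset.sum_le_sum this).trans ?_
  simp

theorem tr_sub {d : ℕ} (A B : E d →L[ℝ] E d) : tr (A - B) = tr A - tr B := by
  simp [tr, map_sub]

/-! ### Moments -/

/-- Bound by exp(αu), then expand to second order. The linear term must be exactly αu, because it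
will vanish in the mean. -/
theorem one_add_rpow_le {α u : ℝ} (hα : 1 ≤ α) (hu : |u| ≤ 1) :
    (1 + u) ^ α ≤ 1 + α * u + α ^ 2 * Real.exp α * u ^ 2 := by
  have hu1 := abs_le.1 hu
  have h1 : (1 + u) ^ α ≤ Real.exp (α * u) := by
    rw [mul_comm, Real.exp_mul]
    exact Real.rpow_le_rpow (by linarith) (by linarith [Real.add_one_le_exp u]) (by linarith)
  have h2 := Complex.norm_exp_sub_sum_le_norm_mul_exp ((α * u : ℝ) : ℂ) 2
  have h3 : |Real.exp (α * u) - (1 + α * u)| ≤ |α * u| ^ 2 * Real.exp |α * u| := by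
    have e1 : Complex.exp ((α * u : ℝ) : ℂ) - ∑ m ∈ Finset.range 2, ((α * u : ℝ) : ℂ) ^ m / m.factorial
        = ((Real.exp (α * u) - (1 + α * u) : ℝ) : ℂ) := by
      simp [Finset.sum_range_succ]
    rw [e1, Complex.norm_real, Complex.norm_real, Real.norm_eq_abs, Real.norm_eq_abs] at h2
    exact h2
  have h4 : |α * u| ≤ α := by
    rw [abs_mul, abs_of_nonneg (by linarith)]
    nlinarith
  have h5 : Real.exp |α * u| ≤ Real.exp α := Real.exp_le_exp.2 h4
  have h6 : |α * u| ^ 2 = α ^ 2 * u ^ 2 := by rw [sq_abs]; ring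
  have h7 := (abs_le.1 h3).2
  rw [h6] at h7
  have h8 : α ^ 2 * u ^ 2 * Real.exp |α * u| ≤ α ^ 2 * u ^ 2 * Real.exp α := by gcongr
  linarith

/-- The constant of the moment estimates. -/
def momentConst (Λ α : ℝ) : ℝ := Λ ^ 2 + 4 * Λ ^ 2 * (α * Real.exp α)

theorem momentConst_nonneg {Λ α : ℝ} (hα : 1 ≤ α) : 0 ≤ momentConst Λ α := by
  unfold momentConst
  have : 0 ≤ α := by linarith
  positivity

/-- With R = ‖a‖² + Λ²‖s‖², the squared norm is at most R (1 + v) where v is centered, |v| ≤ 1 and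
v² = O(‖s‖² / R). The expansion of (1 + v)^α has no first order contribution in the mean. Keeping
the whole bound inside the power α leaves the coefficient 1 in front of ‖a‖², which is indispensable
for an iteration over many steps. -/
theorem Cubature.avg_norm_add_rpow_le {d : ℕ} {Λ α : ℝ} (q : Cubature d Λ) (hα : 1 ≤ α)
    (a : E d) (s : E d →L[ℝ] E d) :
    q.avg (fun γ => (‖a + s γ‖ ^ 2) ^ α) ≤ (‖a‖ ^ 2 + momentConst Λ α * ‖s‖ ^ 2) ^ α := by
  set R : ℝ := ‖a‖ ^ 2 + Λ ^ 2 * ‖s‖ ^ 2 with hR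
  have hα0 : 0 ≤ α := by linarith
  have hR0 : 0 ≤ R := by positivity
  have hsγ : ∀ γ ∈ q.S, ‖s γ‖ ≤ Λ * ‖s‖ := fun γ hγ => by
    rw [mul_comm]
    exact (s.le_opNorm γ).trans (by gcongr; exact q.bdd γ hγ)
  -- If R = 0, then a and every s γ vanish; this case is set apart because v has R as denominator.
  rcases hR0.eq_or_lt with h0 | hRpos
  · have ha : ‖a‖ = 0 := by
      have : 0 ≤ Λ ^ 2 * ‖s‖ ^ 2 := by positivity
      nlinarith [sq_nonneg ‖a‖]
    have hs0 : Λ ^ 2 * ‖s‖ ^ 2 = 0 := by nlinarith [sq_nonneg ‖a‖]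
    have hs1 : Λ * ‖s‖ = 0 := by
      have : (Λ * ‖s‖) ^ 2 = 0 := by rw [mul_pow]; exact hs0
      exact pow_eq_zero_iff (two_ne_zero) |>.1 this
    refine q.avg_le fun γ hγ => ?_
    have h1 : ‖a + s γ‖ = 0 := by
      refine le_antisymm ((norm_add_le _ _).trans ?_) (norm_nonneg _)
      rw [ha, zero_add]
      exact (hsγ γ hγ).trans hs1.le
    rw [h1]
    apply Real.rpow_le_rpow (by norm_num) _ hα0
    have := momentConst_nonneg (Λ := Λ) hα
    simp only [ne_eq, OfNat.ofNat_ne_zero, not_false_eq_true, zero_pow]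
    positivity
  · set v : E d → ℝ := fun γ => 2 * ⟪a, s γ⟫ / R
    have hv : ∀ γ ∈ q.S, |v γ| ≤ 1 := by
      intro γ hγ
      simp only [v, abs_div, abs_of_pos hRpos, div_le_one hRpos, abs_mul]
      have h1 := abs_real_inner_le_norm a (s γ)
      have h2 := hsγ γ hγ
      norm_num
      nlinarith [sq_nonneg (‖a‖ - Λ * ‖s‖), norm_nonneg a, norm_nonneg (s γ)]
    have hv2 : ∀ γ ∈ q.S, (v γ) ^ 2 ≤ 4 * Λ ^ 2 * ‖s‖ ^ 2 / R := by
      intro γ hγ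
      simp only [v, div_pow]
      rw [div_le_div_iff₀ (by positivity) hRpos]
      have h1 : ⟪a, s γ⟫ ^ 2 ≤ R * (Λ ^ 2 * ‖s‖ ^ 2) := by
        have h1 := abs_real_inner_le_norm a (s γ)
        have h2 : |⟪a, s γ⟫| ≤ ‖a‖ * (Λ * ‖s‖) := h1.trans (by gcongr; exact hsγ γ hγ)
        calc ⟪a, s γ⟫ ^ 2 = |⟪a, s γ⟫| ^ 2 := (sq_abs _).symm
          _ ≤ (‖a‖ * (Λ * ‖s‖)) ^ 2 := by gcongr
          _ = ‖a‖ ^ 2 * (Λ ^ 2 * ‖s‖ ^ 2) := by ring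
          _ ≤ _ := by gcongr; rw [hR]; nlinarith [show 0 ≤ Λ ^ 2 * ‖s‖ ^ 2 by positivity]
      nlinarith
    have hpt : ∀ γ ∈ q.S, (‖a + s γ‖ ^ 2) ^ α ≤
        R ^ α * (1 + α * v γ + α ^ 2 * Real.exp α * (4 * Λ ^ 2 * ‖s‖ ^ 2 / R)) := by
      intro γ hγ
      have h1 : ‖a + s γ‖ ^ 2 ≤ R * (1 + v γ) := by
        rw [norm_add_sq_real]
        have : R * (1 + v γ) = R + 2 * ⟪a, s γ⟫ := by simp only [v]; field_simp
        rw [this, hR]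
        have : ‖s γ‖ ^ 2 ≤ (Λ * ‖s‖) ^ 2 := by gcongr; exact hsγ γ hγ
        linarith [mul_pow Λ ‖s‖ 2]
      have hv1 := abs_le.1 (hv γ hγ)
      refine (Real.rpow_le_rpow (by positivity) h1 hα0).trans ?_
      rw [Real.mul_rpow hR0 (by linarith)]
      gcongr
      refine (one_add_rpow_le hα (hv γ hγ)).trans ?_
      gcongr
      exact hv2 γ hγ
    refine (q.avg_mono hpt).trans ?_
    rw [q.avg_mul, q.avg_add, q.avg_add, q.avg_const, q.avg_const, q.avg_mul]
    have hvavg : q.avg v = 0 := by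
      have : v = fun γ => (2 / R) * ⟪(ContinuousLinearMap.adjoint s) a, γ⟫ := by
        ext γ; simp only [v, ContinuousLinearMap.adjoint_inner_left]; ring
      rw [this, q.avg_mul, q.avg_inner, mul_zero]
    rw [hvavg, mul_zero, add_zero]
    -- Bernoulli's inequality puts the second order term back under the power α.
    have hB : 1 + α * (α * Real.exp α * (4 * Λ ^ 2 * ‖s‖ ^ 2 / R)) ≤
        (1 + α * Real.exp α * (4 * Λ ^ 2 * ‖s‖ ^ 2 / R)) ^ α :=
      one_add_mul_self_le_rpow_one_add (by
        have : 0 ≤ α * Real.exp α * (4 * Λ ^ 2 * ‖s‖ ^ 2 / R) := by positivity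
        linarith) hα
    calc R ^ α * (1 + α ^ 2 * Real.exp α * (4 * Λ ^ 2 * ‖s‖ ^ 2 / R))
        ≤ R ^ α * (1 + α * Real.exp α * (4 * Λ ^ 2 * ‖s‖ ^ 2 / R)) ^ α := by
          gcongr
          refine le_trans (le_of_eq ?_) hB
          ring
      _ = (R * (1 + α * Real.exp α * (4 * Λ ^ 2 * ‖s‖ ^ 2 / R))) ^ α := by
          rw [Real.mul_rpow hR0 (by positivity)]
      _ = _ := by
          congr 1
          unfold momentConst
          field_simp
          rw [hR]
          ring

end MKV
end

noncomputable section

namespace MKV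

/-! ### Independent finitely valued noises -/

theorem integrable_inner_of_memLp {Ω V : Type*} {mΩ : MeasurableSpace Ω} {P : Measure Ω}
    [NormedAddCommGroup V] [InnerProductSpace ℝ V] {f g : Ω → V} (hf : MemLp f 2 P)
    (hg : MemLp g 2 P) : Integrable (fun ω => ⟪f ω, g ω⟫) P :=
  (hf.norm.integrable_mul hg.norm).mono' (hf.1.inner hg.1)
    (.of_forall fun _ => abs_real_inner_le_norm _ _)

/-- `G` has the law `q` and is independent of `m`. -/
structure IsNoise {Ω : Type*} {d : ℕ} {Λ : ℝ} (q : Cubature d Λ) (m : MeasurableSpace Ω)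
    {mΩ : MeasurableSpace Ω} (P : Measure Ω) (G : Ω → E d) : Prop where
  le : m ≤ mΩ
  measurable : Measurable G
  mem : ∀ ω, G ω ∈ q.S
  law : ∀ γ ∈ q.S, ∀ A, MeasurableSet[m] A → P (A ∩ G ⁻¹' {γ}) = ENNReal.ofReal (q.w γ) * P A

namespace IsNoise

variable {Ω : Type*} {m mΩ : MeasurableSpace Ω} {d : ℕ} {Λ : ℝ} {q : Cubature d Λ} {P : Measure Ω}
  [IsProbabilityMeasure P] {G : Ω → E d} {V : Type*} [NormedAddCommGroup V] [NormedSpace ℝ V]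
  [CompleteSpace V]

theorem measurableSet (hG : IsNoise q m P G) (γ : E d) : MeasurableSet (G ⁻¹' {γ}) :=
  hG.measurable (measurableSet_singleton γ)

/-- Independence in terms of measures: on m, the event G = γ acts as multiplication by its weight.
-/
theorem trim_restrict (hG : IsNoise q m P G) {γ : E d} (hγ : γ ∈ q.S) :
    (P.restrict (G ⁻¹' {γ})).trim hG.le = ENNReal.ofReal (q.w γ) • P.trim hG.le := by
  refine @Measure.ext _ m _ _ fun A hA => ?_
  rw [trim_measurableSet_eq _ hA, Measure.restrict_apply (hG.le _ hA), hG.law γ hγ A hA]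
  simp [trim_measurableSet_eq hG.le hA]

theorem sum_indicator (hG : IsNoise q m P G) {V : Type*} [AddCommMonoid V] (F : Ω → E d → V)
    (ω : Ω) :
    F ω (G ω) = ∑ γ ∈ q.S, (G ⁻¹' {γ}).indicator (fun ω => F ω γ) ω := by
  rw [Finset.sum_eq_single_of_mem (G ω) (hG.mem ω)]
  · exact (indicator_of_mem (s := G ⁻¹' {G ω}) (mem_preimage.2 (mem_singleton _))
      (fun ω' => F ω' (G ω))).symm
  · intro γ _ hne
    exact indicator_of_notMem (fun h => hne h.symm) _

theorem memLp_comp (hG : IsNoise q m P G) {p : ℝ≥0∞} {F : Ω → E d → V}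
    (hF : ∀ γ ∈ q.S, MemLp (fun ω => F ω γ) p P) : MemLp (fun ω => F ω (G ω)) p P := by
  simp_rw [fun ω => hG.sum_indicator F ω]
  exact memLp_finsetSum _ fun γ hγ => (hF γ hγ).indicator (hG.measurableSet γ)

theorem stronglyMeasurable_comp (hG : IsNoise q m P G) {V : Type*} [NormedAddCommGroup V]
    {F : Ω → E d → V}
    (hF : ∀ γ ∈ q.S, StronglyMeasurable[m] fun ω => F ω γ) :
    StronglyMeasurable fun ω => F ω (G ω) := by
  simp_rw [fun ω => hG.sum_indicator F ω]
  refine Finset.stronglyMeasurable_fun_sum _ fun γ hγ => ?_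
  exact ((hF γ hγ).mono hG.le).indicator (hG.measurableSet γ)

/-- Freezing of the variables known at the time m: as G has finitely many values, the random
function is a finite sum of indicators and independence applies to each summand. -/
theorem condExp_comp (hG : IsNoise q m P G) {F : Ω → E d → V}
    (hF : ∀ γ ∈ q.S, StronglyMeasurable[m] fun ω => F ω γ)
    (hFi : ∀ γ ∈ q.S, Integrable (fun ω => F ω γ) P) :
    P[fun ω => F ω (G ω) | m] =ᵐ[P] fun ω => q.avg (F ω) := by
  symm
  have hint : Integrable (fun ω => F ω (G ω)) P := by
    rw [← memLp_one_iff_integrable]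
    exact hG.memLp_comp fun γ hγ => memLp_one_iff_integrable.2 (hFi γ hγ)
  have hsm : ∀ γ ∈ q.S, Integrable (fun ω => q.w γ • F ω γ) P := fun γ hγ =>
    (hFi γ hγ).smul _
  refine ae_eq_condExp_of_forall_setIntegral_eq hG.le hint
    (fun A _ _ => (integrable_finsetSum _ hsm).integrableOn) (fun A hA _ => ?_)
    (StronglyMeasurable.aestronglyMeasurable ?_)
  · simp_rw [fun ω => hG.sum_indicator F ω]
    unfold Cubature.avg
    rw [integral_finsetSum _ fun γ hγ => (hsm γ hγ).integrableOn,
      integral_finsetSum _ fun γ hγ => ((hFi γ hγ).indicator (hG.measurableSet γ)).integrableOn]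
    refine Finset.sum_congr rfl fun γ hγ => ?_
    have hA' := hG.le _ hA
    rw [integral_smul, ← integral_indicator hA', ← integral_indicator hA', indicator_indicator,
      inter_comm, ← indicator_indicator, integral_indicator (hG.measurableSet γ)]
    have hsmI : StronglyMeasurable[m] (A.indicator fun ω => F ω γ) := (hF γ hγ).indicator hA
    rw [integral_trim hG.le hsmI, integral_trim hG.le hsmI, hG.trim_restrict hγ,
      integral_smul_measure, ENNReal.toReal_ofReal (q.w_nonneg γ)]
  · unfold Cubature.avg
    exact Finset.stronglyMeasurable_fun_sum _ fun γ hγ => (hF γ hγ).const_smul _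

theorem integral_comp (hG : IsNoise q m P G) {F : Ω → E d → V}
    (hF : ∀ γ ∈ q.S, StronglyMeasurable[m] fun ω => F ω γ)
    (hFi : ∀ γ ∈ q.S, Integrable (fun ω => F ω γ) P) :
    ∫ ω, F ω (G ω) ∂P = ∫ ω, q.avg (F ω) ∂P := by
  rw [← integral_condExp hG.le (f := fun ω => F ω (G ω))]
  exact integral_congr_ae (hG.condExp_comp hF hFi)

theorem norm_le (hG : IsNoise q m P G) (ω : Ω) : ‖G ω‖ ≤ Λ := q.bdd _ (hG.mem ω)

theorem memLp_smul (hG : IsNoise q m P G) {p : ℝ≥0∞} {y : Ω → ℝ} (hy : MemLp y p P) :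
    MemLp (fun ω => y ω • G ω) p P := by
  refine MemLp.of_le_mul (c := Λ) hy (hy.1.smul hG.measurable.aestronglyMeasurable) ?_
  refine .of_forall fun ω => ?_
  rw [norm_smul, mul_comm]
  gcongr
  exact hG.norm_le ω

/-- Bessel's inequality for the conditional expectation. -/
theorem sq_condExp_add_sq_le (hG : IsNoise q m P G) {y : Ω → ℝ} (hy : MemLp y 2 P) :
    ∀ᵐ ω ∂P, (P[y | m] ω) ^ 2 + ‖P[fun ω => y ω • G ω | m] ω‖ ^ 2 ≤ P[fun ω => y ω ^ 2 | m] ω := by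
  set a : Ω → ℝ := P[y | m] with ha
  set z : Ω → E d := P[fun ω => y ω • G ω | m] with hz
  have hyG := hG.memLp_smul hy
  have a2 : MemLp a 2 P := hy.condExp (by norm_num)
  have z2 : MemLp z 2 P := hyG.condExp (by norm_num)
  have am : StronglyMeasurable[m] a := stronglyMeasurable_condExp
  have zm : StronglyMeasurable[m] z := stronglyMeasurable_condExp
  have yi : Integrable y P := hy.integrable (by norm_num)
  have yGi : Integrable (fun ω => y ω • G ω) P := hyG.integrable (by norm_num)
  have I1 : Integrable (fun ω => y ω ^ 2) P := hy.integrable_sq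
  have I2 : Integrable (a * y) P := a2.integrable_mul hy
  have I3 : Integrable (fun ω => ⟪z ω, y ω • G ω⟫) P := by
    exact integrable_inner_of_memLp z2 hyG
  have hM : ∀ γ, MemLp (fun ω => a ω + ⟪z ω, γ⟫) 2 P := fun γ => a2.add (z2.inner_const γ)
  have I4 : Integrable (fun ω => (a ω + ⟪z ω, G ω⟫) ^ 2) P := by
    have : MemLp (fun ω => a ω + ⟪z ω, G ω⟫) 2 P :=
      hG.memLp_comp (F := fun ω γ => a ω + ⟪z ω, γ⟫) fun γ _ => hM γ
    exact this.integrable_sq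
  have e2 := condExp_mul_of_stronglyMeasurable_left am I2 yi
  have e3 : P[fun ω => ⟪z ω, y ω • G ω⟫ | m] =ᵐ[P] fun ω => ⟪z ω, z ω⟫ :=
    condExp_bilin_of_stronglyMeasurable_left (innerSL ℝ) zm I3 yGi
  have e4 := hG.condExp_comp (F := fun ω γ => (a ω + ⟪z ω, γ⟫) ^ 2)
    (fun γ _ => (am.add (zm.inner stronglyMeasurable_const)).pow 2)
    (fun γ _ => (hM γ).integrable_sq)
  -- The conditional mean square of the residual y - (a + ⟪z, G⟫), where a is the conditional mean
  -- and z the conditional covariance with the noise, is nonnegative; expanding this square gives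
  -- the inequality.
  have hpos : 0 ≤ᵐ[P] P[fun ω => (y ω ^ 2 - (2 : ℝ) • ((a * y) ω + ⟪z ω, y ω • G ω⟫))
      + (a ω + ⟪z ω, G ω⟫) ^ 2 | m] := by
    refine condExp_nonneg (.of_forall fun ω => ?_)
    have : (y ω ^ 2 - (2 : ℝ) • ((a * y) ω + ⟪z ω, y ω • G ω⟫))
      + (a ω + ⟪z ω, G ω⟫) ^ 2 = (y ω - (a ω + ⟪z ω, G ω⟫)) ^ 2 := by
      rw [real_inner_smul_right]
      simp
      ring
    exact (sq_nonneg _).trans_eq this.symm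
  have s1 := condExp_add (I1.sub ((I2.add I3).smul (2 : ℝ))) I4 m
  have s2 := condExp_sub I1 ((I2.add I3).smul (2 : ℝ)) m
  have s3 := condExp_smul (μ := P) (2 : ℝ) ((a * y) + fun ω => ⟪z ω, y ω • G ω⟫) m
  have s4 := condExp_add I2 I3 m
  filter_upwards [hpos, s1, s2, s3, s4, e2, e3, e4] with ω hpos s1 s2 s3 s4 e2 e3 e4
  have hpos' := hpos.trans_eq s1
  simp only [Pi.add_apply, Pi.zero_apply] at hpos' s4
  rw [s2] at hpos'
  simp only [Pi.sub_apply] at hpos'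
  rw [s3] at hpos'
  simp only [Pi.smul_apply] at hpos'
  rw [s4, e2, e3, e4] at hpos'
  simp only [Pi.mul_apply, smul_eq_mul] at hpos'
  rw [← ha, real_inner_self_eq_norm_sq] at hpos'
  -- Conditionally on m, the constant 1 and the coordinates of the noise form an orthonormal system.
  have havg : q.avg (fun γ => (a ω + ⟪z ω, γ⟫) ^ 2) = a ω ^ 2 + ‖z ω‖ ^ 2 := by
    have : (fun γ => (a ω + ⟪z ω, γ⟫) ^ 2) = fun γ => (a ω ^ 2 + 2 * a ω * ⟪z ω, γ⟫) +
        ⟪γ, z ω⟫ * ⟪γ, z ω⟫ := by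
      ext γ; rw [real_inner_comm γ (z ω)]; ring
    rw [this, q.avg_add, q.avg_add, q.avg_const, q.avg_mul, q.avg_inner, q.avg_inner_mul,
      real_inner_self_eq_norm_sq]
    ring
  rw [havg] at hpos'
  linarith

end IsNoise

/-! ### Estimates in `L^{2α}` -/

section LpTwoAlpha

variable {Ω : Type*} {m mΩ : MeasurableSpace Ω} {d : ℕ} {P : Measure Ω}

theorem one_le_ofReal_two_mul {α : ℝ} (hα : 1 ≤ α) : 1 ≤ ENNReal.ofReal (2 * α) := by
  rw [← ENNReal.ofReal_one]; exact ENNReal.ofReal_le_ofReal (by linarith)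

theorem two_le_ofReal_two_mul {α : ℝ} (hα : 1 ≤ α) : 2 ≤ ENNReal.ofReal (2 * α) := by
  rw [← ENNReal.ofReal_ofNat]; exact ENNReal.ofReal_le_ofReal (by linarith)

theorem one_le_ofReal' {α : ℝ} (hα : 1 ≤ α) : 1 ≤ ENNReal.ofReal α := by
  rw [← ENNReal.ofReal_one]; exact ENNReal.ofReal_le_ofReal hα

variable {V : Type*} [NormedAddCommGroup V]

theorem eLpNorm_norm_sq {α : ℝ} (hα : 1 ≤ α) (f : Ω → V) :
    eLpNorm (fun ω => ‖f ω‖ ^ 2) (ENNReal.ofReal α) P = eLpNorm f (ENNReal.ofReal (2 * α)) P ^ 2 := by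
  have := eLpNorm_norm_rpow (μ := P) (p := ENNReal.ofReal α) f (q := 2) (by norm_num)
  simp only [Real.rpow_two] at this
  rw [this, mul_comm 2 α, ENNReal.ofReal_mul (by linarith)]
  exact ENNReal.rpow_two _

theorem MemLp.norm_sq_ofReal {α : ℝ} (hα : 1 ≤ α) {f : Ω → V}
    (hf : MemLp f (ENNReal.ofReal (2 * α)) P) :
    MemLp (fun ω => ‖f ω‖ ^ 2) (ENNReal.ofReal α) P := by
  refine ⟨hf.1.norm.pow 2, ?_⟩
  rw [eLpNorm_norm_sq hα]
  exact ENNReal.pow_lt_top hf.2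

theorem lpNorm_norm_sq {α : ℝ} (hα : 1 ≤ α) {f : Ω → V} (hf : AEStronglyMeasurable f P) :
    lpNorm (fun ω => ‖f ω‖ ^ 2) (ENNReal.ofReal α) P = lpNorm f (ENNReal.ofReal (2 * α)) P ^ 2 := by
  have h : AEStronglyMeasurable (fun ω => ‖f ω‖ ^ 2) P := hf.norm.pow 2
  rw [← toReal_eLpNorm hf, ← toReal_eLpNorm h, eLpNorm_norm_sq hα, ENNReal.toReal_pow]

theorem lpNorm_mono_ae {p : ℝ≥0∞} {V' : Type*} [NormedAddCommGroup V'] {f : Ω → V} {g : Ω → V'}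
    (hg : MemLp g p P) (h : ∀ᵐ ω ∂P, ‖f ω‖ ≤ ‖g ω‖) : lpNorm f p P ≤ lpNorm g p P := by
  by_cases hf : AEStronglyMeasurable f P
  · rw [← toReal_eLpNorm hf, ← toReal_eLpNorm hg.1]
    exact ENNReal.toReal_mono hg.eLpNorm_ne_top (eLpNorm_mono_ae h)
  · rw [lpNorm_of_not_aestronglyMeasurable hf]; exact lpNorm_nonneg

theorem lpNorm_mono_real_ae {p : ℝ≥0∞} {f : Ω → V} {g : Ω → ℝ}
    (hg : MemLp g p P) (h : ∀ᵐ ω ∂P, ‖f ω‖ ≤ g ω) : lpNorm f p P ≤ lpNorm g p P :=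
  lpNorm_mono_ae hg (h.mono fun _ hω => hω.trans (Real.le_norm_self _))

theorem lpNorm_congr_ae {p : ℝ≥0∞} {f g : Ω → V} (h : f =ᵐ[P] g) : lpNorm f p P = lpNorm g p P := by
  by_cases hf : AEStronglyMeasurable f P
  · rw [← toReal_eLpNorm hf, ← toReal_eLpNorm (hf.congr h), eLpNorm_congr_ae h]
  · rw [lpNorm_of_not_aestronglyMeasurable hf,
      lpNorm_of_not_aestronglyMeasurable fun h' => hf (h'.congr h.symm)]

theorem lpNorm_le_lpNorm_of_le [IsProbabilityMeasure P] {p r : ℝ≥0∞} (hpr : p ≤ r) {f : Ω → V}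
    (hf : MemLp f r P) : lpNorm f p P ≤ lpNorm f r P := by
  rw [← toReal_eLpNorm hf.1, ← toReal_eLpNorm hf.1]
  exact ENNReal.toReal_mono hf.eLpNorm_ne_top (eLpNorm_le_eLpNorm_of_exponent_le hpr hf.1)

theorem lpNorm_const_mul {p : ℝ≥0∞} {c : ℝ} (hc : 0 ≤ c) (f : Ω → ℝ) :
    lpNorm (fun ω => c * f ω) p P = c * lpNorm f p P := by
  have := lpNorm_const_smul (p := p) c f P
  rw [coe_nnnorm, Real.norm_of_nonneg hc] at this
  exact this

variable [IsProbabilityMeasure P] {Λ α : ℝ} {q : Cubature d Λ} {G : Ω → E d}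

theorem memLp_clm_apply {p : ℝ≥0∞} {s : Ω → E d →L[ℝ] E d} (hs : MemLp s p P) (γ : E d) :
    MemLp (fun ω => s ω γ) p P := by
  refine hs.of_le_mul (c := ‖γ‖) ?_ (.of_forall fun ω => ?_)
  · exact (ContinuousLinearMap.apply ℝ (E d) γ).continuous.comp_aestronglyMeasurable hs.1
  · rw [mul_comm]; exact (s ω).le_opNorm γ

/-- A step of a martingale type increases the square of the norm of `L^{2α}` by a term of the order
of the square of the increment. -/
theorem IsNoise.lpNorm_add_sq_le (hG : IsNoise q m P G) (hα : 1 ≤ α) {A : Ω → E d}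
    {s : Ω → E d →L[ℝ] E d} (hAm : StronglyMeasurable[m] A) (hsm : StronglyMeasurable[m] s)
    (hA : MemLp A (ENNReal.ofReal (2 * α)) P) (hs : MemLp s (ENNReal.ofReal (2 * α)) P) :
    lpNorm (fun ω => A ω + s ω (G ω)) (ENNReal.ofReal (2 * α)) P ^ 2 ≤
      lpNorm A (ENNReal.ofReal (2 * α)) P ^ 2
        + momentConst Λ α * lpNorm s (ENNReal.ofReal (2 * α)) P ^ 2 := by
  have hC := momentConst_nonneg (Λ := Λ) hα
  have hα0 : 0 < α := by linarith
  have hpα : ENNReal.ofReal α ≠ 0 := by simpa using hα0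
  have hsγ : ∀ γ : E d, MemLp (fun ω => A ω + s ω γ) (ENNReal.ofReal (2 * α)) P := fun γ =>
    hA.add (memLp_clm_apply hs γ)
  have hAs : MemLp (fun ω => A ω + s ω (G ω)) (ENNReal.ofReal (2 * α)) P :=
    hG.memLp_comp (F := fun ω γ => A ω + s ω γ) fun γ _ => hsγ γ
  have hint : ∀ f : Ω → E d, MemLp f (ENNReal.ofReal (2 * α)) P →
      Integrable (fun ω => (‖f ω‖ ^ 2) ^ α) P := by
    intro f hf
    have := (MemLp.norm_sq_ofReal hα hf).integrable_norm_rpow hpα ENNReal.ofReal_ne_top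
    simpa [ENNReal.toReal_ofReal hα0.le] using this
  have hg : MemLp (fun ω => ‖A ω‖ ^ 2 + momentConst Λ α * ‖s ω‖ ^ 2) (ENNReal.ofReal α) P :=
    (MemLp.norm_sq_ofReal hα hA).add ((MemLp.norm_sq_ofReal hα hs).const_mul _)
  have hgi : Integrable (fun ω => (‖A ω‖ ^ 2 + momentConst Λ α * ‖s ω‖ ^ 2) ^ α) P := by
    have := hg.integrable_norm_rpow hpα ENNReal.ofReal_ne_top
    rw [ENNReal.toReal_ofReal hα0.le] at this
    refine this.congr (.of_forall fun ω => ?_)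
    simp only
    rw [Real.norm_of_nonneg (by positivity)]
  have h1 : ∫ ω, (‖A ω + s ω (G ω)‖ ^ 2) ^ α ∂P ≤
      ∫ ω, (‖A ω‖ ^ 2 + momentConst Λ α * ‖s ω‖ ^ 2) ^ α ∂P := by
    rw [hG.integral_comp (F := fun ω γ => (‖A ω + s ω γ‖ ^ 2) ^ α) ?_ fun γ _ => hint _ (hsγ γ)]
    · refine integral_mono ?_ hgi fun ω => q.avg_norm_add_rpow_le hα _ _
      unfold Cubature.avg
      exact integrable_finsetSum _ fun γ _ => (hint _ (hsγ γ)).smul (q.w γ)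
    · intro γ _
      have : StronglyMeasurable[m] fun ω => A ω + s ω γ :=
        hAm.add ((ContinuousLinearMap.apply ℝ (E d) γ).continuous.comp_stronglyMeasurable hsm)
      exact ((Real.continuous_rpow_const hα0.le).comp (continuous_pow 2)).comp_stronglyMeasurable
        this.norm
  rw [← lpNorm_norm_sq hα hAs.1]
  have h2 : lpNorm (fun ω => ‖A ω + s ω (G ω)‖ ^ 2) (ENNReal.ofReal α) P ≤
      lpNorm (fun ω => ‖A ω‖ ^ 2 + momentConst Λ α * ‖s ω‖ ^ 2) (ENNReal.ofReal α) P := by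
    have hm2 : AEStronglyMeasurable (fun ω => ‖A ω + s ω (G ω)‖ ^ 2) P := hAs.1.norm.pow 2
    rw [lpNorm_eq_integral_norm_rpow_toReal hpα ENNReal.ofReal_ne_top hm2,
      lpNorm_eq_integral_norm_rpow_toReal hpα ENNReal.ofReal_ne_top hg.1,
      ENNReal.toReal_ofReal hα0.le]
    refine Real.rpow_le_rpow (integral_nonneg fun _ => by positivity) ?_ (by positivity)
    refine le_trans (le_of_eq ?_) (h1.trans (le_of_eq ?_))
    · simp
    · refine integral_congr_ae (.of_forall fun ω => ?_)
      simp only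
      rw [Real.norm_of_nonneg (by positivity)]
  -- Minkowski's inequality is applied to the squares, in L^α.
  refine h2.trans ((lpNorm_add_le (MemLp.norm_sq_ofReal hα hA) (one_le_ofReal' hα)).trans ?_)
  rw [lpNorm_norm_sq hα hA.1, lpNorm_const_mul hC, lpNorm_norm_sq hα hs.1]

/-- The norm of the conditional expectation of `y` and of its conditional covariance with the
noise. -/
theorem IsNoise.lpNorm_condExp_add_le (hG : IsNoise q m P G) (hα : 1 ≤ α) {y : Ω → ℝ}
    (hy : MemLp y (ENNReal.ofReal (2 * α)) P) (K : ℝ) :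
    lpNorm (fun ω => |P[y | m] ω| + K * ‖P[fun ω => y ω • G ω | m] ω‖) (ENNReal.ofReal (2 * α)) P ≤
      (1 + K ^ 2) * lpNorm y (ENNReal.ofReal (2 * α)) P := by
  have hy2 : MemLp y 2 P := hy.mono_exponent (two_le_ofReal_two_mul hα)
  have h1 := one_le_ofReal_two_mul hα
  set f : Ω → ℝ := fun ω => |P[y | m] ω| + K * ‖P[fun ω => y ω • G ω | m] ω‖ with hf
  have fL : MemLp f (ENNReal.ofReal (2 * α)) P :=
    (hy.condExp h1).norm.add (((hG.memLp_smul hy).condExp h1).norm.const_mul K)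
  -- Pointwise Cauchy–Schwarz with the weights (1, K), then the Bessel inequality, then the
  -- contraction of the conditional expectation on y² in L^α. In the application K² is of order h,
  -- so the factor is 1 + O(h).
  have hsq : lpNorm f (ENNReal.ofReal (2 * α)) P ^ 2 ≤
      (1 + K ^ 2) * lpNorm y (ENNReal.ofReal (2 * α)) P ^ 2 := by
    rw [← lpNorm_norm_sq hα fL.1, ← lpNorm_norm_sq hα hy.1, ← lpNorm_const_mul (by positivity)]
    have hyα := MemLp.norm_sq_ofReal hα hy
    have hc : MemLp (fun ω => (1 + K ^ 2) * P[fun ω => ‖y ω‖ ^ 2 | m] ω) (ENNReal.ofReal α) P :=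
      (hyα.condExp (one_le_ofReal' hα)).const_mul _
    refine (lpNorm_mono_real_ae hc ?_).trans ?_
    · filter_upwards [hG.sq_condExp_add_sq_le hy2] with ω hω
      simp only [Real.norm_eq_abs, sq_abs] at hω ⊢
      rw [abs_of_nonneg (sq_nonneg _)]
      refine le_trans ?_ (mul_le_mul_of_nonneg_left hω (by positivity))
      simp only [hf]
      have e1 := sq_abs (P[y | m] ω)
      rw [← e1]
      nlinarith [sq_nonneg (‖P[fun ω => y ω • G ω | m] ω‖ - K * |P[y | m] ω|)]
    · rw [lpNorm_const_mul (by positivity), lpNorm_const_mul (by positivity)]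
      gcongr
      exact hyα.lpNorm_condExp_le_lpNorm (one_le_ofReal' hα)
  refine le_of_sq_le_sq ?_ (mul_nonneg (by positivity) lpNorm_nonneg)
  refine hsq.trans ?_
  rw [mul_pow]
  have : (1 + K ^ 2) ≤ (1 + K ^ 2) ^ 2 := by nlinarith [sq_nonneg K, sq_nonneg (K ^ 2)]
  gcongr

end LpTwoAlpha

end MKV
end

noncomputable section

namespace MKV

/-! ### Laws of square integrable variables -/

section Laws

variable {Ω : Type*} {mΩ : MeasurableSpace Ω} {P : Measure Ω} [IsProbabilityMeasure P]
  {V : Type*} [NormedAddCommGroup V] [MeasurableSpace V] [BorelSpace V]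
  [SecondCountableTopology V]

theorem isP2_map {X : Ω → V} (hX : MemLp X 2 P) : IsP2 (P.map X) where
  isProb := Measure.isProbabilityMeasure_map hX.1.aemeasurable
  memLp := (memLp_map_measure_iff (g := fun x : V => x) aestronglyMeasurable_id
    hX.1.aemeasurable).2 hX

theorem norm2_map {X : Ω → V} (hX : AEStronglyMeasurable X P) : norm2 (P.map X) = lpNorm X 2 P := by
  unfold norm2
  rw [eLpNorm_map_measure (g := fun x : V => x) aestronglyMeasurable_id hX.aemeasurable,
    ← toReal_eLpNorm hX]
  rfl

theorem W2_nonneg (μ ν : Measure V) : 0 ≤ W2 μ ν := Real.sqrt_nonneg _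

/-- The pair (X, X') is itself a coupling. All upper bounds of Wasserstein distances below come from
this one, which turns them into L² norms of differences. -/
theorem W2_map_le {X X' : Ω → V} (hX : MemLp X 2 P) (hX' : MemLp X' 2 P) :
    W2 (P.map X) (P.map X') ≤ lpNorm (fun ω => X ω - X' ω) 2 P := by
  have hXX' := hX.1.aemeasurable.prodMk hX'.1.aemeasurable
  have hsub : MemLp (fun ω => X ω - X' ω) 2 P := hX.sub hX'
  unfold W2
  refine Real.sqrt_le_iff.2 ⟨lpNorm_nonneg, ?_⟩
  have hmem : P.map (fun ω => (X ω, X' ω)) ∈ couplings (P.map X) (P.map X') := by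
    constructor
    · rw [AEMeasurable.map_map_of_aemeasurable measurable_fst.aemeasurable hXX']; rfl
    · rw [AEMeasurable.map_map_of_aemeasurable measurable_snd.aemeasurable hXX']; rfl
  have hle : (⨅ ρ ∈ couplings (P.map X) (P.map X'), ∫⁻ p, ‖p.1 - p.2‖ₑ ^ 2 ∂ρ) ≤
      eLpNorm (fun ω => X ω - X' ω) 2 P ^ 2 := by
    refine (iInf₂_le _ hmem).trans ?_
    rw [lintegral_map' (by fun_prop) hXX', eLpNorm_eq_lintegral_rpow_enorm_toReal (by norm_num) (by norm_num)]
    simp only [ENNReal.toReal_ofNat, ENNReal.rpow_ofNat, one_div]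
    rw [← ENNReal.rpow_natCast, ← ENNReal.rpow_mul]
    simp
  rw [← toReal_eLpNorm hsub.1, ← ENNReal.toReal_pow]
  exact ENNReal.toReal_mono (ENNReal.pow_ne_top hsub.eLpNorm_ne_top) hle

end Laws

section JointLaws

variable {Ω : Type*} {mΩ : MeasurableSpace Ω} {P : Measure Ω} [IsProbabilityMeasure P] {d : ℕ}

theorem norm_toLp_le (x : E d) (y : ℝ) : ‖(WithLp.toLp 2 (x, y) : EY d)‖ ≤ ‖x‖ + |y| := by
  rw [WithLp.prod_norm_eq_of_L2]
  refine Real.sqrt_le_iff.2 ⟨by positivity, ?_⟩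
  simp only [Real.norm_eq_abs]
  change ‖x‖ ^ 2 + |y| ^ 2 ≤ _
  nlinarith [norm_nonneg x, abs_nonneg y, mul_nonneg (norm_nonneg x) (abs_nonneg y)]

theorem memLp_toLp {p : ℝ≥0∞} {X : Ω → E d} {Y : Ω → ℝ} (hX : MemLp X p P) (hY : MemLp Y p P) :
    MemLp (fun ω => (WithLp.toLp 2 (X ω, Y ω) : EY d)) p P := by
  refine (hX.norm.add hY.norm).of_le ?_ (.of_forall fun ω => ?_)
  · exact (WithLp.prod_continuous_toLp 2 (E d) ℝ).comp_aestronglyMeasurable (hX.1.prodMk hY.1)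
  · refine (norm_toLp_le _ _).trans ?_
    exact Real.le_norm_self _

theorem isP2_jointLaw {X : Ω → E d} {Y : Ω → ℝ} (hX : MemLp X 2 P) (hY : MemLp Y 2 P) :
    IsP2 (jointLaw P X Y) := isP2_map (memLp_toLp hX hY)

theorem W2_jointLaw_le {X X' : Ω → E d} {Y Y' : Ω → ℝ} (hX : MemLp X 2 P) (hY : MemLp Y 2 P)
    (hX' : MemLp X' 2 P) (hY' : MemLp Y' 2 P) :
    W2 (jointLaw P X Y) (jointLaw P X' Y') ≤
      lpNorm (fun ω => X ω - X' ω) 2 P + lpNorm (fun ω => Y ω - Y' ω) 2 P := by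
  refine (W2_map_le (memLp_toLp hX hY) (memLp_toLp hX' hY')).trans ?_
  have h1 : MemLp (fun ω => ‖X ω - X' ω‖) 2 P := (hX.sub hX').norm
  have h2 : MemLp (fun ω => |Y ω - Y' ω|) 2 P := (hY.sub hY').norm
  refine (lpNorm_mono_real_ae (h1.add h2) (.of_forall fun ω => ?_)).trans
    ((lpNorm_add_le h1 (by norm_num)).trans (le_of_eq ?_))
  · rw [← WithLp.toLp_sub]
    exact norm_toLp_le _ _
  · rw [lpNorm_norm (hX.sub hX').1 (f := fun ω => X ω - X' ω), lpNorm_fun_abs (hY.sub hY').1 (f := fun ω => Y ω - Y' ω)]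

theorem graphLaw_map (u : Field d) (t : ℝ) {X : Ω → E d} (hX : AEMeasurable X P)
    (hU : Continuous fun x => u.U t x (P.map X)) :
    u.graphLaw t (P.map X) = jointLaw P X fun ω => u.U t (X ω) (P.map X) := by
  unfold Field.graphLaw jointLaw
  have h : Measurable fun v : E d => (WithLp.toLp 2 (v, u.U t v (P.map X)) : EY d) :=
    ((WithLp.prod_continuous_toLp 2 (E d) ℝ).comp (continuous_id.prodMk hU)).measurable
  rw [AEMeasurable.map_map_of_aemeasurable h.aemeasurable hX]
  rfl

end JointLaws

/-! ### The derivative along a curve of laws -/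

section LionsCurve

variable {Ω : Type*} {m₀ mΩ : MeasurableSpace Ω} {P : Measure Ω} [IsProbabilityMeasure P] {d : ℕ}

/-- The curve `A + (s - t) B + √(s - t) C`. -/
def curve (t : ℝ) (A B C : Ω → E d) (s : ℝ) (ω : Ω) : E d :=
  A ω + (s - t) • B ω + Real.sqrt (s - t) • C ω

theorem memLp_curve {p : ℝ≥0∞} {A B C : Ω → E d} (hA : MemLp A p P) (hB : MemLp B p P)
    (hC : MemLp C p P) (t s : ℝ) : MemLp (curve t A B C s) p P :=
  (hA.add (hB.const_smul (s - t))).add (hC.const_smul (Real.sqrt (s - t)))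

theorem abs_sqrt_sub_sqrt_le {a b : ℝ} (ha : 0 ≤ a) (hb : 0 < b) :
    |Real.sqrt a - Real.sqrt b| ≤ |a - b| / Real.sqrt b := by
  have hb' := Real.sqrt_pos.2 hb
  rw [le_div_iff₀ hb']
  have h : a - b = (Real.sqrt a - Real.sqrt b) * (Real.sqrt a + Real.sqrt b) := by
    nlinarith [Real.sq_sqrt ha, Real.sq_sqrt hb.le]
  rw [h, abs_mul]
  gcongr
  rw [abs_of_nonneg (by positivity)]
  linarith [Real.sqrt_nonneg a]

/-- Away from its initial time the curve is Lipschitz in L²; the constant blows up like (s -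
t)^{-1/2} because of the square root. -/
theorem lpNorm_curve_sub_le {A B C : Ω → E d} (hB : MemLp B 2 P) {t s s' : ℝ} (hs : t < s) (hs' : t ≤ s') :
    lpNorm (fun ω => curve t A B C s' ω - curve t A B C s ω) 2 P ≤
      (lpNorm B 2 P + lpNorm C 2 P / Real.sqrt (s - t)) * |s' - s| := by
  have e : (fun ω => curve t A B C s' ω - curve t A B C s ω) =
      ((s' - s) • B + (Real.sqrt (s' - t) - Real.sqrt (s - t)) • C) := by
    ext1 ω
    simp only [curve, Pi.add_apply, Pi.smul_apply]
    module
  rw [e]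
  refine (lpNorm_add_le (hB.const_smul _) (by norm_num)).trans ?_
  rw [lpNorm_const_smul, lpNorm_const_smul, coe_nnnorm, coe_nnnorm, Real.norm_eq_abs,
    Real.norm_eq_abs]
  have h := abs_sqrt_sub_sqrt_le (a := s' - t) (b := s - t) (by linarith) (by linarith)
  have h2 : s' - t - (s - t) = s' - s := by ring
  rw [h2] at h
  have h3 := mul_le_mul_of_nonneg_right h (lpNorm_nonneg (f := C) (p := 2) (μ := P))
  have h4 : |s' - s| / Real.sqrt (s - t) * lpNorm C 2 P = lpNorm C 2 P / Real.sqrt (s - t) * |s' - s| := by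
    ring
  linarith

/-- The triple (A, B, C) need not be measurable with respect to m₀. It is replaced by a copy that
is, with the same joint law, so that the laws along the whole curve and the two integrals are
unchanged; on the copy, the Fréchet differentiability of the lifting applies to the increments of
the curve. -/
theorem HasLionsDeriv.hasDerivAt_curve (hm : m₀ ≤ mΩ) (hat : Atomless m₀ P)
    {V : Measure (E d) → ℝ} {D : Measure (E d) → E d → E d} (hV : HasLionsDeriv m₀ P V D)
    {A B C : Ω → E d} (hAm : Measurable A) (hBm : Measurable B) (hCm : Measurable C)
    (hA : MemLp A 2 P) (hB : MemLp B 2 P) (hC : MemLp C 2 P) {t s : ℝ} (hts : t < s)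
    (hD : Continuous (D (P.map (curve t A B C s)))) :
    HasDerivAt (fun s' => V (P.map (curve t A B C s')))
      (∫ ω, ⟪D (P.map (curve t A B C s)) (curve t A B C s ω), B ω⟫ ∂P
        + (∫ ω, ⟪D (P.map (curve t A B C s)) (curve t A B C s ω), C ω⟫ ∂P)
          * (1 / (2 * Real.sqrt (s - t)))) s := by
  obtain ⟨Θ, hΘ, hΘlaw⟩ := hat.exists_copy hm (fun ω => (A ω, B ω, C ω))
    (hAm.prodMk (hBm.prodMk hCm))
  have hΘm : Measurable Θ := hΘ.mono hm le_rfl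
  have hTm : Measurable fun ω => (A ω, B ω, C ω) := hAm.prodMk (hBm.prodMk hCm)
  set A' : Ω → E d := fun ω => (Θ ω).1
  set B' : Ω → E d := fun ω => (Θ ω).2.1
  set C' : Ω → E d := fun ω => (Θ ω).2.2
  -- Any function of the triple has the same law on both sides; it is applied to the points of the
  -- curve, and likewise, below, to integrability and to integrals.
  have transfer : ∀ {S : Type} [MeasurableSpace S] (F : E d × E d × E d → S), Measurable F →
      P.map (fun ω => F (Θ ω)) = P.map (fun ω => F (A ω, B ω, C ω)) := by
    intro S _ F hF
    have h1 := Measure.map_map (μ := P) hF hΘm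
    have h2 := Measure.map_map (μ := P) hF hTm
    rw [hΘlaw] at h1
    exact h1.symm.trans h2
  have memT : ∀ F : E d × E d × E d → E d, Measurable F →
      MemLp (fun ω => F (A ω, B ω, C ω)) 2 P → MemLp (fun ω => F (Θ ω)) 2 P := by
    intro F hF h
    have h1 := (memLp_map_measure_iff (μ := P) (p := 2) (g := F)
      hF.aestronglyMeasurable hTm.aemeasurable).2 h
    rw [← hΘlaw] at h1
    exact (memLp_map_measure_iff (μ := P) (p := 2) (g := F)
      hF.aestronglyMeasurable hΘm.aemeasurable).1 h1
  have intT : ∀ F : E d × E d × E d → ℝ, Measurable F →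
      ∫ ω, F (Θ ω) ∂P = ∫ ω, F (A ω, B ω, C ω) ∂P := by
    intro F hF
    have h1 := integral_map (μ := P) hΘm.aemeasurable hF.aestronglyMeasurable
    have h2 := integral_map (μ := P) hTm.aemeasurable hF.aestronglyMeasurable
    rw [hΘlaw] at h1
    exact h1.symm.trans h2
  have hA' : MemLp A' 2 P := memT (fun θ => θ.1) measurable_fst hA
  have hB' : MemLp B' 2 P := memT (fun θ => θ.2.1) (by fun_prop) hB
  have hC' : MemLp C' 2 P := memT (fun θ => θ.2.2) (by fun_prop) hC
  have hmap : ∀ s', P.map (curve t A' B' C' s') = P.map (curve t A B C s') := fun s' =>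
    transfer (fun θ => θ.1 + (s' - t) • θ.2.1 + Real.sqrt (s' - t) • θ.2.2) (by fun_prop)
  have hsm : ∀ s', StronglyMeasurable[m₀] (curve t A' B' C' s') := by
    intro s'
    have h1 : Measurable[m₀] A' := measurable_fst.comp hΘ
    have h2 : Measurable[m₀] B' := (measurable_fst.comp measurable_snd).comp hΘ
    have h3 : Measurable[m₀] C' := (measurable_snd.comp measurable_snd).comp hΘ
    exact ((h1.stronglyMeasurable.add (h2.stronglyMeasurable.const_smul (s' - t))).add
      (h3.stronglyMeasurable.const_smul (Real.sqrt (s' - t))))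
  have hmem := fun s' => memLp_curve hA' hB' hC' t s'
  set μ := P.map (curve t A B C s) with hμ
  obtain ⟨hDmem, hderiv⟩ := hV (curve t A' B' C' s) (hsm s) (hmem s)
  rw [hmap] at hDmem hderiv
  have eB : ∫ ω, ⟪D μ (curve t A B C s ω), B ω⟫ ∂P = ∫ ω, ⟪D μ (curve t A' B' C' s ω), B' ω⟫ ∂P :=
    (intT (fun θ => ⟪D μ (θ.1 + (s - t) • θ.2.1 + Real.sqrt (s - t) • θ.2.2), θ.2.1⟫)
      (Measurable.inner (hD.measurable.comp (by fun_prop)) (by fun_prop))).symm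
  have eC : ∫ ω, ⟪D μ (curve t A B C s ω), C ω⟫ ∂P = ∫ ω, ⟪D μ (curve t A' B' C' s ω), C' ω⟫ ∂P :=
    (intT (fun θ => ⟪D μ (θ.1 + (s - t) • θ.2.1 + Real.sqrt (s - t) • θ.2.2), θ.2.2⟫)
      (Measurable.inner (hD.measurable.comp (by fun_prop)) (by fun_prop))).symm
  rw [eB, eC]
  set β := ∫ ω, ⟪D μ (curve t A' B' C' s ω), B' ω⟫ ∂P
  set κ := ∫ ω, ⟪D μ (curve t A' B' C' s ω), C' ω⟫ ∂P
  have hlin : HasDerivAt (fun s' => (s' - s) * β + (Real.sqrt (s' - t) - Real.sqrt (s - t)) * κ)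
      (β + κ * (1 / (2 * Real.sqrt (s - t)))) s := by
    have h1 : HasDerivAt (fun s' => (s' - s) * β) (1 * β) s :=
      ((hasDerivAt_id s).sub_const s).mul_const β
    have h2 : HasDerivAt (fun s' => Real.sqrt (s' - t)) (1 / (2 * Real.sqrt (s - t))) s :=
      ((hasDerivAt_id s).sub_const t).sqrt (by simp; linarith)
    exact (h1.add ((h2.sub_const (Real.sqrt (s - t))).mul_const κ)).congr_deriv (by ring)
  -- The Fréchet remainder is o of the L² norm of the increment, and this norm is O(|s' - s|); the
  -- pairing of the gradient with the increment is computed exactly by bilinearity.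
  have hrem : HasDerivAt (fun s' => V (P.map (curve t A B C s')) -
      ((s' - s) * β + (Real.sqrt (s' - t) - Real.sqrt (s - t)) * κ)) 0 s := by
    rw [hasDerivAt_iff_isLittleO]
    refine Asymptotics.IsLittleO.of_bound fun ε hε => ?_
    set K := lpNorm B' 2 P + lpNorm C' 2 P / Real.sqrt (s - t) with hK
    have hK0 : 0 ≤ K := add_nonneg lpNorm_nonneg (div_nonneg lpNorm_nonneg (Real.sqrt_nonneg _))
    obtain ⟨η, hη, hηb⟩ := hderiv (ε / (K + 1)) (by positivity)
    have hev : ∀ᶠ s' in 𝓝 s, |s' - s| < η / (K + 1) := by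
      have := Metric.ball_mem_nhds s (show 0 < η / (K + 1) by positivity)
      filter_upwards [this] with s' hs'
      simpa [Real.dist_eq] using hs'
    filter_upwards [hev, lt_mem_nhds hts] with s' h1 h2
    have hζ := lpNorm_curve_sub_le (A := A') (C := C') hB' hts h2.le
    rw [← hK] at hζ
    have hζm : MemLp (fun ω => curve t A' B' C' s' ω - curve t A' B' C' s ω) 2 P :=
      (hmem s').sub (hmem s)
    rw [lt_div_iff₀ (by positivity)] at h1
    have hKle : K * |s' - s| ≤ η := by nlinarith [abs_nonneg (s' - s)]
    have h3 := hηb (fun ω => curve t A' B' C' s' ω - curve t A' B' C' s ω)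
      ((hsm s').sub (hsm s)) hζm (by rw [toReal_eLpNorm hζm.1]; exact hζ.trans hKle)
    rw [toReal_eLpNorm hζm.1] at h3
    have e1 : (fun ω => curve t A' B' C' s ω + (curve t A' B' C' s' ω - curve t A' B' C' s ω)) =
        curve t A' B' C' s' := by ext1 ω; abel
    have e2 : ∫ ω, ⟪D μ (curve t A' B' C' s ω), curve t A' B' C' s' ω - curve t A' B' C' s ω⟫ ∂P =
        (s' - s) * β + (Real.sqrt (s' - t) - Real.sqrt (s - t)) * κ := by
      have : ∀ ω, ⟪D μ (curve t A' B' C' s ω), curve t A' B' C' s' ω - curve t A' B' C' s ω⟫ =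
          (s' - s) * ⟪D μ (curve t A' B' C' s ω), B' ω⟫ +
          (Real.sqrt (s' - t) - Real.sqrt (s - t)) * ⟪D μ (curve t A' B' C' s ω), C' ω⟫ := by
        intro ω
        rw [← real_inner_smul_right, ← real_inner_smul_right, ← inner_add_right]
        congr 1
        simp only [curve]
        module
      simp_rw [this]
      rw [integral_add ((integrable_inner_of_memLp hDmem hB').const_mul _)
        ((integrable_inner_of_memLp hDmem hC').const_mul _), integral_const_mul, integral_const_mul]
    rw [e1, e2, hmap] at h3
    simp only [sub_self, zero_mul, add_zero, smul_zero, sub_zero]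
    rw [Real.norm_eq_abs, Real.norm_eq_abs]
    have h4 : V (P.map (curve t A B C s')) -
        ((s' - s) * β + (Real.sqrt (s' - t) - Real.sqrt (s - t)) * κ) - V (P.map (curve t A B C s)) =
        V (P.map (curve t A B C s')) - V μ -
        ((s' - s) * β + (Real.sqrt (s' - t) - Real.sqrt (s - t)) * κ) := by rw [hμ]; ring
    rw [h4]
    refine h3.trans ?_
    calc ε / (K + 1) * lpNorm (fun ω => curve t A' B' C' s' ω - curve t A' B' C' s ω) 2 P
        ≤ ε / (K + 1) * (K * |s' - s|) := by gcongr
      _ = ε * |s' - s| * (K / (K + 1)) := by ring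
      _ ≤ ε * |s' - s| * 1 := by
          gcongr
          rw [div_le_one (by positivity)]; linarith
      _ = ε * |s' - s| := mul_one _
  have := hrem.add hlin
  rw [zero_add] at this
  refine this.congr_of_eventuallyEq (.of_forall fun s' => ?_)
  simp

end LionsCurve

end MKV
end

/-! ### The chain rule for the decoupling field -/

noncomputable section

namespace MKV

section FieldCurve

variable {Ω : Type*} {m₀ mΩ : MeasurableSpace Ω} {P : Measure Ω} [IsProbabilityMeasure P] {d : ℕ}
  {T : ℝ} {c : Coeffs d} {u : Field d}

theorem IsClassicalSolution.continuous_Um (h : IsClassicalSolution m₀ P T c u) {t : ℝ}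
    (ht : t ∈ Icc 0 T) (x : E d) {μ : Measure (E d)} (hμ : IsP2 μ) : Continuous (u.Um t x μ) :=
  continuous_iff_continuousAt.2 fun v => (h.hasDeriv_vm t ht x μ hμ v).continuousAt

theorem IsClassicalSolution.continuous_U (h : IsClassicalSolution m₀ P T c u) {t : ℝ}
    (ht : t ∈ Icc 0 T) {μ : Measure (E d)} (hμ : IsP2 μ) : Continuous fun x => u.U t x μ :=
  continuous_iff_continuousAt.2 fun v => (h.hasDeriv_x t ht v μ hμ).hasFDerivAt.continuousAt

/-- The chain rule for the decoupling field along a curve of points and a curve of laws. -/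
theorem IsClassicalSolution.hasDerivAt_curve (h : IsClassicalSolution m₀ P T c u) (hm : m₀ ≤ mΩ)
    (hat : Atomless m₀ P) {A B C : Ω → E d} (hAm : Measurable A) (hBm : Measurable B)
    (hCm : Measurable C) (hA : MemLp A 2 P) (hB : MemLp B 2 P) (hC : MemLp C 2 P) {t s : ℝ}
    (ht : 0 ≤ t) (hts : t < s) (hsT : s < T) {x : ℝ → E d} {x' : E d} (hx : HasDerivAt x x' s) :
    HasDerivAt (fun s' => u.U s' (x s') (P.map (curve t A B C s')))
      (u.Ut s (x s) (P.map (curve t A B C s)) + ⟪u.Ux s (x s) (P.map (curve t A B C s)), x'⟫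
        + (∫ ω, ⟪u.Um s (x s) (P.map (curve t A B C s)) (curve t A B C s ω), B ω⟫ ∂P
        + (∫ ω, ⟪u.Um s (x s) (P.map (curve t A B C s)) (curve t A B C s ω), C ω⟫ ∂P)
          * (1 / (2 * Real.sqrt (s - t))))) s := by
  set μ : ℝ → Measure (E d) := fun s' => P.map (curve t A B C s') with hμ
  have hP2 : ∀ s', IsP2 (μ s') := fun s' => isP2_map (memLp_curve hA hB hC t s')
  have hs0 : 0 < s := ht.trans_lt hts
  have hsI : s ∈ Icc 0 T := ⟨hs0.le, hsT.le⟩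
  have hsI' : s ∈ Ico 0 T := ⟨hs0.le, hsT⟩
  have h3 := (h.hasDeriv_m s hsI (x s)).hasDerivAt_curve hm hat hAm hBm hCm hA hB hC hts
    (h.continuous_Um hsI (x s) (hP2 s))
  set K := lpNorm B 2 P + lpNorm C 2 P / Real.sqrt (s - t) with hK
  have hK0 : 0 ≤ K := add_nonneg lpNorm_nonneg (div_nonneg lpNorm_nonneg (Real.sqrt_nonneg _))
  have hW : ∀ η > 0, ∀ᶠ s' in 𝓝 s, W2 (μ s') (μ s) < η := by
    intro η hη
    have hev : ∀ᶠ s' in 𝓝 s, |s' - s| < η / (K + 1) := by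
      filter_upwards [Metric.ball_mem_nhds s (show 0 < η / (K + 1) by positivity)] with s' hs'
      simpa [Real.dist_eq] using hs'
    filter_upwards [hev, lt_mem_nhds hts] with s' h1 h2
    refine (W2_map_le (memLp_curve hA hB hC t s') (memLp_curve hA hB hC t s)).trans_lt
      ((lpNorm_curve_sub_le hB hts h2.le).trans_lt ?_)
    rw [lt_div_iff₀ (by positivity)] at h1
    rw [← hK]
    nlinarith [abs_nonneg (s' - s)]
  have hxc : ∀ η > 0, ∀ᶠ s' in 𝓝 s, ‖x s' - x s‖ < η := by
    intro η hη
    filter_upwards [hx.continuousAt (Metric.ball_mem_nhds (x s) hη)] with s' hs'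
    simpa [dist_eq_norm] using hs'
  have hsc : ∀ η > 0, ∀ᶠ s' in 𝓝 s, |s' - s| < η := by
    intro η hη
    filter_upwards [Metric.ball_mem_nhds s hη] with s' hs'
    simpa [Real.dist_eq] using hs'
  -- The increment is split into time, space and measure, in this order. The time increment is taken
  -- at the moved point and law, and is uniform there by the joint continuity of the time derivative
  -- and the mean value inequality on the segment.
  have h1 : HasDerivAt (fun s' => u.U s' (x s') (μ s') - u.U s (x s') (μ s'))
      (u.Ut s (x s) (μ s)) s := by
    rw [hasDerivAt_iff_isLittleO]
    refine Asymptotics.IsLittleO.of_bound fun ε hε => ?_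
    obtain ⟨η, hη, hηb⟩ := h.cont_t s hsI' (x s) (μ s) (hP2 s) ε hε
    filter_upwards [hW η hη, hxc η hη, hsc η hη, Ioo_mem_nhds hs0 hsT] with s' w1 w2 w3 w4
    simp only [sub_self, sub_zero, smul_eq_mul]
    have hsub : uIcc s s' ⊆ Ioo 0 T := by
      exact ordConnected_Ioo.uIcc_subset ⟨hs0, hsT⟩ w4
    have hd : ∀ r ∈ uIcc s s', HasDerivWithinAt
        (fun r => u.U r (x s') (μ s') - (r - s) * u.Ut s (x s) (μ s))
        (u.Ut r (x s') (μ s') - u.Ut s (x s) (μ s)) (uIcc s s') r := by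
      intro r hr
      have hr' := hsub hr
      have e1 := (h.hasDeriv_t r ⟨hr'.1.le, hr'.2⟩ (x s') (μ s') (hP2 s')).hasDerivAt
        (Icc_mem_nhds hr'.1 hr'.2)
      have e2 : HasDerivAt (fun r => (r - s) * u.Ut s (x s) (μ s)) (1 * u.Ut s (x s) (μ s)) r :=
        ((hasDerivAt_id r).sub_const s).mul_const _
      exact ((e1.sub e2).congr_deriv (by rw [one_mul])).hasDerivWithinAt
    have hb : ∀ r ∈ uIcc s s', ‖u.Ut r (x s') (μ s') - u.Ut s (x s) (μ s)‖ ≤ ε := by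
      intro r hr
      have hr' := hsub hr
      refine (hηb r ⟨hr'.1.le, hr'.2⟩ (x s') (μ s') (hP2 s') ?_ w2 w1).le
      exact (abs_sub_left_of_mem_uIcc hr).trans_lt w3
    have := (convex_uIcc s s').norm_image_sub_le_of_norm_hasDerivWithin_le hd hb
      left_mem_uIcc right_mem_uIcc
    refine le_trans (le_of_eq ?_) this
    congr 1
    ring
  -- The space increment is taken at the moved law, through the joint continuity of the gradient.
  -- The measure increment remains at the frozen point (s, x s), so it only calls for the
  -- differentiability of the lifting there.
  have h2 : HasDerivAt (fun s' => u.U s (x s') (μ s') - u.U s (x s) (μ s'))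
      ⟪u.Ux s (x s) (μ s), x'⟫ s := by
    have hlin : HasDerivAt (fun s' => ⟪u.Ux s (x s) (μ s), x s' - x s⟫)
        ⟪u.Ux s (x s) (μ s), x'⟫ s := by
      have := ((innerSL ℝ (u.Ux s (x s) (μ s))).hasFDerivAt (x := x s - x s)).comp_hasDerivAt s
        (hx.sub_const (x s))
      exact this
    have hrem : HasDerivAt (fun s' => u.U s (x s') (μ s') - u.U s (x s) (μ s') -
        ⟪u.Ux s (x s) (μ s), x s' - x s⟫) 0 s := by
      have hO : (fun s' => x s' - x s) =O[𝓝 s] fun s' => s' - s := hx.isBigO_sub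
      rw [hasDerivAt_iff_isLittleO]
      have hlo : (fun s' => u.U s (x s') (μ s') - u.U s (x s) (μ s') -
          ⟪u.Ux s (x s) (μ s), x s' - x s⟫) =o[𝓝 s] fun s' => x s' - x s := by
        refine Asymptotics.IsLittleO.of_bound fun ε hε => ?_
        obtain ⟨η, hη, hηb⟩ := h.cont_x s hsI (x s) (μ s) (hP2 s) ε hε
        filter_upwards [hW η hη, hxc η hη] with s' w1 w2
        have hd : ∀ y ∈ Metric.ball (x s) η, HasFDerivWithinAt
            (fun y => u.U s y (μ s')) (innerSL ℝ (u.Ux s y (μ s'))) (Metric.ball (x s) η) y :=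
          fun y _ => (h.hasDeriv_x s hsI y (μ s') (hP2 s')).hasFDerivAt.hasFDerivWithinAt
        have hb : ∀ y ∈ Metric.ball (x s) η,
            ‖innerSL ℝ (u.Ux s y (μ s')) - innerSL ℝ (u.Ux s (x s) (μ s))‖ ≤ ε := by
          intro y hy
          rw [← map_sub, innerSL_apply_norm]
          exact (hηb s hsI y (μ s') (hP2 s') (by simpa using hη)
            (by simpa [dist_eq_norm] using hy) w1).le
        have := (convex_ball (x s) η).norm_image_sub_le_of_norm_hasFDerivWithin_le' hd hb
          (Metric.mem_ball_self hη) (by simpa [dist_eq_norm] using w2 : x s' ∈ _)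
        exact this
      refine (hlo.trans_isBigO hO).congr_left fun s' => ?_
      simp
    have := hrem.add hlin
    rw [zero_add] at this
    refine this.congr_of_eventuallyEq (.of_forall fun s' => ?_)
    simp
  refine ((h1.add h2).add h3).congr_of_eventuallyEq (.of_forall fun s' => ?_)
  simp [hμ]

end FieldCurve

/-! ### Second order expansions -/

/-- The second order expansion of the mean of a field along small centered perturbations. -/
theorem Cubature.norm_avg_inner_sub_tr_le {d : ℕ} {Λ : ℝ} (q : Cubature d Λ) {F : E d → E d}
    {F' : E d → E d →L[ℝ] E d} (hF : ∀ x, HasFDerivAt F (F' x) x) {x₀ : E d} {s : E d →L[ℝ] E d}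
    {r M L : ℝ} (hr : 0 < r) (hL0 : 0 ≤ L) (hM : ‖s‖ ≤ M)
    (hL : ∀ x ∈ Metric.closedBall x₀ (r * (M * Λ)), ‖F' x - F' x₀‖ ≤ L * ‖x - x₀‖) :
    |q.avg (fun γ => ⟪F (x₀ + r • s γ), s γ⟫) - r * tr ((F' x₀).comp (s.comp (ContinuousLinearMap.adjoint s)))|
      ≤ L * r ^ 2 * (M * Λ) ^ 3 := by
  have hΛ := q.bound_nonneg
  have hM0 : 0 ≤ M := (norm_nonneg s).trans hM
  rw [← q.avg_trace, ← q.avg_mul]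
  -- The zeroth order term vanishes since the noise is centered; what is left is first order in r,
  -- and its leading part averages to the trace.
  have h0 : q.avg (fun γ => ⟪F x₀, s γ⟫) = 0 := by
    have := q.avg_clm ((innerSL ℝ (F x₀)).comp s) fun γ => γ
    rw [q.avg_id, map_zero] at this
    exact this
  rw [← sub_zero (q.avg fun γ => ⟪F (x₀ + r • s γ), s γ⟫), ← h0, ← q.avg_sub, ← q.avg_sub,
    ← Real.norm_eq_abs]
  refine q.norm_avg_le_of_forall fun γ hγ => ?_
  have hsγ : ‖s γ‖ ≤ M * Λ := (s.le_opNorm γ).trans (by gcongr; exact q.bdd γ hγ)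
  have hrs : ‖r • s γ‖ ≤ r * (M * Λ) := by
    rw [norm_smul, Real.norm_of_nonneg hr.le]; gcongr
  set ρ := ‖r • s γ‖ with hρ
  have hLρ : ∀ x ∈ Metric.closedBall x₀ ρ, ‖F' x - F' x₀‖ ≤ L * ρ := by
    intro x hx
    refine (hL x (Metric.closedBall_subset_closedBall hrs hx)).trans ?_
    rw [Metric.mem_closedBall, dist_eq_norm] at hx
    gcongr
  have hT := (convex_closedBall x₀ ρ).norm_image_sub_le_of_norm_hasFDerivWithin_le'
    (f := F) (f' := F') (φ := F' x₀) (fun x _ => (hF x).hasFDerivWithinAt) hLρ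
    (Metric.mem_closedBall_self (norm_nonneg _))
    (show x₀ + r • s γ ∈ _ by simp [hρ])
  rw [add_sub_cancel_left, ← hρ] at hT
  have e : ⟪F (x₀ + r • s γ), s γ⟫ - ⟪F x₀, s γ⟫ - r * ⟪F' x₀ (s γ), s γ⟫ =
      ⟪F (x₀ + r • s γ) - F x₀ - F' x₀ (r • s γ), s γ⟫ := by
    rw [inner_sub_left, inner_sub_left, map_smul, real_inner_smul_left]
  rw [e, Real.norm_eq_abs]
  refine (abs_real_inner_le_norm _ _).trans ?_
  calc _ ≤ (L * ρ * ρ) * (M * Λ) := by gcongr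
    _ ≤ (L * (r * (M * Λ)) * (r * (M * Λ))) * (M * Λ) := by gcongr
    _ = _ := by ring

end MKV
end

/-! ### Consequences of the regularity assumptions -/

noncomputable section

namespace MKV

section Regularity

variable {Ω : Type*} {m₀ mΩ : MeasurableSpace Ω} {P : Measure Ω} [IsProbabilityMeasure P] {d : ℕ}
  {T Λ α : ℝ} {c : Coeffs d} {u : Field d}

theorem H1.norm_Ux_le (h1 : H1 m₀ P T c u Λ α) (hΛ : 0 ≤ Λ) {t : ℝ} (ht : t ∈ Icc 0 T) (x : E d)
    {μ : Measure (E d)} (hμ : IsP2 μ) : ‖u.Ux t x μ‖ ≤ Λ := by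
  have h := le_self_add.trans (h1.bound_first t ht x μ hμ)
  rwa [← ofReal_norm, ENNReal.ofReal_le_ofReal_iff hΛ] at h

theorem H1.norm_Uxx_le (h1 : H1 m₀ P T c u Λ α) (hΛ : 0 ≤ Λ) {t : ℝ} (ht : t ∈ Icc 0 T) (x : E d)
    {μ : Measure (E d)} (hμ : IsP2 μ) : ‖u.Uxx t x μ‖ ≤ Λ := by
  have h := le_self_add.trans (h1.bound_second t ht x μ hμ)
  rwa [← ofReal_norm, ENNReal.ofReal_le_ofReal_iff hΛ] at h

theorem memLp_and_lpNorm_le_of_map {V : Type*} [NormedAddCommGroup V] {X : Ω → E d}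
    (hX : AEMeasurable X P) {F : E d → V} (hF : Continuous F) (hΛ : 0 ≤ Λ)
    (hb : eLpNorm F 2 (P.map X) ≤ ENNReal.ofReal Λ) :
    MemLp (fun ω => F (X ω)) 2 P ∧ lpNorm (fun ω => F (X ω)) 2 P ≤ Λ := by
  have hm : AEStronglyMeasurable (fun ω => F (X ω)) P :=
    hF.comp_aestronglyMeasurable hX.aestronglyMeasurable
  have he : eLpNorm (fun ω => F (X ω)) 2 P ≤ ENNReal.ofReal Λ := by
    rwa [eLpNorm_map_measure hF.aestronglyMeasurable hX] at hb
  refine ⟨⟨hm, he.trans_lt ENNReal.ofReal_lt_top⟩, ?_⟩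
  rw [← toReal_eLpNorm hm]
  exact ENNReal.toReal_le_of_le_ofReal hΛ he

theorem H1.lpNorm_Um_le (h1 : H1 m₀ P T c u Λ α) (hΛ : 0 ≤ Λ) {t : ℝ} (ht : t ∈ Icc 0 T) (x : E d)
    {X : Ω → E d} (hX : MemLp X 2 P) :
    MemLp (fun ω => u.Um t x (P.map X) (X ω)) 2 P ∧
      lpNorm (fun ω => u.Um t x (P.map X) (X ω)) 2 P ≤ Λ :=
  memLp_and_lpNorm_le_of_map hX.1.aemeasurable
    (h1.classical.continuous_Um ht x (isP2_map hX)) hΛ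
    (le_add_self.trans (h1.bound_first t ht x _ (isP2_map hX)))

/-- On a ball of radius ρ the local Lipschitz constant becomes linear in ρ^α and in the α-power of
the norm of μ. These powers are the origin of the weight V^α in the final estimates. -/
theorem H1.norm_Uvm_sub_le (h1 : H1 m₀ P T c u Λ α) (hα : 1 ≤ α) (hΛ : 0 ≤ Λ) {t : ℝ}
    (ht : t ∈ Icc 0 T) (x : E d) {μ : Measure (E d)} (hμ : IsP2 μ) {v v' : E d} {ρ : ℝ}
    (hv : ‖v‖ ≤ ρ) (hv' : ‖v'‖ ≤ ρ) :
    ‖u.Uvm t x μ v - u.Uvm t x μ v'‖ ≤ Λ * (1 + 2 * ρ ^ α + norm2 μ ^ α) * ‖v - v'‖ := by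
  refine (h1.lip_vm t ht x μ hμ v v').trans ?_
  have hn : 0 ≤ norm2 μ := ENNReal.toReal_nonneg
  have hρ : 0 ≤ ρ := (norm_nonneg v).trans hv
  have hρα : 0 ≤ ρ ^ α := Real.rpow_nonneg hρ _
  have hnα : 0 ≤ norm2 μ ^ α := Real.rpow_nonneg hn _
  gcongr
  refine Real.sqrt_le_iff.2 ⟨by positivity, ?_⟩
  have e : ∀ a : ℝ, 0 ≤ a → a ^ (2 * α) = (a ^ α) ^ 2 := fun a ha => by
    rw [← Real.rpow_two, ← Real.rpow_mul ha, mul_comm]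
  have i1 : ‖v‖ ^ (2 * α) ≤ (ρ ^ α) ^ 2 := by
    rw [← e ρ hρ]; exact Real.rpow_le_rpow (norm_nonneg _) hv (by linarith)
  have i2 : ‖v'‖ ^ (2 * α) ≤ (ρ ^ α) ^ 2 := by
    rw [← e ρ hρ]; exact Real.rpow_le_rpow (norm_nonneg _) hv' (by linarith)
  rw [e _ hn]
  nlinarith [mul_nonneg hρα hnα]

theorem H1.continuous_Uvm (h1 : H1 m₀ P T c u Λ α) (hα : 1 ≤ α) (hΛ : 0 ≤ Λ) {t : ℝ}
    (ht : t ∈ Icc 0 T) (x : E d) {μ : Measure (E d)} (hμ : IsP2 μ) :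
    Continuous (u.Uvm t x μ) := by
  refine continuous_iff_continuousAt.2 fun v => ?_
  have hlip : LipschitzOnWith (Real.toNNReal (Λ * (1 + 2 * (‖v‖ + 1) ^ α + norm2 μ ^ α)))
      (u.Uvm t x μ) (Metric.closedBall v 1) := by
    have hb : ∀ z ∈ Metric.closedBall v 1, ‖z‖ ≤ ‖v‖ + 1 := by
      intro z hz
      rw [Metric.mem_closedBall, dist_eq_norm] at hz
      calc ‖z‖ = ‖v + (z - v)‖ := by congr 1; abel
        _ ≤ ‖v‖ + ‖z - v‖ := norm_add_le _ _
        _ ≤ _ := by gcongr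
    refine LipschitzOnWith.of_dist_le_mul fun z hz z' hz' => ?_
    rw [dist_eq_norm, dist_eq_norm]
    refine (h1.norm_Uvm_sub_le hα hΛ ht x hμ (hb z hz) (hb z' hz')).trans ?_
    gcongr
    exact Real.le_coe_toNNReal _
  exact hlip.continuousOn.continuousAt (Metric.closedBall_mem_nhds v one_pos)

theorem H1.lpNorm_Uvm_le (h1 : H1 m₀ P T c u Λ α) (hα : 1 ≤ α) (hΛ : 0 ≤ Λ) {t : ℝ}
    (ht : t ∈ Icc 0 T) (x : E d) {X : Ω → E d} (hX : MemLp X 2 P) :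
    MemLp (fun ω => u.Uvm t x (P.map X) (X ω)) 2 P ∧
      lpNorm (fun ω => u.Uvm t x (P.map X) (X ω)) 2 P ≤ Λ :=
  memLp_and_lpNorm_le_of_map hX.1.aemeasurable
    (h1.continuous_Uvm hα hΛ ht x (isP2_map hX)) hΛ
    (le_add_self.trans (h1.bound_second t ht x _ (isP2_map hX)))

theorem H1.abs_U_sub_le (h1 : H1 m₀ P T c u Λ α) (hΛ : 0 ≤ Λ) {t : ℝ} (ht : t ∈ Icc 0 T)
    (x x' : E d) {μ μ' : Measure (E d)} (hμ : IsP2 μ) (hμ' : IsP2 μ') :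
    |u.U t x μ - u.U t x' μ'| ≤ Λ * (‖x - x'‖ + W2 μ μ') := by
  have e1 : |u.U t x μ - u.U t x' μ| ≤ Λ * ‖x - x'‖ := by
    have := convex_univ.norm_image_sub_le_of_norm_hasFDerivWithin_le (C := Λ)
      (f := fun y => u.U t y μ) (f' := fun y => innerSL ℝ (u.Ux t y μ))
      (fun y _ => (h1.classical.hasDeriv_x t ht y μ hμ).hasFDerivAt.hasFDerivWithinAt)
      (fun y _ => by rw [innerSL_apply_norm]; exact h1.norm_Ux_le hΛ ht y hμ)
      (mem_univ x') (mem_univ x)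
    exact this
  have e2 : |u.U t x' μ - u.U t x' μ'| ≤ Λ * W2 μ μ' := by
    have := h1.lip_m t ht x' μ μ' hμ hμ'
    linarith [norm_nonneg (u.Ux t x' μ - u.Ux t x' μ')]
  linarith [abs_sub_le (u.U t x μ) (u.U t x' μ) (u.U t x' μ')]

theorem H1.norm_Ux_sub_le (h1 : H1 m₀ P T c u Λ α) (hΛ : 0 ≤ Λ) {t : ℝ} (ht : t ∈ Icc 0 T)
    (x x' : E d) {μ μ' : Measure (E d)} (hμ : IsP2 μ) (hμ' : IsP2 μ') :
    ‖u.Ux t x μ - u.Ux t x' μ'‖ ≤ Λ * (‖x - x'‖ + W2 μ μ') := by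
  have e1 : ‖u.Ux t x μ - u.Ux t x' μ‖ ≤ Λ * ‖x - x'‖ :=
    convex_univ.norm_image_sub_le_of_norm_hasFDerivWithin_le (C := Λ)
      (f := fun y => u.Ux t y μ) (f' := fun y => u.Uxx t y μ)
      (fun y _ => (h1.classical.hasDeriv_xx t ht y μ hμ).hasFDerivWithinAt)
      (fun y _ => h1.norm_Uxx_le hΛ ht y hμ)
      (mem_univ x') (mem_univ x)
  have e2 : ‖u.Ux t x' μ - u.Ux t x' μ'‖ ≤ Λ * W2 μ μ' := by
    have := h1.lip_m t ht x' μ μ' hμ hμ'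
    linarith [abs_nonneg (u.U t x' μ - u.U t x' μ')]
  linarith [norm_sub_le_norm_sub_add_norm_sub (u.Ux t x μ) (u.Ux t x' μ) (u.Ux t x' μ')]

theorem H1.hold_U (h1 : H1 m₀ P T c u Λ α) {t s : ℝ} (ht : 0 ≤ t) (hts : t ≤ s) (hs : s ≤ T)
    (x : E d) {μ : Measure (E d)} (hμ : IsP2 μ) :
    |u.U s x μ - u.U t x μ| ≤ Λ * Real.sqrt (s - t) * (1 + ‖x‖ + norm2 μ) := by
  have := h1.hold_t t (s - t) ht (by linarith) (by linarith) x μ hμ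
  rw [add_sub_cancel] at this
  linarith [norm_nonneg (u.Ux s x μ - u.Ux t x μ)]

theorem H1.hold_Ux (h1 : H1 m₀ P T c u Λ α) {t s : ℝ} (ht : 0 ≤ t) (hts : t ≤ s) (hs : s ≤ T)
    (x : E d) {μ : Measure (E d)} (hμ : IsP2 μ) :
    ‖u.Ux s x μ - u.Ux t x μ‖ ≤ Λ * Real.sqrt (s - t) * (1 + ‖x‖ + norm2 μ) := by
  have := h1.hold_t t (s - t) ht (by linarith) (by linarith) x μ hμ
  rw [add_sub_cancel] at this
  linarith [abs_nonneg (u.U s x μ - u.U t x μ)]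


/-- With the measure fixed, the Lipschitz bound still contains the distance of ν to itself; it is
asked to vanish, which `W2_map_self` provides for the laws of square integrable variables. -/
theorem H0.continuous_b (h0 : H0 c Λ) (hΛ : 0 ≤ Λ) {ν : Measure (EY d)} (hν : IsP2 ν)
    (hW : W2 ν ν = 0) : Continuous fun p : E d × ℝ => c.b p.1 p.2 ν := by
  have : LipschitzWith (Real.toNNReal (Λ * 2)) fun p : E d × ℝ => c.b p.1 p.2 ν := by
    refine LipschitzWith.of_dist_le_mul fun p p' => ?_
    rw [dist_eq_norm, Real.coe_toNNReal _ (by positivity)]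
    refine (h0.b_lip _ _ _ _ _ _ hν hν).trans ?_
    rw [hW, add_zero, mul_assoc]
    have i1 : ‖p.1 - p'.1‖ ≤ dist p p' := by rw [← dist_eq_norm]; exact le_max_left _ _
    have i2 : |p.2 - p'.2| ≤ dist p p' := by rw [← Real.dist_eq]; exact le_max_right _ _
    gcongr
    linarith
  exact this.continuous

theorem H0.continuous_σ (h0 : H0 c Λ) (hΛ : 0 ≤ Λ) {μ : Measure (E d)} (hμ : IsP2 μ)
    (hW : W2 μ μ = 0) : Continuous fun x : E d => c.σ x μ := by
  have : LipschitzWith (Real.toNNReal Λ) fun x : E d => c.σ x μ := by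
    refine LipschitzWith.of_dist_le_mul fun p p' => ?_
    rw [dist_eq_norm, Real.coe_toNNReal _ hΛ, dist_eq_norm]
    refine (h0.σ_lip _ _ _ _ hμ hμ).trans ?_
    rw [hW, add_zero]
  exact this.continuous

theorem H0.continuous_f (h0 : H0 c Λ) (hΛ : 0 ≤ Λ) {ν : Measure (EY d)} (hν : IsP2 ν)
    (hW : W2 ν ν = 0) : Continuous fun p : E d × ℝ × E d => c.f p.1 p.2.1 p.2.2 ν := by
  have : LipschitzWith (Real.toNNReal (Λ * 3)) fun p : E d × ℝ × E d => c.f p.1 p.2.1 p.2.2 ν := by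
    refine LipschitzWith.of_dist_le_mul fun p p' => ?_
    rw [Real.dist_eq, Real.coe_toNNReal _ (by positivity)]
    refine (h0.f_lip _ _ _ _ _ _ _ _ hν hν).trans ?_
    rw [hW, add_zero, mul_assoc]
    have i1 : ‖p.1 - p'.1‖ ≤ dist p p' := by rw [← dist_eq_norm]; exact le_max_left _ _
    have i0 : dist p.2 p'.2 ≤ dist p p' := le_max_right _ _
    have i2 : |p.2.1 - p'.2.1| ≤ dist p p' := by
      rw [← Real.dist_eq]; exact (le_max_left _ _).trans i0
    have i3 : ‖p.2.2 - p'.2.2‖ ≤ dist p p' := by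
      rw [← dist_eq_norm]; exact (le_max_right _ _).trans i0
    gcongr
    linarith
  exact this.continuous

theorem W2_map_self {V : Type*} [NormedAddCommGroup V] [MeasurableSpace V] [BorelSpace V]
    [SecondCountableTopology V] {X : Ω → V} (hX : MemLp X 2 P) : W2 (P.map X) (P.map X) = 0 := by
  refine le_antisymm ((W2_map_le hX hX).trans ?_) (W2_nonneg _ _)
  simp

theorem W2_jointLaw_self {X : Ω → E d} {Y : Ω → ℝ} (hX : MemLp X 2 P) (hY : MemLp Y 2 P) :
    W2 (jointLaw P X Y) (jointLaw P X Y) = 0 := W2_map_self (memLp_toLp hX hY)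

end Regularity

end MKV
end

noncomputable section

namespace MKV

/-! ### Bounds in `Lᵖ` -/

/-- `f ∈ Lᵖ` and `‖f‖_p ≤ a`. -/
def LpBound {Ω V : Type*} {mΩ : MeasurableSpace Ω} [NormedAddCommGroup V] (p : ℝ≥0∞)
    (P : Measure Ω) (f : Ω → V) (a : ℝ) : Prop := MemLp f p P ∧ lpNorm f p P ≤ a

namespace LpBound

variable {Ω V : Type*} {mΩ : MeasurableSpace Ω} [NormedAddCommGroup V] {p : ℝ≥0∞} {P : Measure Ω}
  {f g : Ω → V} {a b : ℝ}

theorem of_memLp (h : MemLp f p P) : LpBound p P f (lpNorm f p P) := ⟨h, le_rfl⟩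

theorem nonneg (h : LpBound p P f a) : 0 ≤ a := lpNorm_nonneg.trans h.2

theorem mono (h : LpBound p P f a) (hab : a ≤ b) : LpBound p P f b := ⟨h.1, h.2.trans hab⟩

theorem add (hp : 1 ≤ p) (hf : LpBound p P f a) (hg : LpBound p P g b) :
    LpBound p P (fun ω => f ω + g ω) (a + b) :=
  ⟨hf.1.add hg.1, (lpNorm_add_le hf.1 hp).trans (add_le_add hf.2 hg.2)⟩

theorem sub (hp : 1 ≤ p) (hf : LpBound p P f a) (hg : LpBound p P g b) :
    LpBound p P (fun ω => f ω - g ω) (a + b) :=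
  ⟨hf.1.sub hg.1, (lpNorm_sub_le hf.1 hp).trans (add_le_add hf.2 hg.2)⟩

theorem const_mul {f : Ω → ℝ} {c : ℝ} (hc : 0 ≤ c) (hf : LpBound p P f a) :
    LpBound p P (fun ω => c * f ω) (c * a) :=
  ⟨hf.1.const_mul c, (lpNorm_const_mul hc f).trans_le (mul_le_mul_of_nonneg_left hf.2 hc)⟩

theorem norm (hf : LpBound p P f a) : LpBound p P (fun ω => ‖f ω‖) a :=
  ⟨hf.1.norm, (lpNorm_norm hf.1.1 p).trans_le hf.2⟩

theorem abs {f : Ω → ℝ} (hf : LpBound p P f a) : LpBound p P (fun ω => |f ω|) a := hf.norm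

theorem const [IsProbabilityMeasure P] (hp : p ≠ 0) {c : ℝ} (hc : 0 ≤ c) :
    LpBound p P (fun _ : Ω => c) c := by
  refine ⟨memLp_const c, ?_⟩
  rw [lpNorm_const hp (IsProbabilityMeasure.ne_zero P)]
  simp [abs_of_nonneg hc]

theorem of_le {g : Ω → ℝ} (hg : LpBound p P g b) (hf : AEStronglyMeasurable f P)
    (h : ∀ᵐ ω ∂P, ‖f ω‖ ≤ g ω) : LpBound p P f b :=
  ⟨hg.1.of_le hf (h.mono fun _ hω => hω.trans (Real.le_norm_self _)),
    (lpNorm_mono_real_ae hg.1 h).trans hg.2⟩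

theorem congr (hf : LpBound p P f a) (h : f =ᵐ[P] g) : LpBound p P g a :=
  ⟨(memLp_congr_ae h).1 hf.1, (lpNorm_congr_ae h).symm.trans_le hf.2⟩

theorem exponent [IsProbabilityMeasure P] {r : ℝ≥0∞} (hr : r ≤ p) (hf : LpBound p P f a) :
    LpBound r P f a :=
  ⟨hf.1.mono_exponent hr, (lpNorm_le_lpNorm_of_le hr hf.1).trans hf.2⟩

theorem condExp {m : MeasurableSpace Ω} [NormedSpace ℝ V] [CompleteSpace V]
    [IsProbabilityMeasure P] (hp : 1 ≤ p) (hf : LpBound p P f a) : LpBound p P (P[f | m]) a :=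
  ⟨hf.1.condExp hp, (hf.1.lpNorm_condExp_le_lpNorm hp).trans hf.2⟩

theorem integral_le [IsProbabilityMeasure P] {f : Ω → ℝ} (hf : LpBound 1 P f a) :
    ∫ ω, f ω ∂P ≤ a := by
  refine le_trans (integral_mono_ae (memLp_one_iff_integrable.1 hf.1)
    (memLp_one_iff_integrable.1 hf.1.norm) (.of_forall fun ω => Real.le_norm_self _)) ?_
  exact (lpNorm_one_eq_integral_norm hf.1.1).symm.trans_le hf.2

end LpBound

theorem abs_integral_inner_le {Ω V : Type*} {mΩ : MeasurableSpace Ω} {P : Measure Ω}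
    [NormedAddCommGroup V] [InnerProductSpace ℝ V] {f g : Ω → V} {a b : ℝ}
    (hf : LpBound 2 P f a) (hg : LpBound 2 P g b) : |∫ ω, ⟪f ω, g ω⟫ ∂P| ≤ a * b := by
  have h1 : ∫ ω, ⟪f ω, g ω⟫ ∂P = ⟪hf.1.toLp f, hg.1.toLp g⟫ := by
    rw [L2.inner_def]
    refine integral_congr_ae ?_
    filter_upwards [hf.1.coeFn_toLp, hg.1.coeFn_toLp] with ω e1 e2
    rw [e1, e2]
  rw [h1]
  refine (abs_real_inner_le_norm _ _).trans ?_
  rw [Lp.norm_toLp, Lp.norm_toLp, toReal_eLpNorm hf.1.1, toReal_eLpNorm hg.1.1]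
  exact mul_le_mul hf.2 hg.2 lpNorm_nonneg hf.nonneg

theorem integral_norm_mul_norm_le {Ω V V' : Type*} {mΩ : MeasurableSpace Ω} {P : Measure Ω}
    [NormedAddCommGroup V] [NormedAddCommGroup V'] {f : Ω → V} {g : Ω → V'} {a b : ℝ}
    (hf : LpBound 2 P f a) (hg : LpBound 2 P g b) : ∫ ω, ‖f ω‖ * ‖g ω‖ ∂P ≤ a * b := by
  have := abs_integral_inner_le hg.norm hf.norm
  simp only [RCLike.inner_apply, conj_trivial] at this
  linarith [le_abs_self (∫ ω, ‖f ω‖ * ‖g ω‖ ∂P)]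

/-! ### Comparison of the data at two times -/

section Compare

variable {Ω : Type*} {m₀ mΩ : MeasurableSpace Ω} {P : Measure Ω} [IsProbabilityMeasure P] {d : ℕ}
  {T Λ α : ℝ} {c : Coeffs d} {u : Field d}

theorem H1.memLp_U (h1 : H1 m₀ P T c u Λ α) (hΛ : 0 ≤ Λ) {t : ℝ} (ht : t ∈ Icc 0 T)
    {p : ℝ≥0∞} {μ : Measure (E d)} (hμ : IsP2 μ) (hW : W2 μ μ = 0) {X : Ω → E d}
    (hX : MemLp X p P) : MemLp (fun ω => u.U t (X ω) μ) p P := by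
  refine MemLp.of_le ((memLp_const |u.U t 0 μ|).add (hX.norm.const_mul Λ))
    ((h1.classical.continuous_U ht hμ).comp_aestronglyMeasurable hX.1) (.of_forall fun ω => ?_)
  refine le_trans ?_ (Real.le_norm_self _)
  have := h1.abs_U_sub_le hΛ ht (X ω) 0 hμ hμ
  rw [hW, add_zero, sub_zero] at this
  simp only [Pi.add_apply, Real.norm_eq_abs]
  linarith [abs_sub_abs_le_abs_sub (u.U t (X ω) μ) (u.U t 0 μ)]

variable {X ζ : Ω → E d} {Y : Ω → ℝ} {t s : ℝ}

/-- Go through the point (s, x, [X]): Lipschitz in space and measure at time s, then Hölder in time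
at (x, [X]), so that the growth weight involves only the data at the earlier time. -/
theorem H1.abs_U_sub_U_le (h1 : H1 m₀ P T c u Λ α) (hΛ : 0 ≤ Λ) (ht : 0 ≤ t) (hts : t ≤ s)
    (hs : s ≤ T) (hX : MemLp X 2 P) (hζ : MemLp ζ 2 P) (x z : E d) :
    |u.U s z (P.map ζ) - u.U t x (P.map X)| ≤
      Λ * (‖z - x‖ + lpNorm (fun ω => ζ ω - X ω) 2 P
        + Real.sqrt (s - t) * (1 + ‖x‖ + lpNorm X 2 P)) := by
  have e1 := h1.abs_U_sub_le hΛ ⟨ht.trans hts, hs⟩ z x (isP2_map hζ) (isP2_map hX)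
  have e2 := h1.hold_U ht hts hs x (isP2_map hX)
  rw [norm2_map hX.1] at e2
  have e3 := mul_le_mul_of_nonneg_left (W2_map_le hζ hX) hΛ
  linarith [abs_sub_le (u.U s z (P.map ζ)) (u.U s x (P.map X)) (u.U t x (P.map X))]

theorem H1.norm_Ux_sub_Ux_le (h1 : H1 m₀ P T c u Λ α) (hΛ : 0 ≤ Λ) (ht : 0 ≤ t) (hts : t ≤ s)
    (hs : s ≤ T) (hX : MemLp X 2 P) (hζ : MemLp ζ 2 P) (x z : E d) :
    ‖u.Ux s z (P.map ζ) - u.Ux t x (P.map X)‖ ≤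
      Λ * (‖z - x‖ + lpNorm (fun ω => ζ ω - X ω) 2 P
        + Real.sqrt (s - t) * (1 + ‖x‖ + lpNorm X 2 P)) := by
  have e1 := h1.norm_Ux_sub_le hΛ ⟨ht.trans hts, hs⟩ z x (isP2_map hζ) (isP2_map hX)
  have e2 := h1.hold_Ux ht hts hs x (isP2_map hX)
  rw [norm2_map hX.1] at e2
  have e3 := mul_le_mul_of_nonneg_left (W2_map_le hζ hX) hΛ
  linarith [norm_sub_le_norm_sub_add_norm_sub (u.Ux s z (P.map ζ)) (u.Ux s x (P.map X)) (u.Ux t x (P.map X))]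

theorem H1.lpBound_U_sub_U (h1 : H1 m₀ P T c u Λ α) (hΛ : 0 ≤ Λ) (ht : 0 ≤ t) (hts : t ≤ s)
    (hs : s ≤ T) (hX : MemLp X 2 P) (hζ : MemLp ζ 2 P) :
    LpBound 2 P (fun ω => u.U s (ζ ω) (P.map ζ) - u.U t (X ω) (P.map X))
      (Λ * (2 * lpNorm (fun ω => ζ ω - X ω) 2 P
        + Real.sqrt (s - t) * (1 + 2 * lpNorm X 2 P))) := by
  have h2 : (1 : ℝ≥0∞) ≤ 2 := by norm_num
  have hmem : AEStronglyMeasurable (fun ω => u.U s (ζ ω) (P.map ζ) - u.U t (X ω) (P.map X)) P :=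
    ((h1.memLp_U hΛ ⟨ht.trans hts, hs⟩ (isP2_map hζ) (W2_map_self hζ) hζ).sub
      (h1.memLp_U hΛ ⟨ht, hts.trans hs⟩ (isP2_map hX) (W2_map_self hX) hX)).1
  have hsub : MemLp (fun ω => ζ ω - X ω) 2 P := hζ.sub hX
  have b := ((((LpBound.of_memLp hsub).norm.add h2
    (LpBound.const (by norm_num) (lpNorm_nonneg (f := fun ω => ζ ω - X ω) (p := 2) (μ := P)))).add h2
    (((LpBound.const (p := 2) (P := P) (by norm_num)
      (add_nonneg zero_le_one (lpNorm_nonneg (f := X) (p := 2) (μ := P)))).add h2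
      (LpBound.of_memLp hX).norm).const_mul (Real.sqrt_nonneg (s - t))))).const_mul hΛ
  refine (b.of_le hmem (.of_forall fun ω => ?_)).mono (le_of_eq (by ring))
  rw [Real.norm_eq_abs]
  refine (h1.abs_U_sub_U_le hΛ ht hts hs hX hζ (X ω) (ζ ω)).trans (le_of_eq (by ring))

/-- The scheme evaluates the drift at (x, y) and the equation at (z, 𝒰(s, z)). The difference y -
𝒰(s, z) is split into the defect at time t and the variation of the field; the same is done in L²
for the joint laws. -/
theorem H1.norm_b_sub_b_le (h0 : H0 c Λ) (h1 : H1 m₀ P T c u Λ α) (hΛ : 1 ≤ Λ) (ht : 0 ≤ t)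
    (hts : t ≤ s) (hs : s ≤ T) (hX : MemLp X 2 P) (hY : MemLp Y 2 P) (hζ : MemLp ζ 2 P)
    (x z : E d) (y : ℝ) :
    ‖c.b x y (jointLaw P X Y) - c.b z (u.U s z (P.map ζ)) (u.graphLaw s (P.map ζ))‖ ≤
      4 * Λ ^ 2 * (|y - u.U t x (P.map X)| + lpNorm (fun ω => Y ω - u.U t (X ω) (P.map X)) 2 P
        + ‖z - x‖ + lpNorm (fun ω => ζ ω - X ω) 2 P
        + Real.sqrt (s - t) * (1 + ‖x‖ + lpNorm X 2 P)) := by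
  have hΛ0 : 0 ≤ Λ := zero_le_one.trans hΛ
  have hs' : s ∈ Icc 0 T := ⟨ht.trans hts, hs⟩
  have ht' : t ∈ Icc 0 T := ⟨ht, hts.trans hs⟩
  have hUζ := h1.memLp_U hΛ0 hs' (isP2_map hζ) (W2_map_self hζ) hζ
  have hUX := h1.memLp_U hΛ0 ht' (isP2_map hX) (W2_map_self hX) hX
  rw [graphLaw_map u s hζ.1.aemeasurable (h1.classical.continuous_U hs' (isP2_map hζ))]
  have e1 := h0.b_lip x z y (u.U s z (P.map ζ)) _ _ (isP2_jointLaw hX hY) (isP2_jointLaw hζ hUζ)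
  have e2 := W2_jointLaw_le hX hY hζ hUζ
  rw [show lpNorm (fun ω => X ω - ζ ω) 2 P = lpNorm (fun ω => ζ ω - X ω) 2 P from
    lpNorm_sub_comm X ζ 2 P] at e2
  have e3 := h1.abs_U_sub_U_le hΛ0 ht hts hs hX hζ x z
  have e4 : lpNorm (fun ω => Y ω - u.U s (ζ ω) (P.map ζ)) 2 P ≤
      lpNorm (fun ω => Y ω - u.U t (X ω) (P.map X)) 2 P +
      Λ * (2 * lpNorm (fun ω => ζ ω - X ω) 2 P + Real.sqrt (s - t) * (1 + 2 * lpNorm X 2 P)) := by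
    have b := (LpBound.of_memLp (hY.sub hUX)).sub (by norm_num)
      (h1.lpBound_U_sub_U hΛ0 ht hts hs hX hζ)
    refine le_trans (le_of_eq ?_) b.2
    congr 1
    ext ω
    simp
  have e5 : |y - u.U s z (P.map ζ)| ≤ |y - u.U t x (P.map X)| +
      |u.U s z (P.map ζ) - u.U t x (P.map X)| := by
    have := abs_sub (y - u.U t x (P.map X)) (u.U s z (P.map ζ) - u.U t x (P.map X))
    rwa [sub_sub_sub_cancel_right] at this
  rw [norm_sub_rev x z] at e1
  have n1 := norm_nonneg (z - x)
  have n2 : 0 ≤ lpNorm (fun ω => ζ ω - X ω) 2 P := lpNorm_nonneg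
  have n3 : 0 ≤ lpNorm X 2 P := lpNorm_nonneg
  have n4 := abs_nonneg (y - u.U t x (P.map X))
  have n5 : 0 ≤ lpNorm (fun ω => Y ω - u.U t (X ω) (P.map X)) 2 P := lpNorm_nonneg
  have n6 := Real.sqrt_nonneg (s - t)
  have n7 := norm_nonneg x
  set e := lpNorm (fun ω => ζ ω - X ω) 2 P
  set D := lpNorm (fun ω => Y ω - u.U t (X ω) (P.map X)) 2 P
  set N := lpNorm X 2 P
  set r := Real.sqrt (s - t)
  set a := |y - u.U t x (P.map X)|
  have hW : W2 (jointLaw P X Y) (jointLaw P ζ fun ω => u.U s (ζ ω) (P.map ζ)) ≤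
      e + (D + Λ * (2 * e + r * (1 + 2 * N))) := by
    refine e2.trans ?_
    exact add_le_add le_rfl e4
  calc _ ≤ _ := e1
    _ ≤ Λ * (‖z - x‖ + (a + Λ * (‖z - x‖ + e + r * (1 + ‖x‖ + N))) +
        (e + (D + Λ * (2 * e + r * (1 + 2 * N))))) := by
        gcongr
        exact e5.trans (by gcongr)
    _ ≤ Λ * (Λ * ‖z - x‖ + (Λ * a + Λ * (‖z - x‖ + e + r * (1 + ‖x‖ + N))) +
        (Λ * e + (Λ * D + Λ * (2 * e + r * (1 + 2 * N))))) := by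
        gcongr <;> exact le_mul_of_one_le_left (by assumption) hΛ
    _ = Λ ^ 2 * (2 * ‖z - x‖ + a + 4 * e + D + r * (2 + ‖x‖ + 3 * N)) := by ring
    _ ≤ Λ ^ 2 * (4 * ‖z - x‖ + 4 * a + 4 * e + 4 * D + r * (4 + 4 * ‖x‖ + 4 * N)) := by
        gcongr <;> linarith
    _ = _ := by ring

theorem norm_adjoint_apply_le (s : E d →L[ℝ] E d) (v : E d) :
    ‖ContinuousLinearMap.adjoint s v‖ ≤ ‖s‖ * ‖v‖ := by
  have := (ContinuousLinearMap.adjoint s).le_opNorm v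
  rwa [LinearIsometryEquiv.norm_map] at this

theorem H0.norm_σ_sub_le (h0 : H0 c Λ) (hΛ : 0 ≤ Λ) (hX : MemLp X 2 P) (hζ : MemLp ζ 2 P)
    (x z : E d) : ‖c.σ z (P.map ζ) - c.σ x (P.map X)‖ ≤
      Λ * (‖z - x‖ + lpNorm (fun ω => ζ ω - X ω) 2 P) := by
  refine (h0.σ_lip z x _ _ (isP2_map hζ) (isP2_map hX)).trans ?_
  gcongr
  exact W2_map_le hζ hX

theorem H1.norm_adjoint_Ux_sub_le (h0 : H0 c Λ) (h1 : H1 m₀ P T c u Λ α) (hΛ : 1 ≤ Λ)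
    (ht : 0 ≤ t) (hts : t ≤ s) (hs : s ≤ T) (hX : MemLp X 2 P) (hζ : MemLp ζ 2 P) (x z : E d) :
    ‖ContinuousLinearMap.adjoint (c.σ z (P.map ζ)) (u.Ux s z (P.map ζ)) -
      ContinuousLinearMap.adjoint (c.σ x (P.map X)) (u.Ux t x (P.map X))‖ ≤
      2 * Λ ^ 2 * (‖z - x‖ + lpNorm (fun ω => ζ ω - X ω) 2 P
        + Real.sqrt (s - t) * (1 + ‖x‖ + lpNorm X 2 P)) := by
  have hΛ0 : 0 ≤ Λ := zero_le_one.trans hΛ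
  have hs' : s ∈ Icc 0 T := ⟨ht.trans hts, hs⟩
  have e1 := h1.norm_Ux_sub_Ux_le hΛ0 ht hts hs hX hζ x z
  have e2 := h0.norm_σ_sub_le hΛ0 hX hζ x z
  have n3 : 0 ≤ lpNorm X 2 P := lpNorm_nonneg
  have n2 : 0 ≤ lpNorm (fun ω => ζ ω - X ω) 2 P := lpNorm_nonneg
  have n6 : 0 ≤ Real.sqrt (s - t) * (1 + ‖x‖ + lpNorm X 2 P) := by positivity
  have e : ContinuousLinearMap.adjoint (c.σ z (P.map ζ)) (u.Ux s z (P.map ζ)) -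
      ContinuousLinearMap.adjoint (c.σ x (P.map X)) (u.Ux t x (P.map X)) =
      ContinuousLinearMap.adjoint (c.σ z (P.map ζ) - c.σ x (P.map X)) (u.Ux s z (P.map ζ)) +
      ContinuousLinearMap.adjoint (c.σ x (P.map X)) (u.Ux s z (P.map ζ) - u.Ux t x (P.map X)) := by
    simp
  rw [e]
  refine (norm_add_le _ _).trans ?_
  have i1 := norm_adjoint_apply_le (c.σ z (P.map ζ) - c.σ x (P.map X)) (u.Ux s z (P.map ζ))
  have i2 := norm_adjoint_apply_le (c.σ x (P.map X)) (u.Ux s z (P.map ζ) - u.Ux t x (P.map X))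
  have j1 := h1.norm_Ux_le hΛ0 hs' z (isP2_map hζ)
  have j2 := h0.σ_bdd x _ (isP2_map hX)
  have k1 : ‖c.σ z (P.map ζ) - c.σ x (P.map X)‖ * ‖u.Ux s z (P.map ζ)‖ ≤
      Λ * (‖z - x‖ + lpNorm (fun ω => ζ ω - X ω) 2 P) * Λ := by gcongr
  have k2 : ‖c.σ x (P.map X)‖ * ‖u.Ux s z (P.map ζ) - u.Ux t x (P.map X)‖ ≤
      Λ * (Λ * (‖z - x‖ + lpNorm (fun ω => ζ ω - X ω) 2 P
        + Real.sqrt (s - t) * (1 + ‖x‖ + lpNorm X 2 P))) := by gcongr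
  nlinarith [mul_nonneg (mul_nonneg hΛ0 hΛ0) n6]

theorem H1.abs_f_sub_f_le (h0 : H0 c Λ) (h1 : H1 m₀ P T c u Λ α) (hΛ : 1 ≤ Λ) (ht : 0 ≤ t)
    (hts : t ≤ s) (hs : s ≤ T) (hX : MemLp X 2 P) (hζ : MemLp ζ 2 P) (x z : E d) :
    |c.f x (u.U t x (P.map X)) (ContinuousLinearMap.adjoint (c.σ x (P.map X)) (u.Ux t x (P.map X)))
        (u.graphLaw t (P.map X)) -
      c.f z (u.U s z (P.map ζ)) (ContinuousLinearMap.adjoint (c.σ z (P.map ζ)) (u.Ux s z (P.map ζ)))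
        (u.graphLaw s (P.map ζ))| ≤
      8 * Λ ^ 3 * (‖z - x‖ + lpNorm (fun ω => ζ ω - X ω) 2 P
        + Real.sqrt (s - t) * (1 + ‖x‖ + lpNorm X 2 P)) := by
  have hΛ0 : 0 ≤ Λ := zero_le_one.trans hΛ
  have hs' : s ∈ Icc 0 T := ⟨ht.trans hts, hs⟩
  have ht' : t ∈ Icc 0 T := ⟨ht, hts.trans hs⟩
  have hUζ := h1.memLp_U hΛ0 hs' (isP2_map hζ) (W2_map_self hζ) hζ
  have hUX := h1.memLp_U hΛ0 ht' (isP2_map hX) (W2_map_self hX) hX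
  rw [graphLaw_map u s hζ.1.aemeasurable (h1.classical.continuous_U hs' (isP2_map hζ)),
    graphLaw_map u t hX.1.aemeasurable (h1.classical.continuous_U ht' (isP2_map hX))]
  rw [abs_sub_comm]
  refine (h0.f_lip _ _ _ _ _ _ _ _ (isP2_jointLaw hζ hUζ) (isP2_jointLaw hX hUX)).trans ?_
  have e2 := W2_jointLaw_le hζ hUζ hX hUX
  have e3 := h1.abs_U_sub_U_le hΛ0 ht hts hs hX hζ x z
  have e4 := (h1.lpBound_U_sub_U hΛ0 ht hts hs hX hζ).2
  have e5 := h1.norm_adjoint_Ux_sub_le h0 hΛ ht hts hs hX hζ x z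
  have n1 := norm_nonneg (z - x)
  have n2 : 0 ≤ lpNorm (fun ω => ζ ω - X ω) 2 P := lpNorm_nonneg
  have n3 : 0 ≤ lpNorm X 2 P := lpNorm_nonneg
  have n6 := Real.sqrt_nonneg (s - t)
  have n7 := norm_nonneg x
  set e := lpNorm (fun ω => ζ ω - X ω) 2 P
  set N := lpNorm X 2 P
  set r := Real.sqrt (s - t)
  have hΛ2 : Λ ≤ Λ ^ 2 := by nlinarith
  have hΛ3 : 1 ≤ Λ ^ 2 := by nlinarith
  calc _ ≤ Λ * (‖z - x‖ + Λ * (‖z - x‖ + e + r * (1 + ‖x‖ + N)) +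
        2 * Λ ^ 2 * (‖z - x‖ + e + r * (1 + ‖x‖ + N)) +
        (e + Λ * (2 * e + r * (1 + 2 * N)))) := by
        gcongr
        exact e2.trans (add_le_add le_rfl e4)
    _ ≤ Λ * (Λ ^ 2 * ‖z - x‖ + Λ ^ 2 * (‖z - x‖ + e + r * (1 + ‖x‖ + N)) +
        2 * Λ ^ 2 * (‖z - x‖ + e + r * (1 + ‖x‖ + N)) +
        (Λ ^ 2 * e + Λ ^ 2 * (2 * e + r * (1 + 2 * N)))) := by
        gcongr
        · exact le_mul_of_one_le_left n1 hΛ3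
        · exact le_mul_of_one_le_left n2 hΛ3
    _ = Λ ^ 3 * (4 * ‖z - x‖ + 6 * e + r * (4 + 3 * ‖x‖ + 5 * N)) := by ring
    _ ≤ Λ ^ 3 * (8 * ‖z - x‖ + 8 * e + r * (8 + 8 * ‖x‖ + 8 * N)) := by
        gcongr <;> linarith
    _ = _ := by ring

end Compare

end MKV
end

/-! ### Second order terms in space and in measure -/

noncomputable section

namespace MKV

section SecondOrder

variable {Ω : Type*} {m₀ m mΩ : MeasurableSpace Ω} {P : Measure Ω} [IsProbabilityMeasure P] {d : ℕ}
  {T Λ α : ℝ} {c : Coeffs d} {u : Field d}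

theorem abs_tr_comp_sub_le {d : ℕ} (A A' a a' : E d →L[ℝ] E d) :
    |tr (A.comp a) - tr (A'.comp a')| ≤ d * (‖A - A'‖ * ‖a‖ + ‖A'‖ * ‖a - a'‖) := by
  rw [← tr_sub]
  refine (abs_tr_le _).trans ?_
  gcongr
  have : A.comp a - A'.comp a' = (A - A').comp a + A'.comp (a - a') := by
    ext; simp
  rw [this]
  exact (norm_add_le _ _).trans
    (add_le_add (ContinuousLinearMap.opNorm_comp_le _ _) (ContinuousLinearMap.opNorm_comp_le _ _))

theorem norm_comp_adjoint_sub_le {d : ℕ} {s s' : E d →L[ℝ] E d} (hs : ‖s‖ ≤ Λ) (hs' : ‖s'‖ ≤ Λ) :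
    ‖s.comp (ContinuousLinearMap.adjoint s) - s'.comp (ContinuousLinearMap.adjoint s')‖ ≤
      2 * Λ * ‖s - s'‖ := by
  have : s.comp (ContinuousLinearMap.adjoint s) - s'.comp (ContinuousLinearMap.adjoint s') =
      (s - s').comp (ContinuousLinearMap.adjoint s) +
        s'.comp (ContinuousLinearMap.adjoint (s - s')) := by
    ext; simp
  rw [this]
  refine (norm_add_le _ _).trans ?_
  have e1 := ContinuousLinearMap.opNorm_comp_le (s - s') (ContinuousLinearMap.adjoint s)
  have e2 := ContinuousLinearMap.opNorm_comp_le s' (ContinuousLinearMap.adjoint (s - s'))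
  rw [LinearIsometryEquiv.norm_map] at e1 e2
  have n := norm_nonneg (s - s')
  nlinarith [mul_le_mul_of_nonneg_left hs n, mul_le_mul_of_nonneg_right hs' n]

theorem norm_comp_adjoint_le {d : ℕ} {s : E d →L[ℝ] E d} (hs : ‖s‖ ≤ Λ) :
    ‖s.comp (ContinuousLinearMap.adjoint s)‖ ≤ Λ ^ 2 := by
  have e1 := ContinuousLinearMap.opNorm_comp_le s (ContinuousLinearMap.adjoint s)
  rw [LinearIsometryEquiv.norm_map] at e1
  nlinarith [norm_nonneg s]

variable {q : Cubature d Λ} {G X B : Ω → E d} {Y : Ω → ℝ} {t s r : ℝ}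

/-- The second order term in the space variable. -/
theorem H1.abs_avg_Ux_sub_le (h0 : H0 c Λ) (h1 : H1 m₀ P T c u Λ α) (hΛ : 0 ≤ Λ)
    (hs : s ∈ Icc 0 T) {ζ : Ω → E d} (hX : MemLp X 2 P) (hζ : MemLp ζ 2 P) (x b : E d)
    (hr : 0 < r) {κ : ℝ}
    (hz : ∀ γ ∈ q.S, ‖x + b + r • c.σ x (P.map X) γ - x‖ + lpNorm (fun ω => ζ ω - X ω) 2 P ≤ κ) :
    |q.avg (fun γ => ⟪u.Ux s (x + b + r • c.σ x (P.map X) γ) (P.map ζ), c.σ x (P.map X) γ⟫)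
        / (2 * r) -
      q.avg (fun γ => 1 / 2 * tr ((u.Uxx s (x + b + r • c.σ x (P.map X) γ) (P.map ζ)).comp
        (c.a (x + b + r • c.σ x (P.map X) γ) (P.map ζ))))| ≤
      Λ ^ 7 * r + d * (Λ ^ 5 * r + 2 * Λ ^ 3 * κ) := by
  set S := c.σ x (P.map X)
  have hS : ‖S‖ ≤ Λ := h0.σ_bdd x _ (isP2_map hX)
  -- Expansion around x + b, the common center of all branches. The trace is then moved from the
  -- center to each branch, at a cost of order r for the Hessian and of order κ for the diffusion
  -- coefficient.
  have e1 := q.norm_avg_inner_sub_tr_le (F := fun y => u.Ux s y (P.map ζ))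
    (F' := fun y => u.Uxx s y (P.map ζ)) (x₀ := x + b) (s := S)
    (fun y => h1.classical.hasDeriv_xx s hs y _ (isP2_map hζ)) hr hΛ hS
    (fun y _ => h1.lip_xx s hs y (x + b) _ (isP2_map hζ))
  have e2 : |q.avg (fun γ => 1 / 2 * tr ((u.Uxx s (x + b + r • S γ) (P.map ζ)).comp
        (c.a (x + b + r • S γ) (P.map ζ)))) -
      1 / 2 * tr ((u.Uxx s (x + b) (P.map ζ)).comp (S.comp (ContinuousLinearMap.adjoint S)))| ≤
      1 / 2 * (d * (Λ ^ 5 * r + 2 * Λ ^ 3 * κ)) := by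
    rw [← q.avg_const (1 / 2 * tr ((u.Uxx s (x + b) (P.map ζ)).comp
      (S.comp (ContinuousLinearMap.adjoint S)))), ← q.avg_sub, ← Real.norm_eq_abs]
    refine q.norm_avg_le_of_forall fun γ hγ => ?_
    rw [← mul_sub, norm_mul, Real.norm_of_nonneg (by norm_num : (0 : ℝ) ≤ 1 / 2), Real.norm_eq_abs,
      abs_sub_comm]
    gcongr
    refine (abs_tr_comp_sub_le _ _ _ _).trans ?_
    refine mul_le_mul_of_nonneg_left (add_le_add ?_ ?_) (Nat.cast_nonneg _)
    · have i1 := h1.lip_xx s hs (x + b) (x + b + r • S γ) _ (isP2_map hζ)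
      have i2 : ‖x + b - (x + b + r • S γ)‖ ≤ r * (Λ * Λ) := by
        rw [sub_add_cancel_left, norm_neg, norm_smul, Real.norm_of_nonneg hr.le]
        gcongr
        exact (S.le_opNorm γ).trans (mul_le_mul hS (q.bdd γ hγ) (norm_nonneg _) hΛ)
      calc _ ≤ (Λ * (r * (Λ * Λ))) * Λ ^ 2 := by
            gcongr
            · exact i1.trans (by gcongr)
            · exact norm_comp_adjoint_le hS
        _ = _ := by ring
    · have i1 := h1.norm_Uxx_le hΛ hs (x + b + r • S γ) (isP2_map hζ)
      have i2 := norm_comp_adjoint_sub_le (Λ := Λ) hS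
        (h0.σ_bdd (x + b + r • S γ) _ (isP2_map hζ))
      have i3 := h0.norm_σ_sub_le hΛ hX hζ x (x + b + r • S γ)
      rw [norm_sub_rev] at i3
      calc _ ≤ Λ * (2 * Λ * (Λ * κ)) := by
            gcongr
            refine i2.trans ?_
            gcongr
            exact i3.trans (mul_le_mul_of_nonneg_left (hz γ hγ) hΛ)
        _ = _ := by ring
  have e3 : |q.avg (fun γ => ⟪u.Ux s (x + b + r • S γ) (P.map ζ), S γ⟫) / (2 * r) -
      1 / 2 * tr ((u.Uxx s (x + b) (P.map ζ)).comp (S.comp (ContinuousLinearMap.adjoint S)))| ≤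
      Λ ^ 7 * r / 2 := by
    have : q.avg (fun γ => ⟪u.Ux s (x + b + r • S γ) (P.map ζ), S γ⟫) / (2 * r) -
      1 / 2 * tr ((u.Uxx s (x + b) (P.map ζ)).comp (S.comp (ContinuousLinearMap.adjoint S))) =
      (q.avg (fun γ => ⟪u.Ux s (x + b + r • S γ) (P.map ζ), S γ⟫) -
      r * tr ((u.Uxx s (x + b) (P.map ζ)).comp (S.comp (ContinuousLinearMap.adjoint S)))) / (2 * r) := by
      field_simp
    rw [this, abs_div, abs_of_pos (by positivity : 0 < 2 * r), div_le_iff₀ (by positivity)]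
    exact e1.trans (le_of_eq (by ring))
  have := abs_sub_le (q.avg (fun γ => ⟪u.Ux s (x + b + r • S γ) (P.map ζ), S γ⟫) / (2 * r))
    (1 / 2 * tr ((u.Uxx s (x + b) (P.map ζ)).comp (S.comp (ContinuousLinearMap.adjoint S))))
    (q.avg (fun γ => 1 / 2 * tr ((u.Uxx s (x + b + r • S γ) (P.map ζ)).comp
        (c.a (x + b + r • S γ) (P.map ζ)))))
  rw [abs_sub_comm (1 / 2 * _)] at this
  have p1 : 0 ≤ Λ ^ 7 * r := by positivity
  have p2 := (abs_nonneg _).trans e2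
  linarith

/-- The second order term in the measure variable. -/
theorem H1.abs_integral_Um_sub_le (h0 : H0 c Λ) (h1 : H1 m₀ P T c u Λ α) (hα : 1 ≤ α) (hΛ : 0 ≤ Λ)
    (hG : IsNoise q m P G) (hs : s ∈ Icc 0 T) (hXm : StronglyMeasurable[m] X)
    (hBm : StronglyMeasurable[m] B) (hX : MemLp X 2 P) (hB : MemLp B 2 P) (hr : 0 < r) (hr1 : r ≤ 1)
    {ζ : Ω → E d} (hζdef : ∀ ω, ζ ω = X ω + B ω + r • c.σ (X ω) (P.map X) (G ω)) {w : ℝ}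
    (hw : LpBound 1 P
      (fun ω => 1 + 2 * (‖X ω‖ + ‖B ω‖ + Λ ^ 2) ^ α + norm2 (P.map ζ) ^ α) w) (z : E d) :
    |(∫ ω, ⟪u.Um s z (P.map ζ) (ζ ω), c.σ (X ω) (P.map X) (G ω)⟫ ∂P) * (1 / (2 * r)) -
      ∫ v, 1 / 2 * tr ((u.Uvm s z (P.map ζ) v).comp (c.a v (P.map ζ))) ∂(P.map ζ)| ≤
      Λ ^ 7 * w * r + d * (Λ ^ 5 * w * r + 2 * Λ ^ 3 * lpNorm (fun ω => ζ ω - X ω) 2 P) := by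
  set W : Ω → ℝ := fun ω => 1 + 2 * (‖X ω‖ + ‖B ω‖ + Λ ^ 2) ^ α + norm2 (P.map ζ) ^ α with hW
  have hn2 : 0 ≤ norm2 (P.map ζ) := ENNReal.toReal_nonneg
  have hW0 : ∀ ω, 0 ≤ W ω := fun ω => by
    have : 0 ≤ norm2 (P.map ζ) ^ α := Real.rpow_nonneg hn2 _
    have : 0 ≤ (‖X ω‖ + ‖B ω‖ + Λ ^ 2) ^ α := Real.rpow_nonneg (by positivity) _
    positivity
  have hσc := h0.continuous_σ hΛ (isP2_map hX) (W2_map_self hX)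
  set S : Ω → E d →L[ℝ] E d := fun ω => c.σ (X ω) (P.map X) with hSdef
  have hSm : StronglyMeasurable[m] S := hσc.comp_stronglyMeasurable hXm
  have hSb : ∀ ω, ‖S ω‖ ≤ Λ := fun ω => h0.σ_bdd _ _ (isP2_map hX)
  have hSγm : ∀ γ, StronglyMeasurable[m] fun ω => S ω γ := fun γ =>
    (ContinuousLinearMap.apply ℝ (E d) γ).continuous.comp_stronglyMeasurable hSm
  have hSγ : ∀ γ ∈ q.S, ∀ ω, ‖S ω γ‖ ≤ Λ ^ 2 := fun γ hγ ω =>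
    ((S ω).le_opNorm γ).trans (by rw [sq]; exact mul_le_mul (hSb ω) (q.bdd γ hγ) (norm_nonneg _) hΛ)
  have hC : MemLp (fun ω => S ω (G ω)) 2 P := by
    refine hG.memLp_comp (F := fun ω γ => S ω γ) fun γ hγ => ?_
    exact MemLp.of_bound ((hSγm γ).mono hG.le).aestronglyMeasurable _ (.of_forall (hSγ γ hγ))
  have hζ : MemLp ζ 2 P := by
    have : ζ = fun ω => X ω + B ω + r • S ω (G ω) := funext hζdef
    rw [this]
    exact (hX.add hB).add (hC.const_smul r)
  have hμ := isP2_map hζ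
  set F : E d → E d := u.Um s z (P.map ζ) with hF
  set F' : E d → E d →L[ℝ] E d := u.Uvm s z (P.map ζ) with hF'
  have hFd : ∀ v, HasFDerivAt F (F' v) v := h1.classical.hasDeriv_vm s hs z _ hμ
  have hFc : Continuous F := h1.classical.continuous_Um hs z hμ
  have hF'c : Continuous F' := h1.continuous_Uvm hα hΛ hs z hμ
  obtain ⟨hFζ, hFζb⟩ := h1.lpNorm_Um_le hΛ hs z hζ
  obtain ⟨hF'ζ, hF'ζb⟩ := h1.lpNorm_Uvm_le hα hΛ hs z hζ
  have hrγ : ∀ ω, ∀ γ ∈ q.S, ‖r • S ω γ‖ ≤ r * Λ ^ 2 := fun ω γ hγ => by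
    rw [norm_smul, Real.norm_of_nonneg hr.le]
    gcongr
    exact hSγ γ hγ ω
  have hball : ∀ ω, ∀ v ∈ Metric.closedBall (X ω + B ω) (r * Λ ^ 2),
      ‖v‖ ≤ ‖X ω‖ + ‖B ω‖ + Λ ^ 2 := by
    intro ω v hv
    rw [Metric.mem_closedBall, dist_eq_norm] at hv
    calc ‖v‖ = ‖X ω + B ω + (v - (X ω + B ω))‖ := by congr 1; abel
      _ ≤ ‖X ω‖ + ‖B ω‖ + r * Λ ^ 2 :=
        (norm_add_le _ _).trans (add_le_add (norm_add_le _ _) hv)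
      _ ≤ _ := by
        have : r * Λ ^ 2 ≤ 1 * Λ ^ 2 := by gcongr
        linarith
  have hmemγ : ∀ ω, ∀ γ ∈ q.S, X ω + B ω + r • S ω γ ∈
      Metric.closedBall (X ω + B ω) (r * Λ ^ 2) := by
    intro ω γ hγ
    rw [Metric.mem_closedBall, dist_eq_norm, add_sub_cancel_left]
    exact hrγ ω γ hγ
  have hcent : ∀ ω, X ω + B ω ∈ Metric.closedBall (X ω + B ω) (r * Λ ^ 2) := fun ω =>
    Metric.mem_closedBall_self (by positivity)
  have hζmem : ∀ ω, ζ ω ∈ Metric.closedBall (X ω + B ω) (r * Λ ^ 2) := fun ω => by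
    rw [hζdef]; exact hmemγ ω _ (hG.mem ω)
  -- All the branches issued from ω lie in one ball, on which ∂_v∂_μ𝒰 is Lipschitz with the random
  -- constant Λ W. Only the integral of W matters in the end.
  have hlip : ∀ ω, ∀ v ∈ Metric.closedBall (X ω + B ω) (r * Λ ^ 2),
      ∀ v' ∈ Metric.closedBall (X ω + B ω) (r * Λ ^ 2), ‖F' v - F' v'‖ ≤ Λ * W ω * ‖v - v'‖ :=
    fun ω v hv v' hv' => h1.norm_Uvm_sub_le hα hΛ hs z hμ (hball ω v hv) (hball ω v' hv')
  have hWi : Integrable W P := memLp_one_iff_integrable.1 hw.1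
  -- integrability for each value of the noise
  have hsub : ∀ γ ∈ q.S, ∀ ω, ‖F (X ω + B ω + r • S ω γ)‖ ≤
      ‖F (ζ ω)‖ + (‖F' (ζ ω)‖ + Λ * W ω * (2 * Λ ^ 2)) * (2 * Λ ^ 2) := by
    intro γ hγ ω
    have hd : ∀ v ∈ Metric.closedBall (X ω + B ω) (r * Λ ^ 2),
        ∀ v' ∈ Metric.closedBall (X ω + B ω) (r * Λ ^ 2), ‖v - v'‖ ≤ 2 * Λ ^ 2 := by
      intro v hv v' hv'
      rw [← dist_eq_norm]
      rw [Metric.mem_closedBall] at hv hv'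
      have := dist_triangle_right v v' (X ω + B ω)
      have : r * Λ ^ 2 ≤ 1 * Λ ^ 2 := by gcongr
      linarith
    have hb : ∀ v ∈ Metric.closedBall (X ω + B ω) (r * Λ ^ 2),
        ‖F' v‖ ≤ ‖F' (ζ ω)‖ + Λ * W ω * (2 * Λ ^ 2) := by
      intro v hv
      have i1 := hlip ω v hv _ (hζmem ω)
      have i2 := hd v hv _ (hζmem ω)
      have i3 : Λ * W ω * ‖v - ζ ω‖ ≤ Λ * W ω * (2 * Λ ^ 2) := by
        have := hW0 ω
        gcongr
      linarith [norm_le_norm_add_norm_sub' (F' v) (F' (ζ ω))]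
    have := (convex_closedBall (X ω + B ω) (r * Λ ^ 2)).norm_image_sub_le_of_norm_hasFDerivWithin_le
      (fun v _ => (hFd v).hasFDerivWithinAt) hb (hζmem ω) (hmemγ ω γ hγ)
    have i2 := hd _ (hmemγ ω γ hγ) _ (hζmem ω)
    have i4 : 0 ≤ ‖F' (ζ ω)‖ + Λ * W ω * (2 * Λ ^ 2) := (norm_nonneg _).trans (hb _ (hcent ω))
    have i3 := mul_le_mul_of_nonneg_left i2 i4
    linarith [norm_le_norm_add_norm_sub' (F (X ω + B ω + r • S ω γ)) (F (ζ ω))]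
  have hFζi : Integrable (fun ω => ‖F (ζ ω)‖) P := (hFζ.integrable (by norm_num)).norm
  have hF'ζi : Integrable (fun ω => ‖F' (ζ ω)‖) P := (hF'ζ.integrable (by norm_num)).norm
  have hvm : ∀ γ, StronglyMeasurable[m] fun ω => X ω + B ω + r • S ω γ := fun γ =>
    (hXm.add hBm).add ((hSγm γ).const_smul r)
  have hinnerm : ∀ γ, StronglyMeasurable[m] fun ω => ⟪F (X ω + B ω + r • S ω γ), S ω γ⟫ := fun γ =>
    (hFc.comp_stronglyMeasurable (hvm γ)).inner (hSγm γ)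
  -- The assumptions control ∂_μ𝒰 and its derivative in L² only along ζ itself. For the other values
  -- of the noise, integrability is carried over from ζ inside the common ball by the mean value
  -- inequality.
  have hinneri : ∀ γ ∈ q.S, Integrable (fun ω => ⟪F (X ω + B ω + r • S ω γ), S ω γ⟫) P := by
    intro γ hγ
    have hdom : Integrable (fun ω => (‖F (ζ ω)‖ + (‖F' (ζ ω)‖ + Λ * W ω * (2 * Λ ^ 2)) * (2 * Λ ^ 2))
        * Λ ^ 2) P :=
      (hFζi.add ((hF'ζi.add ((hWi.const_mul Λ).mul_const _)).mul_const _)).mul_const _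
    refine hdom.mono' ((hinnerm γ).mono hG.le).aestronglyMeasurable (.of_forall fun ω => ?_)
    exact (abs_real_inner_le_norm _ _).trans
      (mul_le_mul (hsub γ hγ ω) (hSγ γ hγ ω) (norm_nonneg _) ((norm_nonneg _).trans (hsub γ hγ ω)))
  -- Integrating out the noise given the past brings in the average over branches, where the
  -- centering can act.
  have hκ : ∫ ω, ⟪F (ζ ω), S ω (G ω)⟫ ∂P =
      ∫ ω, q.avg (fun γ => ⟪F (X ω + B ω + r • S ω γ), S ω γ⟫) ∂P := by
    rw [← hG.integral_comp (F := fun ω γ => ⟪F (X ω + B ω + r • S ω γ), S ω γ⟫)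
      (fun γ _ => hinnerm γ) hinneri]
    simp_rw [hζdef]
    rfl
  have havgi : Integrable (fun ω => q.avg (fun γ => ⟪F (X ω + B ω + r • S ω γ), S ω γ⟫)) P := by
    unfold Cubature.avg
    exact integrable_finsetSum _ fun γ hγ => (hinneri γ hγ).smul (q.w γ)
  -- the trace
  have hac : Continuous fun v => tr ((F' v).comp (c.a v (P.map ζ))) := by
    have hσζ := h0.continuous_σ hΛ hμ (W2_map_self hζ)
    have h1 : Continuous fun v => c.a v (P.map ζ) :=
      hσζ.clm_comp ((ContinuousLinearMap.adjoint (𝕜 := ℝ) (E := E d) (F := E d)).continuous.comp hσζ)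
    have h2 : Continuous fun v => (F' v).comp (c.a v (P.map ζ)) := hF'c.clm_comp h1
    have h3 : Continuous (tr : (E d →L[ℝ] E d) → ℝ) := by
      have : (tr : (E d →L[ℝ] E d) → ℝ) = fun A => ∑ i,
          ⟪EuclideanSpace.basisFun (Fin d) ℝ i, A (EuclideanSpace.basisFun (Fin d) ℝ i)⟫ := by
        ext A
        exact LinearMap.trace_eq_sum_inner _ (EuclideanSpace.basisFun (Fin d) ℝ)
      rw [this]
      fun_prop
    exact h3.comp h2
  have hIa : ∫ v, 1 / 2 * tr ((F' v).comp (c.a v (P.map ζ))) ∂(P.map ζ) =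
      ∫ ω, 1 / 2 * tr ((F' (ζ ω)).comp (c.a (ζ ω) (P.map ζ))) ∂P :=
    integral_map hζ.1.aemeasurable (hac.const_mul _).aestronglyMeasurable
  have htri : Integrable (fun ω => 1 / 2 * tr ((F' (ζ ω)).comp (c.a (ζ ω) (P.map ζ)))) P := by
    refine Integrable.const_mul ?_ _
    refine (hF'ζi.const_mul (d * Λ ^ 2)).mono' (hac.comp_aestronglyMeasurable hζ.1)
      (.of_forall fun ω => ?_)
    refine (abs_tr_le _).trans ?_
    have i1 := ContinuousLinearMap.opNorm_comp_le (F' (ζ ω)) (c.a (ζ ω) (P.map ζ))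
    have i2 : ‖c.a (ζ ω) (P.map ζ)‖ ≤ Λ ^ 2 := norm_comp_adjoint_le (h0.σ_bdd (ζ ω) _ hμ)
    calc (d : ℝ) * ‖(F' (ζ ω)).comp (c.a (ζ ω) (P.map ζ))‖ ≤ d * (‖F' (ζ ω)‖ * Λ ^ 2) := by
          gcongr
          exact i1.trans (by gcongr)
      _ = _ := by ring
  set e := lpNorm (fun ω => ζ ω - X ω) 2 P with he
  have he0 : 0 ≤ e := lpNorm_nonneg
  have hζX : MemLp (fun ω => ζ ω - X ω) 2 P := hζ.sub hX
  have hg : LpBound 2 P (fun ω => ‖ζ ω - X ω‖ + e) (e + e) :=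
    (LpBound.of_memLp hζX).norm.add (by norm_num) (LpBound.const (by norm_num) he0)
  have hpt : ∀ ω, ‖q.avg (fun γ => ⟪F (X ω + B ω + r • S ω γ), S ω γ⟫) * (1 / (2 * r)) -
      1 / 2 * tr ((F' (ζ ω)).comp (c.a (ζ ω) (P.map ζ)))‖ ≤
      (Λ ^ 7 / 2 * r + d * Λ ^ 5 / 2 * r) * W ω +
        d * Λ ^ 2 * (‖F' (ζ ω)‖ * ‖‖ζ ω - X ω‖ + e‖) := by
    intro ω
    have hWω := hW0 ω
    have e1 := q.norm_avg_inner_sub_tr_le (F := F) (F' := F') (x₀ := X ω + B ω) (s := S ω) hFd hr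
      (mul_nonneg hΛ hWω) (hSb ω) (fun v hv => hlip ω v (by rwa [← sq Λ] at hv) _ (hcent ω))
    have e2 : |tr ((F' (X ω + B ω)).comp ((S ω).comp (ContinuousLinearMap.adjoint (S ω)))) -
        tr ((F' (ζ ω)).comp (c.a (ζ ω) (P.map ζ)))| ≤
        d * (Λ ^ 5 * r * W ω + 2 * Λ ^ 2 * (‖F' (ζ ω)‖ * (‖ζ ω - X ω‖ + e))) := by
      refine (abs_tr_comp_sub_le _ _ _ _).trans ?_
      refine mul_le_mul_of_nonneg_left (add_le_add ?_ ?_) (Nat.cast_nonneg _)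
      · have i1 := hlip ω _ (hcent ω) _ (hζmem ω)
        have i2 : ‖X ω + B ω - ζ ω‖ ≤ r * Λ ^ 2 := by
          have := hζmem ω
          rwa [Metric.mem_closedBall, dist_eq_norm, norm_sub_rev] at this
        calc _ ≤ (Λ * W ω * (r * Λ ^ 2)) * Λ ^ 2 := by
              gcongr
              · exact i1.trans (by gcongr)
              · exact norm_comp_adjoint_le (hSb ω)
          _ = _ := by ring
      · have i2 := norm_comp_adjoint_sub_le (Λ := Λ) (hSb ω) (h0.σ_bdd (ζ ω) _ hμ)
        have i3 := h0.norm_σ_sub_le hΛ hX hζ (X ω) (ζ ω)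
        rw [norm_sub_rev] at i3
        calc _ ≤ ‖F' (ζ ω)‖ * (2 * Λ * (Λ * (‖ζ ω - X ω‖ + e))) := by
              gcongr
              exact i2.trans (by gcongr)
          _ = _ := by ring
    rw [Real.norm_eq_abs, Real.norm_of_nonneg (add_nonneg (norm_nonneg _) he0)]
    set AV := q.avg (fun γ => ⟪F (X ω + B ω + r • S ω γ), S ω γ⟫)
    set T0 := tr ((F' (X ω + B ω)).comp ((S ω).comp (ContinuousLinearMap.adjoint (S ω))))
    set T1 := tr ((F' (ζ ω)).comp (c.a (ζ ω) (P.map ζ)))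
    have e3 : |AV * (1 / (2 * r)) - 1 / 2 * T0| ≤ Λ ^ 7 / 2 * r * W ω := by
      have : AV * (1 / (2 * r)) - 1 / 2 * T0 = (AV - r * T0) / (2 * r) := by field_simp
      rw [this, abs_div, abs_of_pos (by positivity : 0 < 2 * r), div_le_iff₀ (by positivity)]
      exact e1.trans (le_of_eq (by ring))
    have e4 : |1 / 2 * T0 - 1 / 2 * T1| ≤
        1 / 2 * (d * (Λ ^ 5 * r * W ω + 2 * Λ ^ 2 * (‖F' (ζ ω)‖ * (‖ζ ω - X ω‖ + e)))) := by
      rw [← mul_sub, abs_mul, abs_of_nonneg (by norm_num : (0 : ℝ) ≤ 1 / 2)]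
      gcongr
    refine (abs_sub_le _ (1 / 2 * T0) _).trans ((add_le_add e3 e4).trans (le_of_eq (by ring)))
  have hprod : Integrable (fun ω => ‖F' (ζ ω)‖ * ‖‖ζ ω - X ω‖ + e‖) P :=
    hF'ζ.norm.integrable_mul hg.1.norm
  have hboundi : Integrable (fun ω => (Λ ^ 7 / 2 * r + d * Λ ^ 5 / 2 * r) * W ω +
        d * Λ ^ 2 * (‖F' (ζ ω)‖ * ‖‖ζ ω - X ω‖ + e‖)) P :=
    (hWi.const_mul _).add (hprod.const_mul _)
  have hfin := norm_integral_le_of_norm_le hboundi (.of_forall hpt)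
  rw [integral_sub (havgi.mul_const _) htri, integral_mul_const, ← hκ, ← hIa,
    integral_add (hWi.const_mul _) (hprod.const_mul _),
    integral_const_mul (Λ ^ 7 / 2 * r + d * Λ ^ 5 / 2 * r),
    integral_const_mul (d * Λ ^ 2 : ℝ)] at hfin
  have hw' := hw.integral_le
  have hpr := integral_norm_mul_norm_le (⟨hF'ζ, hF'ζb⟩ : LpBound 2 P _ Λ) hg
  have hw0 := hw.nonneg
  refine hfin.trans ?_
  calc _ ≤ (Λ ^ 7 / 2 * r + d * Λ ^ 5 / 2 * r) * w + d * Λ ^ 2 * (Λ * (e + e)) :=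
        add_le_add (mul_le_mul_of_nonneg_left hw' (by positivity))
          (mul_le_mul_of_nonneg_left hpr (by positivity))
    _ ≤ _ := by
        have p1 : 0 ≤ Λ ^ 7 * w * r := by positivity
        have p2 : 0 ≤ d * (Λ ^ 5 * w * r) := by positivity
        nlinarith

end SecondOrder

end MKV
end

/-! ### Growth bounds and the interpolated Euler step -/

noncomputable section

namespace MKV

theorem LpBound.rpow {Ω : Type*} {mΩ : MeasurableSpace Ω} {P : Measure Ω} [IsProbabilityMeasure P]
    {α a : ℝ} (hα : 1 ≤ α) {f : Ω → ℝ} (hf : LpBound (ENNReal.ofReal (2 * α)) P f a)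
    (hf0 : ∀ ω, 0 ≤ f ω) : LpBound 1 P (fun ω => f ω ^ α) (a ^ α) := by
  have hα0 : 0 < α := by linarith
  have hf' : LpBound (ENNReal.ofReal α) P f a :=
    hf.exponent (ENNReal.ofReal_le_ofReal (by linarith))
  have he : eLpNorm (fun ω => f ω ^ α) 1 P = eLpNorm f (ENNReal.ofReal α) P ^ α := by
    have := eLpNorm_norm_rpow (μ := P) (p := 1) f hα0
    rw [one_mul] at this
    rw [← this]
    refine eLpNorm_congr_ae (.of_forall fun ω => ?_)
    simp only [Real.norm_of_nonneg (hf0 ω)]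
  have hm : AEStronglyMeasurable (fun ω => f ω ^ α) P :=
    ((Real.continuous_rpow_const hα0.le).comp_aestronglyMeasurable hf'.1.1)
  refine ⟨⟨hm, ?_⟩, ?_⟩
  · rw [he]
    exact ENNReal.rpow_lt_top_of_nonneg hα0.le hf'.1.2.ne
  · rw [← toReal_eLpNorm hm, he, ← ENNReal.toReal_rpow, toReal_eLpNorm hf'.1.1]
    exact Real.rpow_le_rpow lpNorm_nonneg hf'.2 hα0.le

section Growth

variable {Ω : Type*} {m₀ mΩ : MeasurableSpace Ω} {P : Measure Ω} [IsProbabilityMeasure P] {d : ℕ}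
  {T Λ α : ℝ} {c : Coeffs d} {u : Field d} {X : Ω → E d} {Y : Ω → ℝ}

/-- A growth constant of the drift. -/
def Coeffs.bGrowth {d : ℕ} (c : Coeffs d) {mΩ : MeasurableSpace Ω} (P : Measure Ω) (Λ : ℝ) : ℝ :=
  Λ + ‖c.b 0 0 (jointLaw P (fun _ => 0) (fun _ => 0))‖

theorem H0.norm_b_le (h0 : H0 c Λ) (hΛ : 0 ≤ Λ) (hX : MemLp X 2 P) (hY : MemLp Y 2 P) (x : E d)
    (y : ℝ) : ‖c.b x y (jointLaw P X Y)‖ ≤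
      c.bGrowth P Λ * (1 + ‖x‖ + |y| + lpNorm X 2 P + lpNorm Y 2 P) := by
  have hX0 : MemLp (fun _ : Ω => (0 : E d)) 2 P := MemLp.zero'
  have hY0 : MemLp (fun _ : Ω => (0 : ℝ)) 2 P := MemLp.zero'
  have i1 := h0.b_lip x 0 y 0 _ _ (isP2_jointLaw hX hY) (isP2_jointLaw hX0 hY0)
  have i2 := W2_jointLaw_le hX hY hX0 hY0
  simp only [sub_zero] at i1 i2
  have i3 := norm_le_norm_add_norm_sub' (c.b x y (jointLaw P X Y))
    (c.b 0 0 (jointLaw P (fun _ => 0) (fun _ => 0)))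
  have n1 : 0 ≤ lpNorm X 2 P := lpNorm_nonneg
  have n2 : 0 ≤ lpNorm Y 2 P := lpNorm_nonneg
  have n3 := norm_nonneg (c.b 0 0 (jointLaw P (fun _ => 0) (fun _ => 0)))
  have i4 := mul_le_mul_of_nonneg_left (add_le_add_right i2 (‖x‖ + |y|)) hΛ
  unfold Coeffs.bGrowth
  nlinarith [mul_nonneg n3 (by positivity : 0 ≤ ‖x‖ + |y| + lpNorm X 2 P + lpNorm Y 2 P)]

theorem Coeffs.bGrowth_nonneg (hΛ : 0 ≤ Λ) : 0 ≤ c.bGrowth P Λ := by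
  unfold Coeffs.bGrowth
  positivity

/-- A growth constant of the decoupling field. -/
def Field.growth {d : ℕ} (u : Field d) {mΩ : MeasurableSpace Ω} (P : Measure Ω) (T Λ : ℝ) : ℝ :=
  Λ + Λ * Real.sqrt T + |u.U 0 0 (P.map fun _ => 0)|

theorem Field.growth_nonneg (hΛ : 0 ≤ Λ) : 0 ≤ u.growth P T Λ := by
  unfold Field.growth
  positivity

theorem H1.abs_U_le (h1 : H1 m₀ P T c u Λ α) (hΛ : 0 ≤ Λ) {t : ℝ} (ht : t ∈ Icc 0 T)
    (hX : MemLp X 2 P) (x : E d) :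
    |u.U t x (P.map X)| ≤ u.growth P T Λ * (1 + ‖x‖ + lpNorm X 2 P) := by
  have hX0 : MemLp (fun _ : Ω => (0 : E d)) 2 P := MemLp.zero'
  have i1 := h1.abs_U_sub_U_le hΛ le_rfl ht.1 ht.2 hX0 hX 0 x
  simp only [sub_zero, norm_zero, add_zero] at i1
  have z : lpNorm (fun _ : Ω => (0 : E d)) 2 P = 0 := lpNorm_zero _ _
  rw [z] at i1
  have i2 := Real.sqrt_le_sqrt ht.2
  have n1 : 0 ≤ lpNorm X 2 P := lpNorm_nonneg
  have i3 : |u.U t x (P.map X)| ≤ |u.U 0 0 (P.map fun _ => 0)| +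
      |u.U t x (P.map X) - u.U 0 0 (P.map fun _ => 0)| := by
    simpa using norm_le_norm_add_norm_sub' (u.U t x (P.map X)) (u.U 0 0 (P.map fun _ => 0))
  have n3 := abs_nonneg (u.U 0 0 (P.map fun _ => 0))
  have n4 : Λ * (Real.sqrt t) ≤ Λ * Real.sqrt T := by gcongr
  have n5 : 0 ≤ Λ * Real.sqrt T := by positivity
  unfold Field.growth
  nlinarith [mul_nonneg n3 (by positivity : 0 ≤ ‖x‖ + lpNorm X 2 P),
    mul_nonneg n5 (by positivity : 0 ≤ ‖x‖ + lpNorm X 2 P)]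

end Growth

section Euler

variable {Ω : Type*} {m₀ m mΩ : MeasurableSpace Ω} {P : Measure Ω} [IsProbabilityMeasure P] {d : ℕ}
  {T Λ α : ℝ} {c : Coeffs d} {u : Field d}

/-- The data of one step of the forward scheme, with bounds in `L^{2α}`. -/
structure IsEuler (q : Cubature d Λ) (m : MeasurableSpace Ω) {mΩ : MeasurableSpace Ω}
    (P : Measure Ω) (c : Coeffs d) (T α V t h : ℝ)
    (X : Ω → E d) (Y : Ω → ℝ) (G : Ω → E d) : Prop where
  noise : IsNoise q m P G
  meas_X : StronglyMeasurable[m] X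
  meas_Y : StronglyMeasurable[m] Y
  bound_X : LpBound (ENNReal.ofReal (2 * α)) P X V
  bound_Y : LpBound (ENNReal.ofReal (2 * α)) P Y V
  one_le : 1 ≤ V
  nonneg : 0 ≤ t
  pos : 0 < h
  le_one : h ≤ 1
  le_T : t + h ≤ T
  h0 : H0 c Λ
  one_le_Λ : 1 ≤ Λ
  one_le_α : 1 ≤ α

/-- The drift along `(X, Y)`. -/
def Coeffs.drift (c : Coeffs d) {mΩ : MeasurableSpace Ω} (P : Measure Ω) (X : Ω → E d) (Y : Ω → ℝ)
    (ω : Ω) : E d := c.b (X ω) (Y ω) (jointLaw P X Y)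

/-- The diffusion coefficient along `X`. -/
def Coeffs.diffusion (c : Coeffs d) {mΩ : MeasurableSpace Ω} (P : Measure Ω) (X : Ω → E d)
    (ω : Ω) : E d →L[ℝ] E d := c.σ (X ω) (P.map X)

namespace IsEuler

variable {q : Cubature d Λ} {V t h s : ℝ} {X : Ω → E d} {Y : Ω → ℝ} {G : Ω → E d}

/-- The interpolated Euler scheme. -/
def path (c : Coeffs d) {mΩ : MeasurableSpace Ω} (P : Measure Ω) (t : ℝ) (X : Ω → E d) (Y : Ω → ℝ)
    (G : Ω → E d) (s : ℝ) (ω : Ω) : E d :=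
  curve t X (c.drift P X Y) (fun ω => c.diffusion P X ω (G ω)) s ω

/-- The Euler scheme started from `X ω`, for the value `γ` of the noise. -/
def branch (c : Coeffs d) {mΩ : MeasurableSpace Ω} (P : Measure Ω) (t : ℝ) (X : Ω → E d)
    (Y : Ω → ℝ) (ω : Ω) (γ : E d) (s : ℝ) : E d :=
  X ω + (s - t) • c.drift P X Y ω + Real.sqrt (s - t) • c.diffusion P X ω γ

/-- A random size of `(X, Y)`. -/
def size (V : ℝ) (X : Ω → E d) (Y : Ω → ℝ) (ω : Ω) : ℝ := ‖X ω‖ + |Y ω| + V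

/-- A constant which controls the displacement over one step. -/
def speed (c : Coeffs d) {mΩ : MeasurableSpace Ω} (P : Measure Ω) (Λ : ℝ) : ℝ :=
  9 * c.bGrowth P Λ + Λ ^ 2

theorem Λ_nonneg (H : IsEuler q m P c T α V t h X Y G) : 0 ≤ Λ := by linarith [H.one_le_Λ]

theorem speed_nonneg (H : IsEuler q m P c T α V t h X Y G) : 0 ≤ speed c P Λ := by
  have := Coeffs.bGrowth_nonneg (c := c) (P := P) H.Λ_nonneg
  unfold speed
  positivity

theorem bound_X2 (H : IsEuler q m P c T α V t h X Y G) : LpBound 2 P X V :=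
  H.bound_X.exponent (two_le_ofReal_two_mul H.one_le_α)

theorem bound_Y2 (H : IsEuler q m P c T α V t h X Y G) : LpBound 2 P Y V :=
  H.bound_Y.exponent (two_le_ofReal_two_mul H.one_le_α)

theorem one_le_p (H : IsEuler q m P c T α V t h X Y G) : 1 ≤ ENNReal.ofReal (2 * α) :=
  one_le_ofReal_two_mul H.one_le_α

theorem le_size (H : IsEuler q m P c T α V t h X Y G) (ω : Ω) :
    1 ≤ size V X Y ω ∧ V ≤ size V X Y ω ∧ ‖X ω‖ + V ≤ size V X Y ω := by
  have := H.one_le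
  have n1 := norm_nonneg (X ω)
  have n2 := abs_nonneg (Y ω)
  unfold size
  refine ⟨?_, ?_, ?_⟩ <;> linarith

theorem bound_size (H : IsEuler q m P c T α V t h X Y G) :
    LpBound (ENNReal.ofReal (2 * α)) P (size V X Y) (3 * V) :=
  (((H.bound_X.norm.add H.one_le_p H.bound_Y.abs).add H.one_le_p
    (LpBound.const (by have := H.one_le_p; positivity) (by linarith [H.one_le])))).mono (by linarith)

theorem norm_drift_le (H : IsEuler q m P c T α V t h X Y G) (ω : Ω) :
    ‖c.drift P X Y ω‖ ≤ 3 * c.bGrowth P Λ * size V X Y ω := by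
  have hb := Coeffs.bGrowth_nonneg (c := c) (P := P) H.Λ_nonneg
  refine (H.h0.norm_b_le H.Λ_nonneg H.bound_X2.1 H.bound_Y2.1 _ _).trans ?_
  rw [mul_comm 3, mul_assoc]
  refine mul_le_mul_of_nonneg_left ?_ hb
  have n1 := norm_nonneg (X ω)
  have n2 := abs_nonneg (Y ω)
  have n3 := H.one_le
  have n4 := H.bound_X2.2
  have n5 := H.bound_Y2.2
  unfold size
  linarith

theorem meas_drift (H : IsEuler q m P c T α V t h X Y G) :
    StronglyMeasurable[m] (c.drift P X Y) :=
  (H.h0.continuous_b H.Λ_nonneg (isP2_jointLaw H.bound_X2.1 H.bound_Y2.1)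
    (W2_jointLaw_self H.bound_X2.1 H.bound_Y2.1)).comp_stronglyMeasurable
    (H.meas_X.prodMk H.meas_Y)

theorem bound_drift (H : IsEuler q m P c T α V t h X Y G) :
    LpBound (ENNReal.ofReal (2 * α)) P (c.drift P X Y) (9 * c.bGrowth P Λ * V) := by
  have hb := Coeffs.bGrowth_nonneg (c := c) (P := P) H.Λ_nonneg
  exact ((H.bound_size.const_mul (c := 3 * c.bGrowth P Λ) (by positivity)).of_le
    (H.meas_drift.mono H.noise.le).aestronglyMeasurable
    (.of_forall H.norm_drift_le)).mono (le_of_eq (by ring))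

theorem norm_diffusion_le (H : IsEuler q m P c T α V t h X Y G) (ω : Ω) :
    ‖c.diffusion P X ω‖ ≤ Λ := H.h0.σ_bdd _ _ (isP2_map H.bound_X2.1)

theorem norm_diffusion_apply_le (H : IsEuler q m P c T α V t h X Y G) (ω : Ω) {γ : E d}
    (hγ : γ ∈ q.S) : ‖c.diffusion P X ω γ‖ ≤ Λ ^ 2 := by
  rw [sq]
  exact ((c.diffusion P X ω).le_opNorm γ).trans
    (mul_le_mul (H.norm_diffusion_le ω) (q.bdd γ hγ) (norm_nonneg _) H.Λ_nonneg)

theorem meas_diffusion (H : IsEuler q m P c T α V t h X Y G) :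
    StronglyMeasurable[m] (c.diffusion P X) :=
  (H.h0.continuous_σ H.Λ_nonneg (isP2_map H.bound_X2.1)
    (W2_map_self H.bound_X2.1)).comp_stronglyMeasurable H.meas_X

theorem meas_diffusion_apply (H : IsEuler q m P c T α V t h X Y G) (γ : E d) :
    StronglyMeasurable[m] fun ω => c.diffusion P X ω γ :=
  (ContinuousLinearMap.apply ℝ (E d) γ).continuous.comp_stronglyMeasurable H.meas_diffusion

theorem meas_noise (H : IsEuler q m P c T α V t h X Y G) :
    StronglyMeasurable fun ω => c.diffusion P X ω (G ω) :=
  H.noise.stronglyMeasurable_comp (F := fun ω γ => c.diffusion P X ω γ) fun γ _ =>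
    H.meas_diffusion_apply γ

theorem bound_noise (H : IsEuler q m P c T α V t h X Y G) :
    LpBound (ENNReal.ofReal (2 * α)) P (fun ω => c.diffusion P X ω (G ω)) (Λ ^ 2) :=
  (LpBound.const (by have := H.one_le_p; positivity) (sq_nonneg Λ)).of_le
    H.meas_noise.aestronglyMeasurable
    (.of_forall fun ω => H.norm_diffusion_apply_le ω (H.noise.mem ω))

theorem sqrt_le_one (H : IsEuler q m P c T α V t h X Y G) (hs : s ∈ Icc t (t + h)) :
    Real.sqrt (s - t) ≤ 1 :=
  Real.sqrt_le_one.2 (by linarith [hs.2, H.le_one])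

theorem sqrt_le (hs : s ∈ Icc t (t + h)) : Real.sqrt (s - t) ≤ Real.sqrt h :=
  Real.sqrt_le_sqrt (by linarith [hs.2])

/-- A factor √(s - t) comes out of the whole displacement: the drift part keeps one more factor √(s
- t), which is at most 1. -/
theorem norm_branch_sub_le (H : IsEuler q m P c T α V t h X Y G) (hs : s ∈ Icc t (t + h)) (ω : Ω)
    {γ : E d} (hγ : γ ∈ q.S) :
    ‖branch c P t X Y ω γ s - X ω‖ ≤ Real.sqrt (s - t) * (speed c P Λ * size V X Y ω) := by
  have hr0 : 0 ≤ s - t := by linarith [hs.1]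
  have e1 : branch c P t X Y ω γ s - X ω = Real.sqrt (s - t) • (Real.sqrt (s - t) •
      c.drift P X Y ω + c.diffusion P X ω γ) := by
    rw [smul_add, smul_smul, Real.mul_self_sqrt hr0, branch]
    abel
  rw [e1, norm_smul, Real.norm_of_nonneg (Real.sqrt_nonneg _)]
  gcongr
  refine (norm_add_le _ _).trans ?_
  rw [norm_smul, Real.norm_of_nonneg (Real.sqrt_nonneg _)]
  have i1 := mul_le_mul (H.sqrt_le_one hs) (H.norm_drift_le ω) (norm_nonneg _) zero_le_one
  have i2 := H.norm_diffusion_apply_le ω hγ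
  have hb := Coeffs.bGrowth_nonneg (c := c) (P := P) H.Λ_nonneg
  have hsz := (H.le_size ω).1
  unfold speed
  nlinarith [mul_nonneg hb (zero_le_one.trans hsz), mul_le_mul_of_nonneg_left hsz (sq_nonneg Λ)]

theorem bound_path_sub (H : IsEuler q m P c T α V t h X Y G) (hs : s ∈ Icc t (t + h)) :
    LpBound (ENNReal.ofReal (2 * α)) P (fun ω => path c P t X Y G s ω - X ω)
      (Real.sqrt (s - t) * (speed c P Λ * V)) := by
  have hr0 : 0 ≤ s - t := by linarith [hs.1]
  have hr := Real.sqrt_nonneg (s - t)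
  have i1 := ((H.bound_drift.norm.const_mul hr).add H.one_le_p H.bound_noise.norm).const_mul hr
  have hb := Coeffs.bGrowth_nonneg (c := c) (P := P) H.Λ_nonneg
  have hV := H.one_le
  refine (i1.of_le (f := fun ω => path c P t X Y G s ω - X ω) ?_ (.of_forall fun ω => ?_)).mono ?_
  · exact ((memLp_curve H.bound_X.1 H.bound_drift.1 H.bound_noise.1 t s).sub H.bound_X.1).1
  · have e1 : path c P t X Y G s ω - X ω = Real.sqrt (s - t) • (Real.sqrt (s - t) •
        c.drift P X Y ω + c.diffusion P X ω (G ω)) := by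
      rw [smul_add, smul_smul, Real.mul_self_sqrt hr0, path, curve]
      abel
    rw [e1, norm_smul, Real.norm_of_nonneg hr]
    gcongr
    refine (norm_add_le _ _).trans ?_
    rw [norm_smul, Real.norm_of_nonneg hr]
  · unfold speed
    gcongr
    have i2 := mul_le_mul_of_nonneg_right (H.sqrt_le_one hs)
      (by positivity : 0 ≤ 9 * c.bGrowth P Λ * V)
    nlinarith [sq_nonneg Λ]

theorem bound_path_sub2 (H : IsEuler q m P c T α V t h X Y G) (hs : s ∈ Icc t (t + h)) :
    LpBound 2 P (fun ω => path c P t X Y G s ω - X ω) (Real.sqrt (s - t) * (speed c P Λ * V)) :=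
  (H.bound_path_sub hs).exponent (two_le_ofReal_two_mul H.one_le_α)

theorem memLp_path (H : IsEuler q m P c T α V t h X Y G) (s : ℝ) :
    MemLp (path c P t X Y G s) (ENNReal.ofReal (2 * α)) P :=
  memLp_curve H.bound_X.1 H.bound_drift.1 H.bound_noise.1 t s

theorem memLp_path2 (H : IsEuler q m P c T α V t h X Y G) (s : ℝ) :
    MemLp (path c P t X Y G s) 2 P :=
  (H.memLp_path s).mono_exponent (two_le_ofReal_two_mul H.one_le_α)

/-- The typical size of a displacement: it enters all the estimates of increments. -/
theorem displacement_le (H : IsEuler q m P c T α V t h X Y G) (hs : s ∈ Icc t (t + h)) (ω : Ω)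
    {γ : E d} (hγ : γ ∈ q.S) :
    ‖branch c P t X Y ω γ s - X ω‖ + lpNorm (fun ω => path c P t X Y G s ω - X ω) 2 P
      + Real.sqrt (s - t) * (1 + ‖X ω‖ + lpNorm X 2 P) ≤
      Real.sqrt (s - t) * ((2 * speed c P Λ + 2) * size V X Y ω) := by
  have i1 := H.norm_branch_sub_le hs ω hγ
  have i2 := (H.bound_path_sub2 hs).2
  obtain ⟨s1, s2, s3⟩ := H.le_size ω
  have i3 : 1 + ‖X ω‖ + lpNorm X 2 P ≤ 2 * size V X Y ω := by linarith [H.bound_X2.2]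
  have i4 := mul_le_mul_of_nonneg_left i3 (Real.sqrt_nonneg (s - t))
  have i5 := mul_le_mul_of_nonneg_left (mul_le_mul_of_nonneg_left s2 H.speed_nonneg)
    (Real.sqrt_nonneg (s - t))
  linarith

end IsEuler
end Euler
end MKV
end

/-! ### First order terms of the local error -/

noncomputable section

namespace MKV
namespace IsEuler

variable {Ω : Type*} {m₀ m mΩ : MeasurableSpace Ω} {P : Measure Ω} [IsProbabilityMeasure P] {d : ℕ}
  {T Λ α : ℝ} {c : Coeffs d} {u : Field d}
  {q : Cubature d Λ} {V t h s : ℝ} {X : Ω → E d} {Y : Ω → ℝ} {G : Ω → E d}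

theorem V_le_rpow (H : IsEuler q m P c T α V t h X Y G) : V ≤ V ^ α := by
  have := Real.rpow_le_rpow_of_exponent_le H.one_le H.one_le_α
  rwa [Real.rpow_one] at this

/-- The mean of the random Lipschitz weight is of order V^α. The α-powers are integrable because the
norms of order α are dominated by those of order 2α; the factor 4 collects 1, twice the power of the
path, and the power of the norm of its law, each bounded by the same quantity. -/
theorem bound_weight (H : IsEuler q m P c T α V t h X Y G) (hs : s ∈ Icc t (t + h)) :
    LpBound 1 P (fun ω => 1 + 2 * (‖X ω‖ + ‖(s - t) • c.drift P X Y ω‖ + Λ ^ 2) ^ α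
      + norm2 (P.map (path c P t X Y G s)) ^ α) (4 * (1 + speed c P Λ) ^ α * V ^ α) := by
  have hV := H.one_le
  have hK := H.speed_nonneg (c := c) (P := P)
  have hb := Coeffs.bGrowth_nonneg (c := c) (P := P) H.Λ_nonneg
  have hα0 : 0 ≤ α := by linarith [H.one_le_α]
  have hst : ‖s - t‖ ≤ 1 := by
    rw [Real.norm_of_nonneg (by linarith [hs.1])]; linarith [hs.2, H.le_one]
  have i1 : LpBound (ENNReal.ofReal (2 * α)) P
      (fun ω => ‖X ω‖ + ‖(s - t) • c.drift P X Y ω‖ + Λ ^ 2) ((1 + speed c P Λ) * V) := by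
    have j1 : LpBound (ENNReal.ofReal (2 * α)) P (fun ω => ‖(s - t) • c.drift P X Y ω‖)
        (9 * c.bGrowth P Λ * V) := by
      have hm : StronglyMeasurable fun ω => ‖(s - t) • c.drift P X Y ω‖ :=
        ((H.meas_drift.mono H.noise.le).const_smul (s - t)).norm
      refine LpBound.of_le (g := fun ω => ‖c.drift P X Y ω‖) H.bound_drift.norm
        hm.aestronglyMeasurable (.of_forall fun ω => ?_)
      rw [norm_norm, norm_smul]
      exact mul_le_of_le_one_left (norm_nonneg _) hst
    have j2 : LpBound (ENNReal.ofReal (2 * α)) P (fun _ : Ω => Λ ^ 2) (Λ ^ 2) :=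
      LpBound.const (zero_lt_one.trans_le H.one_le_p).ne' (sq_nonneg Λ)
    refine ((H.bound_X.norm.add H.one_le_p j1).add H.one_le_p j2).mono ?_
    unfold speed
    nlinarith [sq_nonneg Λ]
  have i2 := i1.rpow H.one_le_α (fun ω => by positivity)
  have i3 : norm2 (P.map (path c P t X Y G s)) ≤ (1 + speed c P Λ) * V := by
    rw [norm2_map (H.memLp_path2 s).1]
    have := (H.bound_X2.add (by norm_num) (H.bound_path_sub2 hs)).2
    simp only [add_sub_cancel] at this
    refine this.trans ?_
    have := mul_le_mul_of_nonneg_right (H.sqrt_le_one hs) (by positivity : 0 ≤ speed c P Λ * V)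
    linarith
  have i4 : norm2 (P.map (path c P t X Y G s)) ^ α ≤ ((1 + speed c P Λ) * V) ^ α :=
    Real.rpow_le_rpow ENNReal.toReal_nonneg i3 hα0
  have i5 : 1 ≤ ((1 + speed c P Λ) * V) ^ α := Real.one_le_rpow (by nlinarith) hα0
  rw [mul_assoc, ← Real.mul_rpow (by positivity) (by positivity)]
  have i6 : LpBound 1 P (fun _ : Ω => norm2 (P.map (path c P t X Y G s)) ^ α)
      (norm2 (P.map (path c P t X Y G s)) ^ α) :=
    LpBound.const one_ne_zero (Real.rpow_nonneg ENNReal.toReal_nonneg α)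
  refine (((LpBound.const one_ne_zero zero_le_one).add le_rfl
    (i2.const_mul (by norm_num : (0 : ℝ) ≤ 2))).add le_rfl i6).mono ?_
  linarith

/-- The defect of `Y` with respect to the decoupling field along `X`. -/
def defect (u : Field d) {mΩ : MeasurableSpace Ω} (P : Measure Ω) (t : ℝ) (X : Ω → E d)
    (Y : Ω → ℝ) (ω : Ω) : ℝ := Y ω - u.U t (X ω) (P.map X)

/-- The pointwise size of the local error. -/
def localError (u : Field d) {mΩ : MeasurableSpace Ω} (P : Measure Ω) (α V t h : ℝ)
    (X : Ω → E d) (Y : Ω → ℝ) (ω : Ω) : ℝ :=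
  |defect u P t X Y ω| + lpNorm (defect u P t X Y) 2 P
    + Real.sqrt h * (size V X Y ω + V ^ α)

/-- The driver along the decoupling field. -/
def driver (c : Coeffs d) (u : Field d) (t : ℝ) (x : E d) (μ : Measure (E d)) : ℝ :=
  c.f x (u.U t x μ) (ContinuousLinearMap.adjoint (c.σ x μ) (u.Ux t x μ)) (u.graphLaw t μ)

theorem t_mem (H : IsEuler q m P c T α V t h X Y G) (hs : s ∈ Icc t (t + h)) : s ∈ Icc 0 T :=
  ⟨H.nonneg.trans hs.1, hs.2.trans H.le_T⟩

theorem bound_defect2 (H : IsEuler q m P c T α V t h X Y G) (h1 : H1 m₀ P T c u Λ α) :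
    LpBound 2 P (defect u P t X Y) (lpNorm (defect u P t X Y) 2 P) :=
  LpBound.of_memLp (H.bound_Y2.1.sub (h1.memLp_U H.Λ_nonneg (H.t_mem (left_mem_Icc.2
    (by linarith [H.pos]))) (isP2_map H.bound_X2.1) (W2_map_self H.bound_X2.1) H.bound_X2.1))

theorem le_localError (H : IsEuler q m P c T α V t h X Y G) (ω : Ω) :
    |defect u P t X Y ω| + lpNorm (defect u P t X Y) 2 P + Real.sqrt h * size V X Y ω ≤
      localError u P α V t h X Y ω ∧
    lpNorm (defect u P t X Y) 2 P + Real.sqrt h * V ^ α ≤ localError u P α V t h X Y ω := by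
  have hV : 0 ≤ V ^ α := Real.rpow_nonneg (by linarith [H.one_le]) _
  have n1 := Real.sqrt_nonneg h
  have n2 := zero_le_one.trans (H.le_size ω).1
  have n3 : 0 ≤ |defect u P t X Y ω| := abs_nonneg _
  unfold localError
  constructor <;> nlinarith [mul_nonneg n1 hV, mul_nonneg n1 n2]

section Terms

/-- The drift of the scheme at time t meets the drift in the equation at time s on the branch:
besides the displacement, this is where the defect of Y enters, both at ω and in L². -/
theorem abs_inner_drift_le (H : IsEuler q m P c T α V t h X Y G) (h1 : H1 m₀ P T c u Λ α)
    (hs : s ∈ Icc t (t + h)) (ω : Ω) {γ : E d} (hγ : γ ∈ q.S) :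
    |⟪u.Ux s (branch c P t X Y ω γ s) (P.map (path c P t X Y G s)), c.drift P X Y ω⟫ -
      ⟪c.b (branch c P t X Y ω γ s)
        (u.U s (branch c P t X Y ω γ s) (P.map (path c P t X Y G s)))
        (u.graphLaw s (P.map (path c P t X Y G s))),
        u.Ux s (branch c P t X Y ω γ s) (P.map (path c P t X Y G s))⟫| ≤
      4 * Λ ^ 3 * (2 * speed c P Λ + 3) * localError u P α V t h X Y ω := by
  have hΛ := H.Λ_nonneg
  rw [real_inner_comm, ← inner_sub_left]
  refine (abs_real_inner_le_norm _ _).trans ?_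
  have i1 := h1.norm_Ux_le hΛ (H.t_mem hs) (branch c P t X Y ω γ s)
    (isP2_map (H.memLp_path2 s))
  have i2 := h1.norm_b_sub_b_le H.h0 H.one_le_Λ H.nonneg hs.1 (H.t_mem hs).2 H.bound_X2.1
    H.bound_Y2.1 (H.memLp_path2 s) (X ω) (branch c P t X Y ω γ s) (Y ω)
  have i3 := H.displacement_le hs ω hγ
  have i4 := (H.le_localError (u := u) ω).1
  have hK := H.speed_nonneg (c := c) (P := P)
  have hsz := zero_le_one.trans (H.le_size ω).1
  have i5 : Real.sqrt (s - t) * ((2 * speed c P Λ + 2) * size V X Y ω) ≤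
      Real.sqrt h * ((2 * speed c P Λ + 2) * size V X Y ω) := by
    gcongr
    linarith [hs.2]
  have n1 : 0 ≤ |defect u P t X Y ω| := abs_nonneg _
  have n2 : 0 ≤ lpNorm (defect u P t X Y) 2 P := lpNorm_nonneg
  have n3 : 0 ≤ Real.sqrt h * size V X Y ω := mul_nonneg (Real.sqrt_nonneg _) hsz
  calc _ ≤ (4 * Λ ^ 2 * ((2 * speed c P Λ + 3) * localError u P α V t h X Y ω)) * Λ := by
        refine mul_le_mul (i2.trans ?_) i1 (norm_nonneg _) (by
          have := n1.trans (le_trans (by linarith) i4); positivity)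
        refine mul_le_mul_of_nonneg_left ?_ (by positivity)
        change |defect u P t X Y ω| + lpNorm (defect u P t X Y) 2 P + _ + _ + _ ≤ _
        nlinarith [mul_nonneg hK n1, mul_nonneg hK n2]
    _ = _ := by ring

theorem abs_driver_sub_le (H : IsEuler q m P c T α V t h X Y G) (h1 : H1 m₀ P T c u Λ α)
    (hs : s ∈ Icc t (t + h)) (ω : Ω) {γ : E d} (hγ : γ ∈ q.S) :
    |driver c u t (X ω) (P.map X) -
      driver c u s (branch c P t X Y ω γ s) (P.map (path c P t X Y G s))| ≤
      8 * Λ ^ 3 * (2 * speed c P Λ + 2) * localError u P α V t h X Y ω := by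
  have hΛ := H.Λ_nonneg
  refine (h1.abs_f_sub_f_le H.h0 H.one_le_Λ H.nonneg hs.1 (H.t_mem hs).2 H.bound_X2.1
    (H.memLp_path2 s) (X ω) (branch c P t X Y ω γ s)).trans ?_
  have i3 := H.displacement_le hs ω hγ
  have i4 := (H.le_localError (u := u) ω).1
  have hK := H.speed_nonneg (c := c) (P := P)
  have hsz := zero_le_one.trans (H.le_size ω).1
  have i5 : Real.sqrt (s - t) * ((2 * speed c P Λ + 2) * size V X Y ω) ≤
      Real.sqrt h * ((2 * speed c P Λ + 2) * size V X Y ω) := by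
    gcongr
    linarith [hs.2]
  have n1 : 0 ≤ |defect u P t X Y ω| := abs_nonneg _
  have n2 : 0 ≤ lpNorm (defect u P t X Y) 2 P := lpNorm_nonneg
  rw [mul_assoc (8 * Λ ^ 3)]
  refine mul_le_mul_of_nonneg_left ?_ (by positivity)
  nlinarith [mul_nonneg hK n1, mul_nonneg hK n2]

/-- Cauchy–Schwarz between ∂_μ𝒰, bounded in L² of the law, and the drift increment in L². The right
side is stated at an arbitrary ω, to be added to the pointwise estimates, but only the deterministic
part of `localError` serves. -/
theorem abs_integral_drift_le (H : IsEuler q m P c T α V t h X Y G) (h1 : H1 m₀ P T c u Λ α)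
    (hs : s ∈ Icc t (t + h)) (ω : Ω) (z : E d) :
    |∫ ω, ⟪u.Um s z (P.map (path c P t X Y G s)) (path c P t X Y G s ω), c.drift P X Y ω⟫ ∂P -
      ∫ v, ⟪u.Um s z (P.map (path c P t X Y G s)) v,
        c.b v (u.U s v (P.map (path c P t X Y G s)))
          (u.graphLaw s (P.map (path c P t X Y G s)))⟫ ∂(P.map (path c P t X Y G s))| ≤
      4 * Λ ^ 3 * (2 * speed c P Λ + 3) * localError u P α V t h X Y ω := by
  have hΛ := H.Λ_nonneg
  have hζ := H.memLp_path2 s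
  have hμ := isP2_map hζ
  set ζ := path c P t X Y G s with hζdef
  have hUc := h1.classical.continuous_U (H.t_mem hs) hμ
  have hUζ : MemLp (fun ω => u.U s (ζ ω) (P.map ζ)) 2 P :=
    h1.memLp_U hΛ (H.t_mem hs) hμ (W2_map_self hζ) hζ
  have hgr : u.graphLaw s (P.map ζ) = jointLaw P ζ fun ω => u.U s (ζ ω) (P.map ζ) :=
    graphLaw_map u s hζ.1.aemeasurable hUc
  have hgr2 : IsP2 (u.graphLaw s (P.map ζ)) := hgr ▸ isP2_jointLaw hζ hUζ
  have hbc : Continuous fun v => c.b v (u.U s v (P.map ζ)) (u.graphLaw s (P.map ζ)) :=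
    (H.h0.continuous_b hΛ hgr2 (hgr ▸ W2_jointLaw_self hζ hUζ)).comp
      (continuous_id.prodMk hUc)
  have hFc := h1.classical.continuous_Um (H.t_mem hs) z hμ
  rw [integral_map hζ.1.aemeasurable (hFc.inner hbc).aestronglyMeasurable]
  have hF : LpBound 2 P (fun ω => u.Um s z (P.map ζ) (ζ ω)) Λ := h1.lpNorm_Um_le hΛ (H.t_mem hs) z hζ
  -- the increment of the drift
  have hΔ2 : LpBound 2 P (fun ω => c.drift P X Y ω -
      c.b (ζ ω) (u.U s (ζ ω) (P.map ζ)) (u.graphLaw s (P.map ζ)))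
      (4 * Λ ^ 2 * ((2 * speed c P Λ + 3) * localError u P α V t h X Y ω)) := by
    set e := lpNorm (fun ω => ζ ω - X ω) 2 P
    set D := lpNorm (defect u P t X Y) 2 P
    have hr := Real.sqrt_nonneg (s - t)
    have hdom := ((((((H.bound_defect2 h1).abs.add (by norm_num)
      (LpBound.const (by norm_num) (lpNorm_nonneg (f := defect u P t X Y) (p := 2) (μ := P)))).add
      (by norm_num) (H.bound_path_sub2 hs).norm).add (by norm_num)
      (LpBound.const (by norm_num) (lpNorm_nonneg (f := fun ω => ζ ω - X ω) (p := 2) (μ := P)))).add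
      (by norm_num)
      ((((LpBound.const (by norm_num) zero_le_one).add (by norm_num) H.bound_X2.norm).add
        (by norm_num) (LpBound.const (by norm_num)
          (lpNorm_nonneg (f := X) (p := 2) (μ := P)))).const_mul hr)).const_mul
      (by positivity : 0 ≤ 4 * Λ ^ 2))
    refine (hdom.of_le ?_ (.of_forall fun ω' => ?_)).mono ?_
    · exact ((H.meas_drift.mono H.noise.le).aestronglyMeasurable).sub
        (hbc.comp_aestronglyMeasurable hζ.1)
    · exact h1.norm_b_sub_b_le H.h0 H.one_le_Λ H.nonneg hs.1 (H.t_mem hs).2 H.bound_X2.1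
        H.bound_Y2.1 hζ (X ω') (ζ ω') (Y ω')
    · refine mul_le_mul_of_nonneg_left ?_ (by positivity)
      have i4 := (H.le_localError (u := u) ω).2
      have hK := H.speed_nonneg (c := c) (P := P)
      have hV := H.one_le
      have hVα := H.V_le_rpow
      have n2 : 0 ≤ D := lpNorm_nonneg
      have i5 : Real.sqrt (s - t) ≤ Real.sqrt h := sqrt_le hs
      have i6 : Real.sqrt (s - t) * V ≤ Real.sqrt h * V ^ α := by gcongr
      have i7 : e ≤ Real.sqrt (s - t) * (speed c P Λ * V) := (H.bound_path_sub2 hs).2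
      have i8 := H.bound_X2.2
      have i9 : Real.sqrt (s - t) * (1 + V + lpNorm X 2 P) ≤ Real.sqrt (s - t) * (3 * V) := by
        gcongr; linarith
      have n4 : 0 ≤ Real.sqrt h * V ^ α := by positivity
      nlinarith [mul_nonneg hK n2, mul_le_mul_of_nonneg_left i6 hK]
  have hbζ : MemLp (fun ω => c.b (ζ ω) (u.U s (ζ ω) (P.map ζ)) (u.graphLaw s (P.map ζ))) 2 P := by
    have := (H.bound_drift.exponent (two_le_ofReal_two_mul H.one_le_α)).1.sub hΔ2.1
    refine this.ae_eq (.of_forall fun ω' => ?_)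
    simp
  rw [← integral_sub (integrable_inner_of_memLp hF.1
    (H.bound_drift.exponent (two_le_ofReal_two_mul H.one_le_α)).1)
    (integrable_inner_of_memLp hF.1 hbζ)]
  simp_rw [← inner_sub_right]
  refine (abs_integral_inner_le hF hΔ2).trans (le_of_eq (by ring))

end Terms

end IsEuler
end MKV
end

/-! ### The derivative of the averaged field and the equation -/

noncomputable section

namespace MKV
namespace IsEuler

variable {Ω : Type*} {m₀ m mΩ : MeasurableSpace Ω} {P : Measure Ω} [IsProbabilityMeasure P] {d : ℕ}
  {T Λ α : ℝ} {c : Coeffs d} {u : Field d}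
  {q : Cubature d Λ} {V t h s : ℝ} {X : Ω → E d} {Y : Ω → ℝ} {G : Ω → E d}

theorem hasDerivAt_branch (hts : t < s) (ω : Ω) (γ : E d) :
    HasDerivAt (branch c P t X Y ω γ)
      (c.drift P X Y ω + (1 / (2 * Real.sqrt (s - t))) • c.diffusion P X ω γ) s := by
  have h1 : HasDerivAt (fun s' : ℝ => s' - t) 1 s := (hasDerivAt_id s).sub_const t
  have h2 := h1.sqrt (sub_pos.2 hts).ne'
  have := ((h1.smul_const (c.drift P X Y ω)).const_add (X ω)).add
    (h2.smul_const (c.diffusion P X ω γ))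
  rw [one_smul] at this
  exact this

/-- The chain rule on each branch. The open interval avoids both the singularity of the square root
at t and the final time, where the time derivative is not available. -/
theorem hasDerivAt_avg_U (H : IsEuler q m P c T α V t h X Y G) (h1 : H1 m₀ P T c u Λ α)
    (hm : m₀ ≤ mΩ) (hat : Atomless m₀ P) (hs : s ∈ Ioo t (t + h)) (ω : Ω) :
    HasDerivAt (fun s' => q.avg fun γ =>
        u.U s' (branch c P t X Y ω γ s') (P.map (path c P t X Y G s')))
      (q.avg fun γ => (u.Ut s (branch c P t X Y ω γ s) (P.map (path c P t X Y G s))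
        + ⟪u.Ux s (branch c P t X Y ω γ s) (P.map (path c P t X Y G s)),
            c.drift P X Y ω + (1 / (2 * Real.sqrt (s - t))) • c.diffusion P X ω γ⟫
        + (∫ ω', ⟪u.Um s (branch c P t X Y ω γ s) (P.map (path c P t X Y G s))
              (path c P t X Y G s ω'), c.drift P X Y ω'⟫ ∂P
          + (∫ ω', ⟪u.Um s (branch c P t X Y ω γ s) (P.map (path c P t X Y G s))
              (path c P t X Y G s ω'), c.diffusion P X ω' (G ω')⟫ ∂P)
            * (1 / (2 * Real.sqrt (s - t)))))) s := by
  unfold Cubature.avg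
  refine HasDerivAt.fun_sum fun γ _ => HasDerivAt.const_smul (q.w γ) ?_
  exact h1.classical.hasDerivAt_curve hm hat (H.meas_X.mono H.noise.le).measurable
    (H.meas_drift.mono H.noise.le).measurable H.meas_noise.measurable H.bound_X2.1
    (H.bound_drift.exponent (two_le_ofReal_two_mul H.one_le_α)).1
    (H.bound_noise.exponent (two_le_ofReal_two_mul H.one_le_α)).1 H.nonneg hs.1
    (hs.2.trans_le H.le_T) (hasDerivAt_branch hs.1 ω γ)

/-- The constant of the local error. -/
def localConst (c : Coeffs d) {mΩ : MeasurableSpace Ω} (P : Measure Ω) (Λ α : ℝ) : ℝ :=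
  8 * Λ ^ 3 * (2 * speed c P Λ + 3) + 8 * Λ ^ 3 * (2 * speed c P Λ + 2) +
    (Λ ^ 7 + d * (Λ ^ 5 + 2 * Λ ^ 3 * (2 * speed c P Λ))) +
    (Λ ^ 7 + d * Λ ^ 5) * (4 * (1 + speed c P Λ) ^ α) + d * (2 * Λ ^ 3 * speed c P Λ)

/-- The coefficient 1 / (2√(s - t)) is compensated by the average of a centered quantity, whose
first nonzero order is √(s - t); the limit is the trace of the Hessian term. -/
theorem abs_second_order_x_le (H : IsEuler q m P c T α V t h X Y G) (h1 : H1 m₀ P T c u Λ α)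
    (hs : s ∈ Ioo t (t + h)) (ω : Ω) :
    |q.avg (fun γ => ⟪u.Ux s (branch c P t X Y ω γ s) (P.map (path c P t X Y G s)),
        c.diffusion P X ω γ⟫) / (2 * Real.sqrt (s - t)) -
      q.avg (fun γ => 1 / 2 * tr ((u.Uxx s (branch c P t X Y ω γ s)
        (P.map (path c P t X Y G s))).comp
        (c.a (branch c P t X Y ω γ s) (P.map (path c P t X Y G s)))))| ≤
      (Λ ^ 7 + d * (Λ ^ 5 + 2 * Λ ^ 3 * (2 * speed c P Λ))) * localError u P α V t h X Y ω := by
  have hΛ := H.Λ_nonneg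
  have hs' : s ∈ Icc t (t + h) := Ioo_subset_Icc_self hs
  have hr : 0 < Real.sqrt (s - t) := Real.sqrt_pos.2 (by linarith [hs.1])
  have hK := H.speed_nonneg (c := c) (P := P)
  obtain ⟨s1, s2, -⟩ := H.le_size ω
  have := H1.abs_avg_Ux_sub_le (q := q) H.h0 h1 hΛ (H.t_mem hs') H.bound_X2.1 (H.memLp_path2 s)
    (X ω) ((s - t) • c.drift P X Y ω) hr
    (κ := Real.sqrt (s - t) * (2 * speed c P Λ * size V X Y ω)) (fun γ hγ => by
      have i1 := H.norm_branch_sub_le hs' ω hγ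
      have i2 := (H.bound_path_sub2 hs').2
      have i3 := mul_le_mul_of_nonneg_left (mul_le_mul_of_nonneg_left s2 hK) hr.le
      refine (add_le_add i1 i2).trans ?_
      linarith)
  refine this.trans ?_
  have hrh : Real.sqrt (s - t) ≤ Real.sqrt h := sqrt_le hs'
  have i4 : Real.sqrt (s - t) * size V X Y ω ≤ localError u P α V t h X Y ω := by
    have j := (H.le_localError (u := u) ω).1
    have n1 : 0 ≤ |defect u P t X Y ω| := abs_nonneg _
    have n2 : 0 ≤ lpNorm (defect u P t X Y) 2 P := lpNorm_nonneg
    have := mul_le_mul_of_nonneg_right hrh (zero_le_one.trans s1)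
    linarith
  have i5 : Real.sqrt (s - t) ≤ localError u P α V t h X Y ω := by
    have := mul_le_mul_of_nonneg_left s1 hr.le
    linarith
  calc _ = Λ ^ 7 * Real.sqrt (s - t) + d * (Λ ^ 5 * Real.sqrt (s - t)
        + 2 * Λ ^ 3 * (2 * speed c P Λ) * (Real.sqrt (s - t) * size V X Y ω)) := by ring
    _ ≤ Λ ^ 7 * localError u P α V t h X Y ω + d * (Λ ^ 5 * localError u P α V t h X Y ω
        + 2 * Λ ^ 3 * (2 * speed c P Λ) * localError u P α V t h X Y ω) := by gcongr
    _ = _ := by ring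

/-- The same cancellation holds under the integral in the measure direction. The price is the mean
of the weight, hence V^α √h, as the point z is frozen while the law moves. -/
theorem abs_second_order_m_le (H : IsEuler q m P c T α V t h X Y G) (h1 : H1 m₀ P T c u Λ α)
    (hs : s ∈ Ioo t (t + h)) (ω : Ω) (z : E d) :
    |(∫ ω, ⟪u.Um s z (P.map (path c P t X Y G s)) (path c P t X Y G s ω),
        c.diffusion P X ω (G ω)⟫ ∂P) * (1 / (2 * Real.sqrt (s - t))) -
      ∫ v, 1 / 2 * tr ((u.Uvm s z (P.map (path c P t X Y G s)) v).comp
        (c.a v (P.map (path c P t X Y G s)))) ∂(P.map (path c P t X Y G s))| ≤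
      ((Λ ^ 7 + d * Λ ^ 5) * (4 * (1 + speed c P Λ) ^ α) + d * (2 * Λ ^ 3 * speed c P Λ)) *
        localError u P α V t h X Y ω := by
  have hΛ := H.Λ_nonneg
  have hs' : s ∈ Icc t (t + h) := Ioo_subset_Icc_self hs
  have hr : 0 < Real.sqrt (s - t) := Real.sqrt_pos.2 (by linarith [hs.1])
  have hK := H.speed_nonneg (c := c) (P := P)
  have hV := H.one_le
  have := H1.abs_integral_Um_sub_le (B := fun ω => (s - t) • c.drift P X Y ω) H.h0 h1 H.one_le_α hΛ
    H.noise (H.t_mem hs') H.meas_X (H.meas_drift.const_smul (s - t)) H.bound_X2.1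
    ((H.bound_drift.exponent (two_le_ofReal_two_mul H.one_le_α)).1.const_smul (s - t)) hr
    (H.sqrt_le_one hs') (ζ := path c P t X Y G s) (fun ω => rfl) (H.bound_weight hs') z
  refine this.trans ?_
  have hrh : Real.sqrt (s - t) ≤ Real.sqrt h := sqrt_le hs'
  have i4 : Real.sqrt (s - t) * V ^ α ≤ localError u P α V t h X Y ω := by
    have j := (H.le_localError (u := u) ω).2
    have n2 : 0 ≤ lpNorm (defect u P t X Y) 2 P := lpNorm_nonneg
    have := mul_le_mul_of_nonneg_right hrh (Real.rpow_nonneg (zero_le_one.trans hV) α)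
    linarith
  have i5 : Real.sqrt (s - t) * V ≤ localError u P α V t h X Y ω :=
    (mul_le_mul_of_nonneg_left H.V_le_rpow hr.le).trans i4
  have i6 := (H.bound_path_sub2 hs').2
  have hKα : 0 ≤ (1 + speed c P Λ) ^ α := Real.rpow_nonneg (by linarith) _
  calc _ ≤ Λ ^ 7 * (4 * (1 + speed c P Λ) ^ α * V ^ α) * Real.sqrt (s - t)
        + d * (Λ ^ 5 * (4 * (1 + speed c P Λ) ^ α * V ^ α) * Real.sqrt (s - t) +
          2 * Λ ^ 3 * (Real.sqrt (s - t) * (speed c P Λ * V))) := by gcongr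
    _ = (Λ ^ 7 + d * Λ ^ 5) * (4 * (1 + speed c P Λ) ^ α) * (Real.sqrt (s - t) * V ^ α) +
        d * (2 * Λ ^ 3 * speed c P Λ) * (Real.sqrt (s - t) * V) := by ring
    _ ≤ (Λ ^ 7 + d * Λ ^ 5) * (4 * (1 + speed c P Λ) ^ α) * localError u P α V t h X Y ω +
        d * (2 * Λ ^ 3 * speed c P Λ) * localError u P α V t h X Y ω := by gcongr
    _ = _ := by ring

/-- Subtract the equation written at time s on each branch, with the law of the path. Drift, driver,
integral drift and integral trace differences are small branch by branch; the space trace is small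
only after averaging. -/
theorem abs_deriv_add_driver_le (H : IsEuler q m P c T α V t h X Y G) (h1 : H1 m₀ P T c u Λ α)
    (hs : s ∈ Ioo t (t + h)) (ω : Ω) :
    |(q.avg fun γ => (u.Ut s (branch c P t X Y ω γ s) (P.map (path c P t X Y G s))
        + ⟪u.Ux s (branch c P t X Y ω γ s) (P.map (path c P t X Y G s)),
            c.drift P X Y ω + (1 / (2 * Real.sqrt (s - t))) • c.diffusion P X ω γ⟫
        + (∫ ω', ⟪u.Um s (branch c P t X Y ω γ s) (P.map (path c P t X Y G s))
              (path c P t X Y G s ω'), c.drift P X Y ω'⟫ ∂P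
          + (∫ ω', ⟪u.Um s (branch c P t X Y ω γ s) (P.map (path c P t X Y G s))
              (path c P t X Y G s ω'), c.diffusion P X ω' (G ω')⟫ ∂P)
            * (1 / (2 * Real.sqrt (s - t)))))) + driver c u t (X ω) (P.map X)| ≤
      localConst c P Λ α * localError u P α V t h X Y ω := by
  have hs' : s ∈ Icc t (t + h) := Ioo_subset_Icc_self hs
  have hμ := isP2_map (H.memLp_path2 s)
  set ζ := path c P t X Y G s
  set r := Real.sqrt (s - t)
  set L := localError u P α V t h X Y ω
  set z := fun γ => branch c P t X Y ω γ s
  set B := c.drift P X Y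
  set S := c.diffusion P X
  set μ := P.map ζ
  -- the four terms which are estimated for each value of the noise
  let D1 : E d → ℝ := fun γ => ⟪u.Ux s (z γ) μ, B ω⟫ -
    ⟪c.b (z γ) (u.U s (z γ) μ) (u.graphLaw s μ), u.Ux s (z γ) μ⟫
  let D2 : E d → ℝ := fun γ => driver c u t (X ω) (P.map X) - driver c u s (z γ) μ
  let D3 : E d → ℝ := fun γ => (∫ ω', ⟪u.Um s (z γ) μ (ζ ω'), B ω'⟫ ∂P) -
    ∫ v, ⟪u.Um s (z γ) μ v, c.b v (u.U s v μ) (u.graphLaw s μ)⟫ ∂μ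
  let D4 : E d → ℝ := fun γ => (∫ ω', ⟪u.Um s (z γ) μ (ζ ω'), S ω' (G ω')⟫ ∂P) * (1 / (2 * r)) -
    ∫ v, 1 / 2 * tr ((u.Uvm s (z γ) μ v).comp (c.a v μ)) ∂μ
  -- An exact identity, obtained by inserting the equation at (s, z γ, μ) under the average.
  have e1 : (q.avg fun γ => (u.Ut s (z γ) μ + ⟪u.Ux s (z γ) μ, B ω + (1 / (2 * r)) • S ω γ⟫
        + (∫ ω', ⟪u.Um s (z γ) μ (ζ ω'), B ω'⟫ ∂P
          + (∫ ω', ⟪u.Um s (z γ) μ (ζ ω'), S ω' (G ω')⟫ ∂P) * (1 / (2 * r)))))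
        + driver c u t (X ω) (P.map X) =
      q.avg (fun γ => D1 γ + D2 γ + D3 γ + D4 γ) +
        (q.avg (fun γ => ⟪u.Ux s (z γ) μ, S ω γ⟫) / (2 * r) -
          q.avg (fun γ => 1 / 2 * tr ((u.Uxx s (z γ) μ).comp (c.a (z γ) μ)))) := by
    have e2 : q.avg (fun γ => ⟪u.Ux s (z γ) μ, S ω γ⟫) / (2 * r) =
        q.avg (fun γ => (1 / (2 * r)) * ⟪u.Ux s (z γ) μ, S ω γ⟫) := by
      rw [q.avg_mul]; ring
    conv_lhs => rw [← q.avg_const (driver c u t (X ω) (P.map X)), ← q.avg_add]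
    rw [e2, ← q.avg_sub, ← q.avg_add]
    congr 1
    funext γ
    have hp := h1.classical.pde s ⟨H.nonneg.trans hs'.1, hs.2.trans_le H.le_T⟩ (z γ) μ hμ
    rw [inner_add_right, inner_smul_right]
    simp only [D1, D2, D3, D4]
    have hdr : driver c u s (z γ) μ = c.f (z γ) (u.U s (z γ) μ)
      (ContinuousLinearMap.adjoint (c.σ (z γ) μ) (u.Ux s (z γ) μ)) (u.graphLaw s μ) := rfl
    rw [← hdr] at hp
    linarith
  rw [e1]
  have b1 : |q.avg (fun γ => D1 γ + D2 γ + D3 γ + D4 γ)| ≤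
      4 * Λ ^ 3 * (2 * speed c P Λ + 3) * L + 8 * Λ ^ 3 * (2 * speed c P Λ + 2) * L +
      4 * Λ ^ 3 * (2 * speed c P Λ + 3) * L +
      ((Λ ^ 7 + d * Λ ^ 5) * (4 * (1 + speed c P Λ) ^ α) + d * (2 * Λ ^ 3 * speed c P Λ)) * L := by
    rw [← Real.norm_eq_abs]
    refine q.norm_avg_le_of_forall fun γ hγ => ?_
    refine (norm_add_le _ _).trans (add_le_add ((norm_add_le _ _).trans (add_le_add
      ((norm_add_le _ _).trans (add_le_add ?_ ?_)) ?_)) ?_)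
    · exact H.abs_inner_drift_le h1 hs' ω hγ
    · exact H.abs_driver_sub_le h1 hs' ω hγ
    · exact H.abs_integral_drift_le h1 hs' ω (z γ)
    · exact H.abs_second_order_m_le h1 hs ω (z γ)
  have b2 := H.abs_second_order_x_le h1 hs ω
  refine (abs_add_le _ _).trans ((add_le_add b1 b2).trans (le_of_eq ?_))
  unfold localConst
  ring

end IsEuler
end MKV
end

/-! ### Consistency of the field with the backward scheme -/

noncomputable section

namespace MKV
namespace IsEuler

variable {Ω : Type*} {m₀ m mΩ : MeasurableSpace Ω} {P : Measure Ω} [IsProbabilityMeasure P] {d : ℕ}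
  {T Λ α : ℝ} {c : Coeffs d} {u : Field d}
  {q : Cubature d Λ} {V t h s s' : ℝ} {X : Ω → E d} {Y : Ω → ℝ} {G : Ω → E d}

theorem norm_curve_sub_le (A B C : E d) (t s s' : ℝ) :
    ‖(A + (s' - t) • B + Real.sqrt (s' - t) • C) - (A + (s - t) • B + Real.sqrt (s - t) • C)‖ ≤
      |s' - s| * ‖B‖ + |Real.sqrt (s' - t) - Real.sqrt (s - t)| * ‖C‖ := by
  have : (A + (s' - t) • B + Real.sqrt (s' - t) • C) - (A + (s - t) • B + Real.sqrt (s - t) • C) =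
      (s' - s) • B + (Real.sqrt (s' - t) - Real.sqrt (s - t)) • C := by module
  rw [this]
  refine (norm_add_le _ _).trans (le_of_eq ?_)
  rw [norm_smul, norm_smul, Real.norm_eq_abs, Real.norm_eq_abs]

/-- The mean value theorem needs continuity up to the endpoints, where differentiability fails or is
not assumed. The Lipschitz and Hölder bounds provide a modulus of continuity. -/
theorem continuousOn_U_branch (H : IsEuler q m P c T α V t h X Y G) (h1 : H1 m₀ P T c u Λ α)
    (ω : Ω) {γ : E d} (hγ : γ ∈ q.S) :
    ContinuousOn (fun s => u.U s (branch c P t X Y ω γ s) (P.map (path c P t X Y G s)))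
      (Icc t (t + h)) := by
  have hΛ := H.Λ_nonneg
  set bb := lpNorm (c.drift P X Y) 2 P
  set cc := lpNorm (fun ω => c.diffusion P X ω (G ω)) 2 P
  have hB2 : LpBound 2 P (c.drift P X Y) bb :=
    LpBound.of_memLp (H.bound_drift.exponent (two_le_ofReal_two_mul H.one_le_α)).1
  have hC2 : LpBound 2 P (fun ω => c.diffusion P X ω (G ω)) cc :=
    LpBound.of_memLp (H.bound_noise.exponent (two_le_ofReal_two_mul H.one_le_α)).1
  set M := 1 + (‖X ω‖ + speed c P Λ * size V X Y ω) + (V + speed c P Λ * V)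
  -- The modulus is symmetric in the two times; the Hölder estimate is one-sided in time and is used
  -- from the smaller one to the larger one.
  let ψ : ℝ → ℝ → ℝ := fun s s' => Λ *
    ((|s' - s| * ‖c.drift P X Y ω‖ + |Real.sqrt (s' - t) - Real.sqrt (s - t)| * ‖c.diffusion P X ω γ‖) +
     (|s' - s| * bb + |Real.sqrt (s' - t) - Real.sqrt (s - t)| * cc) + Real.sqrt |s' - s| * M)
  set φ := fun s => u.U s (branch c P t X Y ω γ s) (P.map (path c P t X Y G s)) with hφ
  have hK := H.speed_nonneg (c := c) (P := P)
  have key : ∀ s ∈ Icc t (t + h), ∀ s' ∈ Icc t (t + h), s ≤ s' → |φ s' - φ s| ≤ ψ s s' := by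
    intro s hs s' hs' hss
    refine (h1.abs_U_sub_U_le hΛ (H.t_mem hs).1 hss (H.t_mem hs').2 (H.memLp_path2 s)
      (H.memLp_path2 s') _ _).trans ?_
    refine mul_le_mul_of_nonneg_left (add_le_add (add_le_add ?_ ?_) ?_) hΛ
    · exact norm_curve_sub_le _ _ _ _ _ _
    · have hd := (hB2.norm.const_mul (abs_nonneg (s' - s))).add (by norm_num)
        (hC2.norm.const_mul (abs_nonneg (Real.sqrt (s' - t) - Real.sqrt (s - t))))
      exact (hd.of_le ((H.memLp_path2 s').sub (H.memLp_path2 s)).1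
        (.of_forall fun ω' => norm_curve_sub_le _ _ _ _ _ _)).2
    · rw [abs_of_nonneg (by linarith : 0 ≤ s' - s)]
      refine mul_le_mul_of_nonneg_left (add_le_add (add_le_add le_rfl ?_) ?_) (Real.sqrt_nonneg _)
      · have i1 := H.norm_branch_sub_le hs ω hγ
        have i2 := mul_le_mul_of_nonneg_right (H.sqrt_le_one hs)
          (mul_nonneg hK (zero_le_one.trans (H.le_size ω).1))
        have i3 := norm_le_norm_add_norm_sub' (branch c P t X Y ω γ s) (X ω)
        linarith
      · have i1 := (H.bound_X2.add (by norm_num) (H.bound_path_sub2 hs)).2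
        simp only [add_sub_cancel] at i1
        have i2 := mul_le_mul_of_nonneg_right (H.sqrt_le_one hs)
          (mul_nonneg hK (zero_le_one.trans H.one_le))
        linarith
  have key2 : ∀ s ∈ Icc t (t + h), ∀ s' ∈ Icc t (t + h), |φ s' - φ s| ≤ ψ s s' := by
    intro s hs s' hs'
    rcases le_total s s' with h' | h'
    · exact key s hs s' hs' h'
    · have := key s' hs' s hs h'
      simp only [ψ] at this ⊢
      rwa [abs_sub_comm, abs_sub_comm s' s, abs_sub_comm (Real.sqrt (s' - t))]
  intro s hs
  have hψ : Filter.Tendsto (ψ s) (𝓝[Icc t (t + h)] s) (𝓝 0) := by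
    have hc : Continuous (ψ s) := by
      simp only [ψ]
      fun_prop
    have h0 : ψ s s = 0 := by simp [ψ]
    rw [← h0]
    exact hc.continuousWithinAt
  rw [ContinuousWithinAt, tendsto_iff_norm_sub_tendsto_zero]
  refine squeeze_zero' (.of_forall fun _ => norm_nonneg _) ?_ hψ
  filter_upwards [self_mem_nhdsWithin] with s' hs'
  exact key2 s hs s' hs'

/-- The first consistency estimate. -/
theorem abs_avg_U_sub_le (H : IsEuler q m P c T α V t h X Y G) (h1 : H1 m₀ P T c u Λ α)
    (hm : m₀ ≤ mΩ) (hat : Atomless m₀ P) (ω : Ω) :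
    |(q.avg fun γ => u.U (t + h) (branch c P t X Y ω γ (t + h))
        (P.map (path c P t X Y G (t + h)))) - u.U t (X ω) (P.map X)
        + h * driver c u t (X ω) (P.map X)| ≤
      h * (localConst c P Λ α * localError u P α V t h X Y ω) := by
  set φ := fun s' => q.avg fun γ =>
        u.U s' (branch c P t X Y ω γ s') (P.map (path c P t X Y G s')) with hφ
  have hc : ContinuousOn φ (Icc t (t + h)) := by
    simp only [hφ, Cubature.avg]
    exact continuousOn_finsetSum _ fun γ hγ =>
      (H.continuousOn_U_branch h1 ω hγ).const_smul (q.w γ)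
  -- The increment over the step equals h times the derivative at an intermediate time, so the
  -- pointwise bound on the open interval suffices and the singular derivative is never integrated.
  obtain ⟨s, hs, hs'⟩ := exists_hasDerivAt_eq_slope φ _ (by linarith [H.pos] : t < t + h) hc
    fun s hs => H.hasDerivAt_avg_U h1 hm hat hs ω
  have hφt : φ t = u.U t (X ω) (P.map X) := by
    have e1 : ∀ γ, branch c P t X Y ω γ t = X ω := fun γ => by simp [branch]
    have e2 : path c P t X Y G t = X := by ext1 ω'; simp [path, curve]
    simp only [hφ, e1, e2, q.avg_const]
  have key := H.abs_deriv_add_driver_le h1 hs ω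
  rw [hs'] at key
  change |φ (t + h) - _ + _| ≤ _
  rw [← hφt]
  have hh := H.pos
  have e3 : φ (t + h) - φ t + h * driver c u t (X ω) (P.map X) =
      h * ((φ (t + h) - φ t) / (t + h - t) + driver c u t (X ω) (P.map X)) := by
    rw [add_sub_cancel_left]
    field_simp
  rw [e3, abs_mul, abs_of_pos hh]
  gcongr

/-- With v = ∂ₓ𝒰 and s = σ, the covariance of the field with the noise yields σ†∂ₓ𝒰, the argument of
f in the equation. -/
theorem avg_inner_smul_clm (q : Cubature d Λ) (v : E d) (s : E d →L[ℝ] E d) :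
    q.avg (fun γ => ⟪v, s γ⟫ • γ) = ContinuousLinearMap.adjoint s v := by
  simp_rw [← ContinuousLinearMap.adjoint_inner_left]
  exact q.avg_inner_smul _

theorem abs_taylor_le (h1 : H1 m₀ P T c u Λ α) (hΛ : 0 ≤ Λ) (hs : s ∈ Icc 0 T)
    {ζ : Ω → E d} (hζ : MemLp ζ 2 P) (y v : E d) :
    |u.U s (y + v) (P.map ζ) - u.U s y (P.map ζ) - ⟪u.Ux s y (P.map ζ), v⟫| ≤ Λ * ‖v‖ ^ 2 := by
  have hμ := isP2_map hζ
  have key := (convex_closedBall y ‖v‖).norm_image_sub_le_of_norm_hasFDerivWithin_le'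
    (f := fun y => u.U s y (P.map ζ))
    (f' := fun y => InnerProductSpace.toDual ℝ (E d) (u.Ux s y (P.map ζ)))
    (φ := InnerProductSpace.toDual ℝ (E d) (u.Ux s y (P.map ζ))) (C := Λ * ‖v‖)
    (fun z _ => (h1.classical.hasDeriv_x s hs z _ hμ).hasFDerivAt.hasFDerivWithinAt)
    (fun z hz => by
      rw [← map_sub, LinearIsometryEquiv.norm_map]
      refine (h1.norm_Ux_sub_le hΛ hs z y hμ hμ).trans ?_
      rw [W2_map_self hζ, add_zero]
      rw [Metric.mem_closedBall, dist_eq_norm] at hz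
      gcongr)
    (Metric.mem_closedBall_self (norm_nonneg v))
    (show y + v ∈ _ by rw [Metric.mem_closedBall, dist_eq_norm, add_sub_cancel_left])
  rw [add_sub_cancel_left, InnerProductSpace.toDual_apply_apply] at key
  rw [sq, ← mul_assoc]
  exact key

/-- The constant of the second consistency estimate. -/
def gradConst (c : Coeffs d) {mΩ : MeasurableSpace Ω} (P : Measure Ω) (Λ : ℝ) : ℝ :=
  Λ ^ 6 + Λ ^ 2 * (2 * speed c P Λ + 2)

theorem gradConst_nonneg (H : IsEuler q m P c T α V t h X Y G) : 0 ≤ gradConst c P Λ := by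
  have hΛ := H.Λ_nonneg
  have hK := H.speed_nonneg
  unfold gradConst
  positivity

theorem localConst_nonneg (H : IsEuler q m P c T α V t h X Y G) : 0 ≤ localConst c P Λ α := by
  have hΛ := H.Λ_nonneg
  have hK := H.speed_nonneg
  unfold localConst
  positivity

/-- The second consistency estimate. -/
theorem norm_avg_U_smul_sub_le (H : IsEuler q m P c T α V t h X Y G) (h1 : H1 m₀ P T c u Λ α)
    (ω : Ω) :
    ‖(Real.sqrt h)⁻¹ • (q.avg fun γ => u.U (t + h) (branch c P t X Y ω γ (t + h))
        (P.map (path c P t X Y G (t + h))) • γ) -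
      ContinuousLinearMap.adjoint (c.σ (X ω) (P.map X)) (u.Ux t (X ω) (P.map X))‖ ≤
      gradConst c P Λ * (Real.sqrt h * size V X Y ω) := by
  have hΛ := H.Λ_nonneg
  have hs : t + h ∈ Icc t (t + h) := right_mem_Icc.2 (by linarith [H.pos])
  have hζ := H.memLp_path2 (t + h)
  have hr : 0 < Real.sqrt h := Real.sqrt_pos.2 H.pos
  have hK := H.speed_nonneg (c := c) (P := P)
  have hsz := (H.le_size ω).1
  set ζ := path c P t X Y G (t + h)
  set r := Real.sqrt h
  set S := c.diffusion P X ω with hS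
  set y := X ω + h • c.drift P X Y ω
  have hbr : ∀ γ, branch c P t X Y ω γ (t + h) = y + r • S γ := fun γ => by
    simp [branch, y, r, S]
  simp only [hbr]
  -- The value at the center is killed by centering, the linear part gives r σ†∂ₓ𝒰 by the
  -- covariance, and the Taylor remainder is O(r²); division by r = √h leaves O(√h).
  have e1 : q.avg (fun γ => u.U (t + h) (y + r • S γ) (P.map ζ) • γ) =
      q.avg (fun γ => (u.U (t + h) (y + r • S γ) (P.map ζ) - u.U (t + h) y (P.map ζ) -
        ⟪u.Ux (t + h) y (P.map ζ), r • S γ⟫) • γ) +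
      r • ContinuousLinearMap.adjoint S (u.Ux (t + h) y (P.map ζ)) := by
    have e0 : q.avg (fun γ => u.U (t + h) y (P.map ζ) • γ) = 0 := by
      rw [q.avg_smul, q.avg_id, smul_zero]
    rw [← avg_inner_smul_clm q, ← q.avg_smul, ← q.avg_add]
    rw [← sub_eq_zero, ← q.avg_sub, ← e0]
    congr 1
    funext γ
    rw [inner_smul_right]
    module
  have e2 : ‖q.avg (fun γ => (u.U (t + h) (y + r • S γ) (P.map ζ) - u.U (t + h) y (P.map ζ) -
        ⟪u.Ux (t + h) y (P.map ζ), r • S γ⟫) • γ)‖ ≤ Λ ^ 6 * r ^ 2 := by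
    refine q.norm_avg_le_of_forall fun γ hγ => ?_
    rw [norm_smul, Real.norm_eq_abs]
    have i1 := abs_taylor_le h1 hΛ (H.t_mem hs) hζ y (r • S γ)
    have i2 : ‖r • S γ‖ ≤ r * Λ ^ 2 := by
      rw [norm_smul, Real.norm_of_nonneg hr.le]
      gcongr
      exact H.norm_diffusion_apply_le ω hγ
    calc _ ≤ (Λ * (r * Λ ^ 2) ^ 2) * Λ := by
          refine mul_le_mul (i1.trans ?_) (q.bdd γ hγ) (norm_nonneg _) (by positivity)
          gcongr
      _ = _ := by ring
  have e3 : ‖ContinuousLinearMap.adjoint S (u.Ux (t + h) y (P.map ζ)) -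
      ContinuousLinearMap.adjoint S (u.Ux t (X ω) (P.map X))‖ ≤
      Λ ^ 2 * (2 * speed c P Λ + 2) * (r * size V X Y ω) := by
    rw [← map_sub]
    refine (norm_adjoint_apply_le _ _).trans ?_
    have i1 := h1.norm_Ux_sub_Ux_le hΛ H.nonneg hs.1 H.le_T H.bound_X2.1 hζ (X ω) y
    have hth : t + h - t = h := by ring
    rw [hth] at i1
    have i2 : ‖y - X ω‖ ≤ r * (speed c P Λ * size V X Y ω) := by
      rw [add_sub_cancel_left, norm_smul, Real.norm_of_nonneg H.pos.le]
      have hr1 : r ≤ 1 := Real.sqrt_le_one.2 H.le_one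
      have j1 : h = r * r := (Real.mul_self_sqrt H.pos.le).symm
      have j2 : h ≤ r := by nlinarith
      refine mul_le_mul j2 ((H.norm_drift_le ω).trans ?_) (norm_nonneg _) hr.le
      have hb := Coeffs.bGrowth_nonneg (c := c) (P := P) H.Λ_nonneg
      unfold speed
      gcongr
      nlinarith [sq_nonneg Λ]
    have i3 := (H.bound_path_sub2 hs).2
    rw [hth] at i3
    obtain ⟨s1, s2, s3⟩ := H.le_size ω
    have i4 := mul_le_mul_of_nonneg_left (mul_le_mul_of_nonneg_left s2 hK) hr.le
    have i5 : 1 + ‖X ω‖ + lpNorm X 2 P ≤ 2 * size V X Y ω := by linarith [H.bound_X2.2]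
    have i6 := mul_le_mul_of_nonneg_left i5 hr.le
    have i7 : ‖u.Ux (t + h) y (P.map ζ) - u.Ux t (X ω) (P.map X)‖ ≤
        Λ * ((2 * speed c P Λ + 2) * (r * size V X Y ω)) := by
      refine i1.trans (mul_le_mul_of_nonneg_left ?_ hΛ)
      change ‖y - X ω‖ + lpNorm (fun ω => path c P t X Y G (t + h) ω - X ω) 2 P +
        r * (1 + ‖X ω‖ + lpNorm X 2 P) ≤ _
      linarith
    calc _ ≤ Λ * (Λ * ((2 * speed c P Λ + 2) * (r * size V X Y ω))) :=
          mul_le_mul (H.norm_diffusion_le ω) i7 (norm_nonneg _) hΛ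
      _ = _ := by ring
  rw [e1, smul_add, smul_smul, inv_mul_cancel₀ hr.ne', one_smul, add_sub_assoc]
  refine (norm_add_le _ _).trans ?_
  rw [norm_smul, norm_inv, Real.norm_of_nonneg hr.le]
  have e4 : r⁻¹ * ‖q.avg (fun γ => (u.U (t + h) (y + r • S γ) (P.map ζ) - u.U (t + h) y (P.map ζ) -
        ⟪u.Ux (t + h) y (P.map ζ), r • S γ⟫) • γ)‖ ≤ Λ ^ 6 * (r * size V X Y ω) := by
    calc _ ≤ r⁻¹ * (Λ ^ 6 * r ^ 2) := by gcongr
      _ = Λ ^ 6 * (r * 1) := by field_simp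
      _ ≤ _ := by gcongr
  unfold gradConst
  rw [add_mul]
  exact add_le_add e4 e3

/-- The constant of the consistency estimate in `L^{2α}`. -/
def consistencyConst (c : Coeffs d) {mΩ : MeasurableSpace Ω} (P : Measure Ω) (Λ α : ℝ) : ℝ :=
  4 * localConst c P Λ α + 3 * (Λ * gradConst c P Λ)

theorem meas_branch (H : IsEuler q m P c T α V t h X Y G) (s : ℝ) (γ : E d) :
    StronglyMeasurable[m] fun ω => branch c P t X Y ω γ s :=
  (H.meas_X.add (H.meas_drift.const_smul (s - t))).add
    ((H.meas_diffusion_apply γ).const_smul (Real.sqrt (s - t)))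

theorem meas_U_branch (H : IsEuler q m P c T α V t h X Y G) (h1 : H1 m₀ P T c u Λ α) (γ : E d) :
    StronglyMeasurable[m] fun ω =>
      u.U (t + h) (branch c P t X Y ω γ (t + h)) (P.map (path c P t X Y G (t + h))) :=
  (h1.classical.continuous_U (H.t_mem (right_mem_Icc.2 (by linarith [H.pos])))
    (isP2_map (H.memLp_path2 (t + h)))).comp_stronglyMeasurable (H.meas_branch (t + h) γ)

theorem integrable_U_branch (H : IsEuler q m P c T α V t h X Y G) (h1 : H1 m₀ P T c u Λ α)
    {γ : E d} (hγ : γ ∈ q.S) : Integrable (fun ω =>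
      u.U (t + h) (branch c P t X Y ω γ (t + h)) (P.map (path c P t X Y G (t + h)))) P := by
  have hΛ := H.Λ_nonneg
  have hs : t + h ∈ Icc t (t + h) := right_mem_Icc.2 (by linarith [H.pos])
  have hζ := H.memLp_path2 (t + h)
  have hC : MemLp (fun ω => c.diffusion P X ω γ) 2 P :=
    MemLp.of_bound ((H.meas_diffusion_apply γ).mono H.noise.le).aestronglyMeasurable _
      (.of_forall fun ω => H.norm_diffusion_apply_le ω hγ)
  have hbL : MemLp (fun ω => branch c P t X Y ω γ (t + h)) 2 P :=
    (H.bound_X2.1.add ((H.bound_drift.exponent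
      (two_le_ofReal_two_mul H.one_le_α)).1.const_smul (t + h - t))).add
      (hC.const_smul (Real.sqrt (t + h - t)))
  exact (h1.memLp_U hΛ (H.t_mem hs) (isP2_map hζ) (W2_map_self hζ) hbL).integrable (by norm_num)

theorem U_congr {X' : Ω → E d} (hX' : X' =ᵐ[P] path c P t X Y G (t + h)) :
    (fun ω => u.U (t + h) (X' ω) (P.map X')) =ᵐ[P] fun ω =>
      u.U (t + h) (branch c P t X Y ω (G ω) (t + h)) (P.map (path c P t X Y G (t + h))) := by
  rw [Measure.map_congr hX']
  filter_upwards [hX'] with ω hω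
  rw [hω]
  rfl

/-- Conditioning removes the noise by averaging over branches, with the law frozen: the measure
argument is deterministic. Together with `condExp_U_smul`, this puts the backward scheme in the form
of the two consistency estimates. -/
theorem condExp_U (H : IsEuler q m P c T α V t h X Y G) (h1 : H1 m₀ P T c u Λ α)
    {X' : Ω → E d} (hX' : X' =ᵐ[P] path c P t X Y G (t + h)) :
    P[fun ω => u.U (t + h) (X' ω) (P.map X') | m] =ᵐ[P] fun ω => q.avg fun γ =>
      u.U (t + h) (branch c P t X Y ω γ (t + h)) (P.map (path c P t X Y G (t + h))) :=
  (condExp_congr_ae (U_congr hX')).trans (H.noise.condExp_comp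
    (F := fun ω γ => u.U (t + h) (branch c P t X Y ω γ (t + h)) (P.map (path c P t X Y G (t + h))))
    (fun γ _ => H.meas_U_branch h1 γ) (fun _ hγ => H.integrable_U_branch h1 hγ))

theorem condExp_U_smul (H : IsEuler q m P c T α V t h X Y G) (h1 : H1 m₀ P T c u Λ α)
    {X' : Ω → E d} (hX' : X' =ᵐ[P] path c P t X Y G (t + h)) :
    P[fun ω => h⁻¹ • u.U (t + h) (X' ω) (P.map X') • (Real.sqrt h • G ω) | m] =ᵐ[P]
      fun ω => (Real.sqrt h)⁻¹ • q.avg fun γ =>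
      u.U (t + h) (branch c P t X Y ω γ (t + h)) (P.map (path c P t X Y G (t + h))) • γ := by
  have hh := H.pos
  have i1 : (fun ω => h⁻¹ • u.U (t + h) (X' ω) (P.map X') • (Real.sqrt h • G ω)) =ᵐ[P]
      (Real.sqrt h)⁻¹ • fun ω => u.U (t + h) (branch c P t X Y ω (G ω) (t + h))
        (P.map (path c P t X Y G (t + h))) • G ω := by
    filter_upwards [U_congr (u := u) hX'] with ω hω
    rw [hω, Pi.smul_apply, smul_comm _ (Real.sqrt h), smul_smul]
    congr 1
    have := Real.mul_self_sqrt hh.le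
    have := (Real.sqrt_pos.2 hh).ne'
    field_simp
    linarith
  refine (condExp_congr_ae i1).trans ((condExp_smul _ _ _).trans ?_)
  filter_upwards [H.noise.condExp_comp (F := fun ω γ => u.U (t + h)
    (branch c P t X Y ω γ (t + h)) (P.map (path c P t X Y G (t + h))) • γ)
    (fun γ hγ => (H.meas_U_branch h1 γ).smul_const γ)
    (fun γ hγ => (H.integrable_U_branch h1 hγ).smul_const γ)] with ω hω
  rw [Pi.smul_apply, hω]

/-- The decoupling field along the Euler scheme almost solves the backward scheme. -/
theorem bound_consistency (H : IsEuler q m P c T α V t h X Y G) (h1 : H1 m₀ P T c u Λ α)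
    (hm : m₀ ≤ mΩ) (hat : Atomless m₀ P) {X' : Ω → E d} (hX' : X' =ᵐ[P] path c P t X Y G (t + h))
    {Z : Ω → E d} (hZ : Z =ᵐ[P] P[fun ω => h⁻¹ • u.U (t + h) (X' ω) (P.map X') •
      (Real.sqrt h • G ω) | m]) {a : ℝ}
    (ha : LpBound (ENNReal.ofReal (2 * α)) P (defect u P t X Y) a) :
    LpBound (ENNReal.ofReal (2 * α)) P (fun ω =>
      (P[fun ω => u.U (t + h) (X' ω) (P.map X') | m]) ω + h * c.f (X ω) (u.U t (X ω) (P.map X)) (Z ω)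
        (jointLaw P X fun ω => u.U t (X ω) (P.map X)) - u.U t (X ω) (P.map X))
      (h * (consistencyConst c P Λ α * (a + Real.sqrt h * V ^ α))) := by
  have hΛ := H.Λ_nonneg
  have hh := H.pos
  have hr : 0 < Real.sqrt h := Real.sqrt_pos.2 H.pos
  have hV := H.one_le
  have hVα := H.V_le_rpow
  have hs : t + h ∈ Icc t (t + h) := right_mem_Icc.2 (by linarith [H.pos])
  have hs0 : t ∈ Icc t (t + h) := left_mem_Icc.2 (by linarith [H.pos])
  have hζ := H.memLp_path2 (t + h)
  have hE := H.condExp_U h1 hX'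
  have hZ' := hZ.trans (H.condExp_U_smul h1 hX')
  have hgr : u.graphLaw t (P.map X) = jointLaw P X fun ω => u.U t (X ω) (P.map X) :=
    graphLaw_map u t H.bound_X2.1.1.aemeasurable
      (h1.classical.continuous_U (H.t_mem hs0) (isP2_map H.bound_X2.1))
  have hUX : MemLp (fun ω => u.U t (X ω) (P.map X)) 2 P :=
    h1.memLp_U hΛ (H.t_mem hs0) (isP2_map H.bound_X2.1) (W2_map_self H.bound_X2.1) H.bound_X2.1
  have hgr2 := isP2_jointLaw H.bound_X2.1 hUX
  have hgc := H.gradConst_nonneg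
  have hlc := H.localConst_nonneg
  have hp0 : ENNReal.ofReal (2 * α) ≠ 0 := (zero_lt_one.trans_le H.one_le_p).ne'
  have ha2 := (ha.exponent (two_le_ofReal_two_mul H.one_le_α)).2
  -- The defect counts twice, once pointwise and once through its L² norm; the random size
  -- contributes 3V ≤ 3V^α and the deterministic weight V^α.
  have hloc : LpBound (ENNReal.ofReal (2 * α)) P (localError u P α V t h X Y)
      (2 * a + 4 * (Real.sqrt h * V ^ α)) := by
    have j2 : LpBound (ENNReal.ofReal (2 * α)) P (fun _ : Ω => lpNorm (defect u P t X Y) 2 P)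
        (lpNorm (defect u P t X Y) 2 P) := LpBound.const hp0 lpNorm_nonneg
    have j3 : LpBound (ENNReal.ofReal (2 * α)) P (fun _ : Ω => V ^ α) (V ^ α) :=
      LpBound.const hp0 (by positivity)
    refine ((ha.abs.add H.one_le_p j2).add H.one_le_p
      ((H.bound_size.add H.one_le_p j3).const_mul hr.le)).mono ?_
    nlinarith
  have hdom := (hloc.const_mul (by positivity : 0 ≤ h * localConst c P Λ α)).add H.one_le_p
    (H.bound_size.const_mul (by positivity : 0 ≤ h * (Λ * gradConst c P Λ) * Real.sqrt h))
  refine (hdom.of_le ?_ ?_).mono ?_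
  · refine (integrable_condExp.1.add (AEStronglyMeasurable.const_mul ?_ h)).sub hUX.1
    have hfc := H.h0.continuous_f hΛ hgr2 (W2_jointLaw_self H.bound_X2.1 hUX)
    have hZm : AEStronglyMeasurable Z P := integrable_condExp.1.congr hZ.symm
    exact hfc.comp_aestronglyMeasurable (H.bound_X2.1.1.prodMk (hUX.1.prodMk hZm))
  · filter_upwards [hE, hZ'] with ω hω hω'
    have k1 := H.abs_avg_U_sub_le h1 hm hat ω
    have k2 := H.norm_avg_U_smul_sub_le h1 ω
    rw [← hω] at k1
    rw [← hω'] at k2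
    have k3 := H.h0.f_lip (X ω) (X ω) (u.U t (X ω) (P.map X)) (u.U t (X ω) (P.map X)) (Z ω)
      (ContinuousLinearMap.adjoint (c.σ (X ω) (P.map X)) (u.Ux t (X ω) (P.map X))) _ _ hgr2 hgr2
    rw [sub_self, norm_zero, sub_self, abs_zero, W2_jointLaw_self H.bound_X2.1 hUX] at k3
    have k4 : driver c u t (X ω) (P.map X) = c.f (X ω) (u.U t (X ω) (P.map X))
      (ContinuousLinearMap.adjoint (c.σ (X ω) (P.map X)) (u.Ux t (X ω) (P.map X)))
      (jointLaw P X fun ω => u.U t (X ω) (P.map X)) := by rw [← hgr]; rfl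
    rw [← k4] at k3
    set A := P[fun ω => u.U (t + h) (X' ω) (P.map X') | m] ω
    set f1 := c.f (X ω) (u.U t (X ω) (P.map X)) (Z ω) (jointLaw P X fun ω => u.U t (X ω) (P.map X))
    set f0 := driver c u t (X ω) (P.map X)
    -- The driver is first taken at the exact gradient and then corrected to the discrete Z, the
    -- correction being Lipschitz in Z.
    have k5 : A + h * f1 - u.U t (X ω) (P.map X) =
        (A - u.U t (X ω) (P.map X) + h * f0) + h * (f1 - f0) := by ring
    rw [k5]
    refine (norm_add_le _ _).trans (add_le_add ?_ ?_)
    · rw [mul_assoc]; exact k1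
    · rw [norm_mul, Real.norm_of_nonneg hh.le]
      calc _ ≤ h * (Λ * (gradConst c P Λ * (Real.sqrt h * size V X Y ω))) := by
            refine mul_le_mul_of_nonneg_left (k3.trans ?_) hh.le
            simp only [zero_add, add_zero]
            gcongr
        _ = _ := by ring
  · unfold consistencyConst
    have n1 : 0 ≤ a := ha.nonneg
    have n2 : Real.sqrt h * V ≤ Real.sqrt h * V ^ α := by gcongr
    have n3 : h * (Λ * gradConst c P Λ) * (Real.sqrt h * V) ≤
        h * (Λ * gradConst c P Λ) * (Real.sqrt h * V ^ α) := by gcongr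
    have n4 : 0 ≤ h * localConst c P Λ α * a := by positivity
    have n5 : 0 ≤ h * (Λ * gradConst c P Λ) * a := by positivity
    nlinarith

end IsEuler
end MKV
end

/-! ### One-step stability of the forward and backward schemes -/

noncomputable section

namespace MKV

section OneStep

variable {Ω : Type*} {m mΩ : MeasurableSpace Ω} {P : Measure Ω} [IsProbabilityMeasure P] {d : ℕ}
  {Λ α : ℝ} {c : Coeffs d} {q : Cubature d Λ} {h : ℝ} {G : Ω → E d}

/-- The constant of the stability of the backward scheme. -/
def backConst (Λ : ℝ) : ℝ := 4 * Λ + 2 * Λ ^ 2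

/-- One step of the stability estimate of the backward scheme. -/
theorem IsNoise.lpBound_of_abs_le (hG : IsNoise q m P G) (hα : 1 ≤ α) (hΛ : 0 ≤ Λ) (hh : 0 < h)
    (hhΛ : h * Λ ≤ 1 / 4) {e e' R : Ω → ℝ} {a κ : ℝ} (he : MemLp e 2 P)
    (he' : LpBound (ENNReal.ofReal (2 * α)) P e' a)
    (hR : LpBound (ENNReal.ofReal (2 * α)) P R (h * κ))
    (hle : ∀ᵐ ω ∂P, |e ω| ≤ |(P[e' | m]) ω| + h * (Λ * (|e ω| + lpNorm e 2 P
      + ‖(Real.sqrt h)⁻¹ • (P[fun ω => e' ω • G ω | m]) ω‖)) + R ω) :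
    LpBound (ENNReal.ofReal (2 * α)) P e ((1 + backConst Λ * h) * a + 2 * (h * κ)) := by
  have hp1 := one_le_ofReal_two_mul hα
  have hp0 : ENNReal.ofReal (2 * α) ≠ 0 := (zero_lt_one.trans_le hp1).ne'
  have hr : 0 < Real.sqrt h := Real.sqrt_pos.2 hh
  have hrr := Real.mul_self_sqrt hh.le
  -- The weight h Λ h^{-1/2} = √h Λ of the covariance enters the Bessel estimate through its square
  -- hΛ²: this is why the singular factor in Z costs only O(h).
  set M := fun ω => |(P[e' | m]) ω| + (Real.sqrt h * Λ) * ‖(P[fun ω => e' ω • G ω | m]) ω‖ with hM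
  have hMb : LpBound (ENNReal.ofReal (2 * α)) P M ((1 + (Real.sqrt h * Λ) ^ 2) * a) := by
    refine ⟨?_, (hG.lpNorm_condExp_add_le hα he'.1 _).trans
      (mul_le_mul_of_nonneg_left he'.2 (by positivity))⟩
    exact (he'.condExp hp1).abs.1.add
      (((LpBound.of_memLp (hG.memLp_smul he'.1)).condExp hp1).norm.1.const_mul (Real.sqrt h * Λ))
  have hle2 : ∀ᵐ ω ∂P, (1 - h * Λ) * |e ω| ≤ M ω + h * Λ * lpNorm e 2 P + R ω := by
    filter_upwards [hle] with ω hω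
    rw [norm_smul, norm_inv, Real.norm_of_nonneg hr.le] at hω
    have : h * (Λ * ((Real.sqrt h)⁻¹ * ‖(P[fun ω => e' ω • G ω | m]) ω‖)) =
        Real.sqrt h * Λ * ‖(P[fun ω => e' ω • G ω | m]) ω‖ := by
      nth_rewrite 1 [← hrr]
      field_simp
    simp only [hM]
    linarith
  have n0 : 0 ≤ lpNorm e 2 P := lpNorm_nonneg
  have hc : LpBound (ENNReal.ofReal (2 * α)) P (fun _ : Ω => h * Λ * lpNorm e 2 P)
      (h * Λ * lpNorm e 2 P) := LpBound.const hp0 (by positivity)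
  have hdom := (hMb.add hp1 hc).add hp1 hR
  have h34 : 0 < 1 - h * Λ := by linarith
  have hb1 := (hdom.const_mul (inv_nonneg.2 h34.le)).of_le he.1 (by
    filter_upwards [hle2] with ω hω
    rw [inv_mul_eq_div, le_div_iff₀ h34, Real.norm_eq_abs]
    linarith)
  refine ⟨hb1.1, ?_⟩
  have i1 : lpNorm e 2 P ≤ lpNorm e (ENNReal.ofReal (2 * α)) P :=
    lpNorm_le_lpNorm_of_le (two_le_ofReal_two_mul hα) hb1.1
  have i2 := hb1.2
  set x := lpNorm e (ENNReal.ofReal (2 * α)) P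
  rw [inv_mul_eq_div, le_div_iff₀ h34] at i2
  have i3 : (Real.sqrt h * Λ) ^ 2 = h * Λ ^ 2 := by rw [mul_pow, Real.sq_sqrt hh.le]
  rw [i3] at i2
  have n1 : 0 ≤ h * κ := hR.nonneg
  have n2 : 0 ≤ a := he'.nonneg
  have i4 : h * Λ * lpNorm e 2 P ≤ h * Λ * x := by gcongr
  -- The implicit dependence is absorbed: e occurs pointwise and through its L² norm, hence 2hΛ. The
  -- condition hΛ ≤ 1/4 is exactly what makes 1 + 4hΛ an upper bound of the inverse of 1 - 2hΛ.
  have i5 : x * (1 - 2 * (h * Λ)) ≤ (1 + h * Λ ^ 2) * a + h * κ := by linarith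
  have i6 : 0 ≤ (1 + 4 * (h * Λ)) * (1 - 2 * (h * Λ)) - 1 := by
    nlinarith [mul_nonneg hh.le hΛ]
  have n3 : 0 ≤ x := lpNorm_nonneg
  have i7 : x ≤ (1 + 4 * (h * Λ)) * ((1 + h * Λ ^ 2) * a + h * κ) := by
    have := mul_le_mul_of_nonneg_left i5 (by positivity : 0 ≤ 1 + 4 * (h * Λ))
    nlinarith [mul_nonneg i6 n3]
  refine i7.trans ?_
  have i8 : (1 + 4 * (h * Λ)) * (h * κ) ≤ 2 * (h * κ) := by
    have : 1 + 4 * (h * Λ) ≤ 2 := by linarith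
    gcongr
  have i9 : (1 + 4 * (h * Λ)) * (1 + h * Λ ^ 2) ≤ 1 + backConst Λ * h := by
    unfold backConst
    nlinarith [mul_le_mul_of_nonneg_left hhΛ (by positivity : 0 ≤ 4 * (h * Λ ^ 2))]
  have := mul_le_mul_of_nonneg_right i9 n2
  linarith

/-- Complete the square with y + w: since x ≤ y, the product x w is at most y w. It converts the
O(h) increase of squared norms into a linear recursion for the norms. -/
theorem le_of_sq_le_sq_add {x y z w : ℝ} (hx : 0 ≤ x) (hy : 0 ≤ y) (hw : 0 ≤ w) (hxy : x ≤ y)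
    (h : z ^ 2 ≤ y ^ 2 + x * w) : z ≤ y + w := by
  refine (le_abs_self z).trans (abs_le_of_sq_le_sq ?_ (by positivity))
  nlinarith [mul_le_mul_of_nonneg_right hxy hw, mul_nonneg hx hw, sq_nonneg w]

/-- A growth constant of the forward scheme. -/
def forwardConst (c : Coeffs d) {mΩ : MeasurableSpace Ω} (P : Measure Ω) (Λ α : ℝ) : ℝ :=
  2 * Λ + 3 * c.bGrowth P Λ + 4 * momentConst Λ α * Λ ^ 2

theorem forwardConst_nonneg (hΛ : 0 ≤ Λ) (hα : 1 ≤ α) : 0 ≤ forwardConst c P Λ α := by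
  have := Coeffs.bGrowth_nonneg (c := c) (P := P) hΛ
  have := momentConst_nonneg (Λ := Λ) hα
  unfold forwardConst
  positivity

/-- The size `(1 + ‖X‖²)^{1/2}`. -/
def bracket {mΩ : MeasurableSpace Ω} (P : Measure Ω) (α : ℝ) (X : Ω → E d) : ℝ :=
  Real.sqrt (1 + lpNorm X (ENNReal.ofReal (2 * α)) P ^ 2)

theorem one_le_bracket (X : Ω → E d) : 1 ≤ bracket P α X :=
  Real.one_le_sqrt.2 (by nlinarith [sq_nonneg (lpNorm X (ENNReal.ofReal (2 * α)) P)])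

theorem lpNorm_le_bracket (X : Ω → E d) :
    lpNorm X (ENNReal.ofReal (2 * α)) P ≤ bracket P α X :=
  Real.le_sqrt_of_sq_le (by linarith)

theorem bracket_sq (X : Ω → E d) :
    bracket P α X ^ 2 = 1 + lpNorm X (ENNReal.ofReal (2 * α)) P ^ 2 :=
  Real.sq_sqrt (by positivity)

theorem bracket_congr {X X' : Ω → E d} (h : X =ᵐ[P] X') : bracket P α X = bracket P α X' := by
  unfold bracket
  rw [lpNorm_congr_ae h]

theorem bracket_le (X : Ω → E d) :
    bracket P α X ≤ 1 + lpNorm X (ENNReal.ofReal (2 * α)) P := by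
  have n : 0 ≤ lpNorm X (ENNReal.ofReal (2 * α)) P := lpNorm_nonneg
  exact Real.sqrt_le_iff.2 ⟨by positivity, by nlinarith⟩

variable {X X₁ X₂ X' X₁' X₂' : Ω → E d} {Y Y₁ Y₂ : Ω → ℝ}

/-- One step of the Euler scheme, with the noise `G`. -/
def euler (c : Coeffs d) {mΩ : MeasurableSpace Ω} (P : Measure Ω) (h : ℝ) (X : Ω → E d)
    (Y : Ω → ℝ) (G : Ω → E d) (ω : Ω) : E d :=
  X ω + h • c.b (X ω) (Y ω) (jointLaw P X Y) + c.σ (X ω) (P.map X) (Real.sqrt h • G ω)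

theorem stronglyMeasurable_b (h0 : H0 c Λ) (hΛ : 0 ≤ Λ) (hXm : StronglyMeasurable[m] X)
    (hYm : StronglyMeasurable[m] Y) (hX : MemLp X 2 P) (hY : MemLp Y 2 P) :
    StronglyMeasurable[m] fun ω => c.b (X ω) (Y ω) (jointLaw P X Y) :=
  (h0.continuous_b hΛ (isP2_jointLaw hX hY) (W2_jointLaw_self hX hY)).comp_stronglyMeasurable
    (hXm.prodMk hYm)

theorem stronglyMeasurable_σ (h0 : H0 c Λ) (hΛ : 0 ≤ Λ) (hXm : StronglyMeasurable[m] X)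
    (hX : MemLp X 2 P) : StronglyMeasurable[m] fun ω => c.σ (X ω) (P.map X) :=
  (h0.continuous_σ hΛ (isP2_map hX) (W2_map_self hX)).comp_stronglyMeasurable hXm

theorem lpBound_b (h0 : H0 c Λ) (hα : 1 ≤ α) (hΛ : 0 ≤ Λ) (hm : m ≤ mΩ)
    (hXm : StronglyMeasurable[m] X) (hYm : StronglyMeasurable[m] Y) {x y : ℝ}
    (hX : LpBound (ENNReal.ofReal (2 * α)) P X x) (hY : LpBound (ENNReal.ofReal (2 * α)) P Y y) :
    LpBound (ENNReal.ofReal (2 * α)) P (fun ω => c.b (X ω) (Y ω) (jointLaw P X Y))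
      (c.bGrowth P Λ * (1 + 2 * x + 2 * y)) := by
  have hp1 := one_le_ofReal_two_mul hα
  have hp0 : ENNReal.ofReal (2 * α) ≠ 0 := (zero_lt_one.trans_le hp1).ne'
  have hp2 := two_le_ofReal_two_mul hα
  have hb := Coeffs.bGrowth_nonneg (c := c) (P := P) hΛ
  have c1 : LpBound (ENNReal.ofReal (2 * α)) P (fun _ : Ω => (1 : ℝ)) 1 :=
    LpBound.const hp0 zero_le_one
  have c2 : LpBound (ENNReal.ofReal (2 * α)) P (fun _ : Ω => lpNorm X 2 P) (lpNorm X 2 P) :=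
    LpBound.const hp0 lpNorm_nonneg
  have c3 : LpBound (ENNReal.ofReal (2 * α)) P (fun _ : Ω => lpNorm Y 2 P) (lpNorm Y 2 P) :=
    LpBound.const hp0 lpNorm_nonneg
  refine ((((((c1.add hp1 hX.norm).add hp1 hY.abs).add hp1 c2).add hp1 c3).const_mul hb).of_le
    ((stronglyMeasurable_b h0 hΛ hXm hYm (hX.exponent hp2).1 (hY.exponent hp2).1).mono
      hm).aestronglyMeasurable
    (.of_forall fun ω => h0.norm_b_le hΛ (hX.exponent hp2).1 (hY.exponent hp2).1 _ _)).mono ?_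
  have := (hX.exponent hp2).2
  have := (hY.exponent hp2).2
  exact mul_le_mul_of_nonneg_left (by linarith) hb

theorem smul_σ_eq (s : E d →L[ℝ] E d) (γ : E d) (r : ℝ) : s (r • γ) = (r • s) γ := by simp

/-- Growth of one step of the Euler scheme. -/
theorem IsNoise.bracket_euler_le (hG : IsNoise q m P G) (h0 : H0 c Λ) (hα : 1 ≤ α) (hΛ : 0 ≤ Λ)
    (hh : 0 < h) (hXm : StronglyMeasurable[m] X) (hYm : StronglyMeasurable[m] Y) {y : ℝ}
    (hX : MemLp X (ENNReal.ofReal (2 * α)) P) (hY : LpBound (ENNReal.ofReal (2 * α)) P Y y) :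
    MemLp (euler c P h X Y G) (ENNReal.ofReal (2 * α)) P ∧
    bracket P α (euler c P h X Y G) ≤ (1 + forwardConst c P Λ α * h) * bracket P α X
      + forwardConst c P Λ α * h * y := by
  have hp1 := one_le_ofReal_two_mul hα
  have hp0 : ENNReal.ofReal (2 * α) ≠ 0 := (zero_lt_one.trans_le hp1).ne'
  have hp2 := two_le_ofReal_two_mul hα
  have hX2 : MemLp X 2 P := hX.mono_exponent hp2
  have hb := Coeffs.bGrowth_nonneg (c := c) (P := P) hΛ
  have hmc := momentConst_nonneg (Λ := Λ) hα
  have hXb := LpBound.of_memLp hX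
  set x := lpNorm X (ENNReal.ofReal (2 * α)) P with hx
  have hB := lpBound_b h0 hα hΛ hG.le hXm hYm hXb hY
  have hBm := stronglyMeasurable_b h0 hΛ hXm hYm hX2 (hY.exponent hp2).1
  have hSm := stronglyMeasurable_σ h0 hΛ hXm hX2
  have hS : LpBound (ENNReal.ofReal (2 * α)) P
      (fun ω => Real.sqrt h • c.σ (X ω) (P.map X)) (Real.sqrt h * Λ) := by
    have c1 : LpBound (ENNReal.ofReal (2 * α)) P (fun _ : Ω => Real.sqrt h * Λ)
      (Real.sqrt h * Λ) := LpBound.const hp0 (by positivity)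
    refine c1.of_le ((hSm.mono hG.le).const_smul (Real.sqrt h)).aestronglyMeasurable
      (.of_forall fun ω => ?_)
    rw [norm_smul, Real.norm_of_nonneg (Real.sqrt_nonneg h)]
    exact mul_le_mul_of_nonneg_left (h0.σ_bdd _ _ (isP2_map hX2)) (Real.sqrt_nonneg h)
  have hA : LpBound (ENNReal.ofReal (2 * α)) P
      (fun ω => X ω + h • c.b (X ω) (Y ω) (jointLaw P X Y))
      (x + h * (c.bGrowth P Λ * (1 + 2 * x + 2 * y))) := by
    refine hXb.add hp1 ((hB.norm.const_mul hh.le).of_le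
      ((hBm.mono hG.le).const_smul h).aestronglyMeasurable (.of_forall fun ω => ?_))
    rw [norm_smul, Real.norm_of_nonneg hh.le]
  have heq : euler c P h X Y G = fun ω => (X ω + h • c.b (X ω) (Y ω) (jointLaw P X Y)) +
      (Real.sqrt h • c.σ (X ω) (P.map X)) (G ω) := by
    funext ω
    rw [euler, smul_σ_eq]
  have hmem : MemLp (euler c P h X Y G) (ENNReal.ofReal (2 * α)) P := by
    rw [heq]
    refine hA.1.add (hG.memLp_comp (F := fun ω γ => (Real.sqrt h • c.σ (X ω) (P.map X)) γ)
      fun γ _ => memLp_clm_apply hS.1 γ)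
  refine ⟨hmem, ?_⟩
  have key : lpNorm (euler c P h X Y G) (ENNReal.ofReal (2 * α)) P ^ 2 ≤
      lpNorm (fun ω => X ω + h • c.b (X ω) (Y ω) (jointLaw P X Y)) (ENNReal.ofReal (2 * α)) P ^ 2
      + momentConst Λ α *
      lpNorm (fun ω => Real.sqrt h • c.σ (X ω) (P.map X)) (ENNReal.ofReal (2 * α)) P ^ 2 := by
    rw [heq]
    exact hG.lpNorm_add_sq_le hα (hXm.add (hBm.const_smul h)) (hSm.const_smul (Real.sqrt h))
      hA.1 hS.1
  have i1 : lpNorm (fun ω => X ω + h • c.b (X ω) (Y ω) (jointLaw P X Y))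
      (ENNReal.ofReal (2 * α)) P ^ 2 ≤ (x + h * (c.bGrowth P Λ * (1 + 2 * x + 2 * y))) ^ 2 :=
    pow_le_pow_left₀ lpNorm_nonneg hA.2 2
  have i2 : lpNorm (fun ω => Real.sqrt h • c.σ (X ω) (P.map X)) (ENNReal.ofReal (2 * α)) P ^ 2 ≤
      h * Λ ^ 2 := by
    refine (pow_le_pow_left₀ lpNorm_nonneg hS.2 2).trans (le_of_eq ?_)
    rw [mul_pow, Real.sq_sqrt hh.le]
  have i2' := mul_le_mul_of_nonneg_left i2 hmc
  have hv1 := one_le_bracket (P := P) (α := α) X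
  have hvx := lpNorm_le_bracket (P := P) (α := α) X
  have hv2 := bracket_sq (P := P) (α := α) X
  rw [← hx] at hvx hv2
  have hv2' := bracket_sq (P := P) (α := α) (euler c P h X Y G)
  set v := bracket P α X
  have hx0 : 0 ≤ x := lpNorm_nonneg
  have hy0 := hY.nonneg
  set β := h * (c.bGrowth P Λ * (1 + 2 * x + 2 * y)) with hβ
  have hβ0 : 0 ≤ β := by positivity
  -- The diffusion adds an absolute amount of order h to the square. Since the bracket is at least
  -- 1, this increase is also relative to the bracket.
  have i3 : bracket P α (euler c P h X Y G) ^ 2 ≤ (v + β) ^ 2 +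
      1 * (momentConst Λ α * (h * Λ ^ 2)) := by
    rw [hv2']
    nlinarith [mul_le_mul_of_nonneg_right hvx hβ0]
  have i4 := le_of_sq_le_sq_add zero_le_one (by positivity)
    (by positivity : 0 ≤ momentConst Λ α * (h * Λ ^ 2)) (by linarith) i3
  refine i4.trans ?_
  have i5 : β ≤ h * (c.bGrowth P Λ * (3 * v + 2 * y)) := by
    rw [hβ]
    gcongr
    linarith
  have i6 : momentConst Λ α * (h * Λ ^ 2) ≤ momentConst Λ α * (h * Λ ^ 2) * v :=
    le_mul_of_one_le_right (by positivity) hv1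
  have i7 : 0 ≤ momentConst Λ α * (h * Λ ^ 2) := by positivity
  have i8 : 0 ≤ h * c.bGrowth P Λ * y := by positivity
  have i9 : 0 ≤ h * Λ * v := by positivity
  have i10 : 0 ≤ h * Λ * y := by positivity
  have i11 : 0 ≤ momentConst Λ α * (h * Λ ^ 2) * y := by positivity
  have i12 : 0 ≤ momentConst Λ α * (h * Λ ^ 2) * v := by positivity
  unfold forwardConst
  nlinarith

/-- Stability of one step of the Euler scheme. -/
theorem IsNoise.lpNorm_euler_sub_le (hG : IsNoise q m P G) (h0 : H0 c Λ) (hα : 1 ≤ α)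
    (hΛ : 0 ≤ Λ) (hh : 0 < h) (hX₁m : StronglyMeasurable[m] X₁) (hY₁m : StronglyMeasurable[m] Y₁)
    (hX₂m : StronglyMeasurable[m] X₂) (hY₂m : StronglyMeasurable[m] Y₂) {x y : ℝ}
    (hX₁ : MemLp X₁ (ENNReal.ofReal (2 * α)) P) (hY₁ : MemLp Y₁ (ENNReal.ofReal (2 * α)) P)
    (hX₂ : MemLp X₂ (ENNReal.ofReal (2 * α)) P) (hY₂ : MemLp Y₂ (ENNReal.ofReal (2 * α)) P)
    (hx : LpBound (ENNReal.ofReal (2 * α)) P (fun ω => X₁ ω - X₂ ω) x)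
    (hy : LpBound (ENNReal.ofReal (2 * α)) P (fun ω => Y₁ ω - Y₂ ω) y) :
    LpBound (ENNReal.ofReal (2 * α)) P (fun ω => euler c P h X₁ Y₁ G ω - euler c P h X₂ Y₂ G ω)
      ((1 + forwardConst c P Λ α * h) * x + forwardConst c P Λ α * h * y) := by
  have hp1 := one_le_ofReal_two_mul hα
  have hp0 : ENNReal.ofReal (2 * α) ≠ 0 := (zero_lt_one.trans_le hp1).ne'
  have hp2 := two_le_ofReal_two_mul hα
  have hb := Coeffs.bGrowth_nonneg (c := c) (P := P) hΛ
  have hmc := momentConst_nonneg (Λ := Λ) hα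
  have hx0 := hx.nonneg
  have hy0 := hy.nonneg
  have hX₁2 : MemLp X₁ 2 P := hX₁.mono_exponent hp2
  have hX₂2 : MemLp X₂ 2 P := hX₂.mono_exponent hp2
  have hY₁2 : MemLp Y₁ 2 P := hY₁.mono_exponent hp2
  have hY₂2 : MemLp Y₂ 2 P := hY₂.mono_exponent hp2
  have c1 : LpBound (ENNReal.ofReal (2 * α)) P (fun _ : Ω => lpNorm (fun ω => X₁ ω - X₂ ω) 2 P)
      x := (LpBound.const hp0 lpNorm_nonneg).mono (hx.exponent hp2).2
  have c2 : LpBound (ENNReal.ofReal (2 * α)) P (fun _ : Ω => lpNorm (fun ω => Y₁ ω - Y₂ ω) 2 P)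
      y := (LpBound.const hp0 lpNorm_nonneg).mono (hy.exponent hp2).2
  have hBm := (stronglyMeasurable_b h0 hΛ hX₁m hY₁m hX₁2 hY₁2).sub
    (stronglyMeasurable_b h0 hΛ hX₂m hY₂m hX₂2 hY₂2)
  have hSm := (stronglyMeasurable_σ h0 hΛ hX₁m hX₁2).sub (stronglyMeasurable_σ h0 hΛ hX₂m hX₂2)
  set Δb := (fun ω => c.b (X₁ ω) (Y₁ ω) (jointLaw P X₁ Y₁)) -
    fun ω => c.b (X₂ ω) (Y₂ ω) (jointLaw P X₂ Y₂) with hΔb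
  set Δσ := (fun ω => c.σ (X₁ ω) (P.map X₁)) - fun ω => c.σ (X₂ ω) (P.map X₂) with hΔσ
  have hB : LpBound (ENNReal.ofReal (2 * α)) P (fun ω => h • Δb ω) (h * (Λ * (x + y + (x + y)))) := by
    refine ((((hx.norm.add hp1 hy.abs).add hp1 (c1.add hp1 c2)).const_mul hΛ).const_mul hh.le).of_le
      ((hBm.mono hG.le).const_smul h).aestronglyMeasurable (.of_forall fun ω => ?_)
    rw [norm_smul, Real.norm_of_nonneg hh.le]
    refine mul_le_mul_of_nonneg_left ?_ hh.le
    refine (h0.b_lip _ _ _ _ _ _ (isP2_jointLaw hX₁2 hY₁2) (isP2_jointLaw hX₂2 hY₂2)).trans ?_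
    exact mul_le_mul_of_nonneg_left (add_le_add le_rfl (W2_jointLaw_le hX₁2 hY₁2 hX₂2 hY₂2)) hΛ
  have hS : LpBound (ENNReal.ofReal (2 * α)) P (fun ω => Real.sqrt h • Δσ ω)
      (Real.sqrt h * (Λ * (x + x))) := by
    refine (((hx.norm.add hp1 c1).const_mul hΛ).const_mul (Real.sqrt_nonneg h)).of_le
      ((hSm.mono hG.le).const_smul (Real.sqrt h)).aestronglyMeasurable (.of_forall fun ω => ?_)
    rw [norm_smul, Real.norm_of_nonneg (Real.sqrt_nonneg h)]
    refine mul_le_mul_of_nonneg_left ?_ (Real.sqrt_nonneg h)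
    refine (h0.σ_lip _ _ _ _ (isP2_map hX₁2) (isP2_map hX₂2)).trans ?_
    exact mul_le_mul_of_nonneg_left (add_le_add le_rfl (W2_map_le hX₁2 hX₂2)) hΛ
  have hA := hx.add hp1 hB
  have heq : (fun ω => euler c P h X₁ Y₁ G ω - euler c P h X₂ Y₂ G ω) =
      fun ω => (X₁ ω - X₂ ω + h • Δb ω) + (Real.sqrt h • Δσ ω) (G ω) := by
    funext ω
    simp only [euler, smul_σ_eq, hΔb, hΔσ, Pi.sub_apply, smul_sub]
    rw [sub_apply]
    abel
  have key := hG.lpNorm_add_sq_le hα ((hX₁m.sub hX₂m).add (hBm.const_smul h))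
    (hSm.const_smul (Real.sqrt h)) hA.1 hS.1
  rw [heq]
  refine ⟨hA.1.add (hG.memLp_comp (F := fun ω γ => (Real.sqrt h • Δσ ω) γ)
      fun γ _ => memLp_clm_apply hS.1 γ), ?_⟩
  have i1 : lpNorm (fun ω => X₁ ω - X₂ ω + h • Δb ω)
      (ENNReal.ofReal (2 * α)) P ^ 2 ≤ (x + h * (Λ * (x + y + (x + y)))) ^ 2 :=
    pow_le_pow_left₀ lpNorm_nonneg hA.2 2
  -- For a difference of two schemes the increase of the square is quadratic in x; one factor x is
  -- kept apart to obtain an increment linear in x.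
  have i2 : lpNorm (fun ω => Real.sqrt h • Δσ ω) (ENNReal.ofReal (2 * α)) P ^ 2 ≤
      x * (h * (4 * Λ ^ 2 * x)) := by
    refine (pow_le_pow_left₀ lpNorm_nonneg hS.2 2).trans (le_of_eq ?_)
    rw [mul_pow, Real.sq_sqrt hh.le]
    ring
  have i3 := mul_le_mul_of_nonneg_left i2 hmc
  have i4 := le_of_sq_le_sq_add (z := lpNorm (fun ω => X₁ ω - X₂ ω + h • Δb ω +
      (Real.sqrt h • Δσ ω) (G ω)) (ENNReal.ofReal (2 * α)) P) hx0
    (by positivity : 0 ≤ x + h * (Λ * (x + y + (x + y))))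
    (by positivity : 0 ≤ momentConst Λ α * (h * (4 * Λ ^ 2 * x)))
    (by have : 0 ≤ h * (Λ * (x + y + (x + y))) := by positivity
        linarith) (by
      refine key.trans ((add_le_add i1 i3).trans (le_of_eq ?_))
      ring)
  refine i4.trans ?_
  have j1 : 0 ≤ h * c.bGrowth P Λ * y := by positivity
  have j2 : 0 ≤ h * c.bGrowth P Λ * x := by positivity
  have j3 : 0 ≤ momentConst Λ α * (h * Λ ^ 2) * y := by positivity
  unfold forwardConst
  nlinarith

end OneStep

end MKV
end

/-! ### Quantized increments, time grid and discrete Gronwall lemmas -/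

noncomputable section

namespace MKV

section Quantizer

variable {d : ℕ} {Λ : ℝ} {Γ : E d → E d}

theorem IsQuantizer.integral_comp (hΓ : IsQuantizer Γ Λ) {V : Type*} [NormedAddCommGroup V]
    [NormedSpace ℝ V] [CompleteSpace V] (F : E d → V) :
    ∫ w, F (Γ w) ∂(stdGaussian (E d)) =
      ∑ γ ∈ hΓ.finite.toFinset, (stdGaussian (E d)).real (Γ ⁻¹' {γ}) • F γ := by
  have h1 : ∀ w, F (Γ w) = ∑ γ ∈ hΓ.finite.toFinset, (Γ ⁻¹' {γ}).indicator (fun _ => F γ) w := by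
    intro w
    rw [Finset.sum_eq_single (Γ w)]
    · rw [indicator_of_mem (by simp)]
    · intro γ _ hγ
      exact indicator_of_notMem (by simpa using hγ.symm) _
    · intro hw
      exact absurd (hΓ.finite.mem_toFinset.2 (mem_range_self w)) hw
  simp_rw [h1]
  have hm : ∀ γ, MeasurableSet (Γ ⁻¹' {γ}) := fun γ => hΓ.measurable (measurableSet_singleton γ)
  rw [integral_finsetSum _ fun γ _ => (integrable_const _).indicator (hm γ)]
  refine Finset.sum_congr rfl fun γ _ => ?_
  rw [integral_indicator_const _ (hm γ)]

/-- The cubature formula of a quantizer. -/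
def IsQuantizer.cubature (hΓ : IsQuantizer Γ Λ) : Cubature d Λ where
  S := hΓ.finite.toFinset
  w γ := (stdGaussian (E d)).real (Γ ⁻¹' {γ})
  w_nonneg _ := measureReal_nonneg
  sum_w := by
    have := hΓ.integral_comp (fun _ => (1 : ℝ))
    simpa using this.symm
  bdd γ hγ := by
    obtain ⟨w, rfl⟩ := hΓ.finite.mem_toFinset.1 hγ
    exact hΓ.bdd w
  centered := by
    rw [← hΓ.integral_comp (fun γ => γ)]
    exact hΓ.centered
  cov u v := by
    rw [← hΓ.covariance u v, hΓ.integral_comp (fun γ => ⟪γ, u⟫ * ⟪γ, v⟫)]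
    simp only [smul_eq_mul]

/-- The variance in the direction of a unit vector is 1 and is at most Λ². This needs one coordinate
at least. -/
theorem IsQuantizer.one_le (hΓ : IsQuantizer Γ Λ) (hd : 0 < d) : 1 ≤ Λ := by
  have hΛ := hΓ.cubature.bound_nonneg
  have e := hΓ.cubature.avg_inner_mul (EuclideanSpace.single ⟨0, hd⟩ (1 : ℝ))
    (EuclideanSpace.single ⟨0, hd⟩ (1 : ℝ))
  rw [real_inner_self_eq_norm_sq, PiLp.norm_single, norm_one, one_pow] at e
  have : (1 : ℝ) ≤ Λ ^ 2 := by
    rw [← e]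
    refine hΓ.cubature.avg_le fun γ hγ => ?_
    have i1 := abs_real_inner_le_norm γ (EuclideanSpace.single (⟨0, hd⟩ : Fin d) (1 : ℝ))
    rw [PiLp.norm_single, norm_one, mul_one] at i1
    have i2 := i1.trans (hΓ.cubature.bdd γ hγ)
    nlinarith [abs_mul_abs_self ⟪γ, EuclideanSpace.single (⟨0, hd⟩ : Fin d) (1 : ℝ)⟫,
      abs_nonneg ⟪γ, EuclideanSpace.single (⟨0, hd⟩ : Fin d) (1 : ℝ)⟫]
  nlinarith

end Quantizer

section Basis

variable {Ω : Type*} {mΩ : MeasurableSpace Ω} {P : Measure Ω} {d : ℕ}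
  {ℱ : Filtration ℝ mΩ} {T t : ℝ} {W : ℝ → Ω → E d}

/-- Null sets belong to the σ-algebra at time 0. The scheme is specified by almost sure equalities,
and this lemma turns them into genuine adaptedness. -/
theorem IsBasis.stronglyMeasurable_congr (hB : IsBasis P ℱ T W) (ht : 0 ≤ t) {V : Type*}
    [NormedAddCommGroup V] [SecondCountableTopology V]
    {f g : Ω → V} (hfg : f =ᵐ[P] g) (hg : StronglyMeasurable[ℱ t] g) :
    StronglyMeasurable[ℱ t] f := by
  borelize V
  have hle := ℱ.mono ht
  have hnull : ∀ A : Set Ω, P A = 0 → MeasurableSet[ℱ t] A := fun A hA =>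
    hle _ (hB.complete A hA)
  have hN : P {ω | f ω ≠ g ω} = 0 := hfg
  have hf : Measurable[ℱ t] f := by
    intro B hBm
    have : f ⁻¹' B = (g ⁻¹' B \ {ω | f ω ≠ g ω}) ∪ (f ⁻¹' B ∩ {ω | f ω ≠ g ω}) := by
      ext ω
      by_cases h : f ω = g ω <;> simp [h]
    rw [this]
    exact ((hg.measurable hBm).diff (hnull _ hN)).union
      (hnull _ (measure_mono_null inter_subset_right hN))
  exact hf.stronglyMeasurable

variable {Γ : E d → E d} {Λ : ℝ} {N : ℕ}

/-- The normalized quantized increment. -/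
def noise {T : ℝ} {N : ℕ} (G : Grid T N) (W : ℝ → Ω → E d) (Γ : E d → E d) (i : ℕ) (ω : Ω) : E d :=
  Γ ((Real.sqrt (G.h i))⁻¹ • (W (G.t (i + 1)) ω - W (G.t i) ω))

/-- Independence of the Brownian increment from the past, and Gaussian scaling: after division by √h
its law is the standard one, under which Γ is a cubature. -/
theorem IsBasis.isNoise (hB : IsBasis P ℱ T W) (hΓ : IsQuantizer Γ Λ) (G : Grid T N) {i : ℕ}
    (h0 : 0 ≤ G.t i) (hh : 0 < G.h i) (hT : G.t (i + 1) ≤ T) :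
    IsNoise hΓ.cubature (ℱ (G.t i)) P (noise G W Γ i) ∧
      StronglyMeasurable[ℱ (G.t (i + 1))] (noise G W Γ i) := by
  have hle : G.t i ≤ G.t (i + 1) := by unfold Grid.h at hh; linarith
  have hΔ' : StronglyMeasurable[ℱ (G.t (i + 1))] fun ω => W (G.t (i + 1)) ω - W (G.t i) ω :=
    (hB.adapted _ ⟨h0.trans hle, hT⟩).sub
      ((hB.adapted _ ⟨h0, hle.trans hT⟩).mono (ℱ.mono hle))
  have hΔ : Measurable fun ω => W (G.t (i + 1)) ω - W (G.t i) ω :=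
    (hΔ'.mono (ℱ.le _)).measurable
  have hΓh : Measurable fun z : E d => Γ ((Real.sqrt (G.h i))⁻¹ • z) :=
    hΓ.measurable.comp (measurable_const_smul _)
  have hr : 0 < Real.sqrt (G.h i) := Real.sqrt_pos.2 hh
  refine ⟨⟨ℱ.le _, hΓh.comp hΔ, fun ω => hΓ.finite.mem_toFinset.2 (mem_range_self _), ?_⟩,
    (hΓh.comp hΔ'.measurable).stronglyMeasurable⟩
  intro γ _ A hA
  have hBm : MeasurableSet ((fun z : E d => Γ ((Real.sqrt (G.h i))⁻¹ • z)) ⁻¹' {γ}) :=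
    hΓh (measurableSet_singleton γ)
  have e1 : noise G W Γ i ⁻¹' {γ} = (fun ω => W (G.t (i + 1)) ω - W (G.t i) ω) ⁻¹'
      ((fun z : E d => Γ ((Real.sqrt (G.h i))⁻¹ • z)) ⁻¹' {γ}) := rfl
  have hind := (Indep_iff _ _ _).1 (hB.indep (G.t i) (G.t (i + 1)) h0 hle hT) _ A
    ⟨_, hBm, rfl⟩ hA
  rw [inter_comm, e1, hind, ← Measure.map_apply hΔ hBm,
    hB.gaussian (G.t i) (G.t (i + 1)) h0 hle hT,
    Measure.map_apply (measurable_const_smul _) hBm]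
  congr 1
  have e2 : (fun z : E d => Real.sqrt (G.t (i + 1) - G.t i) • z) ⁻¹'
      ((fun z : E d => Γ ((Real.sqrt (G.h i))⁻¹ • z)) ⁻¹' {γ}) = Γ ⁻¹' {γ} := by
    ext z
    simp only [mem_preimage]
    change Γ ((Real.sqrt (G.h i))⁻¹ • Real.sqrt (G.h i) • z) ∈ _ ↔ _
    rw [smul_smul, inv_mul_cancel₀ hr.ne', one_smul]
  rw [e2]
  exact (ofReal_measureReal).symm

end Basis

section Grid

variable {T : ℝ} {N : ℕ} (G : Grid T N)

theorem Grid.t_mono {a b : ℕ} (hab : a ≤ b) (hb : b ≤ G.n) : G.t a ≤ G.t b := by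
  induction b, hab using Nat.le_induction with
  | base => exact le_rfl
  | succ b _ ih => exact (ih (by omega)).trans (G.t_lt b (by omega)).le

theorem Grid.t_nonneg {a : ℕ} (ha : a ≤ G.n) : 0 ≤ G.t a := by
  have := G.t_mono (Nat.zero_le a) ha
  rwa [G.t_zero] at this

theorem Grid.t_le {a : ℕ} (ha : a ≤ G.n) : G.t a ≤ T := by
  have := G.t_mono ha le_rfl
  rwa [G.t_last] at this

theorem Grid.j_lt (hT : 0 < T) {k : ℕ} (hk : k < N) : G.j k < G.j (k + 1) := by
  by_contra! h
  have h1 := G.t_mono h (G.j_le k hk.le)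
  rw [G.t_j k hk.le, G.t_j (k + 1) hk] at h1
  have : 0 < T / N := div_pos hT (by exact_mod_cast (Nat.zero_le k).trans_lt hk)
  push_cast at h1
  linarith

/-- The step `h i` for an index between two consecutive points `r_k`. -/
theorem Grid.step {k i : ℕ} (hk : k < N) (hi : i ∈ Ico (G.j k) (G.j (k + 1))) :
    i < G.n ∧ 0 < G.h i ∧ G.h i ≤ T / N ∧ G.h i ≤ G.mesh ∧ 0 ≤ G.t i ∧ G.t (i + 1) ≤ T ∧
      G.t i + G.h i = G.t (i + 1) := by
  have hn : i < G.n := hi.2.trans_le (G.j_le _ hk)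
  have h1 := G.t_mono hi.1 hn.le
  have h2 := G.t_mono (Nat.succ_le_of_lt hi.2) (G.j_le _ hk)
  rw [G.t_j k hk.le] at h1
  rw [G.t_j (k + 1) hk, Nat.succ_eq_add_one] at h2
  push_cast at h2
  refine ⟨hn, sub_pos.2 (G.t_lt i hn), ?_, ?_, G.t_nonneg hn.le, G.t_le hn, ?_⟩
  · unfold Grid.h
    linarith
  · exact le_ciSup (f := fun i : Fin G.n => G.h i) (Set.finite_range _).bddAbove ⟨i, hn⟩
  · unfold Grid.h
    ring

theorem Grid.length {k : ℕ} (hk : k < N) : G.t (G.j (k + 1)) - G.t (G.j k) = T / N := by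
  rw [G.t_j k hk.le, G.t_j (k + 1) hk]
  push_cast
  ring

theorem Grid.mesh_le (hT : 0 < T) : G.mesh ≤ T := by
  have hn : 0 < G.n := by
    rcases Nat.eq_zero_or_pos G.n with h | h
    · have := G.t_last
      rw [h, G.t_zero] at this
      linarith
    · exact h
  have : Nonempty (Fin G.n) := ⟨⟨0, hn⟩⟩
  refine ciSup_le fun i => ?_
  have h1 := G.t_nonneg i.2.le
  have h2 := G.t_le (Nat.succ_le_of_lt i.2)
  unfold Grid.h
  rw [Nat.succ_eq_add_one] at h2
  linarith

/-- A discrete Gronwall lemma, forwards. -/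
theorem gronwall_forward {Q : ℕ → ℝ → Prop} {t : ℕ → ℝ} {a b : ℕ} {C κ x δ : ℝ} (hC : 0 ≤ C)
    (hκ : 0 ≤ κ) (hx : 0 ≤ x) (hQ : ∀ i x y, Q i x → x ≤ y → Q i y)
    (ht : ∀ i ∈ Ico a b, t i ≤ t (i + 1)) (hδ : t b - t a ≤ δ)
    (hstep : ∀ i ∈ Ico a b, ∀ x, 0 ≤ x → Q i x →
      Q (i + 1) ((1 + C * (t (i + 1) - t i)) * x + κ * (t (i + 1) - t i)))
    (h0 : Q a x) {i : ℕ} (hi : i ∈ Icc a b) : Q i (Real.exp (C * δ) * (x + κ * δ)) := by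
  have hmono : ∀ i, a ≤ i → i ≤ b → t a ≤ t i := by
    intro i hai
    induction i, hai using Nat.le_induction with
    | base => intro _; exact le_rfl
    | succ i hi ih => intro hb; exact (ih (by omega)).trans (ht i ⟨hi, by omega⟩)
  have hmono' : ∀ n i, i + n = b → a ≤ i → t i ≤ t b := by
    intro n
    induction n with
    | zero => rintro i rfl _; exact le_rfl
    | succ n ih => intro i hib hai; exact (ht i ⟨hai, by omega⟩).trans (ih (i + 1) (by omega) (by omega))
  -- Induction with 1 + Ch ≤ e^{Ch}; the source term κh is put under the exponential, which is at
  -- least 1.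
  have key : ∀ i, a ≤ i → i ≤ b → Q i (Real.exp (C * (t i - t a)) * (x + κ * (t i - t a))) := by
    intro i hai
    induction i, hai using Nat.le_induction with
    | base => intro _; simpa using h0
    | succ i hi ih =>
      intro hb
      have h1 := hmono i hi (by omega)
      have h2 := ht i ⟨hi, by omega⟩
      have n1 : 0 ≤ κ * (t i - t a) := mul_nonneg hκ (by linarith)
      refine hQ _ _ _ (hstep i ⟨hi, by omega⟩ _ (by positivity) (ih (by omega))) ?_
      have e1 : 1 + C * (t (i + 1) - t i) ≤ Real.exp (C * (t (i + 1) - t i)) := by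
        linarith [Real.add_one_le_exp (C * (t (i + 1) - t i))]
      have e2 : Real.exp (C * (t (i + 1) - t a)) =
          Real.exp (C * (t (i + 1) - t i)) * Real.exp (C * (t i - t a)) := by
        rw [← Real.exp_add]; ring_nf
      have e3 : 1 ≤ Real.exp (C * (t (i + 1) - t a)) :=
        Real.one_le_exp (mul_nonneg hC (by linarith))
      have e4 := mul_le_mul_of_nonneg_right e1
        (by positivity : 0 ≤ Real.exp (C * (t i - t a)) * (x + κ * (t i - t a)))
      have e5 : κ * (t (i + 1) - t i) ≤ Real.exp (C * (t (i + 1) - t a)) * (κ * (t (i + 1) - t i)) :=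
        le_mul_of_one_le_left (mul_nonneg hκ (by linarith)) e3
      rw [e2] at e5 ⊢
      nlinarith
  refine hQ _ _ _ (key i hi.1 hi.2) ?_
  have h1 := hmono i hi.1 hi.2
  have h2 : t i ≤ t b := hmono' (b - i) i (by have := hi.2; omega) hi.1
  have n1 : 0 ≤ κ * (t i - t a) := mul_nonneg hκ (by linarith)
  have n2 : κ * (t i - t a) ≤ κ * δ := mul_le_mul_of_nonneg_left (by linarith) hκ
  gcongr
  linarith

/-- A discrete Gronwall lemma, backwards. -/
theorem gronwall_backward {Q : ℕ → ℝ → Prop} {t : ℕ → ℝ} {a b : ℕ} {C κ x δ : ℝ} (hC : 0 ≤ C)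
    (hκ : 0 ≤ κ) (hx : 0 ≤ x) (hQ : ∀ i x y, Q i x → x ≤ y → Q i y) (hab : a ≤ b)
    (ht : ∀ i ∈ Ico a b, t i ≤ t (i + 1)) (hδ : t b - t a ≤ δ)
    (hstep : ∀ i ∈ Ico a b, ∀ x, 0 ≤ x → Q (i + 1) x →
      Q i ((1 + C * (t (i + 1) - t i)) * x + κ * (t (i + 1) - t i)))
    (h0 : Q b x) {i : ℕ} (hi : i ∈ Icc a b) : Q i (Real.exp (C * δ) * (x + κ * δ)) := by
  -- Reversal of time: the index i becomes b + a - i and the times change sign, so a backward step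
  -- is a forward one.
  have := gronwall_forward (Q := fun i => Q (b + a - i)) (t := fun i => -t (b + a - i)) (a := a)
    (b := b) (δ := δ) hC hκ hx (fun i => hQ _) (fun i hi => by
      have := ht (b + a - (i + 1)) ⟨by have := hi.2; omega, by have := hi.1; have := hi.2; omega⟩
      rw [show b + a - (i + 1) + 1 = b + a - i by have := hi.1; have := hi.2; omega] at this
      linarith) (by
      rw [Nat.add_sub_cancel, Nat.add_sub_cancel_left]; linarith) (fun i hi x hx hq => by
      have e : b + a - (i + 1) + 1 = b + a - i := by have := hi.1; have := hi.2; omega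
      have := hstep (b + a - (i + 1))
        ⟨by have := hi.2; omega, by have := hi.1; have := hi.2; omega⟩ x hx (by rwa [e])
      rw [e] at this
      have e2 : -t (b + a - (i + 1)) - -t (b + a - i) = t (b + a - i) - t (b + a - (i + 1)) := by
        ring
      rwa [e2]) (by rwa [Nat.add_sub_cancel]) (i := b + a - i)
      ⟨by have := hi.2; omega, by have := hi.1; omega⟩
  rwa [show b + a - (b + a - i) = i by have := hi.2; have := hi.1; omega] at this

end Grid

end MKV
end

/-! ### One step of the backward scheme -/

noncomputable section

namespace MKV

section Driver

variable {Ω : Type*} {m mΩ : MeasurableSpace Ω} {P : Measure Ω} [IsProbabilityMeasure P] {d : ℕ}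
  {Λ α : ℝ} {c : Coeffs d} {q : Cubature d Λ} {h : ℝ} {G X Z Z' : Ω → E d} {Y Y' : Ω → ℝ}

theorem memLp_f (h0 : H0 c Λ) (hΛ : 0 ≤ Λ) {ν : Measure (EY d)} (hν : IsP2 ν) (hW : W2 ν ν = 0)
    (hX : MemLp X 2 P) (hY : MemLp Y 2 P) (hZ : MemLp Z 2 P) :
    MemLp (fun ω => c.f (X ω) (Y ω) (Z ω) ν) 2 P := by
  have hdom : MemLp (fun ω => |c.f 0 0 0 ν| + Λ * (‖X ω‖ + |Y ω| + ‖Z ω‖)) 2 P := by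
    have a1 : MemLp (fun _ : Ω => |c.f 0 0 0 ν|) 2 P := memLp_const _
    have a2 : MemLp (fun ω => |Y ω|) 2 P := hY.norm
    have a3 : MemLp (fun ω => ‖X ω‖ + |Y ω| + ‖Z ω‖) 2 P := (hX.norm.add a2).add hZ.norm
    exact a1.add (a3.const_mul Λ)
  refine hdom.mono ((h0.continuous_f hΛ hν hW).comp_aestronglyMeasurable
    (hX.1.prodMk (hY.1.prodMk hZ.1))) (.of_forall fun ω => ?_)
  have i1 := h0.f_lip (X ω) 0 (Y ω) 0 (Z ω) 0 ν ν hν hν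
  rw [sub_zero, sub_zero, sub_zero, hW, add_zero] at i1
  have i2 := norm_le_norm_add_norm_sub' (c.f (X ω) (Y ω) (Z ω) ν) (c.f 0 0 0 ν)
  rw [Real.norm_eq_abs, Real.norm_eq_abs, Real.norm_eq_abs] at i2
  rw [Real.norm_eq_abs, Real.norm_eq_abs]
  exact (by linarith : _ ≤ _).trans (le_abs_self _)

/-- Both joint laws have the same first component, so the distance between them is bounded by the L²
norm of the difference of the second components. -/
theorem abs_f_sub_le (h0 : H0 c Λ) (hΛ : 0 ≤ Λ) (hX : MemLp X 2 P) (hY : MemLp Y 2 P)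
    (hY' : MemLp Y' 2 P) (x : E d) (y y' : ℝ) (z z' : E d) :
    |c.f x y z (jointLaw P X Y) - c.f x y' z' (jointLaw P X Y')| ≤
      Λ * (|y - y'| + lpNorm (fun ω => Y ω - Y' ω) 2 P + ‖z - z'‖) := by
  refine (h0.f_lip _ _ _ _ _ _ _ _ (isP2_jointLaw hX hY) (isP2_jointLaw hX hY')).trans ?_
  have i1 := W2_jointLaw_le hX hY hX hY'
  have i2 : lpNorm (fun ω => X ω - X ω) 2 P = 0 := by
    simp only [sub_self]
    exact lpNorm_zero _ _
  rw [i2, zero_add] at i1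
  rw [sub_self, norm_zero]
  exact mul_le_mul_of_nonneg_left (by linarith) hΛ

/-- One step of the backward scheme. -/
structure IsBackward (m : MeasurableSpace Ω) {mΩ : MeasurableSpace Ω} (P : Measure Ω) (c : Coeffs d)
    (h : ℝ) (G X : Ω → E d) (Y' Y : Ω → ℝ) (Z : Ω → E d) : Prop where
  memLp_Y' : MemLp Y' 2 P
  memLp_Y : MemLp Y 2 P
  meas_Y : StronglyMeasurable[m] Y
  eq_Z : Z =ᵐ[P] P[fun ω => h⁻¹ • Y' ω • (Real.sqrt h • G ω) | m]
  eq_Y : Y =ᵐ[P] fun ω => (P[Y' | m]) ω + h * c.f (X ω) (Y ω) (Z ω) (jointLaw P X Y)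

theorem condExp_smul_noise (hh : 0 < h) (Y' : Ω → ℝ) (G : Ω → E d) :
    P[fun ω => h⁻¹ • Y' ω • (Real.sqrt h • G ω) | m] =ᵐ[P]
      fun ω => (Real.sqrt h)⁻¹ • (P[fun ω => Y' ω • G ω | m]) ω := by
  have : (fun ω => h⁻¹ • Y' ω • (Real.sqrt h • G ω)) =
      (Real.sqrt h)⁻¹ • fun ω => Y' ω • G ω := by
    funext ω
    rw [Pi.smul_apply, smul_comm _ (Real.sqrt h), smul_smul]
    congr 1
    have := Real.mul_self_sqrt hh.le
    have := (Real.sqrt_pos.2 hh).ne'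
    field_simp
    linarith
  rw [this]
  exact condExp_smul _ _ _

theorem IsNoise.memLp_Z (hG : IsNoise q m P G) (h : ℝ) (hY' : MemLp Y' 2 P) :
    MemLp (P[fun ω => h⁻¹ • Y' ω • (Real.sqrt h • G ω) | m]) 2 P := by
  have : (fun ω => h⁻¹ • Y' ω • (Real.sqrt h • G ω)) =
      fun ω => h⁻¹ • Real.sqrt h • Y' ω • G ω := by
    funext ω
    rw [smul_comm (Y' ω)]
  rw [this]
  exact (LpBound.of_memLp (((hG.memLp_smul hY').const_smul (Real.sqrt h)).const_smul h⁻¹)).condExp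
    (by norm_num) |>.1

/-- The driver is a function of variables known at the beginning of the step (Z being replaced by
its version given by the conditional expectation), so it leaves the conditional expectation and an
implicit pointwise equation remains. -/
theorem IsBackward.of_condExp (hG : IsNoise q m P G) (h0 : H0 c Λ) (hΛ : 0 ≤ Λ)
    (hXm : StronglyMeasurable[m] X) (hX : MemLp X 2 P) (hY' : MemLp Y' 2 P) (hY : MemLp Y 2 P)
    (hYm : StronglyMeasurable[m] Y)
    (hZ : Z =ᵐ[P] P[fun ω => h⁻¹ • Y' ω • (Real.sqrt h • G ω) | m])
    (hYeq : Y =ᵐ[P] P[fun ω => Y' ω + h * c.f (X ω) (Y ω) (Z ω) (jointLaw P X Y) | m]) :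
    IsBackward m P c h G X Y' Y Z := by
  refine ⟨hY', hY, hYm, hZ, ?_⟩
  have hν := isP2_jointLaw hX hY
  have hW := W2_jointLaw_self hX hY
  set Z₀ := P[fun ω => h⁻¹ • Y' ω • (Real.sqrt h • G ω) | m]
  have hZ₀ := hG.memLp_Z h hY'
  have hZm : StronglyMeasurable[m] Z₀ := stronglyMeasurable_condExp
  have hF : MemLp (fun ω => h * c.f (X ω) (Y ω) (Z₀ ω) (jointLaw P X Y)) 2 P :=
    (memLp_f h0 hΛ hν hW hX hY hZ₀).const_mul h
  have hFm : StronglyMeasurable[m] fun ω => h * c.f (X ω) (Y ω) (Z₀ ω) (jointLaw P X Y) :=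
    ((h0.continuous_f hΛ hν hW).comp_stronglyMeasurable
      (hXm.prodMk (hYm.prodMk hZm))).const_mul h
  have e1 : (fun ω => Y' ω + h * c.f (X ω) (Y ω) (Z ω) (jointLaw P X Y)) =ᵐ[P]
      Y' + fun ω => h * c.f (X ω) (Y ω) (Z₀ ω) (jointLaw P X Y) := by
    filter_upwards [hZ] with ω hω
    rw [Pi.add_apply, hω]
  have e2 := (condExp_congr_ae (m := m) e1).trans
    (condExp_add (hY'.integrable (by norm_num)) (hF.integrable (by norm_num)) m)
  rw [condExp_of_stronglyMeasurable hG.le hFm (hF.integrable (by norm_num))] at e2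
  filter_upwards [hYeq.trans e2, hZ] with ω hω hω'
  rw [hω']
  exact hω

/-- One step of the comparison of the backward scheme with an approximate solution. -/
theorem IsBackward.lpBound_sub (hB : IsBackward m P c h G X Y' Y Z) (hG : IsNoise q m P G)
    (h0 : H0 c Λ) (hα : 1 ≤ α) (hΛ : 0 ≤ Λ) (hh : 0 < h) (hhΛ : h * Λ ≤ 1 / 4) (hX : MemLp X 2 P)
    {U U' : Ω → ℝ} {Zu : Ω → E d} (hU' : MemLp U' 2 P) (hU : MemLp U 2 P)
    (hZu : Zu =ᵐ[P] P[fun ω => h⁻¹ • U' ω • (Real.sqrt h • G ω) | m]) {a κ : ℝ}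
    (hκ : LpBound (ENNReal.ofReal (2 * α)) P (fun ω =>
      (P[U' | m]) ω + h * c.f (X ω) (U ω) (Zu ω) (jointLaw P X U) - U ω) (h * κ))
    (ha : LpBound (ENNReal.ofReal (2 * α)) P (fun ω => Y' ω - U' ω) a) :
    LpBound (ENNReal.ofReal (2 * α)) P (fun ω => Y ω - U ω)
      ((1 + backConst Λ * h) * a + 2 * (h * κ)) := by
  refine hG.lpBound_of_abs_le hα hΛ hh hhΛ (hB.memLp_Y.sub hU) ha hκ.abs ?_
  have e1 : P[fun ω => Y' ω - U' ω | m] =ᵐ[P] P[Y' | m] - P[U' | m] :=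
    condExp_sub (hB.memLp_Y'.integrable (by norm_num)) (hU'.integrable (by norm_num)) m
  have e2 : P[fun ω => (Y' ω - U' ω) • G ω | m] =ᵐ[P]
      P[fun ω => Y' ω • G ω | m] - P[fun ω => U' ω • G ω | m] := by
    simp_rw [sub_smul]
    exact condExp_sub ((hG.memLp_smul hB.memLp_Y').integrable (by norm_num))
      ((hG.memLp_smul hU').integrable (by norm_num)) m
  filter_upwards [e1, e2, hB.eq_Y, hB.eq_Z, hZu, condExp_smul_noise hh Y' G,
    condExp_smul_noise hh U' G] with ω k1 k2 k3 k4 k5 k6 k7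
  have k8 := abs_f_sub_le h0 hΛ hX hB.memLp_Y hU (X ω) (Y ω) (U ω) (Z ω) (Zu ω)
  -- Z depends linearly on the next value of Y, so the difference of the two Z is the covariance of
  -- the difference with the noise, as the Bessel estimate requires.
  have k9 : Z ω - Zu ω = (Real.sqrt h)⁻¹ • (P[fun ω => (Y' ω - U' ω) • G ω | m]) ω := by
    rw [k4, k5, k6, k7, k2, Pi.sub_apply, smul_sub]
  rw [k9] at k8
  set R := (P[U' | m]) ω + h * c.f (X ω) (U ω) (Zu ω) (jointLaw P X U) - U ω
  set f1 := c.f (X ω) (Y ω) (Z ω) (jointLaw P X Y)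
  set f2 := c.f (X ω) (U ω) (Zu ω) (jointLaw P X U)
  have k10 : Y ω - U ω = (P[fun ω => Y' ω - U' ω | m]) ω + h * (f1 - f2) + R := by
    rw [k1, Pi.sub_apply]
    simp only [R, f2]
    linarith
  calc |Y ω - U ω| = |(P[fun ω => Y' ω - U' ω | m]) ω + h * (f1 - f2) + R| := by rw [← k10]
    _ ≤ |(P[fun ω => Y' ω - U' ω | m]) ω| + |h * (f1 - f2)| + |R| := abs_add_three _ _ _
    _ ≤ _ := by
      rw [abs_mul, abs_of_pos hh]
      gcongr

/-- Growth of one step of the backward scheme, when the driver is bounded at the origin. -/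
theorem IsBackward.lpBound (hB : IsBackward m P c h G X Y' Y Z) (hG : IsNoise q m P G)
    (h0 : H0 c Λ) (hα : 1 ≤ α) (hΛ : 0 ≤ Λ) (hh : 0 < h) (hhΛ : h * Λ ≤ 1 / 4) (hX : MemLp X 2 P)
    {M : ℝ} (hM : ∀ x μ, IsP2 μ → |c.f x 0 0 (μ.map fun v => WithLp.toLp 2 (v, (0 : ℝ)))| ≤ M)
    {a : ℝ} (ha : LpBound (ENNReal.ofReal (2 * α)) P Y' a) :
    LpBound (ENNReal.ofReal (2 * α)) P Y ((1 + backConst Λ * h) * a + 2 * (h * M)) := by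
  have hp0 : ENNReal.ofReal (2 * α) ≠ 0 := (zero_lt_one.trans_le (one_le_ofReal_two_mul hα)).ne'
  have hM0 : 0 ≤ M := (abs_nonneg _).trans (hM 0 _ (isP2_map hX))
  have h00 : MemLp (fun _ : Ω => (0 : ℝ)) 2 P := MemLp.zero'
  have hR : LpBound (ENNReal.ofReal (2 * α)) P (fun _ : Ω => h * M) (h * M) :=
    LpBound.const hp0 (by positivity)
  refine hG.lpBound_of_abs_le hα hΛ hh hhΛ hB.memLp_Y ha hR ?_
  filter_upwards [hB.eq_Y, hB.eq_Z, condExp_smul_noise hh Y' G] with ω k1 k2 k3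
  have k4 := abs_f_sub_le h0 hΛ hX hB.memLp_Y h00 (X ω) (Y ω) 0 (Z ω) 0
  simp only [sub_zero] at k4
  rw [k2, k3] at k4
  have k5 : |c.f (X ω) 0 0 (jointLaw P X fun _ => 0)| ≤ M := by
    have := hM (X ω) _ (isP2_map hX)
    rwa [AEMeasurable.map_map_of_aemeasurable (by fun_prop) hX.1.aemeasurable] at this
  rw [← k3, ← k2] at k4
  set f1 := c.f (X ω) (Y ω) (Z ω) (jointLaw P X Y)
  set f2 := c.f (X ω) 0 0 (jointLaw P X fun _ => 0)
  have k6 : |f1| ≤ |f1 - f2| + M := by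
    have := norm_le_norm_add_norm_sub' f1 f2
    rw [Real.norm_eq_abs, Real.norm_eq_abs, Real.norm_eq_abs] at this
    linarith
  rw [k2, k3] at k4
  calc |Y ω| = |(P[Y' | m]) ω + h * f1| := by rw [← k1]
    _ ≤ |(P[Y' | m]) ω| + h * |f1| := by
      refine (abs_add_le _ _).trans (le_of_eq ?_)
      rw [abs_mul, abs_of_pos hh]
    _ ≤ |(P[Y' | m]) ω| + h * (|f1 - f2| + M) := by gcongr
    _ ≤ _ := by
      rw [mul_add, ← add_assoc]
      gcongr

/-- Existence of one step of the backward scheme. -/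
theorem IsNoise.exists_backward (hG : IsNoise q m P G) (h0 : H0 c Λ) (hΛ : 0 ≤ Λ) (hh : 0 < h)
    (hhΛ : h * Λ ≤ 1 / 4) (hX : MemLp X 2 P) (hY' : MemLp Y' 2 P) :
    ∃ Y : Ω → ℝ, MemLp Y 2 P ∧ Y =ᵐ[P] P[fun ω => Y' ω + h * c.f (X ω) (Y ω)
      ((P[fun ω => h⁻¹ • Y' ω • (Real.sqrt h • G ω) | m]) ω) (jointLaw P X Y) | m] := by
  set Z := P[fun ω => h⁻¹ • Y' ω • (Real.sqrt h • G ω) | m]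
  have hZ := hG.memLp_Z h hY'
  let F : (Ω → ℝ) → Ω → ℝ := fun Y ω => Y' ω + h * c.f (X ω) (Y ω) (Z ω) (jointLaw P X Y)
  have hF : ∀ Y : Ω → ℝ, MemLp Y 2 P → MemLp (F Y) 2 P := fun Y hY =>
    hY'.add ((memLp_f h0 hΛ (isP2_jointLaw hX hY) (W2_jointLaw_self hX hY) hX hY hZ).const_mul h)
  have hE : ∀ Y : Ω → ℝ, MemLp Y 2 P → MemLp (P[F Y | m]) 2 P := fun Y hY =>
    ((LpBound.of_memLp (hF Y hY)).condExp (by norm_num)).1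
  -- Y solves a fixed point equation in L². The driver depends on Y pointwise and through the law,
  -- each time with constant hΛ ≤ 1/4, so the map is a contraction of ratio 1/2.
  let Φ : Lp ℝ 2 P → Lp ℝ 2 P := fun Y => (hE Y (Lp.memLp Y)).toLp _
  have hsub : ∀ Y₁ Y₂ : Lp ℝ 2 P, LpBound 2 P (P[F Y₁ | m] - P[F Y₂ | m])
      (1 / 2 * lpNorm (fun ω => Y₁ ω - Y₂ ω) 2 P) := by
    intro Y₁ Y₂
    have hΔ : LpBound 2 P (fun ω => Y₁ ω - Y₂ ω) (lpNorm (fun ω => Y₁ ω - Y₂ ω) 2 P) :=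
      LpBound.of_memLp ((Lp.memLp Y₁).sub (Lp.memLp Y₂))
    have hc : LpBound 2 P (fun _ : Ω => lpNorm (fun ω => Y₁ ω - Y₂ ω) 2 P)
        (lpNorm (fun ω => Y₁ ω - Y₂ ω) 2 P) := LpBound.const (by norm_num) lpNorm_nonneg
    have h1 : LpBound 2 P (F Y₁ - F Y₂) (1 / 2 * lpNorm (fun ω => Y₁ ω - Y₂ ω) 2 P) := by
      refine ((((hΔ.abs.add (by norm_num) hc).const_mul hΛ).const_mul hh.le).of_le
        ((hF _ (Lp.memLp Y₁)).sub (hF _ (Lp.memLp Y₂))).1 (.of_forall fun ω => ?_)).mono ?_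
      · have k := abs_f_sub_le h0 hΛ hX (Lp.memLp Y₁) (Lp.memLp Y₂) (X ω) (Y₁ ω) (Y₂ ω) (Z ω) (Z ω)
        rw [sub_self, norm_zero, add_zero] at k
        have e : (F Y₁ - F Y₂) ω = h * (c.f (X ω) (Y₁ ω) (Z ω) (jointLaw P X Y₁) -
            c.f (X ω) (Y₂ ω) (Z ω) (jointLaw P X Y₂)) := by
          simp only [F, Pi.sub_apply]; ring
        rw [e, norm_mul, Real.norm_of_nonneg hh.le, Real.norm_eq_abs]
        exact mul_le_mul_of_nonneg_left k hh.le
      · have n : 0 ≤ lpNorm (fun ω => Y₁ ω - Y₂ ω) 2 P := lpNorm_nonneg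
        nlinarith
    exact (h1.condExp (m := m) (by norm_num)).congr
      (condExp_sub ((hF _ (Lp.memLp Y₁)).integrable (by norm_num))
        ((hF _ (Lp.memLp Y₂)).integrable (by norm_num)) m)
  have hcontr : ContractingWith (1 / 2) Φ := by
    refine ⟨by rw [← NNReal.coe_lt_coe]; norm_num, LipschitzWith.of_dist_le_mul fun Y₁ Y₂ => ?_⟩
    rw [dist_eq_norm, dist_eq_norm, Lp.norm_def, Lp.norm_def]
    have e1 : (Φ Y₁ - Φ Y₂ : Lp ℝ 2 P) =ᵐ[P] P[F Y₁ | m] - P[F Y₂ | m] :=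
      (Lp.coeFn_sub _ _).trans ((MemLp.coeFn_toLp _).sub (MemLp.coeFn_toLp _))
    have e2 : (Y₁ - Y₂ : Lp ℝ 2 P) =ᵐ[P] fun ω => Y₁ ω - Y₂ ω := Lp.coeFn_sub _ _
    rw [eLpNorm_congr_ae e1, eLpNorm_congr_ae e2, toReal_eLpNorm (hsub Y₁ Y₂).1.1,
      toReal_eLpNorm (f := fun ω => Y₁ ω - Y₂ ω) ((Lp.memLp Y₁).sub (Lp.memLp Y₂)).1]
    simpa using (hsub Y₁ Y₂).2
  let Y := ContractingWith.fixedPoint Φ hcontr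
  refine ⟨Y, Lp.memLp Y, ?_⟩
  have hfix : Φ Y = Y := hcontr.fixedPoint_isFixedPt
  have : (Φ Y : Ω → ℝ) =ᵐ[P] P[F Y | m] := MemLp.coeFn_toLp _
  rwa [hfix] at this

end Driver

end MKV
end

/-! ### Runs of the one-step solver: adaptedness and existence -/

noncomputable section

namespace MKV

/-- The standing assumptions. -/
structure Setting {Ω : Type*} {mΩ : MeasurableSpace Ω} {d : ℕ} (P : Measure Ω)
    (ℱ : Filtration ℝ mΩ) (T : ℝ) (W : ℝ → Ω → E d) (c : Coeffs d) (u : Field d)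
    (Γ : E d → E d) (Λ α : ℝ) : Prop where
  one_le_α : 1 ≤ α
  one_le_Λ : 1 ≤ Λ
  pos_T : 0 < T
  basis : IsBasis P ℱ T W
  h0 : H0 c Λ
  h1 : H1 (ℱ 0) P T c u Λ α
  quantizer : IsQuantizer Γ Λ

section

variable {Ω : Type*} {mΩ : MeasurableSpace Ω} {P : Measure Ω} [IsProbabilityMeasure P] {d : ℕ}
  {ℱ : Filtration ℝ mΩ} {T Λ α : ℝ} {W : ℝ → Ω → E d} {c : Coeffs d} {u : Field d}
  {Γ : E d → E d} {N k i : ℕ} {G : Grid T N}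

/-- The forward component of a run of the one-step solver. -/
structure IsForward (P : Measure Ω) (ℱ : Filtration ℝ mΩ) (W : ℝ → Ω → E d) (c : Coeffs d)
    (Γ : E d → E d) {T : ℝ} {N : ℕ} (G : Grid T N) (k : ℕ) (ξ : Ω → E d)
    (X : ℕ → Ω → E d) (Y : ℕ → Ω → ℝ) : Prop where
  memLp_X : ∀ i ∈ Icc (G.j k) (G.j (k + 1)), MemLp (X i) 2 P
  meas_X : ∀ i ∈ Icc (G.j k) (G.j (k + 1)), StronglyMeasurable[ℱ (G.t i)] (X i)
  memLp_Y : ∀ i ∈ Icc (G.j k) (G.j (k + 1)), MemLp (Y i) 2 P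
  meas_Y : ∀ i ∈ Ico (G.j k) (G.j (k + 1)), StronglyMeasurable[ℱ (G.t i)] (Y i)
  initial : X (G.j k) =ᵐ[P] ξ
  step : ∀ i ∈ Ico (G.j k) (G.j (k + 1)),
    X (i + 1) =ᵐ[P] euler c P (G.h i) (X i) (Y i) (noise G W Γ i)

namespace Setting

theorem Λ_nonneg (S : Setting P ℱ T W c u Γ Λ α) : 0 ≤ Λ := by linarith [S.one_le_Λ]

theorem isNoise (S : Setting P ℱ T W c u Γ Λ α) (hk : k < N)
    (hi : i ∈ Ico (G.j k) (G.j (k + 1))) :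
    IsNoise S.quantizer.cubature (ℱ (G.t i)) P (noise G W Γ i) ∧
      StronglyMeasurable[ℱ (G.t (i + 1))] (noise G W Γ i) := by
  obtain ⟨-, h1, -, -, h2, h3, -⟩ := G.step hk hi
  exact S.basis.isNoise S.quantizer G h2 h1 h3

theorem t_nonneg (hk : k < N) (hi : i ∈ Icc (G.j k) (G.j (k + 1))) : 0 ≤ G.t i :=
  G.t_nonneg (hi.2.trans (G.j_le _ hk))

theorem t_mem (hk : k < N) (hi : i ∈ Icc (G.j k) (G.j (k + 1))) : G.t i ∈ Icc 0 T :=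
  ⟨G.t_nonneg (hi.2.trans (G.j_le _ hk)), G.t_le (hi.2.trans (G.j_le _ hk))⟩

theorem euler_meas (S : Setting P ℱ T W c u Γ Λ α) (hk : k < N)
    (hi : i ∈ Ico (G.j k) (G.j (k + 1))) {X : Ω → E d} {Y : Ω → ℝ}
    (hXm : StronglyMeasurable[ℱ (G.t i)] X) (hYm : StronglyMeasurable[ℱ (G.t i)] Y)
    (hX : MemLp X 2 P) (hY : MemLp Y 2 P) :
    StronglyMeasurable[ℱ (G.t (i + 1))] (euler c P (G.h i) X Y (noise G W Γ i)) := by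
  obtain ⟨hn, h1, -, -, h2, h3, h4⟩ := G.step hk hi
  have hle : ℱ (G.t i) ≤ ℱ (G.t (i + 1)) := ℱ.mono (by linarith)
  have hb := (stronglyMeasurable_b S.h0 S.Λ_nonneg hXm hYm hX hY).mono hle
  have hσ := (stronglyMeasurable_σ S.h0 S.Λ_nonneg hXm hX).mono hle
  have hG := (S.isNoise hk hi).2.const_smul (Real.sqrt (G.h i))
  have happ : Continuous fun p : (E d →L[ℝ] E d) × E d => p.1 p.2 := by fun_prop
  exact ((hXm.mono hle).add (hb.const_smul (G.h i))).add
    (happ.comp_stronglyMeasurable (hσ.prodMk hG))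

theorem euler_memLp (S : Setting P ℱ T W c u Γ Λ α) (hk : k < N)
    (hi : i ∈ Ico (G.j k) (G.j (k + 1))) {X : Ω → E d} {Y : Ω → ℝ}
    (hXm : StronglyMeasurable[ℱ (G.t i)] X) (hYm : StronglyMeasurable[ℱ (G.t i)] Y)
    (hX : MemLp X 2 P) (hY : MemLp Y 2 P) :
    MemLp (euler c P (G.h i) X Y (noise G W Γ i)) 2 P := by
  -- Square integrability is the case of exponent 1 in the L^{2α} estimate, whatever the α of the
  -- setting.
  have e : ENNReal.ofReal (2 * 1) = 2 := by norm_num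
  obtain ⟨hn, h1, -⟩ := G.step hk hi
  have := ((S.isNoise hk hi).1.bracket_euler_le S.h0 le_rfl S.Λ_nonneg h1 hXm hYm (by rwa [e])
    (LpBound.of_memLp (by rwa [e]))).1
  rwa [e] at this

/-- Adaptedness and square integrability propagate along the grid. The backward component is needed
adapted only before the end of the period: its terminal value never drives the forward component. -/
theorem isForward_aux (S : Setting P ℱ T W c u Γ Λ α) (hk : k < N) {ξ : Ω → E d}
    (hξm : StronglyMeasurable[ℱ (k * (T / N))] ξ) (hξ : MemLp ξ 2 P) {X : ℕ → Ω → E d}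
    {Y : ℕ → Ω → ℝ} (hYL : ∀ i ∈ Icc (G.j k) (G.j (k + 1)), MemLp (Y i) 2 P)
    (hYm : ∀ i ∈ Ico (G.j k) (G.j (k + 1)), StronglyMeasurable[ℱ (G.t i)] (Y i))
    (h0 : X (G.j k) =ᵐ[P] ξ) (hs : ∀ i ∈ Ico (G.j k) (G.j (k + 1)),
      X (i + 1) =ᵐ[P] euler c P (G.h i) (X i) (Y i) (noise G W Γ i)) :
    IsForward P ℱ W c Γ G k ξ X Y := by
  have key : ∀ i, G.j k ≤ i → i ≤ G.j (k + 1) →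
      MemLp (X i) 2 P ∧ StronglyMeasurable[ℱ (G.t i)] (X i) := by
    intro i hi
    induction i, hi using Nat.le_induction with
    | base =>
      intro h
      refine ⟨hξ.ae_eq h0.symm, S.basis.stronglyMeasurable_congr (t_nonneg hk ⟨le_rfl, h⟩) h0 ?_⟩
      rwa [G.t_j k hk.le]
    | succ i hi ih =>
      intro h
      obtain ⟨i1, i2⟩ := ih (by omega)
      have hi' : i ∈ Ico (G.j k) (G.j (k + 1)) := ⟨hi, h⟩
      have hY := hYL i ⟨hi, by omega⟩
      exact ⟨(S.euler_memLp hk hi' i2 (hYm i hi') i1 hY).ae_eq (hs i hi').symm,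
        S.basis.stronglyMeasurable_congr (t_nonneg hk ⟨by omega, h⟩) (hs i hi')
          (S.euler_meas hk hi' i2 (hYm i hi') i1 hY)⟩
  exact ⟨fun i hi => (key i hi.1 hi.2).1, fun i hi => (key i hi.1 hi.2).2, hYL, hYm, h0, hs⟩

theorem isForward (S : Setting P ℱ T W c u Γ Λ α) (hk : k < N) {ξ : Ω → E d}
    (hξm : StronglyMeasurable[ℱ (k * (T / N))] ξ) (hξ : MemLp ξ 2 P) {XX X Z : ℕ → Ω → E d}
    {Y : ℕ → Ω → ℝ} {η : Ω → ℝ} {f' : E d → ℝ → E d → Measure (EY d) → ℝ}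
    (h : IsStep P ℱ W c Γ G k XX η f' X Y Z) (hXX : XX (G.j k) =ᵐ[P] ξ) :
    IsForward P ℱ W c Γ G k ξ X Y :=
  S.isForward_aux hk hξm hξ h.memLp_Y
    (fun i hi => S.basis.stronglyMeasurable_congr (t_nonneg hk ⟨hi.1, hi.2.le⟩)
      (h.backward_Y i hi) stronglyMeasurable_condExp)
    (h.initial_X.trans hXX) h.forward_X

theorem isBackward (S : Setting P ℱ T W c u Γ Λ α) (hk : k < N) {ξ : Ω → E d}
    {XX X Z : ℕ → Ω → E d} {Y Y₀ : ℕ → Ω → ℝ} {η : Ω → ℝ}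
    (h : IsStep P ℱ W c Γ G k XX η c.f X Y Z) (hXX : IsForward P ℱ W c Γ G k ξ XX Y₀)
    (hi : i ∈ Ico (G.j k) (G.j (k + 1))) :
    IsBackward (ℱ (G.t i)) P c (G.h i) (noise G W Γ i) (XX i) (Y (i + 1)) (Y i) (Z i) :=
  IsBackward.of_condExp (S.isNoise hk hi).1 S.h0 S.Λ_nonneg (hXX.meas_X i ⟨hi.1, hi.2.le⟩)
    (hXX.memLp_X i ⟨hi.1, hi.2.le⟩) (h.memLp_Y (i + 1) ⟨hi.1.trans (Nat.le_succ i), hi.2⟩)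
    (h.memLp_Y i ⟨hi.1, hi.2.le⟩)
    (S.basis.stronglyMeasurable_congr (t_nonneg hk ⟨hi.1, hi.2.le⟩)
      (h.backward_Y i hi) stronglyMeasurable_condExp)
    (h.backward_Z i hi) (h.backward_Y i hi)

/-- A step with null terminal condition and null driver has a null backward component. -/
theorem Y_eq_zero {XX X Z : ℕ → Ω → E d} {Y : ℕ → Ω → ℝ}
    (h : IsStep P ℱ W c Γ G k XX 0 (fun _ _ _ _ => 0) X Y Z)
    (hi : i ∈ Icc (G.j k) (G.j (k + 1))) : Y i =ᵐ[P] 0 := by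
  have key : ∀ n i, i + n = G.j (k + 1) → G.j k ≤ i → Y i =ᵐ[P] 0 := by
    intro n
    induction n with
    | zero =>
      rintro i hi -
      rw [add_zero] at hi
      rw [hi]
      exact h.terminal_Y
    | succ n ih =>
      intro i hi hk
      have h1 := ih (i + 1) (by omega) (by omega)
      refine (h.backward_Y i ⟨hk, by omega⟩).trans ?_
      have : (fun ω => Y (i + 1) ω + G.h i * 0) =ᵐ[P] 0 := by
        filter_upwards [h1] with ω hω
        simp [hω]
      refine (condExp_congr_ae this).trans ?_
      rw [condExp_zero]
  exact key (G.j (k + 1) - i) i (by have := hi.2; omega) hi.1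

/-- Existence of the forward component. -/
theorem exists_forward (c : Coeffs d) (W : ℝ → Ω → E d) (Γ : E d → E d) (G : Grid T N) (k : ℕ)
    (ξ : Ω → E d) (Y : ℕ → Ω → ℝ) :
    ∃ X : ℕ → Ω → E d, X (G.j k) = ξ ∧ ∀ i ∈ Ico (G.j k) (G.j (k + 1)),
      X (i + 1) = euler c P (G.h i) (X i) (Y i) (noise G W Γ i) := by
  let F : ℕ → Ω → E d := fun n => Nat.rec ξ (fun n X =>
    euler c P (G.h (G.j k + n)) X (Y (G.j k + n)) (noise G W Γ (G.j k + n))) n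
  refine ⟨fun i => F (i - G.j k), by simp [F], fun i hi => ?_⟩
  obtain ⟨n, rfl⟩ := Nat.exists_eq_add_of_le hi.1
  simp only [Nat.add_sub_cancel_left, add_assoc]
  rfl

/-- The step with null terminal condition and null driver. -/
theorem exists_step_zero (G : Grid T N) (k : ℕ) (ξ : Ω → E d) :
    ∃ (X : ℕ → Ω → E d) (Y : ℕ → Ω → ℝ) (Z : ℕ → Ω → E d),
      IsStep P ℱ W c Γ G k (fun _ => ξ) 0 (fun _ _ _ _ => 0) X Y Z := by
  obtain ⟨X, hX0, hX⟩ := exists_forward (P := P) c W Γ G k ξ fun _ _ => 0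
  refine ⟨X, fun _ _ => 0, fun _ _ => 0, fun _ _ => MemLp.zero', .rfl, .rfl, fun i _ => ?_,
    fun i _ => ?_, .of_eq hX0, fun i hi => .of_eq (hX i hi)⟩
  · simp only [zero_smul, smul_zero]
    have := condExp_zero (E := E d) (μ := P) (m := ℱ (G.t i))
    exact .of_eq this.symm
  · simp only [mul_zero, add_zero]
    have := condExp_zero (E := ℝ) (μ := P) (m := ℱ (G.t i))
    exact .of_eq this.symm

/-- Existence of a run of the one-step solver. -/
theorem exists_step (S : Setting P ℱ T W c u Γ Λ α) (hk : k < N) (hδ : T / N * Λ ≤ 1 / 4)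
    {XX : ℕ → Ω → E d} (hXX : ∀ i ∈ Icc (G.j k) (G.j (k + 1)), MemLp (XX i) 2 P)
    {η : Ω → ℝ} (hη : MemLp η 2 P) :
    ∃ (X : ℕ → Ω → E d) (Y : ℕ → Ω → ℝ) (Z : ℕ → Ω → E d),
      IsStep P ℱ W c Γ G k XX η c.f X Y Z := by
  have hjj := G.j_lt S.pos_T hk
  -- Square integrability is bundled with the variable so that the backward recursion stays in L²;
  -- outside the period the value is simply repeated.
  have hex : ∀ i (Y' : {Y : Ω → ℝ // MemLp Y 2 P}), ∃ Y : {Y : Ω → ℝ // MemLp Y 2 P},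
      i ∈ Ico (G.j k) (G.j (k + 1)) → (Y : Ω → ℝ) =ᵐ[P] P[fun ω => (Y' : Ω → ℝ) ω
        + G.h i * c.f (XX i ω) ((Y : Ω → ℝ) ω)
        ((P[fun ω => (G.h i)⁻¹ • (Y' : Ω → ℝ) ω • (Real.sqrt (G.h i) • noise G W Γ i ω)
          | ℱ (G.t i)]) ω) (jointLaw P (XX i) Y) | ℱ (G.t i)] := by
    intro i Y'
    by_cases hi : i ∈ Ico (G.j k) (G.j (k + 1))
    · obtain ⟨-, h1, h2, -⟩ := G.step hk hi
      obtain ⟨Y, hY, hYe⟩ := (S.isNoise hk hi).1.exists_backward S.h0 S.Λ_nonneg h1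
        ((mul_le_mul_of_nonneg_right h2 S.Λ_nonneg).trans hδ) (hXX i ⟨hi.1, hi.2.le⟩) Y'.2
      exact ⟨⟨Y, hY⟩, fun _ => hYe⟩
    · exact ⟨Y', fun h => absurd h hi⟩
  choose Φ hΦ using hex
  let R : ℕ → {Y : Ω → ℝ // MemLp Y 2 P} := fun n =>
    Nat.rec ⟨η, hη⟩ (fun n Y' => Φ (G.j (k + 1) - (n + 1)) Y') n
  let Y : ℕ → Ω → ℝ := fun i => (R (G.j (k + 1) - i)).1
  -- The value 0 from the end of the period on realizes the terminal condition on Z.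
  let Z : ℕ → Ω → E d := fun i => if i < G.j (k + 1) then
    P[fun ω => (G.h i)⁻¹ • Y (i + 1) ω • incr G W Γ i ω | ℱ (G.t i)] else 0
  obtain ⟨X, hX0, hX⟩ := exists_forward (P := P) c W Γ G k (XX (G.j k)) Y
  have hYend : Y (G.j (k + 1)) = η := by simp [Y, R]
  refine ⟨X, Y, Z, fun i _ => (R _).2, .of_eq hYend, ?_, fun i hi => ?_, fun i hi => ?_,
    .of_eq hX0, fun i hi => .of_eq (hX i hi)⟩
  · simp only [Z, lt_irrefl, if_false]
    exact .rfl
  · simp only [Z, hi.2, if_true]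
    exact .rfl
  · have e : G.j (k + 1) - i = (G.j (k + 1) - (i + 1)) + 1 := by have := hi.2; omega
    have e2 : G.j (k + 1) - ((G.j (k + 1) - (i + 1)) + 1) = i := by have := hi.2; omega
    have hR : R (G.j (k + 1) - i) = Φ i (R (G.j (k + 1) - (i + 1))) := by
      rw [e]
      change Φ (G.j (k + 1) - ((G.j (k + 1) - (i + 1)) + 1)) (R (G.j (k + 1) - (i + 1))) = _
      rw [e2]
    have h1 := hΦ i (R (G.j (k + 1) - (i + 1))) hi
    rw [← hR] at h1
    simp only [Z, hi.2, if_true]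
    exact h1

end Setting

end

end MKV
end

/-! ### Estimates over one period -/

noncomputable section

namespace MKV

variable {Ω : Type*} {mΩ : MeasurableSpace Ω} {P : Measure Ω} [IsProbabilityMeasure P] {d : ℕ}
  {ℱ : Filtration ℝ mΩ} {T Λ α : ℝ} {W : ℝ → Ω → E d} {c : Coeffs d} {u : Field d}
  {Γ : E d → E d} {N k i : ℕ} {G : Grid T N}

theorem euler_eq_path {X : Ω → E d} {Y : Ω → ℝ} {Gn : Ω → E d} (t h : ℝ) :
    euler c P h X Y Gn = IsEuler.path c P t X Y Gn (t + h) := by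
  funext ω
  simp only [euler, IsEuler.path, curve, Coeffs.drift, Coeffs.diffusion, add_sub_cancel_left,
    map_smul]

namespace Setting

variable {ξ : Ω → E d} {X X₁ X₂ : ℕ → Ω → E d} {Y Y₁ Y₂ : ℕ → Ω → ℝ}

theorem one_le_p (S : Setting P ℱ T W c u Γ Λ α) : 1 ≤ ENNReal.ofReal (2 * α) :=
  one_le_ofReal_two_mul S.one_le_α

theorem two_le_p (S : Setting P ℱ T W c u Γ Λ α) : 2 ≤ ENNReal.ofReal (2 * α) :=
  two_le_ofReal_two_mul S.one_le_α

theorem t_le_succ (hk : k < N) (hi : i ∈ Ico (G.j k) (G.j (k + 1))) : G.t i ≤ G.t (i + 1) := by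
  obtain ⟨-, h1, -, -, -, -, h4⟩ := G.step hk hi
  linarith

/-- Growth of the forward component over one period. -/
theorem forward_growth (S : Setting P ℱ T W c u Γ Λ α) (hk : k < N)
    (hF : IsForward P ℱ W c Γ G k ξ X Y) (hξ : MemLp ξ (ENNReal.ofReal (2 * α)) P) {y : ℝ}
    (hy0 : 0 ≤ y)
    (hY : ∀ i ∈ Ico (G.j k) (G.j (k + 1)), LpBound (ENNReal.ofReal (2 * α)) P (Y i) y)
    (hi : i ∈ Icc (G.j k) (G.j (k + 1))) :
    MemLp (X i) (ENNReal.ofReal (2 * α)) P ∧ bracket P α (X i) ≤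
      Real.exp (forwardConst c P Λ α * (T / N)) *
        (bracket P α ξ + forwardConst c P Λ α * y * (T / N)) := by
  have hC := forwardConst_nonneg (c := c) (P := P) S.Λ_nonneg S.one_le_α
  refine gronwall_forward (Q := fun i x => MemLp (X i) (ENNReal.ofReal (2 * α)) P ∧
    bracket P α (X i) ≤ x) (t := G.t) hC (by positivity)
    (zero_le_one.trans (one_le_bracket ξ)) (fun i x y h hxy => ⟨h.1, h.2.trans hxy⟩)
    (fun i hi => t_le_succ hk hi) (G.length hk).le (fun i hi x _ hx => ?_) ?_ hi
  · obtain ⟨-, h1, -⟩ := G.step hk hi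
    obtain ⟨k1, k2⟩ := (S.isNoise hk hi).1.bracket_euler_le S.h0 S.one_le_α S.Λ_nonneg h1
      (hF.meas_X i ⟨hi.1, hi.2.le⟩) (hF.meas_Y i hi) hx.1 (hY i hi)
    refine ⟨k1.ae_eq (hF.step i hi).symm, ?_⟩
    rw [bracket_congr (hF.step i hi)]
    refine k2.trans ?_
    change (1 + _ * G.h i) * _ + _ ≤ (1 + _ * G.h i) * x + _ * _ * G.h i
    have := mul_le_mul_of_nonneg_left hx.2
      (by positivity : 0 ≤ 1 + forwardConst c P Λ α * G.h i)
    linarith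
  · exact ⟨hξ.ae_eq hF.initial.symm, (bracket_congr hF.initial).le⟩

/-- Stability of the forward component over one period. -/
theorem forward_stability (S : Setting P ℱ T W c u Γ Λ α) (hk : k < N)
    (hF₁ : IsForward P ℱ W c Γ G k ξ X₁ Y₁) (hF₂ : IsForward P ℱ W c Γ G k ξ X₂ Y₂)
    (hX₁ : ∀ i ∈ Icc (G.j k) (G.j (k + 1)), MemLp (X₁ i) (ENNReal.ofReal (2 * α)) P)
    (hX₂ : ∀ i ∈ Icc (G.j k) (G.j (k + 1)), MemLp (X₂ i) (ENNReal.ofReal (2 * α)) P)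
    (hY₁ : ∀ i ∈ Ico (G.j k) (G.j (k + 1)), MemLp (Y₁ i) (ENNReal.ofReal (2 * α)) P)
    (hY₂ : ∀ i ∈ Ico (G.j k) (G.j (k + 1)), MemLp (Y₂ i) (ENNReal.ofReal (2 * α)) P) {y : ℝ}
    (hy0 : 0 ≤ y)
    (hY : ∀ i ∈ Ico (G.j k) (G.j (k + 1)),
      LpBound (ENNReal.ofReal (2 * α)) P (fun ω => Y₁ i ω - Y₂ i ω) y)
    (hi : i ∈ Icc (G.j k) (G.j (k + 1))) :
    LpBound (ENNReal.ofReal (2 * α)) P (fun ω => X₁ i ω - X₂ i ω)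
      (Real.exp (forwardConst c P Λ α * (T / N)) * (0 + forwardConst c P Λ α * y * (T / N))) := by
  have hC := forwardConst_nonneg (c := c) (P := P) S.Λ_nonneg S.one_le_α
  refine gronwall_forward (Q := fun i x => LpBound (ENNReal.ofReal (2 * α)) P
    (fun ω => X₁ i ω - X₂ i ω) x) (t := G.t) hC (by positivity)
    le_rfl (fun i x y h hxy => h.mono hxy)
    (fun i hi => t_le_succ hk hi) (G.length hk).le (fun i hi x _ hx => ?_) ?_ hi
  · obtain ⟨-, h1, -⟩ := G.step hk hi
    have hi' : i ∈ Icc (G.j k) (G.j (k + 1)) := ⟨hi.1, hi.2.le⟩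
    have key := (S.isNoise hk hi).1.lpNorm_euler_sub_le S.h0 S.one_le_α S.Λ_nonneg h1
      (hF₁.meas_X i hi') (hF₁.meas_Y i hi) (hF₂.meas_X i hi') (hF₂.meas_Y i hi)
      (hX₁ i hi') (hY₁ i hi) (hX₂ i hi') (hY₂ i hi) hx (hY i hi)
    refine (key.congr ?_).mono (le_of_eq ?_)
    · filter_upwards [hF₁.step i hi, hF₂.step i hi] with ω k1 k2
      rw [k1, k2]
    · change _ = (1 + _ * G.h i) * x + _ * _ * G.h i
      ring
  · have : (fun ω => X₁ (G.j k) ω - X₂ (G.j k) ω) =ᵐ[P] fun _ => 0 := by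
      filter_upwards [hF₁.initial, hF₂.initial] with ω k1 k2
      rw [k1, k2, sub_self]
    exact (LpBound.congr ⟨MemLp.zero', (lpNorm_zero _ _).le⟩ this.symm)

theorem backConst_nonneg (S : Setting P ℱ T W c u Γ Λ α) : 0 ≤ backConst Λ := by
  have := S.Λ_nonneg
  unfold backConst
  positivity

theorem memLp_U' (S : Setting P ℱ T W c u Γ Λ α) {p : ℝ≥0∞} (hp : 2 ≤ p) {t : ℝ}
    (ht : t ∈ Icc 0 T) {X : Ω → E d} (hX : MemLp X p P) :
    MemLp (fun ω => u.U t (X ω) (P.map X)) p P :=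
  S.h1.memLp_U S.Λ_nonneg ht (isP2_map (hX.mono_exponent hp)) (W2_map_self (hX.mono_exponent hp)) hX

theorem lpBound_U (S : Setting P ℱ T W c u Γ Λ α) {t : ℝ} (ht : t ∈ Icc 0 T) {X : Ω → E d}
    (hX : MemLp X (ENNReal.ofReal (2 * α)) P) :
    LpBound (ENNReal.ofReal (2 * α)) P (fun ω => u.U t (X ω) (P.map X))
      (u.growth P T Λ * (3 * bracket P α X)) := by
  have hp0 : ENNReal.ofReal (2 * α) ≠ 0 := (zero_lt_one.trans_le S.one_le_p).ne'
  have hX2 := hX.mono_exponent S.two_le_p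
  have c1 : LpBound (ENNReal.ofReal (2 * α)) P (fun _ : Ω => (1 : ℝ)) 1 :=
    LpBound.const hp0 zero_le_one
  have c2 : LpBound (ENNReal.ofReal (2 * α)) P (fun _ : Ω => lpNorm X 2 P) (lpNorm X 2 P) :=
    LpBound.const hp0 lpNorm_nonneg
  have hK := Field.growth_nonneg (u := u) (P := P) (T := T) S.Λ_nonneg
  refine ((((c1.add S.one_le_p (LpBound.of_memLp hX).norm).add S.one_le_p c2).const_mul hK).of_le
    (S.memLp_U' S.two_le_p ht hX).1
    (.of_forall fun ω => S.h1.abs_U_le S.Λ_nonneg ht hX2 _)).mono ?_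
  have i1 := lpNorm_le_bracket (P := P) (α := α) X
  have i2 := one_le_bracket (P := P) (α := α) X
  have i3 : lpNorm X 2 P ≤ _ := lpNorm_le_lpNorm_of_le S.two_le_p hX
  exact mul_le_mul_of_nonneg_left (by linarith) hK

theorem lpBound_U_sub (S : Setting P ℱ T W c u Γ Λ α) {t : ℝ} (ht : t ∈ Icc 0 T)
    {X X' : Ω → E d} (hX : MemLp X (ENNReal.ofReal (2 * α)) P)
    (hX' : MemLp X' (ENNReal.ofReal (2 * α)) P) {x : ℝ}
    (hx : LpBound (ENNReal.ofReal (2 * α)) P (fun ω => X ω - X' ω) x) :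
    LpBound (ENNReal.ofReal (2 * α)) P
      (fun ω => u.U t (X ω) (P.map X) - u.U t (X' ω) (P.map X')) (2 * Λ * x) := by
  have hp0 : ENNReal.ofReal (2 * α) ≠ 0 := (zero_lt_one.trans_le S.one_le_p).ne'
  have hX2 := hX.mono_exponent S.two_le_p
  have hX2' := hX'.mono_exponent S.two_le_p
  have c2 : LpBound (ENNReal.ofReal (2 * α)) P (fun _ : Ω => lpNorm (fun ω => X ω - X' ω) 2 P) x :=
    (LpBound.const hp0 lpNorm_nonneg).mono (hx.exponent S.two_le_p).2
  refine (((hx.norm.add S.one_le_p c2).const_mul S.Λ_nonneg).of_le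
    ((S.memLp_U' S.two_le_p ht hX).sub (S.memLp_U' S.two_le_p ht hX')).1
    (.of_forall fun ω => ?_)).mono (by linarith)
  refine (S.h1.abs_U_sub_le S.Λ_nonneg ht _ _ (isP2_map hX2) (isP2_map hX2')).trans ?_
  exact mul_le_mul_of_nonneg_left (add_le_add le_rfl (W2_map_le hX2 hX2')) S.Λ_nonneg

/-- The error of the backward component over one period, along its input. -/
theorem backward_error (S : Setting P ℱ T W c u Γ Λ α) (hk : k < N)
    (hδ1 : T / N ≤ 1) (hδ : T / N * Λ ≤ 1 / 4)
    (hF : IsForward P ℱ W c Γ G k ξ X Y) {X' Z' : ℕ → Ω → E d} {Y' : ℕ → Ω → ℝ} {η : Ω → ℝ}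
    (hstep : IsStep P ℱ W c Γ G k X η c.f X' Y' Z') {V a e : ℝ} (hV : 1 ≤ V)
    (hXV : ∀ i ∈ Ico (G.j k) (G.j (k + 1)), LpBound (ENNReal.ofReal (2 * α)) P (X i) V)
    (hYV : ∀ i ∈ Ico (G.j k) (G.j (k + 1)), LpBound (ENNReal.ofReal (2 * α)) P (Y i) V)
    (ha : ∀ i ∈ Ico (G.j k) (G.j (k + 1)), LpBound (ENNReal.ofReal (2 * α)) P
      (fun ω => Y i ω - u.U (G.t i) (X i ω) (P.map (X i))) a) (ha0 : 0 ≤ a)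
    (he : LpBound (ENNReal.ofReal (2 * α)) P (fun ω => η ω - u.U (G.t (G.j (k + 1)))
      (X (G.j (k + 1)) ω) (P.map (X (G.j (k + 1))))) e)
    (hi : i ∈ Icc (G.j k) (G.j (k + 1))) :
    LpBound (ENNReal.ofReal (2 * α)) P (fun ω => Y' i ω - u.U (G.t i) (X i ω) (P.map (X i)))
      (Real.exp (backConst Λ * (T / N)) * (e + 2 * (IsEuler.consistencyConst c P Λ α *
        (a + Real.sqrt G.mesh * V ^ α)) * (T / N))) := by
  have hC0 : 0 ≤ IsEuler.consistencyConst c P Λ α := by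
    have h1 := S.Λ_nonneg
    have h2 := Coeffs.bGrowth_nonneg (c := c) (P := P) h1
    unfold IsEuler.consistencyConst IsEuler.localConst IsEuler.gradConst IsEuler.speed
    positivity
  have hVα : 0 ≤ V ^ α := by positivity
  refine gronwall_backward (Q := fun i x => LpBound (ENNReal.ofReal (2 * α)) P
    (fun ω => Y' i ω - u.U (G.t i) (X i ω) (P.map (X i))) x) (t := G.t) S.backConst_nonneg
    (by positivity) he.nonneg (fun i x y h hxy => h.mono hxy) (G.j_lt S.pos_T hk).le
    (fun i hi => t_le_succ hk hi) (G.length hk).le (fun i hi x _ hx => ?_) ?_ hi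
  · obtain ⟨-, h1, h2, h3, h4, h5, h6⟩ := G.step hk hi
    have hi' : i ∈ Icc (G.j k) (G.j (k + 1)) := ⟨hi.1, hi.2.le⟩
    have hi1 : i + 1 ∈ Icc (G.j k) (G.j (k + 1)) := ⟨hi.1.trans (Nat.le_succ i), hi.2⟩
    have hE : IsEuler S.quantizer.cubature (ℱ (G.t i)) P c T α V (G.t i) (G.h i) (X i) (Y i)
        (noise G W Γ i) :=
      ⟨(S.isNoise hk hi).1, hF.meas_X i hi', hF.meas_Y i hi, hXV i hi, hYV i hi, hV, h4, h1,
        h2.trans hδ1, by linarith, S.h0, S.one_le_Λ, S.one_le_α⟩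
    -- The input X was driven by its own backward component Y, so the consistency error involves the
    -- defect of Y, whereas the solution being compared with the field is Y'.
    have hcons := hE.bound_consistency S.h1 (ℱ.le 0) S.basis.atomless (X' := X (i + 1))
      (by rw [← euler_eq_path]; exact hF.step i hi) (Z := P[fun ω => (G.h i)⁻¹ •
        u.U (G.t i + G.h i) (X (i + 1) ω) (P.map (X (i + 1))) •
          (Real.sqrt (G.h i) • noise G W Γ i ω) | ℱ (G.t i)]) .rfl (ha i hi)
    rw [h6] at hcons
    have hcons' := hcons.mono (b := G.h i * (IsEuler.consistencyConst c P Λ α *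
        (a + Real.sqrt G.mesh * V ^ α))) (by gcongr)
    refine ((S.isBackward hk hstep hF hi).lpBound_sub (S.isNoise hk hi).1 S.h0 S.one_le_α
      S.Λ_nonneg h1 ((mul_le_mul_of_nonneg_right h2 S.Λ_nonneg).trans hδ) (hF.memLp_X i hi')
      (S.memLp_U' le_rfl (t_mem hk hi1) (hF.memLp_X _ hi1))
      (S.memLp_U' le_rfl (t_mem hk hi') (hF.memLp_X _ hi')) .rfl hcons' hx).mono (le_of_eq ?_)
    change _ = (1 + _ * G.h i) * x + _ * G.h i
    ring
  · refine he.congr ?_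
    filter_upwards [hstep.terminal_Y] with ω hω
    rw [hω]

/-- Growth of the backward component over one period. -/
theorem backward_growth (S : Setting P ℱ T W c u Γ Λ α) (hk : k < N) (hδ : T / N * Λ ≤ 1 / 4)
    (hF : IsForward P ℱ W c Γ G k ξ X Y) {X' Z' : ℕ → Ω → E d} {Y' : ℕ → Ω → ℝ} {η : Ω → ℝ}
    (hstep : IsStep P ℱ W c Γ G k X η c.f X' Y' Z') {M e : ℝ}
    (hM : ∀ x μ, IsP2 μ → |c.f x 0 0 (μ.map fun v => WithLp.toLp 2 (v, (0 : ℝ)))| ≤ M)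
    (he : LpBound (ENNReal.ofReal (2 * α)) P η e) (hi : i ∈ Icc (G.j k) (G.j (k + 1))) :
    LpBound (ENNReal.ofReal (2 * α)) P (Y' i)
      (Real.exp (backConst Λ * (T / N)) * (e + 2 * M * (T / N))) := by
  have hM0 : 0 ≤ M := (abs_nonneg _).trans (hM 0 _
    (isP2_map (hF.memLp_X (G.j k) ⟨le_rfl, (G.j_lt S.pos_T hk).le⟩)))
  refine gronwall_backward (Q := fun i x => LpBound (ENNReal.ofReal (2 * α)) P (Y' i) x)
    (t := G.t) S.backConst_nonneg
    (by positivity) he.nonneg (fun i x y h hxy => h.mono hxy) (G.j_lt S.pos_T hk).le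
    (fun i hi => t_le_succ hk hi) (G.length hk).le (fun i hi x _ hx => ?_)
    (he.congr hstep.terminal_Y.symm) hi
  obtain ⟨-, h1, h2, -⟩ := G.step hk hi
  refine ((S.isBackward hk hstep hF hi).lpBound (S.isNoise hk hi).1 S.h0 S.one_le_α
      S.Λ_nonneg h1 ((mul_le_mul_of_nonneg_right h2 S.Λ_nonneg).trans hδ)
      (hF.memLp_X i ⟨hi.1, hi.2.le⟩) hM hx).mono (le_of_eq ?_)
  change _ = (1 + _ * G.h i) * x + _ * G.h i
  ring

end Setting

end MKV
end

/-! ### One Picard iteration -/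

noncomputable section

namespace MKV

theorem exp_le_one_add_two_mul {x : ℝ} (h0 : 0 ≤ x) (h1 : x ≤ 1 / 2) :
    Real.exp x ≤ 1 + 2 * x := by
  refine (Real.exp_bound_div_one_sub_of_interval h0 (by linarith)).trans ?_
  rw [div_le_iff₀ (by linarith)]
  nlinarith

variable {Ω : Type*} {mΩ : MeasurableSpace Ω} {P : Measure Ω} [IsProbabilityMeasure P] {d : ℕ}
  {ℱ : Filtration ℝ mΩ} {T Λ α : ℝ} {W : ℝ → Ω → E d} {c : Coeffs d} {u : Field d}
  {Γ : E d → E d} {N k i : ℕ} {G : Grid T N}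

namespace Setting

variable {ξ : Ω → E d} {X X' Z' : ℕ → Ω → E d} {Y Y' : ℕ → Ω → ℝ} {η : Ω → ℝ}

/-- The constant of one Picard iteration. -/
def picardConst (c : Coeffs d) {mΩ : MeasurableSpace Ω} (P : Measure Ω) (Λ α : ℝ) : ℝ :=
  6 * Λ * forwardConst c P Λ α + 4 * backConst Λ + 12 * IsEuler.consistencyConst c P Λ α + 8 * Λ + 2

theorem consistencyConst_nonneg (S : Setting P ℱ T W c u Γ Λ α) :
    0 ≤ IsEuler.consistencyConst c P Λ α := by
  have h1 := S.Λ_nonneg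
  have h2 := Coeffs.bGrowth_nonneg (c := c) (P := P) h1
  unfold IsEuler.consistencyConst IsEuler.localConst IsEuler.gradConst IsEuler.speed
  positivity

theorem period_pos (S : Setting P ℱ T W c u Γ Λ α) (hk : k < N) : 0 < T / N :=
  div_pos S.pos_T (by exact_mod_cast (Nat.zero_le k).trans_lt hk)

/-- The consequences of the smallness of the period. -/
theorem small (S : Setting P ℱ T W c u Γ Λ α) {δ : ℝ} (hδ0 : 0 < δ)
    (hδ : picardConst c P Λ α * δ ≤ 1 / 2) :
    δ ≤ 1 ∧ δ * Λ ≤ 1 / 4 ∧ forwardConst c P Λ α * δ ≤ 1 / 2 ∧ backConst Λ * δ ≤ 1 / 2 ∧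
      4 * Λ * forwardConst c P Λ α * δ ≤ 1 := by
  have h1 := S.Λ_nonneg
  have h2 := forwardConst_nonneg (c := c) (P := P) S.Λ_nonneg S.one_le_α
  have h3 := S.backConst_nonneg
  have h4 := S.consistencyConst_nonneg
  have j1 : 0 ≤ Λ * forwardConst c P Λ α * δ := by positivity
  have j2 : 0 ≤ backConst Λ * δ := by positivity
  have j3 : 0 ≤ IsEuler.consistencyConst c P Λ α * δ := by positivity
  have j4 : 0 ≤ Λ * δ := by positivity
  have j5 : forwardConst c P Λ α * δ ≤ Λ * forwardConst c P Λ α * δ := by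
    have := S.one_le_Λ
    nlinarith [mul_nonneg h2 hδ0.le]
  unfold picardConst at hδ
  refine ⟨?_, ?_, ?_, ?_, ?_⟩ <;> nlinarith

/-- One Picard iteration. -/
theorem picard_step (S : Setting P ℱ T W c u Γ Λ α) (hk : k < N)
    (hδ : picardConst c P Λ α * (T / N) ≤ 1 / 2)
    (hF : IsForward P ℱ W c Γ G k ξ X Y) (hF' : IsForward P ℱ W c Γ G k ξ X' Y')
    (hstep : IsStep P ℱ W c Γ G k X η c.f X' Y' Z') (hξ : MemLp ξ (ENNReal.ofReal (2 * α)) P)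
    {V a e : ℝ} (hV : 1 ≤ V)
    (hX : ∀ i ∈ Icc (G.j k) (G.j (k + 1)), MemLp (X i) (ENNReal.ofReal (2 * α)) P)
    (hXV : ∀ i ∈ Ico (G.j k) (G.j (k + 1)), LpBound (ENNReal.ofReal (2 * α)) P (X i) V)
    (hYV : ∀ i ∈ Ico (G.j k) (G.j (k + 1)), LpBound (ENNReal.ofReal (2 * α)) P (Y i) V)
    (ha : ∀ i ∈ Ico (G.j k) (G.j (k + 1)), LpBound (ENNReal.ofReal (2 * α)) P
      (fun ω => Y i ω - u.U (G.t i) (X i ω) (P.map (X i))) a) (ha0 : 0 ≤ a)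
    (he : LpBound (ENNReal.ofReal (2 * α)) P (fun ω => η ω - u.U (G.t (G.j (k + 1)))
      (X (G.j (k + 1)) ω) (P.map (X (G.j (k + 1))))) e) :
    (∀ i ∈ Icc (G.j k) (G.j (k + 1)), LpBound (ENNReal.ofReal (2 * α)) P
      (fun ω => Y' i ω - u.U (G.t i) (X i ω) (P.map (X i)))
      ((1 + picardConst c P Λ α * (T / N)) * e
        + picardConst c P Λ α * (T / N) * (a + Real.sqrt G.mesh * V ^ α))) ∧
    (∀ i ∈ Ico (G.j k) (G.j (k + 1)), LpBound (ENNReal.ofReal (2 * α)) P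
      (fun ω => Y' i ω - u.U (G.t i) (X' i ω) (P.map (X' i)))
      ((1 + picardConst c P Λ α * (T / N)) * e
        + picardConst c P Λ α * (T / N) * (a + Real.sqrt G.mesh * V ^ α))) ∧
    (∀ i ∈ Icc (G.j k) (G.j (k + 1)), MemLp (X' i) (ENNReal.ofReal (2 * α)) P) := by
  have hδ0 := S.period_pos hk
  obtain ⟨k1, k2, k3, k4, k5⟩ := S.small hδ0 hδ
  have h1 := S.Λ_nonneg
  have h2 := forwardConst_nonneg (c := c) (P := P) S.Λ_nonneg S.one_le_α
  have h3 := S.backConst_nonneg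
  have h4 := S.consistencyConst_nonneg
  have he0 := he.nonneg
  have hs0 : 0 ≤ Real.sqrt G.mesh * V ^ α := by positivity
  set s := Real.sqrt G.mesh * V ^ α
  set δ := T / N
  set Cf := forwardConst c P Λ α
  set Cb := backConst Λ
  set Cc := IsEuler.consistencyConst c P Λ α
  have x1 := exp_le_one_add_two_mul (by positivity : 0 ≤ Cb * δ) k4
  have x2 := exp_le_one_add_two_mul (by positivity : 0 ≤ Cf * δ) k3
  have hκ0 : 0 ≤ 2 * (Cc * (a + s)) * δ := by positivity
  set e1 := (1 + 2 * (Cb * δ)) * e + 2 * (2 * (Cc * (a + s)) * δ) with he1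
  have he10 : 0 ≤ e1 := by positivity
  -- Error of the new backward component along the old forward component: the old defect a comes
  -- with a factor of order δ.
  have b1 : ∀ i ∈ Icc (G.j k) (G.j (k + 1)), LpBound (ENNReal.ofReal (2 * α)) P
      (fun ω => Y' i ω - u.U (G.t i) (X i ω) (P.map (X i))) e1 := by
    intro i hi
    refine (S.backward_error hk k1 k2 hF hstep hV hXV hYV ha ha0 he hi).mono ?_
    have i1 := mul_le_mul_of_nonneg_right x1 (add_nonneg he0 hκ0)
    have i2 : (1 + 2 * (Cb * δ)) * (2 * (Cc * (a + s)) * δ) ≤ 2 * (2 * (Cc * (a + s)) * δ) :=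
      mul_le_mul_of_nonneg_right (by linarith) hκ0
    refine i1.trans ?_
    rw [he1, mul_add]
    linarith
  have hK := Field.growth_nonneg (u := u) (P := P) (T := T) S.Λ_nonneg
  -- This bound is qualitative: it only serves to know that Y', and hence the new forward component,
  -- lies in L^{2α}.
  have bY' : ∀ i ∈ Ico (G.j k) (G.j (k + 1)), LpBound (ENNReal.ofReal (2 * α)) P (Y' i)
      (e1 + u.growth P T Λ * (3 * (1 + V))) := by
    intro i hi
    have hi' : i ∈ Icc (G.j k) (G.j (k + 1)) := ⟨hi.1, hi.2.le⟩
    have i1 := (b1 i hi').add S.one_le_p (S.lpBound_U (t_mem hk hi') (hX i hi'))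
    simp only [sub_add_cancel] at i1
    refine i1.mono (add_le_add le_rfl (mul_le_mul_of_nonneg_left ?_ hK))
    have := bracket_le (P := P) (α := α) (X i)
    have := (hXV i hi).2
    linarith
  have hX' : ∀ i ∈ Icc (G.j k) (G.j (k + 1)), MemLp (X' i) (ENNReal.ofReal (2 * α)) P :=
    fun i hi => (S.forward_growth hk hF' hξ (by positivity) bY' hi).1
  -- Passing from the old forward component to the new one costs 4ΛCδ times the change of the
  -- backward component, itself at most e1 + a. The smallness of 4ΛCδ keeps the products of two
  -- factors of order δ linear in δ.
  have fin : e1 + 4 * Λ * Cf * δ * (e1 + a) ≤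
      (1 + picardConst c P Λ α * δ) * e + picardConst c P Λ α * δ * (a + s) := by
    have j0 : 0 ≤ 4 * Λ * Cf * δ := by positivity
    have j1 : 4 * Λ * Cf * δ * ((1 + 2 * (Cb * δ)) * e) ≤
        4 * Λ * Cf * δ * e + 2 * (Cb * δ) * e := by
      have : 4 * Λ * Cf * δ * (2 * (Cb * δ) * e) ≤ 1 * (2 * (Cb * δ) * e) := by gcongr
      linarith
    have j2 : 4 * Λ * Cf * δ * (2 * (2 * (Cc * (a + s)) * δ)) ≤
        1 * (2 * (2 * (Cc * (a + s)) * δ)) := by gcongr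
    have j3 : 0 ≤ Λ * Cf * δ * e := by positivity
    have j4 : 0 ≤ Λ * Cf * δ * a := by positivity
    have j5 : 0 ≤ Λ * Cf * δ * s := by positivity
    have j6 : 0 ≤ Cb * δ * a := by positivity
    have j7 : 0 ≤ Cb * δ * s := by positivity
    have j8 : 0 ≤ Cc * δ * e := by positivity
    have j9 : 0 ≤ Cc * δ * a := by positivity
    have j10 : 0 ≤ Cc * δ * s := by positivity
    have j11 : 0 ≤ Λ * δ * e := by positivity
    have j12 : 0 ≤ Λ * δ * a := by positivity
    have j13 : 0 ≤ Λ * δ * s := by positivity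
    have j14 : 0 ≤ δ * e := by positivity
    have j15 : 0 ≤ δ * a := by positivity
    have j16 : 0 ≤ δ * s := by positivity
    have eq1 : picardConst c P Λ α = 6 * Λ * Cf + 4 * Cb + 12 * Cc + 8 * Λ + 2 := rfl
    rw [eq1, he1]
    nlinarith
  have fin1 : e1 ≤ (1 + picardConst c P Λ α * δ) * e + picardConst c P Λ α * δ * (a + s) :=
    le_trans (le_add_of_nonneg_right (by positivity)) fin
  refine ⟨fun i hi => (b1 i hi).mono fin1, fun i hi => ?_, hX'⟩
  have hi' : i ∈ Icc (G.j k) (G.j (k + 1)) := ⟨hi.1, hi.2.le⟩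
  -- Both backward components are compared with the field along the same X; their difference drives
  -- the difference of the forward components.
  have hΔY : ∀ i ∈ Ico (G.j k) (G.j (k + 1)),
      LpBound (ENNReal.ofReal (2 * α)) P (fun ω => Y i ω - Y' i ω) (e1 + a) := by
    intro i hi
    refine LpBound.congr (((ha i hi).sub S.one_le_p (b1 i ⟨hi.1, hi.2.le⟩)).mono (by linarith))
      (.of_forall fun ω => ?_)
    simp only []
    ring
  have hΔX := S.forward_stability hk hF hF' hX hX' (fun i hi => (hYV i hi).1)
    (fun i hi => (bY' i hi).1) (by positivity) hΔY hi'
  have hΔU := S.lpBound_U_sub (t_mem hk hi') (hX i hi') (hX' i hi') hΔX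
  refine LpBound.congr (((b1 i hi').add S.one_le_p hΔU).mono (le_trans ?_ fin))
    (.of_forall fun ω => ?_)
  · have : Real.exp (Cf * δ) * (0 + Cf * (e1 + a) * δ) ≤ 2 * (Cf * (e1 + a) * δ) := by
      rw [zero_add]
      exact mul_le_mul_of_nonneg_right (by linarith) (by positivity)
    have := mul_le_mul_of_nonneg_left this (by positivity : 0 ≤ 2 * Λ)
    linarith
  · simp only []
    ring

end Setting

end MKV
end

/-! ### The Picard iterations over one period -/

noncomputable section

namespace MKV

variable {Ω : Type*} {mΩ : MeasurableSpace Ω} {P : Measure Ω} [IsProbabilityMeasure P] {d : ℕ}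
  {ℱ : Filtration ℝ mΩ} {T Λ α : ℝ} {W : ℝ → Ω → E d} {c : Coeffs d} {u : Field d}
  {Γ : E d → E d} {N J k i : ℕ} {G : Grid T N} {ξ : Ω → E d} {v : Ω → ℝ}

/-- The Picard iterations of the full solver over one period; `η q` is the terminal condition of
the iteration `q + 1`. -/
structure IsLevel (P : Measure Ω) (ℱ : Filtration ℝ mΩ) (W : ℝ → Ω → E d) (c : Coeffs d)
    (Γ : E d → E d) {T : ℝ} {N : ℕ} (G : Grid T N) (J k : ℕ) (ξ : Ω → E d)
    (X : ℕ → ℕ → Ω → E d) (Y : ℕ → ℕ → Ω → ℝ) (Z : ℕ → ℕ → Ω → E d) (η : ℕ → Ω → ℝ) : Prop where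
  zero : IsStep P ℱ W c Γ G k (fun _ => ξ) 0 (fun _ _ _ _ => 0) (X 0) (Y 0) (Z 0)
  step : ∀ q < J, IsStep P ℱ W c Γ G k (X q) (η q) c.f (X (q + 1)) (Y (q + 1)) (Z (q + 1))
  sol : ∀ q < J, IsSol P ℱ W c Γ G J (k + 1) (X q (G.j (k + 1))) (η q)

theorem isSol_top_iff :
    IsSol P ℱ W c Γ G J N ξ v ↔ v =ᵐ[P] fun ω => c.g (ξ ω) (P.map ξ) := by
  simp only [IsSol, Nat.sub_self, IsSolFrom]

/-- One unfolding of the recursion, where the terminal conditions of all the iterations are chosen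
at once as a sequence. -/
theorem isSol_iff (hk : k < N) :
    IsSol P ℱ W c Γ G J k ξ v ↔ ∃ X Y Z η,
      IsLevel P ℱ W c Γ G J k ξ X Y Z η ∧ v =ᵐ[P] Y J (G.j k) := by
  have e1 : N - k = (N - (k + 1)) + 1 := by omega
  have e2 : N - (N - (k + 1) + 1) = k := by omega
  unfold IsSol
  rw [e1, IsSolFrom]
  simp only [e2]
  constructor
  · rintro ⟨X, Y, Z, h0, hs, hv⟩
    have : ∀ q, ∃ η, q < J → IsSolFrom P ℱ W c Γ G J (N - (k + 1)) (X q (G.j (k + 1))) η ∧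
        IsStep P ℱ W c Γ G k (X q) η c.f (X (q + 1)) (Y (q + 1)) (Z (q + 1)) := by
      intro q
      by_cases hq : q < J
      · obtain ⟨η, h⟩ := hs q hq
        exact ⟨η, fun _ => h⟩
      · exact ⟨0, fun h => absurd h hq⟩
    choose η hη using this
    exact ⟨X, Y, Z, η, ⟨h0, fun q hq => (hη q hq).2, fun q hq => (hη q hq).1⟩, hv⟩
  · rintro ⟨X, Y, Z, η, h, hv⟩
    exact ⟨X, Y, Z, h.zero, fun q hq => ⟨η q, h.sol q hq, h.step q hq⟩, hv⟩

namespace Setting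

variable {X Z : ℕ → ℕ → Ω → E d} {Y : ℕ → ℕ → Ω → ℝ} {η : ℕ → Ω → ℝ}

theorem isForward_level (S : Setting P ℱ T W c u Γ Λ α) (hk : k < N)
    (hξm : StronglyMeasurable[ℱ (k * (T / N))] ξ) (hξ : MemLp ξ 2 P)
    (h : IsLevel P ℱ W c Γ G J k ξ X Y Z η) {q : ℕ} (hq : q ≤ J) :
    IsForward P ℱ W c Γ G k ξ (X q) (Y q) := by
  induction q with
  | zero => exact S.isForward hk hξm hξ h.zero .rfl
  | succ q ih => exact S.isForward hk hξm hξ (h.step q hq) (ih (by omega)).initial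

theorem meas_end (S : Setting P ℱ T W c u Γ Λ α) (hk : k < N) {X : ℕ → Ω → E d} {Y : ℕ → Ω → ℝ}
    (hF : IsForward P ℱ W c Γ G k ξ X Y) :
    StronglyMeasurable[ℱ ((k + 1 : ℕ) * (T / N))] (X (G.j (k + 1))) ∧
      MemLp (X (G.j (k + 1))) 2 P := by
  have hj := (G.j_lt S.pos_T hk).le
  refine ⟨?_, hF.memLp_X _ ⟨hj, le_rfl⟩⟩
  rw [← G.t_j (k + 1) hk]
  exact hF.meas_X _ ⟨hj, le_rfl⟩

theorem memLp_g (S : Setting P ℱ T W c u Γ Λ α) {p : ℝ≥0∞} (hp : 2 ≤ p) (hξ : MemLp ξ p P) :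
    MemLp (fun ω => c.g (ξ ω) (P.map ξ)) p P := by
  have h2 := isP2_map (hξ.mono_exponent hp)
  have := S.memLp_U' hp ⟨S.pos_T.le, le_rfl⟩ hξ
  simpa only [S.h1.classical.terminal _ _ h2] using this

/-- Existence of an output of the full solver. -/
theorem exists_isSol (S : Setting P ℱ T W c u Γ Λ α) (hδ : T / N * Λ ≤ 1 / 4) (J : ℕ) {l : ℕ} :
    ∀ k ξ, k + l = N → StronglyMeasurable[ℱ (k * (T / N))] ξ → MemLp ξ 2 P →
      ∃ v, IsSol P ℱ W c Γ G J k ξ v ∧ MemLp v 2 P := by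
  induction l with
  | zero =>
    intro k ξ hk _ hξ
    obtain rfl : k = N := hk
    exact ⟨_, isSol_top_iff.2 .rfl, S.memLp_g le_rfl hξ⟩
  | succ l ih =>
    intro k ξ hkl hξm hξ
    have hk : k < N := by omega
    have hj := (G.j_lt S.pos_T hk).le
    -- A run is bundled with the adaptedness of its forward component, which is what the solver at
    -- the next level requires of its input; choice then iterates the map from one run to the next.
    let R := {r : (ℕ → Ω → E d) × (ℕ → Ω → ℝ) × (ℕ → Ω → E d) //
      IsForward P ℱ W c Γ G k ξ r.1 r.2.1}
    have hex : ∀ r : R, ∃ (r' : R) (η : Ω → ℝ),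
        IsSol P ℱ W c Γ G J (k + 1) (r.1.1 (G.j (k + 1))) η ∧
        IsStep P ℱ W c Γ G k r.1.1 η c.f r'.1.1 r'.1.2.1 r'.1.2.2 := by
      rintro ⟨⟨X, Y, Z⟩, hF⟩
      obtain ⟨m1, m2⟩ := S.meas_end hk hF
      obtain ⟨η, hη, hη2⟩ := ih (k + 1) _ (by omega) m1 m2
      obtain ⟨X', Y', Z', h'⟩ := S.exists_step hk hδ hF.memLp_X hη2
      exact ⟨⟨⟨X', Y', Z'⟩, S.isForward hk hξm hξ h' hF.initial⟩, η, hη, h'⟩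
    choose Φ η hη hΦ using hex
    obtain ⟨X₀, Y₀, Z₀, h₀⟩ := exists_step_zero (P := P) (ℱ := ℱ) (c := c) (W := W) (Γ := Γ) G k ξ
    let r : ℕ → R := fun q => Nat.rec ⟨⟨X₀, Y₀, Z₀⟩, S.isForward hk hξm hξ h₀ .rfl⟩
      (fun _ r => Φ r) q
    refine ⟨(r J).1.2.1 (G.j k), (isSol_iff hk).2 ⟨fun q => (r q).1.1, fun q => (r q).1.2.1,
      fun q => (r q).1.2.2, fun q => η (r q), ⟨h₀, fun q _ => hΦ (r q), fun q _ => hη (r q)⟩, .rfl⟩,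
      (r J).2.memLp_Y _ ⟨le_rfl, hj⟩⟩

theorem initial_error (hk : k < N) {X : ℕ → Ω → E d}
    {Y : ℕ → Ω → ℝ} (hF : IsForward P ℱ W c Γ G k ξ X Y) {y : Ω → ℝ} {a : ℝ}
    (h : LpBound (ENNReal.ofReal (2 * α)) P
      (fun ω => y ω - u.U (G.t (G.j k)) (X (G.j k) ω) (P.map (X (G.j k)))) a) :
    LpBound (ENNReal.ofReal (2 * α)) P
      (fun ω => y ω - u.U (k * (T / N)) (ξ ω) (P.map ξ)) a := by
  rw [G.t_j k hk.le, Measure.map_congr hF.initial] at h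
  refine h.congr ?_
  filter_upwards [hF.initial] with ω hω
  rw [hω]

theorem picardConst_nonneg (S : Setting P ℱ T W c u Γ Λ α) : 0 ≤ picardConst c P Λ α := by
  have h1 := S.Λ_nonneg
  have h2 := forwardConst_nonneg (c := c) (P := P) S.Λ_nonneg S.one_le_α
  have h3 := S.backConst_nonneg
  have h4 := S.consistencyConst_nonneg
  unfold picardConst
  positivity

/-- The error of the solver over one period. -/
theorem level_error (S : Setting P ℱ T W c u Γ Λ α) (hk : k < N)
    (hδ : picardConst c P Λ α * (T / N) ≤ 1 / 2) (hJ : 1 ≤ J)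
    (hξm : StronglyMeasurable[ℱ (k * (T / N))] ξ)
    (hξ : MemLp ξ (ENNReal.ofReal (2 * α)) P) (h : IsLevel P ℱ W c Γ G J k ξ X Y Z η)
    {V a e : ℝ} (hV : 1 ≤ V) (ha0 : 0 ≤ a) (he0 : 0 ≤ e)
    (hX : ∀ q < J, ∀ i ∈ Icc (G.j k) (G.j (k + 1)), MemLp (X q i) (ENNReal.ofReal (2 * α)) P)
    (hXV : ∀ q < J, ∀ i ∈ Ico (G.j k) (G.j (k + 1)),
      LpBound (ENNReal.ofReal (2 * α)) P (X q i) V)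
    (hYV : ∀ q < J, ∀ i ∈ Ico (G.j k) (G.j (k + 1)),
      LpBound (ENNReal.ofReal (2 * α)) P (Y q i) V)
    (ha : ∀ i ∈ Ico (G.j k) (G.j (k + 1)), LpBound (ENNReal.ofReal (2 * α)) P
      (fun ω => Y 0 i ω - u.U (G.t i) (X 0 i ω) (P.map (X 0 i))) a)
    (he : ∀ q < J, LpBound (ENNReal.ofReal (2 * α)) P (fun ω => η q ω - u.U ((k + 1 : ℕ) * (T / N))
      (X q (G.j (k + 1)) ω) (P.map (X q (G.j (k + 1))))) e) :
    LpBound (ENNReal.ofReal (2 * α)) P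
      (fun ω => Y J (G.j k) ω - u.U (k * (T / N)) (ξ ω) (P.map ξ))
      ((1 + 4 * (picardConst c P Λ α * (T / N))) * e
        + 2 * (picardConst c P Λ α * (T / N)) * (Real.sqrt G.mesh * V ^ α)
        + (picardConst c P Λ α * (T / N)) ^ J * a) := by
  have hj := G.j_lt S.pos_T hk
  have hξ2 := hξ.mono_exponent S.two_le_p
  have hC := S.picardConst_nonneg
  have hδ0 := S.period_pos hk
  have hθ0 : 0 ≤ picardConst c P Λ α * (T / N) := by positivity
  have hs0 : 0 ≤ Real.sqrt G.mesh * V ^ α := by positivity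
  have hstep := fun q (hq : q < J) {a : ℝ} (ha0 : 0 ≤ a)
    (ha : ∀ i ∈ Ico (G.j k) (G.j (k + 1)), LpBound (ENNReal.ofReal (2 * α)) P
      (fun ω => Y q i ω - u.U (G.t i) (X q i ω) (P.map (X q i))) a) =>
    S.picard_step hk hδ (S.isForward_level hk hξm hξ2 h hq.le)
      (S.isForward_level hk hξm hξ2 h hq) (h.step q hq) hξ hV (hX q hq) (hXV q hq) (hYV q hq) ha ha0
      (e := e) (by rw [G.t_j (k + 1) hk]; exact he q hq)
  set s := Real.sqrt G.mesh * V ^ α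
  set θ := picardConst c P Λ α * (T / N)
  set D := (1 + θ) * e + θ * s with hD
  have hD0 : 0 ≤ D := by positivity
  -- Iterating a ↦ D + θa: the geometric series stays below 1 + 2θ as θ ≤ 1/2, and the initial
  -- defect is damped by θ^q.
  have key : ∀ q < J, ∀ i ∈ Ico (G.j k) (G.j (k + 1)), LpBound (ENNReal.ofReal (2 * α)) P
      (fun ω => Y q i ω - u.U (G.t i) (X q i ω) (P.map (X q i))) (D * (1 + 2 * θ) + θ ^ q * a) := by
    intro q
    induction q with
    | zero =>
      intro _ i hi
      refine (ha i hi).mono ?_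
      have : 0 ≤ D * (1 + 2 * θ) := by positivity
      rw [pow_zero]
      linarith
    | succ q ih =>
      intro hq i hi
      refine ((hstep q (by omega) (by positivity) (ih (by omega))).2.1 i hi).mono ?_
      have : θ * D * θ ≤ θ * D * (1 / 2) := mul_le_mul_of_nonneg_left hδ (by positivity)
      rw [pow_succ]
      nlinarith
  -- The last iteration is treated apart: its estimate along its input suffices, as all iterations
  -- share the initial value ξ at r_k.
  obtain ⟨q, rfl⟩ : ∃ q, J = q + 1 := ⟨J - 1, by omega⟩
  have fin := (hstep q (by omega) (by positivity) (key q (by omega))).1 (G.j k) ⟨le_rfl, hj.le⟩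
  refine (initial_error hk (S.isForward_level hk hξm hξ2 h (q := q) (by omega)) fin).mono ?_
  have h1 : θ * D * θ ≤ θ * D * (1 / 2) := mul_le_mul_of_nonneg_left hδ (by positivity)
  have h2 : θ * e * θ ≤ θ * e * (1 / 2) := mul_le_mul_of_nonneg_left hδ (by positivity)
  have h3 : θ * s * θ ≤ θ * s * (1 / 2) := mul_le_mul_of_nonneg_left hδ (by positivity)
  have h4 : D * (1 + 2 * θ) ≤ (1 + 4 * θ) * e + 2 * θ * s := by
    rw [hD]
    nlinarith
  rw [pow_succ]
  nlinarith

end Setting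

end MKV
end

/-! ### Amplification over the levels and a priori bounds -/

noncomputable section

namespace MKV

/-- The solution of an arithmetico-geometric recursion. -/
def amplification (x : ℝ) (l : ℕ) : ℝ := Real.exp (x * l) * l

theorem amplification_nonneg (x : ℝ) (l : ℕ) : 0 ≤ amplification x l := by
  unfold amplification
  positivity

/-- One level: multiply by at most 1 + x ≤ eˣ and add one unit, which is also at most the new
exponential. -/
theorem amplification_succ {x y : ℝ} (hx : 0 ≤ x) (hy : y ≤ 1 + x) (l : ℕ) :
    y * amplification x l + 1 ≤ amplification x (l + 1) := by
  have e : Real.exp (x * (l + 1 : ℕ)) = Real.exp (x * l) * Real.exp x := by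
    rw [← Real.exp_add]
    push_cast
    ring_nf
  have h1 : (1 : ℝ) ≤ Real.exp (x * l) := Real.one_le_exp (by positivity)
  have h2 : y ≤ Real.exp x := hy.trans (by linarith [Real.add_one_le_exp x])
  have h3 : 1 ≤ Real.exp x := Real.one_le_exp hx
  unfold amplification
  rw [e]
  push_cast
  have h4 : (1 : ℝ) ≤ Real.exp (x * l) * Real.exp x := one_le_mul_of_one_le_of_one_le h1 h3
  have h5 : y * (Real.exp (x * l) * l) ≤ Real.exp x * (Real.exp (x * l) * l) := by gcongr
  linarith

theorem amplification_mono {x : ℝ} (hx : 0 ≤ x) {l n : ℕ} (h : l ≤ n) :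
    amplification x l ≤ amplification x n := by
  unfold amplification
  gcongr

variable {Ω : Type*} {mΩ : MeasurableSpace Ω} {P : Measure Ω} [IsProbabilityMeasure P] {d : ℕ}
  {ℱ : Filtration ℝ mΩ} {T Λ α : ℝ} {W : ℝ → Ω → E d} {c : Coeffs d} {u : Field d}
  {Γ : E d → E d} {N J k i : ℕ} {G : Grid T N} {ξ : Ω → E d} {v : Ω → ℝ}

namespace Setting

variable {X Z : ℕ → ℕ → Ω → E d} {Y : ℕ → ℕ → Ω → ℝ} {η : ℕ → Ω → ℝ}

theorem lpBound_Y_zero (h : IsLevel P ℱ W c Γ G J k ξ X Y Z η) {p : ℝ≥0∞} {y : ℝ}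
    (hy : 0 ≤ y) (hi : i ∈ Icc (G.j k) (G.j (k + 1))) : LpBound p P (Y 0 i) y :=
  LpBound.congr ⟨MemLp.zero', (lpNorm_zero _ _).le.trans hy⟩ (Y_eq_zero h.zero hi).symm

/-- The bound on the solver when the data are bounded by `M`. -/
def solBound (Λ M δ : ℝ) (l : ℕ) : ℝ :=
  Real.exp (backConst Λ * (δ * l)) * (M + 2 * M * (δ * l))

theorem solBound_nonneg (S : Setting P ℱ T W c u Γ Λ α) {M δ : ℝ} (hM : 0 ≤ M) (hδ : 0 ≤ δ)
    (l : ℕ) : 0 ≤ solBound Λ M δ l := by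
  have := S.backConst_nonneg
  unfold solBound
  positivity

theorem solBound_mono (S : Setting P ℱ T W c u Γ Λ α) {M δ : ℝ} (hM : 0 ≤ M) (hδ : 0 ≤ δ)
    {l n : ℕ} (h : l ≤ n) : solBound Λ M δ l ≤ solBound Λ M δ n := by
  have := S.backConst_nonneg
  unfold solBound
  gcongr

/-- The explicit bound is stable under the growth estimate of one period: exponents add up, and the
new source term is placed under the accumulated exponential. -/
theorem solBound_succ (S : Setting P ℱ T W c u Γ Λ α) {M δ : ℝ} (hM : 0 ≤ M) (hδ : 0 ≤ δ)
    (l : ℕ) : Real.exp (backConst Λ * δ) * (solBound Λ M δ l + 2 * M * δ) ≤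
      solBound Λ M δ (l + 1) := by
  have hC := S.backConst_nonneg
  have e : Real.exp (backConst Λ * (δ * (l + 1 : ℕ))) =
      Real.exp (backConst Λ * (δ * l)) * Real.exp (backConst Λ * δ) := by
    rw [← Real.exp_add]
    push_cast
    ring_nf
  have h1 : (1 : ℝ) ≤ Real.exp (backConst Λ * (δ * l)) := Real.one_le_exp (by positivity)
  unfold solBound
  rw [e]
  push_cast
  have h2 : Real.exp (backConst Λ * δ) * (2 * M * δ) ≤
      Real.exp (backConst Λ * (δ * l)) * (Real.exp (backConst Λ * δ) * (2 * M * δ)) :=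
    le_mul_of_one_le_left (by positivity) h1
  linarith

/-- The solver is bounded in `Lᵖ` when the data are bounded. -/
theorem sol_growth (S : Setting P ℱ T W c u Γ Λ α) (hδ : T / N * Λ ≤ 1 / 4) (hJ : 1 ≤ J) {M : ℝ}
    (hM : ∀ x μ, IsP2 μ → |c.g x μ| ≤ M ∧
      |c.f x 0 0 (μ.map fun v => WithLp.toLp 2 (v, (0 : ℝ)))| ≤ M) {l : ℕ} :
    ∀ k ξ v, k + l = N → StronglyMeasurable[ℱ (k * (T / N))] ξ → MemLp ξ 2 P →
      IsSol P ℱ W c Γ G J k ξ v →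
      LpBound (ENNReal.ofReal (2 * α)) P v (solBound Λ M (T / N) l) := by
  have hp0 : ENNReal.ofReal (2 * α) ≠ 0 := (zero_lt_one.trans_le S.one_le_p).ne'
  induction l with
  | zero =>
    intro k ξ v hk _ hξ hv
    obtain rfl : k = N := hk
    have hM0 : 0 ≤ M := (abs_nonneg _).trans (hM 0 _ (isP2_map hξ)).1
    have e : solBound Λ M (T / k) 0 = M := by simp [solBound]
    rw [e]
    refine ((LpBound.const hp0 hM0).of_le (S.memLp_g le_rfl hξ).1
      (.of_forall fun ω => ?_)).congr (isSol_top_iff.1 hv).symm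
    exact (hM _ _ (isP2_map hξ)).1
  | succ l ih =>
    intro k ξ v hkl hξm hξ hv
    have hk : k < N := by omega
    have hM0 : 0 ≤ M := (abs_nonneg _).trans (hM 0 _ (isP2_map hξ)).1
    obtain ⟨X, Y, Z, η, h, hv⟩ := (isSol_iff hk).1 hv
    obtain ⟨q, rfl⟩ : ∃ q, J = q + 1 := ⟨J - 1, by omega⟩
    have hF := S.isForward_level hk hξm hξ h (q := q) (by omega)
    obtain ⟨m1, m2⟩ := S.meas_end hk hF
    have hη := ih (k + 1) _ _ (by omega) m1 m2 (h.sol q (by omega))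
    exact ((S.backward_growth hk hδ hF (h.step q (by omega)) (fun x μ hμ => (hM x μ hμ).2) hη
      ⟨le_rfl, (G.j_lt S.pos_T hk).le⟩).mono (S.solBound_succ hM0 (S.period_pos hk).le l)).congr
      hv.symm

/-- The backward components are bounded in `Lᵖ` when the data are bounded. -/
theorem level_growth (S : Setting P ℱ T W c u Γ Λ α) (hδ : T / N * Λ ≤ 1 / 4) (hJ : 1 ≤ J) {M : ℝ}
    (hM : ∀ x μ, IsP2 μ → |c.g x μ| ≤ M ∧
      |c.f x 0 0 (μ.map fun v => WithLp.toLp 2 (v, (0 : ℝ)))| ≤ M)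
    (hk : k < N) (hξm : StronglyMeasurable[ℱ (k * (T / N))] ξ) (hξ : MemLp ξ 2 P)
    (h : IsLevel P ℱ W c Γ G J k ξ X Y Z η) {q : ℕ} (hq : q ≤ J)
    (hi : i ∈ Icc (G.j k) (G.j (k + 1))) :
    LpBound (ENNReal.ofReal (2 * α)) P (Y q i) (solBound Λ M (T / N) N) := by
  have hM0 : 0 ≤ M := (abs_nonneg _).trans (hM 0 _ (isP2_map hξ)).1
  have hδ0 := S.period_pos hk
  cases q with
  | zero => exact lpBound_Y_zero h (S.solBound_nonneg hM0 hδ0.le N) hi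
  | succ q =>
    have hF := S.isForward_level hk hξm hξ h (q := q) (by omega)
    obtain ⟨m1, m2⟩ := S.meas_end hk hF
    have hη := S.sol_growth hδ hJ hM (k + 1) (l := N - (k + 1)) _ _ (by omega) m1 m2
      (h.sol q (by omega))
    exact (S.backward_growth hk hδ hF (h.step q (by omega)) (fun x μ hμ => (hM x μ hμ).2) hη
      hi).mono ((S.solBound_succ hM0 hδ0.le _).trans (S.solBound_mono hM0 hδ0.le (by omega)))

/-- The growth constant of the forward components whose backward components are of order `m`. -/
def spread (c : Coeffs d) {mΩ : MeasurableSpace Ω} (P : Measure Ω) (Λ α m : ℝ) : ℝ :=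
  2 * forwardConst c P Λ α * (1 + m)

theorem spread_nonneg (S : Setting P ℱ T W c u Γ Λ α) {m : ℝ} (hm : 0 ≤ m) :
    0 ≤ spread c P Λ α m := by
  have h2 := forwardConst_nonneg (c := c) (P := P) S.Λ_nonneg S.one_le_α
  unfold spread
  positivity

/-- The relative growth over one period is 1 + O(δ), not merely bounded: the error is proportional
to a power of the bracket and this factor is compounded over N levels. The cruder bound with 2 + m
supplies V. -/
theorem forward_bracket (S : Setting P ℱ T W c u Γ Λ α) (hk : k < N)
    (hδ : picardConst c P Λ α * (T / N) ≤ 1 / 2) {X : ℕ → Ω → E d} {Y : ℕ → Ω → ℝ}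
    (hF : IsForward P ℱ W c Γ G k ξ X Y) (hξ : MemLp ξ (ENNReal.ofReal (2 * α)) P) {m : ℝ}
    (hm : 0 ≤ m) (hY : ∀ i ∈ Ico (G.j k) (G.j (k + 1)),
      LpBound (ENNReal.ofReal (2 * α)) P (Y i) (m * bracket P α ξ))
    (hi : i ∈ Icc (G.j k) (G.j (k + 1))) :
    MemLp (X i) (ENNReal.ofReal (2 * α)) P ∧
      bracket P α (X i) ≤ (1 + spread c P Λ α m * (T / N)) * bracket P α ξ ∧
      LpBound (ENNReal.ofReal (2 * α)) P (X i) ((2 + m) * bracket P α ξ) := by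
  have hb := one_le_bracket (P := P) (α := α) ξ
  have h2 := forwardConst_nonneg (c := c) (P := P) S.Λ_nonneg S.one_le_α
  have hδ0 := S.period_pos hk
  obtain ⟨-, -, k3, -⟩ := S.small hδ0 hδ
  obtain ⟨h3, h4⟩ := S.forward_growth hk hF hξ (by positivity) hY hi
  have x2 := exp_le_one_add_two_mul (by positivity) k3
  set θ := forwardConst c P Λ α * (T / N) with hθ
  have hθ0 : 0 ≤ θ := by positivity
  have h5 : bracket P α ξ + forwardConst c P Λ α * (m * bracket P α ξ) * (T / N) =
      (1 + θ * m) * bracket P α ξ := by rw [hθ]; ring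
  have e : spread c P Λ α m * (T / N) = 2 * θ * (1 + m) := by rw [hθ, spread]; ring
  rw [h5] at h4
  have j1 : Real.exp θ * (1 + θ * m) ≤ 1 + 2 * θ * (1 + m) := by
    refine (mul_le_mul_of_nonneg_right x2 (by positivity)).trans ?_
    have : θ * m * θ ≤ θ * m * (1 / 2) := mul_le_mul_of_nonneg_left k3 (by positivity)
    linarith
  have j2 : bracket P α (X i) ≤ (1 + 2 * θ * (1 + m)) * bracket P α ξ := by
    refine h4.trans ?_
    rw [← mul_assoc]
    exact mul_le_mul_of_nonneg_right j1 (by positivity)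
  rw [e]
  refine ⟨h3, j2, (LpBound.of_memLp h3).mono ((lpNorm_le_bracket (X i)).trans (j2.trans ?_))⟩
  refine mul_le_mul_of_nonneg_right ?_ (by positivity)
  nlinarith

end Setting

end MKV
end

/-! ### The error for bounded data -/

noncomputable section

namespace MKV

variable {Ω : Type*} {mΩ : MeasurableSpace Ω} {P : Measure Ω} [IsProbabilityMeasure P] {d : ℕ}
  {ℱ : Filtration ℝ mΩ} {T Λ α : ℝ} {W : ℝ → Ω → E d} {c : Coeffs d} {u : Field d}
  {Γ : E d → E d} {N J k i : ℕ} {G : Grid T N} {ξ : Ω → E d} {v : Ω → ℝ}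

namespace Setting

variable {X Z : ℕ → ℕ → Ω → E d} {Y : ℕ → ℕ → Ω → ℝ} {η : ℕ → Ω → ℝ}

/-- The output of the solver is exact at the final time. -/
theorem terminal_error (S : Setting P ℱ T W c u Γ Λ α) (hN : 0 < N) {p : ℝ≥0∞} (hξ : MemLp ξ 2 P)
    (hv : IsSol P ℱ W c Γ G J N ξ v) {x : ℝ} (hx : 0 ≤ x) :
    LpBound p P (fun ω => v ω - u.U (N * (T / N)) (ξ ω) (P.map ξ)) x := by
  have e : (N : ℝ) * (T / N) = T := mul_div_cancel₀ T (by positivity)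
  refine LpBound.congr (f := fun _ => (0 : ℝ))
    ⟨MemLp.zero', (lpNorm_zero _ _).le.trans hx⟩ ?_
  filter_upwards [isSol_top_iff.1 hv] with ω hω
  rw [e, hω, S.h1.classical.terminal _ _ (isP2_map hξ), sub_self]

/-- The first defect, when the backward components are bounded. -/
theorem exists_first_defect (S : Setting P ℱ T W c u Γ Λ α) (hk : k < N)
    (hδ : picardConst c P Λ α * (T / N) ≤ 1 / 2) (hJ : 1 ≤ J)
    (hξm : StronglyMeasurable[ℱ (k * (T / N))] ξ)
    (hξ : MemLp ξ (ENNReal.ofReal (2 * α)) P) (h : IsLevel P ℱ W c Γ G J k ξ X Y Z η)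
    {V m e : ℝ} (hV : 1 ≤ V)
    (hX : ∀ i ∈ Icc (G.j k) (G.j (k + 1)), MemLp (X 0 i) (ENNReal.ofReal (2 * α)) P)
    (hXV : ∀ i ∈ Ico (G.j k) (G.j (k + 1)), LpBound (ENNReal.ofReal (2 * α)) P (X 0 i) V)
    (hYm : ∀ i ∈ Ico (G.j k) (G.j (k + 1)), LpBound (ENNReal.ofReal (2 * α)) P (Y 1 i) m)
    (he : LpBound (ENNReal.ofReal (2 * α)) P (fun ω => η 0 ω - u.U ((k + 1 : ℕ) * (T / N))
      (X 0 (G.j (k + 1)) ω) (P.map (X 0 (G.j (k + 1))))) e) :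
    ∀ i ∈ Ico (G.j k) (G.j (k + 1)), LpBound (ENNReal.ofReal (2 * α)) P
      (fun ω => Y 0 i ω - u.U (G.t i) (X 0 i ω) (P.map (X 0 i)))
      (2 * m + 3 * e + Real.sqrt G.mesh * V ^ α) := by
  have hj := G.j_lt S.pos_T hk
  have hξ2 := hξ.mono_exponent S.two_le_p
  have hs0 : 0 ≤ Real.sqrt G.mesh * V ^ α := by positivity
  have hY0 : ∀ i ∈ Ico (G.j k) (G.j (k + 1)), LpBound (ENNReal.ofReal (2 * α)) P (Y 0 i) 0 :=
    fun i hi => lpBound_Y_zero h le_rfl ⟨hi.1, hi.2.le⟩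
  have hmem : ∀ i ∈ Ico (G.j k) (G.j (k + 1)), MemLp
      (fun ω => Y 0 i ω - u.U (G.t i) (X 0 i ω) (P.map (X 0 i))) (ENNReal.ofReal (2 * α)) P :=
    fun i hi => (hY0 i hi).1.sub
      (S.memLp_U' S.two_le_p (t_mem hk ⟨hi.1, hi.2.le⟩) (hX i ⟨hi.1, hi.2.le⟩))
  -- The worst defect over the period is bounded in terms of itself, so it has to be attained at
  -- some index before it can be absorbed.
  obtain ⟨i₀, hi₀, hmax⟩ := Finset.exists_max_image (Finset.Ico (G.j k) (G.j (k + 1)))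
    (fun i => lpNorm (fun ω => Y 0 i ω - u.U (G.t i) (X 0 i ω) (P.map (X 0 i)))
      (ENNReal.ofReal (2 * α)) P) (Finset.nonempty_Ico.2 hj)
  rw [Finset.mem_Ico] at hi₀
  have ha : ∀ i ∈ Ico (G.j k) (G.j (k + 1)), LpBound (ENNReal.ofReal (2 * α)) P
      (fun ω => Y 0 i ω - u.U (G.t i) (X 0 i ω) (P.map (X 0 i)))
      (lpNorm (fun ω => Y 0 i₀ ω - u.U (G.t i₀) (X 0 i₀ ω) (P.map (X 0 i₀)))
        (ENNReal.ofReal (2 * α)) P) :=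
    fun i hi => ⟨hmem i hi, hmax i (Finset.mem_Ico.2 hi)⟩
  have hstep := (S.picard_step hk hδ (S.isForward_level hk hξm hξ2 h (Nat.zero_le _))
      (S.isForward_level hk hξm hξ2 h hJ) (h.step 0 hJ) hξ hV hX hXV
      (fun i hi => (hY0 i hi).mono (by linarith)) ha lpNorm_nonneg
      (e := e) (by rw [G.t_j (k + 1) hk]; exact he)).1 i₀ ⟨hi₀.1, hi₀.2.le⟩
  -- Y⁰ = 0, so the defect is the field along X⁰. It is compared with Y¹, which is bounded by m; the
  -- error of Y¹ contains the defect with a factor θ ≤ 1/2, which is absorbed.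
  have hfin := (((hY0 i₀ hi₀).sub S.one_le_p (hYm i₀ hi₀)).add S.one_le_p hstep).2
  have e1 : (fun ω => Y 0 i₀ ω - Y 1 i₀ ω + (Y (0 + 1) i₀ ω
      - u.U (G.t i₀) (X 0 i₀ ω) (P.map (X 0 i₀)))) =
      fun ω => Y 0 i₀ ω - u.U (G.t i₀) (X 0 i₀ ω) (P.map (X 0 i₀)) := by
    funext ω
    simp only [zero_add]
    ring
  rw [e1] at hfin
  have he0 := he.nonneg
  set A := lpNorm (fun ω => Y 0 i₀ ω - u.U (G.t i₀) (X 0 i₀ ω) (P.map (X 0 i₀)))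
    (ENNReal.ofReal (2 * α)) P
  have hA0 : 0 ≤ A := lpNorm_nonneg
  set s := Real.sqrt G.mesh * V ^ α
  refine fun i hi => (ha i hi).mono ?_
  have j1 : picardConst c P Λ α * (T / N) * e ≤ 1 / 2 * e := by gcongr
  have j2 : picardConst c P Λ α * (T / N) * (A + s) ≤ 1 / 2 * (A + s) := by gcongr
  linarith

/-- The rate of amplification of the error. -/
def errorRate (c : Coeffs d) {mΩ : MeasurableSpace Ω} (P : Measure Ω) (Λ α m : ℝ) : ℝ :=
  14 * picardConst c P Λ α + 2 * α * spread c P Λ α m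

theorem errorRate_nonneg (S : Setting P ℱ T W c u Γ Λ α) {m : ℝ} (hm : 0 ≤ m) :
    0 ≤ errorRate c P Λ α m := by
  have h1 := S.picardConst_nonneg
  have h2 := S.spread_nonneg hm
  have h3 := S.one_le_α
  unfold errorRate
  positivity

/-- The error of the solver when the data are bounded. -/
theorem error_of_bounded (S : Setting P ℱ T W c u Γ Λ α) (hN : 0 < N)
    (hδ : picardConst c P Λ α * (T / N) ≤ 1 / 2) (hJ : 1 ≤ J) {M m : ℝ}
    (hM : ∀ x μ, IsP2 μ → |c.g x μ| ≤ M ∧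
      |c.f x 0 0 (μ.map fun v => WithLp.toLp 2 (v, (0 : ℝ)))| ≤ M)
    (hm0 : 0 ≤ m) (hm : solBound Λ M (T / N) N ≤ m)
    (hδm : 2 * α * spread c P Λ α m * (T / N) ≤ 1) {l : ℕ} :
    ∀ k ξ v, k + l = N → StronglyMeasurable[ℱ (k * (T / N))] ξ →
      MemLp ξ (ENNReal.ofReal (2 * α)) P → IsSol P ℱ W c Γ G J k ξ v →
      LpBound (ENNReal.ofReal (2 * α)) P (fun ω => v ω - u.U (k * (T / N)) (ξ ω) (P.map ξ))
        (amplification (errorRate c P Λ α m * (T / N)) l *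
          (2 * m * (picardConst c P Λ α * (T / N)) ^ J + 3 * (picardConst c P Λ α * (T / N)) *
            (2 + m) ^ α * Real.sqrt G.mesh * bracket P α ξ ^ α)) := by
  have hC := S.picardConst_nonneg
  have hsp := S.spread_nonneg hm0
  have hα := S.one_le_α
  have hδ0 : 0 < T / N := div_pos S.pos_T (by exact_mod_cast hN)
  obtain ⟨-, k2, -⟩ := S.small hδ0 hδ
  induction l with
  | zero =>
    intro k ξ v hk _ hξ hv
    obtain rfl : k = N := hk
    exact S.terminal_error hN (hξ.mono_exponent S.two_le_p) hv (by simp [amplification])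
  | succ l ih =>
    intro k ξ v hkl hξm hξ hv
    have hk : k < N := by omega
    have hξ2 := hξ.mono_exponent S.two_le_p
    have hj := G.j_lt S.pos_T hk
    obtain ⟨X, Y, Z, η, h, hv⟩ := (isSol_iff hk).1 hv
    have hb := one_le_bracket (P := P) (α := α) ξ
    have hYm : ∀ q ≤ J, ∀ i ∈ Icc (G.j k) (G.j (k + 1)),
        LpBound (ENNReal.ofReal (2 * α)) P (Y q i) m :=
      fun q hq i hi => (S.level_growth k2 hJ hM hk hξm hξ2 h hq hi).mono hm
    have hmb : m ≤ m * bracket P α ξ := le_mul_of_one_le_right hm0 hb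
    have hfb := fun q (hq : q < J) i (hi : i ∈ Icc (G.j k) (G.j (k + 1))) =>
      S.forward_bracket hk hδ (S.isForward_level hk hξm hξ2 h hq.le) hξ hm0
        (fun i hi => (hYm q hq.le i ⟨hi.1, hi.2.le⟩).mono hmb) hi
    have hF0 := amplification_nonneg (errorRate c P Λ α m * (T / N)) l
    set x := 2 * α * spread c P Λ α m * (T / N) with hx
    have hx0 : 0 ≤ x := by positivity
    -- The α-power of 1 + O(δ) is again 1 + O(δ), by comparison with the exponential.
    have hpow : ∀ q < J, bracket P α (X q (G.j (k + 1))) ^ α ≤ (1 + x) * bracket P α ξ ^ α := by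
      intro q hq
      have i0 : 0 ≤ bracket P α (X q (G.j (k + 1))) := zero_le_one.trans (one_le_bracket _)
      refine (Real.rpow_le_rpow i0 (hfb q hq _ ⟨hj.le, le_rfl⟩).2.1 (by linarith)).trans ?_
      rw [Real.mul_rpow (by positivity) (by positivity)]
      refine mul_le_mul_of_nonneg_right ?_ (by positivity)
      have i1 : 1 + spread c P Λ α m * (T / N) ≤ Real.exp (spread c P Λ α m * (T / N)) := by
        linarith [Real.add_one_le_exp (spread c P Λ α m * (T / N))]
      refine (Real.rpow_le_rpow (by positivity) i1 (by linarith)).trans ?_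
      rw [← Real.exp_mul]
      refine (exp_le_one_add_two_mul (by positivity) (by nlinarith)).trans (le_of_eq ?_)
      rw [hx]
      ring
    set θ := picardConst c P Λ α * (T / N) with hθ
    have hθ0 : 0 ≤ θ := by positivity
    set b := bracket P α ξ
    set F := amplification (errorRate c P Λ α m * (T / N)) l
    set r := 2 * m * θ ^ J + 3 * θ * (2 + m) ^ α * Real.sqrt G.mesh * b ^ α with hr
    have hr0 : 0 ≤ r := by positivity
    set e := (1 + x) * F * r with he'
    have he0 : 0 ≤ e := by positivity
    -- The induction hypothesis at the end of the period, with the size of the new input brought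
    -- back to that of ξ at the cost of the factor 1 + x.
    have he : ∀ q < J, LpBound (ENNReal.ofReal (2 * α)) P (fun ω => η q ω -
        u.U ((k + 1 : ℕ) * (T / N)) (X q (G.j (k + 1)) ω) (P.map (X q (G.j (k + 1))))) e := by
      intro q hq
      obtain ⟨m1, -⟩ := S.meas_end hk (S.isForward_level hk hξm hξ2 h hq.le)
      refine (ih (k + 1) _ _ (by omega) m1 (hfb q hq _ ⟨hj.le, le_rfl⟩).1 (h.sol q hq)).mono ?_
      have i1 := mul_le_mul_of_nonneg_left (hpow q hq)
        (by positivity : 0 ≤ 3 * θ * (2 + m) ^ α * Real.sqrt G.mesh)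
      have i2 : 0 ≤ x * (2 * m * θ ^ J) := by positivity
      have i3 : 2 * m * θ ^ J + 3 * θ * (2 + m) ^ α * Real.sqrt G.mesh *
          bracket P α (X q (G.j (k + 1))) ^ α ≤ (1 + x) * r := by
        rw [hr]
        linarith
      calc _ ≤ F * ((1 + x) * r) := mul_le_mul_of_nonneg_left i3 hF0
        _ = e := by rw [he']; ring
    have hV : 1 ≤ (2 + m) * b := one_le_mul_of_one_le_of_one_le (by linarith) hb
    have hmV : m ≤ (2 + m) * b := by nlinarith
    have ha := S.exists_first_defect hk hδ hJ hξm hξ h hV (fun i hi => (hfb 0 hJ i hi).1)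
      (fun i hi => (hfb 0 hJ i ⟨hi.1, hi.2.le⟩).2.2) (fun i hi => hYm 1 hJ i ⟨hi.1, hi.2.le⟩)
      (he 0 hJ)
    have hfin := S.level_error hk hδ hJ hξm hξ h hV (by positivity) he0
      (fun q hq i hi => (hfb q hq i hi).1) (fun q hq i hi => (hfb q hq i ⟨hi.1, hi.2.le⟩).2.2)
      (fun q hq i hi => (hYm q hq.le i ⟨hi.1, hi.2.le⟩).mono hmV) ha he
    refine (hfin.congr ?_).mono ?_
    · filter_upwards [hv] with ω hω
      rw [hω]
    rw [Real.mul_rpow (by positivity) (by positivity), ← hθ]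
    -- J ≥ 1 allows the parts 3e + s of the first defect to be counted with the factor θ only; the
    -- constant part 2m keeps θ^J, which gives the geometric rate. This is the origin of 7θ = 4θ +
    -- 3θ and of 3θ s = 2θ s + θ s.
    have i1 : θ ^ J ≤ θ := pow_le_of_le_one hθ0 (hδ.trans (by norm_num)) (by omega)
    set s := Real.sqrt G.mesh * ((2 + m) ^ α * b ^ α) with hs
    have hs0 : 0 ≤ s := by positivity
    have i2 : r = 2 * m * θ ^ J + 3 * θ * s := by rw [hr, hs]; ring
    have i3 : θ ^ J * (3 * e + s) ≤ θ * (3 * e + s) := by gcongr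
    have i4 : (1 + 4 * θ) * e + 2 * θ * s + θ ^ J * (2 * m + 3 * e + s) ≤
        ((1 + 7 * θ) * (1 + x) * F + 1) * r := by
      have : ((1 + 7 * θ) * (1 + x) * F + 1) * r = (1 + 7 * θ) * e + r := by rw [he']; ring
      rw [this, i2]
      linarith
    refine i4.trans (mul_le_mul_of_nonneg_right (amplification_succ ?_ ?_ l) hr0)
    · have := S.errorRate_nonneg hm0
      positivity
    -- The product of 1 + 7θ and 1 + x is at most 1 + 14θ + x because x ≤ 1.
    · have : errorRate c P Λ α m * (T / N) = 14 * θ + x := by rw [errorRate, hθ, hx]; ring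
      rw [this]
      nlinarith

end Setting

end MKV
end

/-! ### The error for α = 1 -/

noncomputable section

namespace MKV

variable {Ω : Type*} {mΩ : MeasurableSpace Ω} {P : Measure Ω} [IsProbabilityMeasure P] {d : ℕ}
  {ℱ : Filtration ℝ mΩ} {T Λ α : ℝ} {W : ℝ → Ω → E d} {c : Coeffs d} {u : Field d}
  {Γ : E d → E d} {N J k i : ℕ} {G : Grid T N} {ξ : Ω → E d} {v : Ω → ℝ}

namespace Setting

variable {X Z : ℕ → ℕ → Ω → E d} {Y : ℕ → ℕ → Ω → ℝ} {η : ℕ → Ω → ℝ}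

/-- The ratio of the backward components to the size of the initial condition. -/
def ratio (u : Field d) {mΩ : MeasurableSpace Ω} (P : Measure Ω) (T Λ : ℝ) : ℝ :=
  4 + 6 * u.growth P T Λ

theorem four_le_ratio (S : Setting P ℱ T W c u Γ Λ α) : 4 ≤ ratio u P T Λ := by
  have := Field.growth_nonneg (u := u) (P := P) (T := T) S.Λ_nonneg
  unfold ratio
  linarith

/-- The Picard iterations remain of the order of the initial condition. -/
theorem level_bound (S : Setting P ℱ T W c u Γ Λ 1) (hk : k < N)
    (hδ : picardConst c P Λ 1 * (T / N) ≤ 1 / 2)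
    (hδs : spread c P Λ 1 (ratio u P T Λ) * (T / N) ≤ 1)
    (hδm : picardConst c P Λ 1 * (T / N) *
      (ratio u P T Λ + Real.sqrt T * (2 + ratio u P T Λ)) ≤ 1)
    (hξm : StronglyMeasurable[ℱ (k * (T / N))] ξ)
    (hξ : MemLp ξ (ENNReal.ofReal (2 * 1)) P) (h : IsLevel P ℱ W c Γ G J k ξ X Y Z η)
    (he : ∀ q, q + 1 < J → MemLp (X q (G.j (k + 1))) (ENNReal.ofReal (2 * 1)) P →
      LpBound (ENNReal.ofReal (2 * 1)) P (fun ω => η q ω - u.U ((k + 1 : ℕ) * (T / N))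
      (X q (G.j (k + 1)) ω) (P.map (X q (G.j (k + 1))))) (bracket P 1 (X q (G.j (k + 1))))) :
    ∀ q < J, ∀ i ∈ Ico (G.j k) (G.j (k + 1)),
      LpBound (ENNReal.ofReal (2 * 1)) P (Y q i) (ratio u P T Λ * bracket P 1 ξ) ∧
      LpBound (ENNReal.ofReal (2 * 1)) P (fun ω => Y q i ω - u.U (G.t i) (X q i ω) (P.map (X q i)))
        (ratio u P T Λ * bracket P 1 ξ) := by
  have hj := G.j_lt S.pos_T hk
  have hξ2 := hξ.mono_exponent S.two_le_p
  have hb := one_le_bracket (P := P) (α := 1) ξ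
  have hm4 := S.four_le_ratio
  have hm0 : 0 ≤ ratio u P T Λ := by linarith
  have hC := S.picardConst_nonneg
  have hδ0 := S.period_pos hk
  have hK := Field.growth_nonneg (u := u) (P := P) (T := T) S.Λ_nonneg
  have hU : ∀ q i, i ∈ Icc (G.j k) (G.j (k + 1)) → MemLp (X q i) (ENNReal.ofReal (2 * 1)) P →
      bracket P 1 (X q i) ≤ 2 * bracket P 1 ξ → LpBound (ENNReal.ofReal (2 * 1)) P
        (fun ω => u.U (G.t i) (X q i ω) (P.map (X q i)))
        (6 * u.growth P T Λ * bracket P 1 ξ) := by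
    intro q i hi hX hXb
    refine (S.lpBound_U (t_mem hk hi) hX).mono ?_
    have := mul_le_mul_of_nonneg_left hXb (by positivity : 0 ≤ 3 * u.growth P T Λ)
    linarith
  have hfb := fun q (hq : q < J) (hY : ∀ i ∈ Ico (G.j k) (G.j (k + 1)),
      LpBound (ENNReal.ofReal (2 * 1)) P (Y q i) (ratio u P T Λ * bracket P 1 ξ)) i
      (hi : i ∈ Icc (G.j k) (G.j (k + 1))) =>
    S.forward_bracket hk hδ (S.isForward_level hk hξm hξ2 h hq.le) hξ hm0 hY hi
  have hdouble : ∀ x, x ≤ (1 + spread c P Λ 1 (ratio u P T Λ) * (T / N)) * bracket P 1 ξ →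
      x ≤ 2 * bracket P 1 ξ := fun x hx => hx.trans (by gcongr; linarith)
  intro q
  induction q with
  | zero =>
    intro hJ i hi
    have hY : ∀ i ∈ Ico (G.j k) (G.j (k + 1)),
        LpBound (ENNReal.ofReal (2 * 1)) P (Y 0 i) (ratio u P T Λ * bracket P 1 ξ) :=
      fun i hi => lpBound_Y_zero h (by positivity) ⟨hi.1, hi.2.le⟩
    refine ⟨hY i hi, ?_⟩
    have hi' : i ∈ Icc (G.j k) (G.j (k + 1)) := ⟨hi.1, hi.2.le⟩
    obtain ⟨f1, f2, -⟩ := hfb 0 hJ hY i hi'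
    refine ((lpBound_Y_zero h le_rfl hi').sub S.one_le_p (hU 0 i hi' f1 (hdouble _ f2))).mono ?_
    unfold ratio
    linarith
  | succ q ih =>
    intro hq i hi
    have hq' : q < J := by omega
    have hY := fun i hi => (ih hq' i hi).1
    have hi' : i ∈ Icc (G.j k) (G.j (k + 1)) := ⟨hi.1, hi.2.le⟩
    obtain ⟨f1, f2, -⟩ := hfb q hq' hY _ ⟨hj.le, le_rfl⟩
    have he' := (he q hq f1).mono (hdouble _ f2)
    rw [← G.t_j (k + 1) hk] at he'
    -- The error at the next level is at most the bracket of the new input, hence at most 2 brackets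
    -- of ξ; with θ ≤ 1/2 this gives 3, and the remaining terms add at most 1. Then 4 plus the
    -- growth 6 of the field reproduces `ratio`, which closes the induction on the iterations.
    have hbnd : (1 + picardConst c P Λ 1 * (T / N)) * (2 * bracket P 1 ξ) +
        picardConst c P Λ 1 * (T / N) * (ratio u P T Λ * bracket P 1 ξ +
          Real.sqrt G.mesh * ((2 + ratio u P T Λ) * bracket P 1 ξ) ^ (1 : ℝ)) ≤
        4 * bracket P 1 ξ := by
      rw [Real.rpow_one]
      have i1 : Real.sqrt G.mesh ≤ Real.sqrt T :=
        Real.sqrt_le_sqrt (G.mesh_le S.pos_T)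
      have i2 := mul_le_mul_of_nonneg_right hδm (zero_le_one.trans hb)
      have i3 := mul_le_mul_of_nonneg_right hδ (zero_le_one.trans hb)
      have i4 : picardConst c P Λ 1 * (T / N) * (Real.sqrt G.mesh *
          ((2 + ratio u P T Λ) * bracket P 1 ξ)) ≤ picardConst c P Λ 1 * (T / N) * (Real.sqrt T *
          ((2 + ratio u P T Λ) * bracket P 1 ξ)) := by gcongr
      linarith
    obtain ⟨s1, s2, -⟩ := S.picard_step hk hδ (S.isForward_level hk hξm hξ2 h hq'.le)
      (S.isForward_level hk hξm hξ2 h hq') (h.step q hq') hξ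
      (V := (2 + ratio u P T Λ) * bracket P 1 ξ)
      (one_le_mul_of_one_le_of_one_le (by linarith) hb) (fun i hi => (hfb q hq' hY i hi).1)
      (fun i hi => (hfb q hq' hY i ⟨hi.1, hi.2.le⟩).2.2)
      (fun i hi => (hY i hi).mono (by gcongr; linarith)) (fun i hi => (ih hq' i hi).2)
      (by positivity) he'
    obtain ⟨g1, g2, -⟩ := hfb q hq' hY i hi'
    constructor
    · have := ((s1 i hi').mono hbnd).add S.one_le_p (hU q i hi' g1 (hdouble _ g2))
      simp only [sub_add_cancel] at this
      refine this.mono ?_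
      unfold ratio
      linarith
    · exact ((s2 i hi).mono hbnd).mono (by gcongr)

/-- The error of the solver when `α = 1`. -/
theorem error_of_quadratic (S : Setting P ℱ T W c u Γ Λ 1) (hN : 0 < N)
    (hδ : picardConst c P Λ 1 * (T / N) ≤ 1 / 2) (hJ : 1 ≤ J)
    (hδs : 2 * spread c P Λ 1 (ratio u P T Λ) * (T / N) ≤ 1)
    (hδm : picardConst c P Λ 1 * (T / N) *
      (ratio u P T Λ + Real.sqrt T * (2 + ratio u P T Λ)) ≤ 1)
    (hsmall : 2 ≤ J →
      amplification (errorRate c P Λ 1 (ratio u P T Λ) * (T / N)) N *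
        (ratio u P T Λ * (picardConst c P Λ 1 * (T / N)) ^ J +
          2 * (picardConst c P Λ 1 * (T / N)) * (2 + ratio u P T Λ) * Real.sqrt G.mesh) ≤ 1)
    {l : ℕ} :
    ∀ k ξ v, k + l = N → StronglyMeasurable[ℱ (k * (T / N))] ξ →
      MemLp ξ (ENNReal.ofReal (2 * 1)) P → IsSol P ℱ W c Γ G J k ξ v →
      LpBound (ENNReal.ofReal (2 * 1)) P (fun ω => v ω - u.U (k * (T / N)) (ξ ω) (P.map ξ))
        (amplification (errorRate c P Λ 1 (ratio u P T Λ) * (T / N)) l *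
        (ratio u P T Λ * (picardConst c P Λ 1 * (T / N)) ^ J +
          2 * (picardConst c P Λ 1 * (T / N)) * (2 + ratio u P T Λ) * Real.sqrt G.mesh) *
            bracket P 1 ξ) := by
  have hm4 := S.four_le_ratio
  have hm0 : 0 ≤ ratio u P T Λ := by linarith
  have hC := S.picardConst_nonneg
  have hsp := S.spread_nonneg hm0
  have hδ0 : 0 < T / N := div_pos S.pos_T (by exact_mod_cast hN)
  have hL0 := S.errorRate_nonneg hm0
  have hLδ : 0 ≤ errorRate c P Λ 1 (ratio u P T Λ) * (T / N) := by positivity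
  induction l with
  | zero =>
    intro k ξ v hk _ hξ hv
    obtain rfl : k = N := hk
    exact S.terminal_error hN (hξ.mono_exponent S.two_le_p) hv (by simp [amplification])
  | succ l ih =>
    intro k ξ v hkl hξm hξ hv
    have hk : k < N := by omega
    have hξ2 := hξ.mono_exponent S.two_le_p
    have hj := G.j_lt S.pos_T hk
    obtain ⟨X, Y, Z, η, h, hv⟩ := (isSol_iff hk).1 hv
    have hb := one_le_bracket (P := P) (α := 1) ξ
    have hF0 := amplification_nonneg (errorRate c P Λ 1 (ratio u P T Λ) * (T / N)) l
    have herr := fun q (hq : q < J) (hX : MemLp (X q (G.j (k + 1))) (ENNReal.ofReal (2 * 1)) P) =>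
      ih (k + 1) _ _ (by omega) (S.meas_end hk (S.isForward_level hk hξm hξ2 h hq.le)).1 hX
        (h.sol q hq)
    have hr0 : 0 ≤ ratio u P T Λ * (picardConst c P Λ 1 * (T / N)) ^ J +
          2 * (picardConst c P Λ 1 * (T / N)) * (2 + ratio u P T Λ) * Real.sqrt G.mesh := by
      positivity
    -- The error obtained at the next level is turned into a bound by the bracket itself through the
    -- smallness hypothesis. It is needed only for an iteration followed by another one, which
    -- forces J ≥ 2.
    have hlev := S.level_bound hk hδ (by nlinarith) hδm hξm hξ h (fun q hq hX =>
      (herr q (by omega) hX).mono (mul_le_of_le_one_left (zero_le_one.trans (one_le_bracket _))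
        ((mul_le_mul_of_nonneg_right (amplification_mono hLδ (by omega)) hr0).trans
          (hsmall (by omega)))))
    have hfb := fun q (hq : q < J) i (hi : i ∈ Icc (G.j k) (G.j (k + 1))) =>
      S.forward_bracket hk hδ (S.isForward_level hk hξm hξ2 h hq.le) hξ hm0
        (fun i hi => (hlev q hq i hi).1) hi
    set m := ratio u P T Λ
    set x := spread c P Λ 1 m * (T / N) with hx
    have hx0 : 0 ≤ x := by positivity
    set F := amplification (errorRate c P Λ 1 m * (T / N)) l
    set θ := picardConst c P Λ 1 * (T / N) with hθ
    have hθ0 : 0 ≤ θ := by positivity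
    set r := m * θ ^ J + 2 * θ * (2 + m) * Real.sqrt G.mesh with hr
    set b := bracket P 1 ξ
    have he : ∀ q < J, LpBound (ENNReal.ofReal (2 * 1)) P (fun ω => η q ω -
        u.U ((k + 1 : ℕ) * (T / N)) (X q (G.j (k + 1)) ω) (P.map (X q (G.j (k + 1)))))
        (F * r * ((1 + x) * b)) := by
      intro q hq
      obtain ⟨f1, f2, -⟩ := hfb q hq _ ⟨hj.le, le_rfl⟩
      exact (herr q hq f1).mono (by gcongr)
    have hV : 1 ≤ (2 + m) * b := one_le_mul_of_one_le_of_one_le (by linarith) hb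
    have hfin := S.level_error hk hδ hJ hξm hξ h hV (by positivity) (by positivity)
      (fun q hq i hi => (hfb q hq i hi).1) (fun q hq i hi => (hfb q hq i ⟨hi.1, hi.2.le⟩).2.2)
      (fun q hq i hi => (hlev q hq i hi).1.mono (by gcongr; linarith))
      (fun i hi => (hlev 0 hJ i hi).2) he
    refine (hfin.congr ?_).mono ?_
    · filter_upwards [hv] with ω hω
      rw [hω]
    rw [Real.rpow_one, ← hθ]
    have i4 : (1 + 4 * θ) * (F * r * ((1 + x) * b)) + 2 * θ * (Real.sqrt G.mesh * ((2 + m) * b)) +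
        θ ^ J * (m * b) = ((1 + 4 * θ) * (1 + x) * F + 1) * r * b := by
      rw [hr]
      ring
    rw [i4]
    refine mul_le_mul_of_nonneg_right (mul_le_mul_of_nonneg_right
      (amplification_succ hLδ ?_ l) hr0) (by positivity)
    have : errorRate c P Λ 1 m * (T / N) = 14 * θ + 2 * x := by
      rw [errorRate, hθ, hx]
      ring
    rw [this]
    nlinarith

end Setting

end MKV
end

/-! ### Choice of the constants and conclusion -/

noncomputable section

namespace MKV

theorem amplification_period {L T : ℝ} {N l : ℕ} (hL : 0 ≤ L) (hT : 0 ≤ T) (hN : 0 < N)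
    (hl : l ≤ N) : amplification (L * (T / N)) l ≤ Real.exp (L * T) * N := by
  refine (amplification_mono (by positivity) hl).trans (le_of_eq ?_)
  have : (N : ℝ) ≠ 0 := by positivity
  unfold amplification
  congr 2
  field_simp

/-- The accumulation of the errors over all the periods. -/
theorem accumulated_error_le {B E T C a b w s : ℝ} {N J : ℕ} (hN : 0 < N) (hJ : 1 ≤ J) (hB : 0 ≤ B)
    (hT : 0 < T) (hw : 0 ≤ w) (hs : 0 ≤ s)
    (hδ : T / N ≤ 1) (hBC : B ≤ C) (haC : E * T * B * a ≤ C) (hbC : E * T * B * b ≤ C) :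
    E * N * (a * (B * (T / N)) ^ J + b * (B * (T / N)) * s * w) ≤
      C * ((C * (T / N)) ^ (J - 1) + s / (T / N) * w) := by
  have hN0 : (0 : ℝ) < N := by exact_mod_cast hN
  have hδ0 : 0 < T / N := by positivity
  have hC : 0 ≤ C := hB.trans hBC
  have e : (N : ℝ) * (T / N) = T := mul_div_cancel₀ T hN0.ne'
  obtain ⟨q, rfl⟩ : ∃ q, J = q + 1 := ⟨J - 1, by omega⟩
  set δ := T / N
  -- One factor δ pays for the N levels, because Nδ = T; this explains the exponent J - 1.
  have h1 : E * N * (a * (B * δ) ^ (q + 1)) = E * T * B * a * (B * δ) ^ q := by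
    rw [← e]
    ring
  have h2 : E * N * (b * (B * δ) * s * w) = E * T * B * b * (s * w) := by
    rw [← e]
    ring
  -- The accumulated discretization error is in fact of order s; the factor 1 / δ is introduced only
  -- here, by δ ≤ 1.
  have h3 : s ≤ s / δ := le_div_self hs hδ0 hδ
  rw [mul_add, h1, h2, Nat.add_sub_cancel, mul_add]
  gcongr

theorem Grid.mesh_pos {T : ℝ} {N : ℕ} (G : Grid T N) (hT : 0 < T) (hN : 0 < N) : 0 < G.mesh := by
  have hj := G.j_lt hT hN
  obtain ⟨-, h1, -, h3, -⟩ := G.step hN (i := G.j 0) ⟨le_rfl, hj⟩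
  exact h1.trans_le h3

/-- For J ≥ 2 all the factors around K √|π| are at least 1: J - 1, the exponential of βT, and the
quotient of e^{βδ} by e^{βδ} - 1. This inequality is all that is extracted from the condition. -/
theorem Smallness.mul_sqrt_le_one {Λ K β T mesh : ℝ} {N J : ℕ} (h : Smallness Λ 1 K β T N J mesh)
    (hJ : 2 ≤ J) (hN : 0 < N) (hΛ : 0 ≤ Λ) (hβ : 0 < β) (hT : 0 < T) (hK : 0 ≤ K) :
    K * Real.sqrt mesh ≤ 1 := by
  have hJ' : (1 : ℝ) ≤ (J : ℝ) - 1 := by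
    rw [le_sub_iff_add_le]
    exact_mod_cast hJ
  have hN0 : (0 : ℝ) < N := by exact_mod_cast hN
  have hδ0 : 0 < T / N := by positivity
  unfold Smallness at h
  rw [one_mul, mul_one] at h
  set δ := T / N
  set x := K * Real.sqrt mesh
  have hx : 0 ≤ x := by positivity
  have h1 : 1 < Real.exp (β * δ) := Real.one_lt_exp_iff.2 (by positivity)
  have h2 : 1 ≤ Real.exp (β * T) := Real.one_le_exp (by positivity)
  have h3 : 0 < Real.exp (β * δ) - 1 := by linarith
  calc x ≤ Real.exp (β * δ) * x * (Real.exp (β * T) / (Real.exp (β * δ) - 1)) := by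
        rw [mul_div_assoc', le_div_iff₀ h3]
        have : x * (Real.exp (β * δ) - 1) ≤ Real.exp (β * δ) * x := by linarith
        exact this.trans (le_mul_of_one_le_right (by positivity) h2)
    _ ≤ (Λ * δ ^ J + Real.exp (β * δ) * x) * (Real.exp (β * T) / (Real.exp (β * δ) - 1)) := by
        gcongr
        linarith [show 0 ≤ Λ * δ ^ J by positivity]
    _ ≤ ((J : ℝ) - 1) * ((Λ * δ ^ J + Real.exp (β * δ) * x) *
        (Real.exp (β * T) / (Real.exp (β * δ) - 1))) :=
        le_mul_of_one_le_left (by positivity) hJ'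
    _ ≤ 1 := by rwa [← mul_assoc]

/-- Several smallness conditions on δ are met at once by letting A be the sum of all the constants
involved. -/
theorem mul_le_one_of_lt_inv {A δ : ℝ} (hA : 0 ≤ A) (h : δ < (A + 1)⁻¹) : (A + 1) * δ ≤ 1 := by
  have h1 : 0 < A + 1 := by linarith
  calc (A + 1) * δ ≤ (A + 1) * (A + 1)⁻¹ := mul_le_mul_of_nonneg_left h.le h1.le
    _ = 1 := mul_inv_cancel₀ h1.ne'

theorem one_add_rpow_le_mul {x a : ℝ} (hx : 0 ≤ x) (ha : 0 ≤ a) :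
    (1 + x) ^ a ≤ 2 ^ a * (1 + x ^ a) := by
  have h1 : 0 ≤ x ^ a := by positivity
  rcases le_total x 1 with h | h
  · calc (1 + x) ^ a ≤ 2 ^ a := Real.rpow_le_rpow (by positivity) (by linarith) ha
      _ ≤ 2 ^ a * (1 + x ^ a) := le_mul_of_one_le_right (by positivity) (by linarith)
  · calc (1 + x) ^ a ≤ (2 * x) ^ a := Real.rpow_le_rpow (by positivity) (by linarith) ha
      _ = 2 ^ a * x ^ a := Real.mul_rpow (by norm_num) hx
      _ ≤ 2 ^ a * (1 + x ^ a) := by gcongr; linarith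

variable {Ω : Type*} {mΩ : MeasurableSpace Ω} {P : Measure Ω} [IsProbabilityMeasure P] {d : ℕ}
  {ℱ : Filtration ℝ mΩ} {T Λ α : ℝ} {W : ℝ → Ω → E d} {c : Coeffs d} {u : Field d}
  {Γ : E d → E d}

theorem LpBound.eLpNorm_le {V : Type*} [NormedAddCommGroup V] {p : ℝ≥0∞} {f : Ω → V} {a : ℝ}
    (h : LpBound p P f a) : eLpNorm f p P ≤ ENNReal.ofReal a := by
  rw [← ofReal_lpNorm h.1]
  exact ENNReal.ofReal_le_ofReal h.2

namespace Setting

theorem exists_rate_of_bounded (S : Setting P ℱ T W c u Γ Λ α) (hc : BoundedData c) :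
    ∃ c₀ C : ℝ, 0 < c₀ ∧ 0 < C ∧ ∀ (N J : ℕ) (G : Grid T N), 0 < N → 1 ≤ J → T / N < c₀ →
    ∀ k ≤ N, ∀ ξ : Ω → E d, StronglyMeasurable[ℱ (k * (T / N))] ξ →
      ∀ v, IsSol P ℱ W c Γ G J k ξ v →
        eLpNorm (fun ω => v ω - u.U (k * (T / N)) (ξ ω) (P.map ξ)) (ENNReal.ofReal (2 * α)) P
          ≤ ENNReal.ofReal C * (ENNReal.ofReal ((C * (T / N)) ^ (J - 1))
            + ENNReal.ofReal (Real.sqrt G.mesh / (T / N))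
              * (1 + eLpNorm ξ (ENNReal.ofReal (2 * α)) P ^ α)) := by
  obtain ⟨M, hM⟩ := hc
  have hα := S.one_le_α
  have hT := S.pos_T
  have hC := S.picardConst_nonneg
  have hM0 : 0 ≤ M := (abs_nonneg _).trans
    (hM 0 _ (isP2_map (P := P) (MemLp.zero' (ε := E d) (α := Ω)))).1
  have hCb := S.backConst_nonneg
  -- The a priori bound after all N levels, where Nδ = T; it no longer depends on N.
  set m := Real.exp (backConst Λ * T) * (M + 2 * M * T) with hm
  have hm0 : 0 ≤ m := by positivity
  have hL0 := S.errorRate_nonneg hm0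
  have hsp := S.spread_nonneg hm0
  set L := errorRate c P Λ α m with hL
  set B := picardConst c P Λ α with hB
  set p := Real.exp (L * T) * T * B * (2 * m) with hp
  set q := Real.exp (L * T) * T * B * (3 * (2 + m) ^ α * 2 ^ α) with hq
  have hp0 : 0 ≤ p := by positivity
  have hq0 : 0 ≤ q := by positivity
  refine ⟨(2 * B + 2 * α * spread c P Λ α m + 1)⁻¹, B + p + q + 1, by positivity, by positivity,
    fun N J G hN hJ hδ k hk ξ hξm v hv => ?_⟩
  have hN0 : (0 : ℝ) < N := by exact_mod_cast hN
  have hδ0 : 0 < T / N := by positivity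
  have hδ1 := mul_le_one_of_lt_inv (by positivity) hδ
  have t1 : 0 ≤ B * (T / N) := by positivity
  have t2 : 0 ≤ 2 * α * spread c P Λ α m * (T / N) := by positivity
  have hBδ : B * (T / N) ≤ 1 / 2 := by linarith
  have hsδ : 2 * α * spread c P Λ α m * (T / N) ≤ 1 := by linarith
  have hmesh := G.mesh_pos hT hN
  have hr : 0 < Real.sqrt G.mesh / (T / N) := div_pos (Real.sqrt_pos.2 hmesh) hδ0
  -- If ξ is not in L^{2α} the right side is infinite, because the mesh is positive.
  by_cases htop : eLpNorm ξ (ENNReal.ofReal (2 * α)) P = ∞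
  · have h1 : ENNReal.ofReal (Real.sqrt G.mesh / (T / N)) ≠ 0 := (ENNReal.ofReal_pos.2 hr).ne'
    have h2 : ENNReal.ofReal (B + p + q + 1) ≠ 0 := (ENNReal.ofReal_pos.2 (by positivity)).ne'
    rw [htop, ENNReal.top_rpow_of_pos (by linarith), add_top, ENNReal.mul_top h1, add_top,
      ENNReal.mul_top h2]
    exact le_top
  have hξ : MemLp ξ (ENNReal.ofReal (2 * α)) P :=
    ⟨(hξm.mono (ℱ.le _)).aestronglyMeasurable, lt_top_iff_ne_top.2 htop⟩
  have hsol : solBound Λ M (T / N) N ≤ m := by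
    have e : T / N * N = T := div_mul_cancel₀ T hN0.ne'
    rw [solBound, e]
  have key := S.error_of_bounded hN hBδ hJ hM hm0 hsol hsδ (l := N - k) k ξ v (by omega) hξm hξ hv
  set n := lpNorm ξ (ENNReal.ofReal (2 * α)) P with hn
  have hn0 : 0 ≤ n := lpNorm_nonneg
  have hb : bracket P α ξ ^ α ≤ 2 ^ α * (1 + n ^ α) :=
    (Real.rpow_le_rpow (zero_le_one.trans (one_le_bracket ξ)) (bracket_le ξ) (by linarith)).trans
      (one_add_rpow_le_mul hn0 (by linarith))
  have hb0 := one_le_bracket (P := P) (α := α) ξ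
  have hamp := amplification_period (T := T) hL0 hT.le hN (Nat.sub_le N k)
  have hreal := accumulated_error_le (B := B) (E := Real.exp (L * T)) (T := T)
    (C := B + p + q + 1) (a := 2 * m) (b := 3 * (2 + m) ^ α * 2 ^ α) (w := 1 + n ^ α)
    (s := Real.sqrt G.mesh) hN hJ hC hT
    (by positivity) (by positivity) (S.small hδ0 hBδ).1 (by linarith) (by linarith) (by linarith)
  have hnn : eLpNorm ξ (ENNReal.ofReal (2 * α)) P ^ α = ENNReal.ofReal (n ^ α) := by
    rw [← ofReal_lpNorm hξ, ENNReal.ofReal_rpow_of_nonneg hn0 (by linarith)]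
  rw [hnn, ← ENNReal.ofReal_one, ← ENNReal.ofReal_add zero_le_one (by positivity),
    ← ENNReal.ofReal_mul hr.le, ← ENNReal.ofReal_add (by positivity) (by positivity),
    ← ENNReal.ofReal_mul (by positivity)]
  refine (key.mono (le_trans ?_ hreal)).eLpNorm_le
  refine mul_le_mul hamp ?_ (by positivity) (by positivity)
  refine add_le_add le_rfl ?_
  have := mul_le_mul_of_nonneg_left hb
    (by positivity : 0 ≤ 3 * (B * (T / N)) * (2 + m) ^ α * Real.sqrt G.mesh)
  linarith

theorem exists_rate_of_quadratic (S : Setting P ℱ T W c u Γ Λ 1) :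
    ∃ c₀ K C : ℝ, 0 < c₀ ∧ 0 < K ∧ 0 < C ∧ ∀ (N J : ℕ) (G : Grid T N) (β : ℝ), 0 < N → 1 ≤ J →
      0 < β → T / N < c₀ → Smallness Λ 1 K β T N J G.mesh →
    ∀ k ≤ N, ∀ ξ : Ω → E d, StronglyMeasurable[ℱ (k * (T / N))] ξ → MemLp ξ 2 P →
      ∀ v, IsSol P ℱ W c Γ G J k ξ v →
        eLpNorm (fun ω => v ω - u.U (k * (T / N)) (ξ ω) (P.map ξ)) (ENNReal.ofReal (2 * 1)) P
          ≤ ENNReal.ofReal C * (ENNReal.ofReal ((C * (T / N)) ^ (J - 1))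
            + ENNReal.ofReal (Real.sqrt G.mesh / (T / N)))
              * (1 + eLpNorm ξ (ENNReal.ofReal (2 * 1)) P) := by
  have hT := S.pos_T
  have hC := S.picardConst_nonneg
  have hm4 := S.four_le_ratio
  set m := ratio u P T Λ with hm
  have hm0 : 0 ≤ m := by linarith
  have hL0 := S.errorRate_nonneg hm0
  have hsp := S.spread_nonneg hm0
  set L := errorRate c P Λ 1 m with hL
  set B := picardConst c P Λ 1 with hB
  set p := Real.exp (L * T) * T * B * m with hp
  set q := Real.exp (L * T) * T * B * (2 * (2 + m)) with hq
  have hp0 : 0 ≤ p := by positivity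
  have hq0 : 0 ≤ q := by positivity
  -- The sum under the inverse makes θ, the spread, the condition of `level_bound` and 2pBδ all
  -- small; K = 2q + 1 bounds q √|π| by 1/2.
  refine ⟨(2 * B + 2 * spread c P Λ 1 m + B * (m + Real.sqrt T * (2 + m)) + 2 * p * B + 1)⁻¹,
    2 * q + 1, B + p + q + 1, by positivity, by positivity, by positivity,
    fun N J G β hN hJ hβ hδ hsmall k hk ξ hξm hξ v hv => ?_⟩
  have hN0 : (0 : ℝ) < N := by exact_mod_cast hN
  have hδ0 : 0 < T / N := by positivity
  have e : (N : ℝ) * (T / N) = T := mul_div_cancel₀ T hN0.ne'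
  have hδ1 := mul_le_one_of_lt_inv (by positivity) hδ
  have t1 : 0 ≤ B * (T / N) := by positivity
  have t2 : 0 ≤ 2 * spread c P Λ 1 m * (T / N) := by positivity
  have t3 : 0 ≤ B * (T / N) * (m + Real.sqrt T * (2 + m)) := by positivity
  have t4 : 0 ≤ p * B * (T / N) := by positivity
  have hBδ : B * (T / N) ≤ 1 / 2 := by linarith
  have hsδ : 2 * spread c P Λ 1 m * (T / N) ≤ 1 := by linarith
  have hmδ : B * (T / N) * (m + Real.sqrt T * (2 + m)) ≤ 1 := by linarith
  have hpδ : p * B * (T / N) ≤ 1 / 2 := by linarith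
  have hmesh := G.mesh_pos hT hN
  have hr : 0 < Real.sqrt G.mesh / (T / N) := div_pos (Real.sqrt_pos.2 hmesh) hδ0
  have hp2 : ENNReal.ofReal (2 * 1) = 2 := by norm_num
  have hξ' : MemLp ξ (ENNReal.ofReal (2 * 1)) P := by rwa [hp2]
  -- With two factors θ, the geometric part summed over the levels is at most pBδ ≤ 1/2; the
  -- discretization part is at most q √|π| ≤ 1/2.
  have hone : 2 ≤ J → amplification (L * (T / N)) N * (m * (B * (T / N)) ^ J +
      2 * (B * (T / N)) * (2 + m) * Real.sqrt G.mesh) ≤ 1 := by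
    intro hJ2
    have h1 := hsmall.mul_sqrt_le_one hJ2 hN S.Λ_nonneg hβ hT (by positivity)
    have h2 := amplification_period (T := T) hL0 hT.le hN le_rfl
    have h3 : (B * (T / N)) ^ J ≤ (B * (T / N)) ^ 2 :=
      pow_le_pow_of_le_one t1 (by linarith) hJ2
    have h4 : m * (B * (T / N)) ^ J + 2 * (B * (T / N)) * (2 + m) * Real.sqrt G.mesh ≤
        m * (B * (T / N)) ^ 2 + 2 * (B * (T / N)) * (2 + m) * Real.sqrt G.mesh := by gcongr
    refine (mul_le_mul h2 h4 (by positivity) (by positivity)).trans ?_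
    have h5 : Real.exp (L * T) * N * (m * (B * (T / N)) ^ 2 +
        2 * (B * (T / N)) * (2 + m) * Real.sqrt G.mesh) =
        p * B * (T / N) + q * Real.sqrt G.mesh := by
      calc _ = Real.exp (L * T) * (N * (T / N)) * B * m * B * (T / N) + Real.exp (L * T) *
            (N * (T / N)) * B * (2 * (2 + m)) * Real.sqrt G.mesh := by ring
        _ = _ := by rw [e]
    have h6 := Real.sqrt_nonneg G.mesh
    rw [h5]
    linarith
  have key := S.error_of_quadratic hN hBδ hJ hsδ hmδ hone (l := N - k) k ξ v (by omega) hξm hξ' hv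
  set n := lpNorm ξ (ENNReal.ofReal (2 * 1)) P with hn
  have hn0 : 0 ≤ n := lpNorm_nonneg
  have hb : bracket P 1 ξ ≤ 1 + n := bracket_le ξ
  have hb0 := one_le_bracket (P := P) (α := 1) ξ
  have hamp := amplification_period (T := T) hL0 hT.le hN (Nat.sub_le N k)
  have hreal := accumulated_error_le (B := B) (E := Real.exp (L * T)) (T := T)
    (C := B + p + q + 1) (a := m) (b := 2 * (2 + m)) (w := 1)
    (s := Real.sqrt G.mesh) hN hJ hC hT
    (by positivity) (by positivity) (S.small hδ0 hBδ).1 (by linarith) (by linarith) (by linarith)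
  rw [← ofReal_lpNorm hξ', ← hn, ← ENNReal.ofReal_one,
    ← ENNReal.ofReal_add zero_le_one (by positivity),
    ← ENNReal.ofReal_add (by positivity) (by positivity),
    ← ENNReal.ofReal_mul (by positivity), ← ENNReal.ofReal_mul (by positivity)]
  refine (key.mono ?_).eLpNorm_le
  rw [mul_one, mul_one] at hreal
  refine mul_le_mul (le_trans (mul_le_mul hamp ?_ (by positivity) (by positivity)) hreal) hb
    (by positivity) (by positivity)
  linarith

/-- The constants have to exist before the boundedness of the data is assumed, hence the distinction
of cases with arbitrary constants when it fails. `exists_rate_one` does the same for the condition α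
= 1. -/
theorem exists_rate_bounded_data (S : Setting P ℱ T W c u Γ Λ α) :
    ∃ c₀ C : ℝ, 0 < c₀ ∧ 0 < C ∧ (BoundedData c → ∀ (N J : ℕ) (G : Grid T N), 0 < N → 1 ≤ J →
      T / N < c₀ →
    ∀ k ≤ N, ∀ ξ : Ω → E d, StronglyMeasurable[ℱ (k * (T / N))] ξ →
      ∀ v, IsSol P ℱ W c Γ G J k ξ v →
        eLpNorm (fun ω => v ω - u.U (k * (T / N)) (ξ ω) (P.map ξ)) (ENNReal.ofReal (2 * α)) P
          ≤ ENNReal.ofReal C * (ENNReal.ofReal ((C * (T / N)) ^ (J - 1))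
            + ENNReal.ofReal (Real.sqrt G.mesh / (T / N))
              * (1 + eLpNorm ξ (ENNReal.ofReal (2 * α)) P ^ α))) := by
  by_cases hc : BoundedData c
  · obtain ⟨c₀, C, h1, h2, h⟩ := S.exists_rate_of_bounded hc
    exact ⟨c₀, C, h1, h2, fun _ => h⟩
  · exact ⟨1, 1, one_pos, one_pos, fun h => absurd h hc⟩

theorem exists_rate_one (S : Setting P ℱ T W c u Γ Λ α) :
    ∃ c₀ K C : ℝ, 0 < c₀ ∧ 0 < K ∧ 0 < C ∧ (α = 1 → ∀ (N J : ℕ) (G : Grid T N) (β : ℝ), 0 < N →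
      1 ≤ J → 0 < β → T / N < c₀ → Smallness Λ 1 K β T N J G.mesh →
    ∀ k ≤ N, ∀ ξ : Ω → E d, StronglyMeasurable[ℱ (k * (T / N))] ξ → MemLp ξ 2 P →
      ∀ v, IsSol P ℱ W c Γ G J k ξ v →
        eLpNorm (fun ω => v ω - u.U (k * (T / N)) (ξ ω) (P.map ξ)) (ENNReal.ofReal (2 * α)) P
          ≤ ENNReal.ofReal C * (ENNReal.ofReal ((C * (T / N)) ^ (J - 1))
            + ENNReal.ofReal (Real.sqrt G.mesh / (T / N)))
              * (1 + eLpNorm ξ (ENNReal.ofReal (2 * α)) P)) := by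
  by_cases hα : α = 1
  · subst hα
    obtain ⟨c₀, K, C, h1, h2, h3, h⟩ := S.exists_rate_of_quadratic
    exact ⟨c₀, K, C, h1, h2, h3, fun _ => h⟩
  · exact ⟨1, 1, 1, one_pos, one_pos, one_pos, fun h => absurd h hα⟩

end Setting

end MKV
end

open MKV in
theorem mainTheorem3 (d : ℕ) (hd : 0 < d) (Λ α : ℝ) (hα : 1 ≤ α) :
    ∃ C₀ : ℝ, 0 < C₀ ∧
    ∀ (Ω : Type*) [mΩ : MeasurableSpace Ω] (P : Measure Ω) [IsProbabilityMeasure P]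
      (ℱ : Filtration ℝ mΩ) (T : ℝ) (W : ℝ → Ω → E d) (c : Coeffs d) (u : Field d)
      (Γ : E d → E d),
      0 < T → IsBasis P ℱ T W → H0 c Λ → H1 (ℱ 0) P T c u Λ α → IsQuantizer Γ Λ →
    ∃ c₀ K C : ℝ, 0 < c₀ ∧ 0 < K ∧ 0 < C ∧
    ∀ (N J : ℕ) (G : Grid T N) (β : ℝ), 2 ≤ N → 1 ≤ J → 0 < β →
      C₀ * (T / N) < min c₀ 1 → Smallness Λ C₀ K β T N J G.mesh →
    ∀ k ≤ N, ∀ ξ : Ω → E d, StronglyMeasurable[ℱ (k * (T / N))] ξ → MemLp ξ 2 P →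
      (∃ v, IsSol P ℱ W c Γ G J k ξ v) ∧
      ∀ v, IsSol P ℱ W c Γ G J k ξ v →
        (BoundedData c →
          eLpNorm (fun ω => v ω - u.U (k * (T / N)) (ξ ω) (P.map ξ)) (ENNReal.ofReal (2 * α)) P
            ≤ ENNReal.ofReal C * (ENNReal.ofReal ((C * (T / N)) ^ (J - 1))
              + ENNReal.ofReal (Real.sqrt G.mesh / (T / N))
                * (1 + eLpNorm ξ (ENNReal.ofReal (2 * α)) P ^ α))) ∧
        (α = 1 →
          eLpNorm (fun ω => v ω - u.U (k * (T / N)) (ξ ω) (P.map ξ)) (ENNReal.ofReal (2 * α)) P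
            ≤ ENNReal.ofReal C * (ENNReal.ofReal ((C * (T / N)) ^ (J - 1))
              + ENNReal.ofReal (Real.sqrt G.mesh / (T / N)))
                * (1 + eLpNorm ξ (ENNReal.ofReal (2 * α)) P)) := by
  -- The normalization C₀ = 1 is enough, since all other dependencies can be put into c₀.
  refine ⟨1, one_pos, fun Ω _ P _ ℱ T W c u Γ hT hbasis h0 h1 hΓ => ?_⟩
  have S : Setting P ℱ T W c u Γ Λ α := ⟨hα, hΓ.one_le hd, hT, hbasis, h0, h1, hΓ⟩
  obtain ⟨c₁, C₁, hc₁, hC₁, H₁⟩ := S.exists_rate_bounded_data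
  obtain ⟨c₂, K, C₂, hc₂, hK, hC₂, H₂⟩ := S.exists_rate_one
  have hΛ := S.Λ_nonneg
  -- The third bound on the period gives 4Λδ ≤ 1, the condition for the implicit backward steps to
  -- be solvable by contraction.
  refine ⟨min (min c₁ c₂) (4 * Λ + 1)⁻¹, K, max C₁ C₂, by positivity, hK, by positivity,
    fun N J G β hN hJ hβ hδ hsmall k hk ξ hξm hξ => ?_⟩
  rw [one_mul] at hδ
  have hδ' := hδ.trans_le (min_le_left _ _)
  have hδ1 := hδ'.trans_le ((min_le_left _ _).trans (min_le_left _ _))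
  have hδ2 := hδ'.trans_le ((min_le_left _ _).trans (min_le_right _ _))
  have hδ3 := mul_le_one_of_lt_inv (by positivity) (hδ'.trans_le (min_le_right _ _))
  have hδ0 : 0 ≤ T / N := by positivity
  have hN0 : 0 < N := by omega
  refine ⟨?_, fun v hv => ⟨fun hc => ?_, fun hα1 => ?_⟩⟩
  · obtain ⟨v, hv, -⟩ := S.exists_isSol (G := G) (by linarith) J (l := N - k) k ξ (by omega) hξm hξ
    exact ⟨v, hv⟩
  · refine (H₁ hc N J G hN0 hJ hδ1 k hk ξ hξm v hv).trans ?_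
    gcongr <;> exact le_max_left _ _
  · refine (H₂ hα1 N J G β hN0 hJ hβ hδ2 hsmall k hk ξ hξm hξ v hv).trans ?_
    gcongr <;> exact le_max_right _ _
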